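/- **Setting.** Fix $d$, $r\ge 1$ and a group $\Lambda$ of translations of $\mathbb R^d$ ($\Lambda=0$ for a table in $\mathbb R^d$; $\Lambda=\mathbb Z^d$ for a table in the torus, described by its lift; all objects below are $\Lambda$-periodic). Let $D$ be a closed set, compact modulo $\Lambda$, with $\partial D=\Gamma_1\cup\dots\cup\Gamma_n$, $\Gamma_i$ closed. The corner set $\Gamma^*$ consists of the points of the $\Gamma_i$ at which $\Gamma_i$ is not an embedded $C^{r+1}$ hypersurface (for submanifolds with boundary, $\Gamma^*=\bigcup_i\partial\Gamma_i$). Let $V(q;\epsilon)$, $0<\epsilon<\epsilon_0$, be a potential of class $C^{r+1}$ in $q$ on an open set $\tilde D\supset D\setminus\Gamma^*$, and assume: * **(I)** On every compact $K\subset \mathrm{int}\,D$ the potential tends to $0$ uniformly with its derivatives up to order $r+1$ as $\epsilon\to0$. * **(II)** There is a pattern function $Q(q;\epsilon)$ on $\tilde D$, $0\le\epsilon<\epsilon_0$, of class $C^{r+1}$ in $q$ and continuous in $\epsilon$ in the $C^{r+1}$ topology, whose derivatives of order $r+1$ are Lipschitz in $q$ near each point of $\Gamma_i\setminus\Gamma^*$,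 uniformly in small $\epsilon$. On $\Gamma_i\setminus\Gamma^*$, $Q(q;0)=Q_i$, and locally $D=\{\sigma_i(Q(q;0)-Q_i)\ge0\}$ with a sign $\sigma_i=\pm1$. In a neighbourhood $N_i$ of $\Gamma_i\setminus\Gamma^*$, $\nabla Q\neq0$ and $V(q;\epsilon)=W_i(Q(q;\epsilon)-Q_i;\epsilon)$, where the barrier function $W_i(s;\epsilon)$ is $C^{r+1}$ in $s$ with $W_i'\ne0$ for $|s|<a$. * **(III)** For $|s|<a$: $W_i\ge0$, and as $\epsilon\to0$, $W_i(s;\epsilon)\to0$ if $\sigma_is>0$ and $W_i(s;\epsilon)\to\mathcal E$ if $\sigma_is<0$, where $\frac12<\mathcal E\le\infty$. * **(IV)** Let $\mathcal Q_i(w;\epsilon)\in(-a,a)$ be the inverse function, $W_i(\mathcal Q_i(w;\epsilon);\epsilon)=w$. For $0<w_1<w_2<\mathcal E$, $\mathcal Q_i\to0$ uniformly on $[w_1,w_2]$ with its derivatives up to order $r+1$ as $\epsilon\to0$. Choose $\nu_i(\epsilon)\to+0$ in the range of $W_i(\cdot;\epsilon)$ on $(-a,a)$, put $\eta_i=\mathcal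 Q_i(\nu_i;\epsilon)$, and choose $\delta_i(\epsilon)\to0$. Let $D^\epsilon$ and $D^\epsilon_{int}\subset D^\epsilon$ be regions close to $D$ which away from the corners are bounded by the surfaces $\Gamma_i^\epsilon=\{Q=Q_i+\eta_i\}$ and $\{Q=Q_i+\delta_i\}$ (that is, for $\epsilon$ small they contain any given compact subset of $\mathrm{int}\,D$, miss any given compact set disjoint from $D$, and near each point of $\Gamma_i\setminus\Gamma^*$ they are $\{\sigma_i(Q-Q_i-\eta_i)\ge0\}$, resp. $\{\sigma_i(Q-Q_i-\delta_i)\ge0\}$). Let $$m^{(r)}=\sup_{q\in D^\epsilon_{int},\,1\le l\le r+1}\|\partial^lV(q;\epsilon)\|,\qquad M_i^{(r)}=\sup_{\nu_i\le w\le\frac12,\,0\le l\le r+1}|\mathcal Q_i^{(l)}(w;\epsilon)|,$$ $\nu=\max_i\nu_i$, $M^{(r)}=\max_iM^{(r)}_i$, and suppose that $m^{(r)},M^{(r)}\to0$ as $\epsilon\to0$. Let $n(q)=\sigma_i\nabla Q/\|\nabla Q\|$ near $\Gamma_i$. On the energy level $\frac{p^2}2+V=\frac12$ consider the cross-section $S_\epsilon=\{(q,p):q\in\partial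 D^\epsilon,\langle p,n(q)\rangle>0\}$. Let $\Phi^\epsilon=R^\epsilon\circ F^\epsilon$ be the Poincaré map of the flow $\dot q=p$, $\dot p=-\nabla V(q;\epsilon)$: $F^\epsilon$ follows an orbit inside $D^\epsilon$ until it reaches $\partial D^\epsilon$, and $R^\epsilon$ then follows it outside $D^\epsilon$ until it returns to $\partial D^\epsilon$. Let $B^\epsilon=R^\epsilon_\circ\circ F^\epsilon_\circ$ be the billiard map in $D^\epsilon$: $F_\circ^\epsilon(q,p)=(q+p\tau_\circ,p)$ with $\tau_\circ$ the first hitting time of $\partial D^\epsilon$, and $R^\epsilon_\circ(q,p)=(q,p-2\langle p,n(q)\rangle n(q))$. **Explicit corrections.** $F_1^\epsilon(q,p)=\big(p\,\tau_1+\int_0^{\tau_\circ}\nabla V(q+ps;\epsilon)(s-\tau_\circ)\,ds,\;-\int_0^{\tau_\circ}\nabla V(q+ps;\epsilon)\,ds\big)$, where $\tau_1=\langle\nabla Q,\int_0^{\tau_\circ}\nabla V(q+ps;\epsilon)(\tau_\circ-s)\,ds\rangle/\langle\nabla Q,p\rangle$ with $\nabla Q$ taken at $q+p\tau_\circ$.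 With $p_y=\langle n(q),p\rangle$, $p_x=p-p_yn(q)$, $Q_y=\langle\nabla Q,n\rangle$, $K$ and $l$ the derivatives of $n$ in the tangent directions and in the direction $n$, $$I_1=2\int_0^{P}\mathcal Q_i'\Big(\tfrac{1-p_x^2-s^2}2;\epsilon\Big)ds,\quad I_2=2\int_0^{P}\mathcal Q_i'\Big(\tfrac{1-p_x^2-s^2}2;\epsilon\Big)s^2ds,\quad P=\sqrt{1-2\nu_i-p_x^2},$$ ($P=|p_y|$ on $\Gamma^\epsilon_i$ at energy $\frac12$), and $J=\big[-\frac{I_2}{p_y}l-I_1Kp_x\big]/Q_y$, put $R_1^\epsilon(q,p)=\big(-\frac{I_1}{Q_y}p_x,\;-p_yJ-n\langle p_x,J\rangle\big)$. Finally $\Phi_1^\epsilon=(R_\circ^\epsilon+R_1^\epsilon)\circ(F_\circ^\epsilon+F_1^\epsilon)-B^\epsilon$. **Theorem.** For every $C>0$ there are $\kappa,K,\epsilon_1>0$ such that the following holds for all $0<\epsilon<\epsilon_1$ and every billiard orbit of $D$ that starts with unit momentum $p_0$ at $q_0\in\Gamma_j$, next hits $\partial D$ at $\bar q_0=q_0+Tp_0\in\Gamma_i$,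 and is regular with constant $C$: $\langle p_0,n(q_0)\rangle\ge C$, $\langle p_0,n(\bar q_0)\rangle\le-C$, $q_0$ and $\bar q_0$ have distance at least $C$ from $\Gamma^*$, $T\le 1/C$, and $\mathrm{dist}(q_0+tp_0,\partial D)\ge C\min(t,T-t)$ for $0<t<T$. On the part of $S_\epsilon$ in the ball of radius $\kappa$ around $(q_0,p_0)$, the billiard map $B^\epsilon$ is defined and its flight hits $\Gamma_i^\epsilon$ transversally, the Poincaré map $\Phi^\epsilon$ is defined with values in $S_\epsilon$, and $$\Phi^\epsilon=B^\epsilon+O_{C^r}\big(m^{(r)}+\nu+M^{(r)}\big),\qquad \Phi^\epsilon=B^\epsilon+\Phi_1^\epsilon+O_{C^{r-1}}\big((m^{(r)}+\nu+M^{(r)})^2\big),\qquad \Phi_1^\epsilon=O_{C^{r-1}}\big(m^{(r)}+\nu+M^{(r)}\big),$$ where $f=O_{C^k}(b)$ means that $f$ is the restriction of a $C^k$ map on that ball whose derivatives of orders $0,\dots,k$ are bounded there by $K\,b$. -/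

import Mathlib

open Set Filter Topology
open scoped ENNReal NNReal

noncomputable section

/-- Position (and momentum) space `ℝ^d` with its Euclidean structure. -/
abbrev Pos (d : ℕ) : Type := EuclideanSpace ℝ (Fin d)

/-- Phase points `(q, p)`. -/
abbrev Phase (d : ℕ) : Type := Pos d × Pos d

/-- The data of a billiard table together with a family of steep potentials. Everything lives on
`ℝ^d` and is periodic under a group `Λ` of translations: `Λ = ⊥` is a table in `ℝ^d`, and
`Λ = ℤ^d` is a table in the torus, seen through its lift. The conditions on the data are the
predicates below. -/
structure SteepFamily (d n : ℕ) where
  /-- the group of translations -/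
  Λ : AddSubgroup (Pos d)
  /-- the billiard table -/
  D : Set (Pos d)
  /-- the boundary components -/
  Γ : Fin n → Set (Pos d)
  /-- the parameter `ε` ranges over `(0, ε₀)` -/
  ε₀ : ℝ
  /-- the neighbourhood of the table minus its corners on which `V` and `Q` are defined -/
  Dt : Set (Pos d)
  /-- the potential `V(q; ε)` -/
  V : Pos d → ℝ → ℝ
  /-- the pattern function `Q(q; ε)` -/
  Q : Pos d → ℝ → ℝ
  /-- the boundary values `Q_i` of the pattern function -/
  Qc : Fin n → ℝ
  /-- `σ_i = 1` if `Q > Q_i` is the inner side of `Γ_i`, and `σ_i = -1` if it is the outer side -/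
  σ : Fin n → ℝ
  /-- the neighbourhoods `N_i` of the boundary components -/
  N : Fin n → Set (Pos d)
  /-- the barrier functions `W_i(s; ε)`, with `s = Q - Q_i` -/
  W : Fin n → ℝ → ℝ → ℝ
  /-- the barrier functions are considered for `|s| < a` -/
  a : ℝ
  /-- the height of the barrier, possibly infinite -/
  height : EReal

/-- Near its point `x` the set `H` is an embedded hypersurface of class `C^k`. -/
def IsHypersurfaceAt {d : ℕ} (k : ℕ) (H : Set (Pos d)) (x : Pos d) : Prop :=
  ∃ g : Pos d → ℝ, ContDiffAt ℝ k g x ∧ fderiv ℝ g x ≠ 0 ∧ ∀ᶠ y in 𝓝 x, (y ∈ H ↔ g y = 0)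

namespace SteepFamily

variable {d n : ℕ} (S : SteepFamily d n)

/-- The corner set `Γ*`: the points of the closed components `Γ_i` at which `Γ_i` is not a
hypersurface of class `C^{r+1}`. For submanifolds with boundary this is `⋃ i, ∂Γ_i`. -/
def cornerSet (r : ℕ) : Set (Pos d) :=
  ⋃ i, {x | x ∈ S.Γ i ∧ ¬ IsHypersurfaceAt (r + 1) (S.Γ i) x}

/-- The table: closed, compact modulo `Λ`, with boundary `Γ_1 ∪ … ∪ Γ_n`. -/
structure IsTable : Prop where
  isClosed : IsClosed S.D
  compact_mod : ∃ K : Set (Pos d), IsCompact K ∧ ∀ q ∈ S.D, ∃ v ∈ S.Λ, q + v ∈ K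
  isClosed_comp : ∀ i, IsClosed (S.Γ i)
  frontier_eq : frontier S.D = ⋃ i, S.Γ i
  periodic : ∀ v ∈ S.Λ, ∀ q, q + v ∈ S.D ↔ q ∈ S.D
  periodic_comp : ∀ i, ∀ v ∈ S.Λ, ∀ q, q + v ∈ S.Γ i ↔ q ∈ S.Γ i

/-- The potential: of class `C^{r+1}` on a neighbourhood of the table minus its corners. -/
structure IsPotential (r : ℕ) : Prop where
  pos : 0 < S.ε₀
  isOpen_dom : IsOpen S.Dt
  subset_dom : S.D \ S.cornerSet r ⊆ S.Dt
  periodic_dom : ∀ v ∈ S.Λ, ∀ q, q + v ∈ S.Dt ↔ q ∈ S.Dt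
  periodic : ∀ v ∈ S.Λ, ∀ q ∈ S.Dt, ∀ ε, S.V (q + v) ε = S.V q ε
  contDiffOn : ∀ ε ∈ Ioo 0 S.ε₀, ContDiffOn ℝ (r + 1) (fun q => S.V q ε) S.Dt

/-- On compact sets in the interior of the table the potential tends to zero with
all its derivatives up to order `r + 1`. -/
def InteriorDecay (r : ℕ) : Prop :=
  ∀ K : Set (Pos d), IsCompact K → K ⊆ interior S.D → ∀ l ≤ r + 1,
    TendstoUniformlyOn (fun (ε : ℝ) q => iteratedFDeriv ℝ l (fun x => S.V x ε) q) 0 (𝓝[>] 0) K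

/-- The pattern function: of class `C^{r+1}` in `q` and, in the `C^{r+1}` topology, continuous in
`ε ∈ [0, ε₀)`. Near the boundary its derivatives of order `r + 1` are Lipschitz in `q`,
locally uniformly in `q` and uniformly in small `ε`. -/
structure IsPattern (r : ℕ) : Prop where
  periodic : ∀ v ∈ S.Λ, ∀ q ∈ S.Dt, ∀ ε, S.Q (q + v) ε = S.Q q ε
  contDiffOn : ∀ ε ∈ Ico 0 S.ε₀, ContDiffOn ℝ (r + 1) (fun q => S.Q q ε) S.Dt
  continuousOn : ∀ l ≤ r + 1, ContinuousOn
    (fun z : ℝ × Pos d => iteratedFDeriv ℝ l (fun x => S.Q x z.1) z.2) (Ico 0 S.ε₀ ×ˢ S.Dt)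
  lipschitz : ∀ i, ∀ x ∈ S.Γ i \ S.cornerSet r, ∃ L : ℝ≥0, ∃ U ∈ 𝓝 x, ∀ᶠ ε in 𝓝[>] (0 : ℝ),
    LipschitzOnWith L (iteratedFDeriv ℝ (r + 1) (fun q => S.Q q ε)) U

/-- The boundary components are level surfaces of `Q(·; 0)`; the table lies
locally on the side of `Γ_i` that is given by the sign `σ_i`. -/
structure BoundaryLevels (r : ℕ) : Prop where
  level : ∀ i, ∀ q ∈ S.Γ i \ S.cornerSet r, S.Q q 0 = S.Qc i
  sign : ∀ i, S.σ i = 1 ∨ S.σ i = -1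
  side : ∀ i, ∀ x ∈ S.Γ i \ S.cornerSet r,
    ∀ᶠ q in 𝓝 x, (q ∈ S.D ↔ 0 ≤ S.σ i * (S.Q q 0 - S.Qc i))

/-- Near `Γ_i` the potential is a function of `Q - Q_i` and `ε` only, the barrier
function, which is of class `C^{r+1}`. -/
structure BarrierForm (r : ℕ) : Prop where
  isOpen : ∀ i, IsOpen (S.N i)
  subset : ∀ i, S.Γ i \ S.cornerSet r ⊆ S.N i ∧ S.N i ⊆ S.Dt
  eq : ∀ i, ∀ ε ∈ Ioo 0 S.ε₀, ∀ q ∈ S.N i, S.V q ε = S.W i (S.Q q ε - S.Qc i) ε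
  pos : 0 < S.a
  contDiffOn : ∀ i, ∀ ε ∈ Ioo 0 S.ε₀, ContDiffOn ℝ (r + 1) (fun s => S.W i s ε) (Ioo (-S.a) S.a)

/-- Near the boundary `∇Q` and the derivative of the barrier do not vanish. -/
structure NonvanishingGradient : Prop where
  gradient_ne : ∀ i, ∀ ε ∈ Ico 0 S.ε₀, ∀ q ∈ S.N i, gradient (fun x => S.Q x ε) q ≠ 0
  deriv_ne : ∀ i, ∀ ε ∈ Ioo 0 S.ε₀, ∀ s ∈ Ioo (-S.a) S.a, deriv (fun u => S.W i u ε) s ≠ 0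

/-- As `ε → 0` the barrier function, which is nonnegative, grows from zero on the
inner side of the boundary to the height of the barrier on the outer side; the height exceeds
the energy `1/2`. -/
structure BarrierGrowth : Prop where
  nonneg : ∀ i, ∀ ε ∈ Ioo 0 S.ε₀, ∀ s ∈ Ioo (-S.a) S.a, 0 ≤ S.W i s ε
  inside : ∀ i, ∀ s ∈ Ioo (-S.a) S.a, 0 < S.σ i * s →
    Tendsto (fun ε => S.W i s ε) (𝓝[>] 0) (𝓝 0)
  outside : ∀ i, ∀ s ∈ Ioo (-S.a) S.a, S.σ i * s < 0 →
    Tendsto (fun ε => (S.W i s ε : EReal)) (𝓝[>] 0) (𝓝 S.height)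
  energy_lt : ((1 / 2 : ℝ) : EReal) < S.height

/-- The inverse barrier function `𝒬_i(w; ε)`: the `s ∈ (-a, a)` with `W_i(s; ε) = w`. -/
def invBarrier (i : Fin n) (w ε : ℝ) : ℝ :=
  Function.invFunOn (fun s => S.W i s ε) (Ioo (-S.a) S.a) w

/-- On compact intervals of heights strictly between zero and the height of the
barrier, the inverse barrier tends to zero with its derivatives up to order `r + 1`. -/
def SteepBarrier (r : ℕ) : Prop :=
  ∀ w₁ w₂ : ℝ, 0 < w₁ → w₁ < w₂ → (w₂ : EReal) < S.height → ∀ i, ∀ l ≤ r + 1,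
    TendstoUniformlyOn (fun (ε : ℝ) w => iteratedDeriv l (fun u => S.invBarrier i u ε) w)
      0 (𝓝[>] 0) (Icc w₁ w₂)

/-- All the standing conditions, with smoothness index `r`. -/
structure IsAdmissible (r : ℕ) : Prop where
  table : S.IsTable
  potential : S.IsPotential r
  pattern : S.IsPattern r
  decay : S.InteriorDecay r
  levels : S.BoundaryLevels r
  barrier : S.BarrierForm r
  nonvanishing : S.NonvanishingGradient
  growth : S.BarrierGrowth
  steep : S.SteepBarrier r

/-- `A ε` is, for small `ε` and away from the corner set, the region close to the table that is
bounded by the surfaces `Q(q; ε) = Q_i + s_i(ε)`. The pattern function is not defined at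
corners, so nothing is prescribed there. -/
structure IsLevelRegion (r : ℕ) (s : Fin n → ℝ → ℝ) (A : ℝ → Set (Pos d)) : Prop where
  periodic : ∀ ε, ∀ v ∈ S.Λ, ∀ q, q + v ∈ A ε ↔ q ∈ A ε
  inner : ∀ K : Set (Pos d), IsCompact K → K ⊆ interior S.D → ∀ᶠ ε in 𝓝[>] (0 : ℝ), K ⊆ A ε
  outer : ∀ K : Set (Pos d), IsCompact K → Disjoint K S.D →
    ∀ᶠ ε in 𝓝[>] (0 : ℝ), Disjoint K (A ε)
  boundary : ∀ i, ∀ x ∈ S.Γ i \ S.cornerSet r, ∃ U ∈ 𝓝 x, ∀ᶠ ε in 𝓝[>] (0 : ℝ), ∀ q ∈ U,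
    (q ∈ A ε ↔ 0 ≤ S.σ i * (S.Q q ε - S.Qc i - s i ε))

/-- `m^{(r)}(ε)`: the supremum over the region `A` of the derivatives of the potential of orders
`1, …, r + 1`. -/
def mSup (r : ℕ) (A : Set (Pos d)) (ε : ℝ) : ℝ≥0∞ :=
  ⨆ l ∈ Icc 1 (r + 1), ⨆ q ∈ A, ‖iteratedFDeriv ℝ l (fun x => S.V x ε) q‖ₑ

/-- `M_i^{(r)}(ν; ε)`: the supremum over `w ∈ [ν, 1/2]` of the inverse barrier and its derivatives
up to order `r + 1`. -/
def MSup (r : ℕ) (i : Fin n) (ν ε : ℝ) : ℝ≥0∞ :=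
  ⨆ l ∈ Icc 0 (r + 1), ⨆ w ∈ Icc ν (1 / 2), ‖iteratedDeriv l (fun u => S.invBarrier i u ε) w‖ₑ

/-- The small quantity `m^{(r)} + ν + M^{(r)}`, with `ν = max ν_i` and `M^{(r)} = max M_i^{(r)}`. -/
def err (r : ℕ) (ν : Fin n → ℝ → ℝ) (Dint : ℝ → Set (Pos d)) (ε : ℝ) : ℝ≥0∞ :=
  S.mSup r (Dint ε) ε + (⨆ i, ENNReal.ofReal (ν i ε)) + ⨆ i, S.MSup r i (ν i ε) ε

/-- The unit normal, pointing inwards near `Γ_i`, of the level surface of `Q(·; ε)` at `q`. -/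
def normal (i : Fin n) (ε : ℝ) (q : Pos d) : Pos d :=
  (S.σ i / ‖gradient (fun x => S.Q x ε) q‖) • gradient (fun x => S.Q x ε) q

/-! ### The smooth Hamiltonian flow and its Poincaré map -/

/-- `γ = (q, p)` solves `q' = p`, `p' = -∇V(q; ε)` on the time interval `[0, T]`. -/
def IsOrbit (ε T : ℝ) (γ : ℝ → Phase d) : Prop :=
  ∀ t ∈ Icc 0 T, (γ t).1 ∈ S.Dt ∧
    HasDerivWithinAt γ ((γ t).2, -gradient (fun x => S.V x ε) (γ t).1) (Icc 0 T) t

/-- The free flight map `F^ε` of the smooth flow as a relation: the orbit of `ρ` runs in the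
interior of the region `A` until it arrives at `∂A` in the phase point `ρ'`. -/
def SmoothFlight (ε : ℝ) (A : Set (Pos d)) (ρ ρ' : Phase d) : Prop :=
  ∃ τ > 0, ∃ γ : ℝ → Phase d, S.IsOrbit ε τ γ ∧ γ 0 = ρ ∧ γ τ = ρ' ∧
    (∀ t ∈ Ioo 0 τ, (γ t).1 ∈ interior A) ∧ ρ'.1 ∈ frontier A

/-- The reflection map `R^ε` of the smooth flow as a relation: the orbit of `ρ` runs outside the
region `A` until it returns to `∂A` in the phase point `ρ'`. -/
def SmoothReflection (ε : ℝ) (A : Set (Pos d)) (ρ ρ' : Phase d) : Prop :=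
  ∃ τ > 0, ∃ γ : ℝ → Phase d, S.IsOrbit ε τ γ ∧ γ 0 = ρ ∧ γ τ = ρ' ∧
    (∀ t ∈ Ioo 0 τ, (γ t).1 ∉ closure A) ∧ ρ'.1 ∈ frontier A

/-- The Poincaré map `Φ^ε = R^ε ∘ F^ε` of the smooth flow as a relation. -/
def SmoothPoincare (ε : ℝ) (A : Set (Pos d)) (ρ ρ' : Phase d) : Prop :=
  ∃ ρ₁, S.SmoothFlight ε A ρ ρ₁ ∧ S.SmoothReflection ε A ρ₁ ρ'

/-- The part of the cross-section `S_ε` near `Γ_i`, on the energy level `1/2`. -/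
def crossSection (i : Fin n) (ε : ℝ) (A : Set (Pos d)) : Set (Phase d) :=
  {ρ | ρ.1 ∈ frontier A ∧ ‖ρ.2‖ ^ 2 / 2 + S.V ρ.1 ε = 1 / 2 ∧
    0 < inner ℝ ρ.2 (S.normal i ε ρ.1)}

end SteepFamily

/-! ### The billiard in a region -/

/-- The times at which the straight line of `ρ` meets the boundary of `A`. -/
def hitTimes {d : ℕ} (A : Set (Pos d)) (ρ : Phase d) : Set ℝ :=
  {t | 0 < t ∧ ρ.1 + t • ρ.2 ∈ frontier A}

/-- The time `τ_∘` of the first hit. -/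
def freeTime {d : ℕ} (A : Set (Pos d)) (ρ : Phase d) : ℝ := sInf (hitTimes A ρ)

/-- The free flight map `F_∘` of the billiard in `A`. -/
def freeFlight {d : ℕ} (A : Set (Pos d)) (ρ : Phase d) : Phase d :=
  (ρ.1 + freeTime A ρ • ρ.2, ρ.2)

namespace SteepFamily

variable {d n : ℕ} (S : SteepFamily d n)

/-- The billiard reflection `R_∘^ε` near `Γ_i`. -/
def reflect (i : Fin n) (ε : ℝ) (ρ : Phase d) : Phase d :=
  (ρ.1, ρ.2 - (2 * inner ℝ ρ.2 (S.normal i ε ρ.1)) • S.normal i ε ρ.1)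

/-- The billiard map `B^ε = R_∘^ε ∘ F_∘^ε` in `A`, for orbits that hit the boundary near `Γ_i`. -/
def billiardMap (i : Fin n) (ε : ℝ) (A : Set (Pos d)) (ρ : Phase d) : Phase d :=
  S.reflect i ε (freeFlight A ρ)

/-! ### The first-order corrections -/

/-- The first-order correction of the flight time,
`⟨∇Q, ∫_0^{τ_∘} ∇V(q + p s; ε) (τ_∘ - s) ds⟩ / ⟨∇Q, p⟩` with `∇Q` at the billiard collision
point. -/
def timeCorrection (ε : ℝ) (A : Set (Pos d)) (ρ : Phase d) : ℝ :=
  inner ℝ (gradient (fun x => S.Q x ε) (freeFlight A ρ).1)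
      (∫ s in (0 : ℝ)..freeTime A ρ,
        (freeTime A ρ - s) • gradient (fun x => S.V x ε) (ρ.1 + s • ρ.2)) /
    inner ℝ (gradient (fun x => S.Q x ε) (freeFlight A ρ).1) ρ.2

/-- The first-order correction `F_1^ε` of the free flight. -/
def flightCorrection (ε : ℝ) (A : Set (Pos d)) (ρ : Phase d) : Phase d :=
  (S.timeCorrection ε A ρ • ρ.2 + ∫ s in (0 : ℝ)..freeTime A ρ,
      (s - freeTime A ρ) • gradient (fun x => S.V x ε) (ρ.1 + s • ρ.2),
    -∫ s in (0 : ℝ)..freeTime A ρ, gradient (fun x => S.V x ε) (ρ.1 + s • ρ.2))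

/-- The normal component `p_y` of the momentum. -/
def normalPart (i : Fin n) (ε : ℝ) (ρ : Phase d) : ℝ := inner ℝ (S.normal i ε ρ.1) ρ.2

/-- The tangential component `p_x` of the momentum. -/
def tangentPart (i : Fin n) (ε : ℝ) (ρ : Phase d) : Pos d :=
  ρ.2 - S.normalPart i ε ρ • S.normal i ε ρ.1

/-- The derivative `Q_y` of `Q` in the direction of the normal. -/
def Qy (i : Fin n) (ε : ℝ) (q : Pos d) : ℝ :=
  inner ℝ (gradient (fun x => S.Q x ε) q) (S.normal i ε q)

/-- The integral `2 ∫ 𝒬_i'((1 - p_x² - s²)/2; ε) s^k ds` over `0 ≤ s ≤ √(1 - 2 ν_i - p_x²)`;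
`k = 0` and `k = 2` give `I_1` and `I_2`. On the energy level `1/2` at the surface `V = ν_i` the
upper limit equals `|p_y|`; in this form the integrand is evaluated only where its argument is at
least `ν_i`, also at nearby phase points off that surface. -/
def layerIntegral (k : ℕ) (i : Fin n) (ν ε : ℝ) (ρ : Phase d) : ℝ :=
  2 * ∫ s in (0 : ℝ)..Real.sqrt (1 - 2 * ν - ‖S.tangentPart i ε ρ‖ ^ 2),
    deriv (fun w => S.invBarrier i w ε) ((1 - ‖S.tangentPart i ε ρ‖ ^ 2 - s ^ 2) / 2) * s ^ k

/-- The vector `J = (-(I_2 / p_y) l - I_1 K p_x) / Q_y`, where `K` and `l` are the derivatives of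
the unit normal in the tangent directions and in the direction of the normal. -/
def vecJ (i : Fin n) (ν ε : ℝ) (ρ : Phase d) : Pos d :=
  (S.Qy i ε ρ.1)⁻¹ •
    (-(S.layerIntegral 2 i ν ε ρ / S.normalPart i ε ρ) •
        fderiv ℝ (S.normal i ε) ρ.1 (S.normal i ε ρ.1) -
      S.layerIntegral 0 i ν ε ρ • fderiv ℝ (S.normal i ε) ρ.1 (S.tangentPart i ε ρ))

/-- The first-order correction `R_1^ε` of the reflection,
`(-(I_1 / Q_y) p_x, -p_y J - ⟨p_x, J⟩ n)`. -/
def reflectCorrection (i : Fin n) (ν ε : ℝ) (ρ : Phase d) : Phase d :=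
  (-(S.layerIntegral 0 i ν ε ρ / S.Qy i ε ρ.1) • S.tangentPart i ε ρ,
    -S.normalPart i ε ρ • S.vecJ i ν ε ρ -
      (inner ℝ (S.tangentPart i ε ρ) (S.vecJ i ν ε ρ) : ℝ) • S.normal i ε ρ.1)

/-- The first-order correction `Φ_1^ε = (R_∘^ε + R_1^ε) ∘ (F_∘^ε + F_1^ε) - B^ε`. -/
def mapCorrection (i : Fin n) (ν ε : ℝ) (A : Set (Pos d)) (ρ : Phase d) : Phase d :=
  S.reflect i ε (freeFlight A ρ + S.flightCorrection ε A ρ) +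
    S.reflectCorrection i ν ε (freeFlight A ρ + S.flightCorrection ε A ρ) -
    S.billiardMap i ε A ρ

/-! ### Regular reflections and closeness -/

/-- A billiard orbit of the table `D` that starts with unit speed at `q ∈ Γ_j` and has a regular
reflection at `q + T p ∈ Γ_i`, quantified by `C > 0`: the angles with the boundary at both ends,
the distances of both ends from the corners, and the distance of the flight to the boundary are
bounded from below, and the time of flight is bounded from above. -/
structure IsRegularOrbit (r : ℕ) (C : ℝ) (j i : Fin n) (q p : Pos d) (T : ℝ) : Prop where
  speed : ‖p‖ = 1
  start_mem : q ∈ S.Γ j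
  end_mem : q + T • p ∈ S.Γ i
  time_pos : 0 < T
  time_le : T ≤ 1 / C
  start_corner : ∀ c ∈ S.cornerSet r, C ≤ dist q c
  end_corner : ∀ c ∈ S.cornerSet r, C ≤ dist (q + T • p) c
  start_angle : C ≤ inner ℝ p (S.normal j 0 q)
  end_angle : inner ℝ p (S.normal i 0 (q + T • p)) ≤ -C
  inside : ∀ t ∈ Ioo 0 T, q + t • p ∈ S.D
  clearance : ∀ t ∈ Ioo 0 T, ∀ y ∈ frontier S.D, C * min t (T - t) ≤ dist (q + t • p) y

end SteepFamily

/-- On the part of `M` in the open set `U`, the function `f` is of class `C^k` and bounded by `b`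
in the `C^k` norm: it is the restriction of a `C^k` function on `U` whose derivatives of order at
most `k` are bounded by `b`. (Here `M` is a submanifold, so that this is how its `C^k` functions
and their norms are described in the ambient space.) -/
def IsCkBounded {d : ℕ} (k : ℕ) (U M : Set (Phase d)) (f : Phase d → Phase d) (b : ℝ≥0∞) : Prop :=
  ∃ g : Phase d → Phase d, ContDiffOn ℝ k g U ∧ (∀ ρ ∈ U ∩ M, g ρ = f ρ) ∧
    ∀ l ≤ k, ∀ ρ ∈ U, ‖iteratedFDeriv ℝ l g ρ‖ₑ ≤ b

end

set_option linter.unusedSectionVars false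

noncomputable section

/-! ### Families of functions that are uniformly bounded in `C^k` -/

section CkBigO

variable {α E F G H : Type} [NormedAddCommGroup E] [NormedSpace ℝ E]
  [NormedAddCommGroup F] [NormedSpace ℝ F] [NormedAddCommGroup G] [NormedSpace ℝ G]
  [NormedAddCommGroup H] [NormedSpace ℝ H]

/-- Along the filter `𝓕` the functions `f a` are of class `C^k`, with derivatives of order at most
`k` bounded by a constant multiple of `b a`. -/
structure CkBigO (𝓕 : Filter (α × E)) (k : ℕ) (f : α → E → F) (b : α → ℝ≥0) : Prop where
  exists_bound : ∃ K : ℝ≥0, ∀ᶠ p in 𝓕, ContDiffAt ℝ k (f p.1) p.2 ∧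
    ∀ j ≤ k, ‖iteratedFDeriv ℝ j (f p.1) p.2‖ ≤ K * b p.1

/-- What holds eventually along the filter holds eventually on neighbourhoods in the second
variable. -/
class SpreadFilter (𝓕 : Filter (α × E)) : Prop where
  spread : ∀ P : α × E → Prop, (∀ᶠ p in 𝓕, P p) → ∀ᶠ p in 𝓕, ∀ᶠ y in 𝓝 p.2, P (p.1, y)

instance (l : Filter α) (s : Set E) : SpreadFilter (l ×ˢ 𝓝ˢ s) where
  spread P h := by
    obtain ⟨p, hp, q, hq, hpq⟩ := eventually_prod_iff.1 h
    refine eventually_prod_iff.2 ⟨p, hp, fun x => ∀ᶠ y in 𝓝 x, q y, ?_, fun {x} hx {y} hy =>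
      hy.mono fun z hz => hpq hx hz⟩
    obtain ⟨U, hU, hsU, hUq⟩ := eventually_nhdsSet_iff_exists.1 hq
    exact eventually_nhdsSet_iff_exists.2 ⟨U, hU, hsU, fun x hx =>
      Filter.mem_of_superset (hU.mem_nhds hx) fun y hy => hUq y hy⟩

instance (l : Filter α) (z : E) : SpreadFilter (l ×ˢ 𝓝 z) where
  spread P h := by
    rw [← nhdsSet_singleton] at h ⊢
    exact SpreadFilter.spread P h

variable {𝓕 : Filter (α × E)} {𝓖 : Filter (α × F)} {k : ℕ} {f g : α → E → F} {b c : α → ℝ≥0}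

theorem CkBigO.of_le {m : ℕ} (h : CkBigO 𝓕 k f b) (hm : m ≤ k) : CkBigO 𝓕 m f b := by
  obtain ⟨K, hK⟩ := h
  exact ⟨K, hK.mono fun p hp => ⟨hp.1.of_le (by exact_mod_cast hm),
    fun j hj => hp.2 j (hj.trans hm)⟩⟩

theorem CkBigO.mono_filter {𝓕' : Filter (α × E)} (h : CkBigO 𝓕 k f b) (hF : 𝓕' ≤ 𝓕) :
    CkBigO 𝓕' k f b := by
  obtain ⟨K, hK⟩ := h
  exact ⟨K, hK.filter_mono hF⟩

theorem CkBigO.scale (h : CkBigO 𝓕 k f b) (C : ℝ≥0) (hc : ∀ᶠ p in 𝓕, b p.1 ≤ C * c p.1) :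
    CkBigO 𝓕 k f c := by
  obtain ⟨K, hK⟩ := h
  refine ⟨K * C, (hK.and hc).mono fun p hp => ⟨hp.1.1, fun j hj => (hp.1.2 j hj).trans ?_⟩⟩
  have : K * b p.1 ≤ K * C * c p.1 := by rw [mul_assoc]; gcongr; exact hp.2
  exact_mod_cast this

theorem CkBigO.congr [SpreadFilter 𝓕] (h : CkBigO 𝓕 k f b)
    (hfg : ∀ᶠ p in 𝓕, f p.1 p.2 = g p.1 p.2) : CkBigO 𝓕 k g b := by
  obtain ⟨K, hK⟩ := h
  refine ⟨K, (hK.and (SpreadFilter.spread _ hfg)).mono fun p hp => ?_⟩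
  have e : f p.1 =ᶠ[𝓝 p.2] g p.1 := hp.2
  exact ⟨hp.1.1.congr_of_eventuallyEq e.symm, fun j hj =>
    (e.iteratedFDeriv ℝ j).eq_of_nhds ▸ hp.1.2 j hj⟩

theorem CkBigO.contDiffAt (h : CkBigO 𝓕 k f b) : ∀ᶠ p in 𝓕, ContDiffAt ℝ k (f p.1) p.2 :=
  let ⟨_, hK⟩ := h; hK.mono fun _ hp => hp.1

theorem CkBigO.norm_le (h : CkBigO 𝓕 k f b) : ∃ K : ℝ≥0, ∀ᶠ p in 𝓕, ‖f p.1 p.2‖ ≤ K * b p.1 :=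
  let ⟨K, hK⟩ := h; ⟨K, hK.mono fun p hp => by simpa using hp.2 0 (Nat.zero_le k)⟩

theorem CkBigO.norm_fderiv_le (h : CkBigO 𝓕 (k + 1) f b) :
    ∃ K : ℝ≥0, ∀ᶠ p in 𝓕, ‖fderiv ℝ (f p.1) p.2‖ ≤ K * b p.1 :=
  let ⟨K, hK⟩ := h
  ⟨K, hK.mono fun p hp => by simpa [norm_iteratedFDeriv_one] using hp.2 1 (by omega)⟩

theorem CkBigO.differentiableAt (h : CkBigO 𝓕 (k + 1) f b) :
    ∀ᶠ p in 𝓕, DifferentiableAt ℝ (f p.1) p.2 :=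
  h.contDiffAt.mono fun _ hp => hp.differentiableAt (by simp)

theorem CkBigO.fderiv (h : CkBigO 𝓕 (k + 1) f b) :
    CkBigO 𝓕 k (fun a => fderiv ℝ (f a)) b := by
  obtain ⟨K, hK⟩ := h
  refine ⟨K, hK.mono fun p hp => ⟨hp.1.fderiv_right (by simp), fun j hj => ?_⟩⟩
  rw [norm_iteratedFDeriv_fderiv]
  exact hp.2 _ (by omega)

theorem CkBigO.succ [SpreadFilter 𝓕] (h0 : ∃ K : ℝ≥0, ∀ᶠ p in 𝓕, ‖f p.1 p.2‖ ≤ K * b p.1)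
    {f' : α → E → E →L[ℝ] F} (hd : ∀ᶠ p in 𝓕, HasFDerivAt (f p.1) (f' p.1 p.2) p.2)
    (h1 : CkBigO 𝓕 k f' b) : CkBigO 𝓕 (k + 1) f b := by
  have h1' : CkBigO 𝓕 k (fun a => _root_.fderiv ℝ (f a)) b :=
    h1.congr (hd.mono fun p hp => hp.fderiv.symm)
  obtain ⟨K, hK⟩ := h1'
  obtain ⟨K0, hK0⟩ := h0
  refine ⟨K + K0, ((hK.and hK0).and (SpreadFilter.spread _ hd)).mono fun p hp => ⟨?_, ?_⟩⟩
  · exact contDiffAt_succ_iff_hasFDerivAt.2 ⟨_, ⟨_, hp.2, fun x hx =>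
      (HasFDerivAt.differentiableAt hx).hasFDerivAt⟩, hp.1.1.1⟩
  · intro j hj
    rcases j with _ | j
    · rw [norm_iteratedFDeriv_zero]
      refine hp.1.2.trans ?_
      gcongr
      exact_mod_cast le_add_self
    · rw [← norm_iteratedFDeriv_fderiv]
      refine (hp.1.1.2 j (by omega)).trans ?_
      gcongr
      exact_mod_cast le_self_add

theorem CkBigO.const {v : α → F} {K : ℝ≥0} (h : ∀ᶠ p in 𝓕, ‖v p.1‖ ≤ K * b p.1) :
    CkBigO 𝓕 k (fun a _ => v a) b := by
  refine ⟨K, h.mono fun p hp => ⟨contDiffAt_const, fun j hj => ?_⟩⟩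
  rcases j with _ | j
  · simpa using hp
  · rw [iteratedFDeriv_succ_const]
    simp only [Pi.zero_apply, norm_zero]
    positivity

theorem CkBigO.const_one (v : F) : CkBigO 𝓕 k (fun _ _ => v) (fun _ => 1) :=
  CkBigO.const (K := ‖v‖₊) (by simp)

theorem ckBigO_of_contDiffAt {l : Filter α} {φ : E → F} {z : E} (h : ContDiffAt ℝ k φ z) :
    CkBigO (l ×ˢ 𝓝 z) k (fun _ => φ) (fun _ => 1) := by
  refine ⟨∑ j ∈ Finset.range (k + 1), (‖iteratedFDeriv ℝ j φ z‖₊ + 1), ?_⟩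
  have h1 : ∀ᶠ y in 𝓝 z, ContDiffAt ℝ k φ y := h.eventually (by simp)
  have h2 : ∀ᶠ y in 𝓝 z, ∀ j ∈ Finset.range (k + 1),
      ‖iteratedFDeriv ℝ j φ y‖ < ‖iteratedFDeriv ℝ j φ z‖ + 1 := by
    rw [eventually_all_finset]
    intro j hj
    have hc : ContinuousAt (iteratedFDeriv ℝ j φ) z :=
      h.continuousAt_iteratedFDeriv (by exact_mod_cast Finset.mem_range_succ_iff.1 hj)
    exact hc.norm.eventually_lt_const (by simp)
  refine ((h1.and h2).prod_inr l).mono fun p hp => ⟨hp.1, fun j hj => ?_⟩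
  have hj' : j ∈ Finset.range (k + 1) := Finset.mem_range_succ_iff.2 hj
  refine (hp.2 j hj').le.trans ?_
  have := Finset.single_le_sum (f := fun j => ‖iteratedFDeriv ℝ j φ z‖₊ + 1)
    (fun _ _ => zero_le) hj'
  simpa using NNReal.coe_le_coe.2 this

theorem ckBigO_id {l : Filter α} {z : E} :
    CkBigO (l ×ˢ 𝓝 z) k (fun _ x => x) (fun _ => 1) := ckBigO_of_contDiffAt contDiffAt_id

theorem CkBigO.add (hf : CkBigO 𝓕 k f b) (hg : CkBigO 𝓕 k g b) :
    CkBigO 𝓕 k (fun a x => f a x + g a x) b := by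
  obtain ⟨K, hK⟩ := hf
  obtain ⟨L, hL⟩ := hg
  refine ⟨K + L, (hK.and hL).mono fun p hp => ⟨hp.1.1.add hp.2.1, fun j hj => ?_⟩⟩
  have hj' : (j : WithTop ℕ∞) ≤ k := by exact_mod_cast hj
  have : iteratedFDeriv ℝ j (fun x => f p.1 x + g p.1 x) p.2 = _ :=
    iteratedFDeriv_add_apply (hp.1.1.of_le hj') (hp.2.1.of_le hj')
  rw [this]
  refine (norm_add_le _ _).trans ?_
  push_cast
  rw [add_mul]
  exact add_le_add (hp.1.2 j hj) (hp.2.2 j hj)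

theorem CkBigO.clm (L : F →L[ℝ] G) (hf : CkBigO 𝓕 k f b) :
    CkBigO 𝓕 k (fun a x => L (f a x)) b := by
  obtain ⟨K, hK⟩ := hf
  refine ⟨‖L‖₊ * K, hK.mono fun p hp => ⟨L.contDiff.contDiffAt.comp _ hp.1, fun j hj => ?_⟩⟩
  refine (L.norm_iteratedFDeriv_comp_left hp.1 (by exact_mod_cast hj)).trans ?_
  push_cast
  rw [mul_assoc]
  exact mul_le_mul_of_nonneg_left (hp.2 j hj) (norm_nonneg _)

theorem CkBigO.neg (hf : CkBigO 𝓕 k f b) : CkBigO 𝓕 k (fun a x => -f a x) b := by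
  simpa using hf.clm (-ContinuousLinearMap.id ℝ F)

theorem CkBigO.sub (hf : CkBigO 𝓕 k f b) (hg : CkBigO 𝓕 k g b) :
    CkBigO 𝓕 k (fun a x => f a x - g a x) b := by
  simpa [sub_eq_add_neg] using hf.add hg.neg

theorem CkBigO.prodMk {g : α → E → G} (hf : CkBigO 𝓕 k f b) (hg : CkBigO 𝓕 k g b) :
    CkBigO 𝓕 k (fun a x => (f a x, g a x)) b := by
  simpa using (hf.clm (ContinuousLinearMap.inl ℝ F G)).add (hg.clm (ContinuousLinearMap.inr ℝ F G))

theorem CkBigO.fst {f : α → E → F × G} (hf : CkBigO 𝓕 k f b) :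
    CkBigO 𝓕 k (fun a x => (f a x).1) b := hf.clm (ContinuousLinearMap.fst ℝ F G)

theorem CkBigO.snd {f : α → E → F × G} (hf : CkBigO 𝓕 k f b) :
    CkBigO 𝓕 k (fun a x => (f a x).2) b := hf.clm (ContinuousLinearMap.snd ℝ F G)

theorem norm_iteratedFDeriv_bilin_le (B : F →L[ℝ] G →L[ℝ] H) {f : E → F} {g : E → G} {x : E}
    (hf : ContDiffAt ℝ k f x) (hg : ContDiffAt ℝ k g x) {a b : ℝ} (ha : 0 ≤ a)
    (hfa : ∀ j ≤ k, ‖iteratedFDeriv ℝ j f x‖ ≤ a) (hgb : ∀ j ≤ k, ‖iteratedFDeriv ℝ j g x‖ ≤ b)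
    {j : ℕ} (hj : j ≤ k) :
    ‖iteratedFDeriv ℝ j (fun y => B (f y) (g y)) x‖ ≤ ‖B‖ * 2 ^ j * (a * b) := by
  obtain ⟨u, hu, hfu⟩ := hf.contDiffOn le_rfl (by simp)
  obtain ⟨v, hv, hgv⟩ := hg.contDiffOn le_rfl (by simp)
  obtain ⟨s, hs, hso, hxs⟩ := mem_nhds_iff.1 (inter_mem hu hv)
  have key := B.norm_iteratedFDerivWithin_le_of_bilinear (hfu.mono fun y hy => (hs hy).1)
    (hgv.mono fun y hy => (hs hy).2) hso.uniqueDiffOn hxs (n := j) (by exact_mod_cast hj)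
  rw [iteratedFDerivWithin_of_isOpen j hso hxs] at key
  refine key.trans ?_
  rw [mul_assoc]
  refine mul_le_mul_of_nonneg_left ?_ (by positivity)
  have : ((2 : ℝ) ^ j) * (a * b) = ∑ i ∈ Finset.range (j + 1), (j.choose i : ℝ) * a * b := by
    rw [← Finset.sum_mul, ← Finset.sum_mul]
    have := Nat.sum_range_choose j
    rw [← Nat.cast_sum, this]
    push_cast; ring
  rw [this]
  refine Finset.sum_le_sum fun i hi => ?_
  have hi' := Finset.mem_range_succ_iff.1 hi
  rw [iteratedFDerivWithin_of_isOpen i hso hxs, iteratedFDerivWithin_of_isOpen (j - i) hso hxs]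
  gcongr
  · exact hfa i (hi'.trans hj)
  · exact hgb _ (by omega)

theorem CkBigO.bilin (B : F →L[ℝ] G →L[ℝ] H) {g : α → E → G} (hf : CkBigO 𝓕 k f b)
    (hg : CkBigO 𝓕 k g c) : CkBigO 𝓕 k (fun a x => B (f a x) (g a x)) (fun a => b a * c a) := by
  obtain ⟨K, hK⟩ := hf
  obtain ⟨L, hL⟩ := hg
  refine ⟨‖B‖₊ * 2 ^ k * (K * L), (hK.and hL).mono fun p hp => ⟨?_, fun j hj => ?_⟩⟩
  · exact B.isBoundedBilinearMap.contDiff.contDiffAt.comp p.2 (hp.1.1.prodMk hp.2.1)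
  · refine (norm_iteratedFDeriv_bilin_le B hp.1.1 hp.2.1 (by positivity) hp.1.2 hp.2.2 hj).trans ?_
    push_cast
    have : (2 : ℝ) ^ j ≤ 2 ^ k := pow_le_pow_right₀ (by norm_num) hj
    calc _ ≤ ‖B‖ * 2 ^ k * (K * b p.1 * (L * c p.1)) := by gcongr
      _ = _ := by ring

theorem CkBigO.smul {f : α → E → ℝ} {g : α → E → G} (hf : CkBigO 𝓕 k f b)
    (hg : CkBigO 𝓕 k g c) : CkBigO 𝓕 k (fun a x => f a x • g a x) (fun a => b a * c a) :=
  hf.bilin (ContinuousLinearMap.lsmul ℝ ℝ) hg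

theorem CkBigO.comp {g : α → F → G} (hg : CkBigO 𝓖 k g b) (hf : CkBigO 𝓕 k f (fun _ => 1))
    (hfg : Tendsto (fun p : α × E => (p.1, f p.1 p.2)) 𝓕 𝓖) :
    CkBigO 𝓕 k (fun a x => g a (f a x)) b := by
  obtain ⟨K, hK⟩ := hg
  obtain ⟨L, hL⟩ := hf
  have hK' := hfg.eventually hK
  refine ⟨k.factorial * K * (max L 1) ^ k, (hK'.and hL).mono fun p hp =>
    ⟨hp.1.1.comp p.2 hp.2.1, fun j hj => ?_⟩⟩
  obtain ⟨⟨hg1, hg2⟩, hf1, hf2⟩ := hp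
  obtain ⟨u, hu, hgu⟩ := hg1.contDiffOn le_rfl (by simp)
  obtain ⟨t, ht, hto, hxt⟩ := mem_nhds_iff.1 hu
  obtain ⟨v, hv, hfv⟩ := hf1.contDiffOn le_rfl (by simp)
  obtain ⟨s, hs, hso, hxs⟩ := mem_nhds_iff.1
    (inter_mem hv (hf1.continuousAt.preimage_mem_nhds (hto.mem_nhds hxt)))
  have key := norm_iteratedFDerivWithin_comp_le (n := j) (hgu.mono ht)
    (hfv.mono fun y hy => (hs hy).1) (by exact_mod_cast hj) hto.uniqueDiffOn hso.uniqueDiffOn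
    (fun y hy => (hs hy).2) hxs (C := K * b p.1) (D := max L 1) ?_ ?_
  · rw [iteratedFDerivWithin_of_isOpen j hso hxs] at key
    refine key.trans ?_
    have h1 : (1 : ℝ) ≤ max (L : ℝ) 1 := le_max_right _ _
    have h2 : (max (L : ℝ) 1) ^ j ≤ (max (L : ℝ) 1) ^ k := pow_le_pow_right₀ h1 hj
    have h3 : (j.factorial : ℝ) ≤ k.factorial := by exact_mod_cast Nat.factorial_le hj
    push_cast
    calc _ ≤ (k.factorial : ℝ) * (K * b p.1) * (max (L : ℝ) 1) ^ k := by gcongr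
      _ = _ := by ring
  · intro i hi
    rw [iteratedFDerivWithin_of_isOpen i hto hxt]
    exact hg2 i (hi.trans hj)
  · intro i h1i hi
    rw [iteratedFDerivWithin_of_isOpen i hso hxs]
    refine (hf2 i (hi.trans hj)).trans ?_
    simp only [NNReal.coe_one, mul_one]
    have h1 : (1 : ℝ) ≤ max (L : ℝ) 1 := le_max_right _ _
    calc (L : ℝ) ≤ max L 1 := le_max_left _ _
      _ = (max (L : ℝ) 1) ^ 1 := (pow_one _).symm
      _ ≤ _ := pow_le_pow_right₀ h1 h1i

/-- Composition with families that converge at the base point. -/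
theorem CkBigO.comp_nhds {l : Filter α} {x₀ : F} {g : α → F → G} {𝓕 : Filter (α × E)}
    (hg : CkBigO (l ×ˢ 𝓝 x₀) k g b) (hf : CkBigO 𝓕 k f (fun _ => 1))
    (hl : Tendsto Prod.fst 𝓕 l) (hfx : Tendsto (fun p : α × E => f p.1 p.2) 𝓕 (𝓝 x₀)) :
    CkBigO 𝓕 k (fun a x => g a (f a x)) b :=
  hg.comp hf (hl.prodMk hfx)

theorem CkBigO.comp_fixed {x₀ : F} {φ : F → G} (hφ : ContDiffAt ℝ k φ x₀)
    (hf : CkBigO 𝓕 k f (fun _ => 1))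
    (hfx : Tendsto (fun p : α × E => f p.1 p.2) 𝓕 (𝓝 x₀)) :
    CkBigO 𝓕 k (fun a x => φ (f a x)) (fun _ => 1) :=
  (ckBigO_of_contDiffAt (l := (⊤ : Filter α)) hφ).comp_nhds hf tendsto_top hfx

theorem CkBigO.tendsto_zero {l : Filter α} {𝓕 : Filter (α × E)} (hf : CkBigO 𝓕 k f b)
    (hl : Tendsto Prod.fst 𝓕 l) (hb : Tendsto b l (𝓝 0)) :
    Tendsto (fun p : α × E => f p.1 p.2) 𝓕 (𝓝 0) := by
  obtain ⟨K, hK⟩ := hf.norm_le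
  refine squeeze_zero_norm' hK ?_
  have : Tendsto (fun p : α × E => ((K * b p.1 : ℝ≥0) : ℝ)) 𝓕 (𝓝 ((K * 0 : ℝ≥0) : ℝ)) :=
    NNReal.tendsto_coe.2 ((hb.comp hl).const_mul K)
  simpa using this

theorem CkBigO.mul_one_right (h : CkBigO 𝓕 k f (fun a => b a * 1)) : CkBigO 𝓕 k f b := by
  simpa using h

theorem CkBigO.one_mul_left (h : CkBigO 𝓕 k f (fun a => 1 * b a)) : CkBigO 𝓕 k f b := by
  simpa using h

/-- Uniform bounds near every point of a compact set hold near the set. -/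
theorem ckBigO_nhdsSet_of_isCompact {l : Filter α} {C : Set E} (hC : IsCompact C)
    (h : ∀ x ∈ C, CkBigO (l ×ˢ 𝓝 x) k f b) : CkBigO (l ×ˢ 𝓝ˢ C) k f b := by
  refine hC.induction_on (p := fun s => CkBigO (l ×ˢ 𝓝ˢ s) k f b) ?_ ?_ ?_ ?_
  · exact ⟨0, by simp [nhdsSet_empty]⟩
  · intro s t hst ht
    exact ht.mono_filter (Filter.prod_mono le_rfl (nhdsSet_mono hst))
  · rintro s t ⟨K, hK⟩ ⟨L, hL⟩
    refine ⟨K + L, ?_⟩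
    rw [nhdsSet_union, Filter.prod_sup, eventually_sup]
    constructor
    · refine hK.mono fun p hp => ⟨hp.1, fun j hj => (hp.2 j hj).trans ?_⟩
      gcongr; exact_mod_cast le_self_add
    · refine hL.mono fun p hp => ⟨hp.1, fun j hj => (hp.2 j hj).trans ?_⟩
      gcongr; exact_mod_cast le_add_self
  · intro x hx
    obtain ⟨K, hK⟩ := h x hx
    obtain ⟨p, hp, q, hq, hpq⟩ := eventually_prod_iff.1 hK
    obtain ⟨U, hU, hUo, hxU⟩ := mem_nhds_iff.1 hq
    refine ⟨U, mem_nhdsWithin_of_mem_nhds (hUo.mem_nhds hxU), K, ?_⟩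
    exact eventually_prod_iff.2 ⟨p, hp, q, by
      rw [hUo.nhdsSet_eq]; exact fun y hy => hU hy, hpq⟩

end CkBigO

/-! ### Families whose highest derivatives are uniformly Lipschitz -/

section CkLip

variable {α E F G H : Type} [NormedAddCommGroup E] [NormedSpace ℝ E]
  [NormedAddCommGroup F] [NormedSpace ℝ F] [NormedAddCommGroup G] [NormedSpace ℝ G]
  [NormedAddCommGroup H] [NormedSpace ℝ H]

/-- Near `z` the functions `f a` are bounded in `C^k` by multiples of `b a`, and so are the
Lipschitz constants of their derivatives of order `k`. -/
structure CkLip (l : Filter α) (k : ℕ) (z : E) (f : α → E → F) (b : α → ℝ≥0) : Prop where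
  ckBigO : CkBigO (l ×ˢ 𝓝 z) k f b
  lipschitz : ∃ K : ℝ≥0, ∀ᶠ p : α × (E × E) in l ×ˢ 𝓝 (z, z),
    ‖iteratedFDeriv ℝ k (f p.1) p.2.1 - iteratedFDeriv ℝ k (f p.1) p.2.2‖ ≤
      K * b p.1 * ‖p.2.1 - p.2.2‖

theorem norm_iteratedFDeriv_zero_sub (f : E → F) (x y : E) :
    ‖iteratedFDeriv ℝ 0 f x - iteratedFDeriv ℝ 0 f y‖ = ‖f x - f y‖ := by
  rw [iteratedFDeriv_zero_eq_comp]
  simp only [Function.comp_apply]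
  rw [← map_sub, LinearIsometryEquiv.norm_map]

theorem norm_iteratedFDeriv_succ_sub (k : ℕ) (f : E → F) (x y : E) :
    ‖iteratedFDeriv ℝ (k + 1) f x - iteratedFDeriv ℝ (k + 1) f y‖ =
      ‖iteratedFDeriv ℝ k (fderiv ℝ f) x - iteratedFDeriv ℝ k (fderiv ℝ f) y‖ := by
  simp only [iteratedFDeriv_succ_eq_comp_right, Function.comp_apply]
  have := (continuousMultilinearCurryRightEquiv' ℝ k E F).symm.dist_map
    (iteratedFDeriv ℝ k (fderiv ℝ f) x) (iteratedFDeriv ℝ k (fderiv ℝ f) y)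
  rwa [dist_eq_norm, dist_eq_norm] at this

variable {l : Filter α} {k : ℕ} {z : E} {f g : α → E → F} {b c : α → ℝ≥0}

theorem CkLip.fderiv (h : CkLip l (k + 1) z f b) : CkLip l k z (fun a => fderiv ℝ (f a)) b := by
  obtain ⟨h1, K, hK⟩ := h
  exact ⟨h1.fderiv, K, hK.mono fun p hp => by rwa [← norm_iteratedFDeriv_succ_sub]⟩

theorem CkLip.succ (h0 : CkBigO (l ×ˢ 𝓝 z) (k + 1) f b)
    (h : CkLip l k z (fun a => _root_.fderiv ℝ (f a)) b) : CkLip l (k + 1) z f b := by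
  obtain ⟨-, K, hK⟩ := h
  exact ⟨h0, K, hK.mono fun p hp => by rwa [norm_iteratedFDeriv_succ_sub]⟩

theorem eventually_prod_nhds_prod {P : α × E → Prop} (h : ∀ᶠ p in l ×ˢ 𝓝 z, P p) :
    ∀ᶠ p : α × (E × E) in l ×ˢ 𝓝 (z, z), P (p.1, p.2.1) ∧ P (p.1, p.2.2) := by
  have h1 : Tendsto (fun p : α × (E × E) => (p.1, p.2.1)) (l ×ˢ 𝓝 (z, z)) (l ×ˢ 𝓝 z) :=
    tendsto_fst.prodMk (((continuous_fst.tendsto (z, z)).comp tendsto_snd))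
  have h2 : Tendsto (fun p : α × (E × E) => (p.1, p.2.2)) (l ×ˢ 𝓝 (z, z)) (l ×ˢ 𝓝 z) :=
    tendsto_fst.prodMk (((continuous_snd.tendsto (z, z)).comp tendsto_snd))
  exact (h1.eventually h).and (h2.eventually h)

theorem eventually_prod_nhds_ball {P : α × E → Prop} (h : ∀ᶠ p in l ×ˢ 𝓝 z, P p) :
    ∃ r > 0, ∀ᶠ a in l, ∀ x ∈ Metric.ball z r, P (a, x) := by
  obtain ⟨p, hp, q, hq, hpq⟩ := eventually_prod_iff.1 h
  obtain ⟨r, hr, hrq⟩ := Metric.eventually_nhds_iff_ball.1 hq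
  exact ⟨r, hr, hp.mono fun a ha x hx => hpq ha (hrq x hx)⟩

theorem CkBigO.ckLip (h : CkBigO (l ×ˢ 𝓝 z) (k + 1) f b) : CkLip l k z f b := by
  refine ⟨h.of_le (by omega), ?_⟩
  obtain ⟨K, hK⟩ := h
  obtain ⟨r, hr, h⟩ := eventually_prod_nhds_ball hK
  refine ⟨K, ?_⟩
  have h2 : ∀ᶠ p : α × (E × E) in l ×ˢ 𝓝 (z, z), p.2.1 ∈ Metric.ball z r ∧
      p.2.2 ∈ Metric.ball z r :=
    eventually_prod_nhds_prod ((eventually_of_mem (Metric.ball_mem_nhds z hr)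
      fun _ h => h).prod_inr l)
  filter_upwards [h2, h.prod_inl (𝓝 (z, z))] with p hp hpr
  have := (convex_ball z r).norm_image_sub_le_of_norm_hasFDerivWithin_le (𝕜 := ℝ)
    (f := iteratedFDeriv ℝ k (f p.1)) (f' := _root_.fderiv ℝ (iteratedFDeriv ℝ k (f p.1)))
    (C := K * b p.1) ?_ ?_ hp.2 hp.1
  · exact this
  · intro x hx
    have := (hpr x hx).1.differentiableAt_iteratedFDeriv (m := k)
      (by exact_mod_cast Nat.lt_succ_self k)
    exact this.hasFDerivAt.hasFDerivWithinAt
  · intro x hx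
    rw [norm_fderiv_iteratedFDeriv]
    exact (hpr x hx).2 _ le_rfl

theorem CkLip.pred (h : CkLip l (k + 1) z f b) : CkLip l k z f b := h.1.ckLip

theorem CkLip.of_le {m : ℕ} (h : CkLip l k z f b) (hm : m ≤ k) : CkLip l m z f b := by
  induction k with
  | zero => obtain rfl : m = 0 := by omega
            exact h
  | succ k ih =>
    rcases hm.eq_or_lt with rfl | hm
    · exact h
    · exact ih h.pred (by omega)

theorem CkLip.congr (h : CkLip l k z f b) (hfg : ∀ᶠ p in l ×ˢ 𝓝 z, f p.1 p.2 = g p.1 p.2) :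
    CkLip l k z g b := by
  refine ⟨h.1.congr hfg, ?_⟩
  obtain ⟨-, K, hK⟩ := h
  refine ⟨K, ?_⟩
  filter_upwards [hK, eventually_prod_nhds_prod (SpreadFilter.spread _ hfg)] with p hp hp2
  have e1 : f p.1 =ᶠ[𝓝 p.2.1] g p.1 := hp2.1
  have e2 : f p.1 =ᶠ[𝓝 p.2.2] g p.1 := hp2.2
  rwa [← (e1.iteratedFDeriv ℝ k).eq_of_nhds, ← (e2.iteratedFDeriv ℝ k).eq_of_nhds]

theorem CkLip.add (hf : CkLip l k z f b) (hg : CkLip l k z g b) :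
    CkLip l k z (fun a x => f a x + g a x) b := by
  refine ⟨hf.1.add hg.1, ?_⟩
  obtain ⟨hf1, K, hK⟩ := hf
  obtain ⟨hg1, L, hL⟩ := hg
  refine ⟨K + L, ?_⟩
  filter_upwards [hK, hL, eventually_prod_nhds_prod hf1.contDiffAt,
    eventually_prod_nhds_prod hg1.contDiffAt] with p h1 h2 h3 h4
  have e1 : iteratedFDeriv ℝ k (fun x => f p.1 x + g p.1 x) p.2.1 = _ :=
    iteratedFDeriv_add_apply h3.1 h4.1
  have e2 : iteratedFDeriv ℝ k (fun x => f p.1 x + g p.1 x) p.2.2 = _ :=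
    iteratedFDeriv_add_apply h3.2 h4.2
  rw [e1, e2, add_sub_add_comm]
  refine (norm_add_le _ _).trans ?_
  push_cast
  linarith

theorem CkLip.bilin (B : F →L[ℝ] G →L[ℝ] H) {g : α → E → G} (hf : CkLip l k z f b)
    (hg : CkLip l k z g c) : CkLip l k z (fun a x => B (f a x) (g a x)) (fun a => b a * c a) := by
  induction k generalizing F G H with
  | zero =>
    refine ⟨hf.1.bilin B hg.1, ?_⟩
    obtain ⟨hf1, K, hK⟩ := hf
    obtain ⟨hg1, L, hL⟩ := hg
    obtain ⟨K0, hK0⟩ := hf1.norm_le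
    obtain ⟨L0, hL0⟩ := hg1.norm_le
    refine ⟨‖B‖₊ * (K * L0 + K0 * L), ?_⟩
    filter_upwards [hK, hL, eventually_prod_nhds_prod hK0, eventually_prod_nhds_prod hL0]
      with p h1 h2 h3 h4
    rw [norm_iteratedFDeriv_zero_sub] at h1 h2 ⊢
    have : B (f p.1 p.2.1) (g p.1 p.2.1) - B (f p.1 p.2.2) (g p.1 p.2.2) =
      B (f p.1 p.2.1 - f p.1 p.2.2) (g p.1 p.2.1) + B (f p.1 p.2.2) (g p.1 p.2.1 - g p.1 p.2.2) := by
      simp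
    rw [this]
    refine (norm_add_le _ _).trans ?_
    have i1 := B.le_opNorm₂ (f p.1 p.2.1 - f p.1 p.2.2) (g p.1 p.2.1)
    have i2 := B.le_opNorm₂ (f p.1 p.2.2) (g p.1 p.2.1 - g p.1 p.2.2)
    have j1 : ‖B‖ * ‖f p.1 p.2.1 - f p.1 p.2.2‖ * ‖g p.1 p.2.1‖ ≤
      ‖B‖ * (K * b p.1 * ‖p.2.1 - p.2.2‖) * (L0 * c p.1) := by gcongr; exact h4.1
    have j2 : ‖B‖ * ‖f p.1 p.2.2‖ * ‖g p.1 p.2.1 - g p.1 p.2.2‖ ≤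
      ‖B‖ * (K0 * b p.1) * (L * c p.1 * ‖p.2.1 - p.2.2‖) := by gcongr; exact h3.2
    push_cast
    calc _ ≤ _ := add_le_add (i1.trans j1) (i2.trans j2)
      _ = _ := by ring
  | succ k ih =>
    refine CkLip.succ (hf.1.bilin B hg.1) ?_
    have h1 := ih (B.precompR E) hf.pred hg.fderiv
    have h2 := ih (B.precompL E) hf.fderiv hg.pred
    refine (h1.add h2).congr ?_
    filter_upwards [hf.1.differentiableAt, hg.1.differentiableAt] with p hp1 hp2
    rw [B.fderiv_of_bilinear hp1 hp2]

theorem CkLip.const {v : α → F} {K : ℝ≥0} (h : ∀ᶠ a in l, ‖v a‖ ≤ K * b a) :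
    CkLip l k z (fun a _ => v a) b :=
  (CkBigO.const (k := k + 1) (h.prod_inl (𝓝 z))).ckLip

theorem CkLip.clm (L : F →L[ℝ] G) (hf : CkLip l k z f b) :
    CkLip l k z (fun a x => L (f a x)) b := by
  have := CkLip.bilin (ContinuousLinearMap.id ℝ (F →L[ℝ] G))
    (CkLip.const (l := l) (k := k) (z := z) (v := fun _ => L) (b := fun _ => 1) (K := ‖L‖₊)
      (by simp)) hf
  simpa using this

theorem CkLip.prodMk {g : α → E → G} (hf : CkLip l k z f b) (hg : CkLip l k z g b) :
    CkLip l k z (fun a x => (f a x, g a x)) b := by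
  simpa using (hf.clm (ContinuousLinearMap.inl ℝ F G)).add (hg.clm (ContinuousLinearMap.inr ℝ F G))

theorem CkLip.smul {f : α → E → ℝ} {g : α → E → G} (hf : CkLip l k z f b)
    (hg : CkLip l k z g c) : CkLip l k z (fun a x => f a x • g a x) (fun a => b a * c a) :=
  hf.bilin (ContinuousLinearMap.lsmul ℝ ℝ) hg

theorem CkLip.neg (hf : CkLip l k z f b) : CkLip l k z (fun a x => -f a x) b := by
  simpa using hf.clm (-ContinuousLinearMap.id ℝ F)

theorem CkLip.sub (hf : CkLip l k z f b) (hg : CkLip l k z g b) :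
    CkLip l k z (fun a x => f a x - g a x) b := by
  simpa [sub_eq_add_neg] using hf.add hg.neg

/-- The difference of two compositions with a family with Lipschitz derivatives. -/
theorem CkLip.comp_sub {x₀ : F} {h : α → F → G} (hh : CkLip l k x₀ h c) {𝓕 : Filter (α × E)}
    [SpreadFilter 𝓕] {A A₀ : α → E → F} (hA : CkBigO 𝓕 k A (fun _ => 1))
    (hA₀ : CkBigO 𝓕 k A₀ (fun _ => 1)) (hd : CkBigO 𝓕 k (fun a x => A a x - A₀ a x) b)
    (hl : Tendsto Prod.fst 𝓕 l) (tA : Tendsto (fun p : α × E => A p.1 p.2) 𝓕 (𝓝 x₀))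
    (tA₀ : Tendsto (fun p : α × E => A₀ p.1 p.2) 𝓕 (𝓝 x₀)) :
    CkBigO 𝓕 k (fun a x => h a (A a x) - h a (A₀ a x)) (fun a => c a * b a) := by
  induction k generalizing G with
  | zero =>
    obtain ⟨hh1, K, hK⟩ := hh
    obtain ⟨L, hL⟩ := hd.norm_le
    have hc := ((hh1.comp_nhds hA hl tA).sub (hh1.comp_nhds hA₀ hl tA₀)).contDiffAt
    have hK' := (hl.prodMk (tA.prodMk_nhds tA₀)).eventually hK
    refine ⟨K * L, ?_⟩
    filter_upwards [hc, hK', hL] with p h1 h2 h3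
    refine ⟨h1, fun j hj => ?_⟩
    obtain rfl : j = 0 := by omega
    rw [norm_iteratedFDeriv_zero]
    rw [norm_iteratedFDeriv_zero_sub] at h2
    refine h2.trans ?_
    push_cast
    calc (K * c p.1 * ‖A p.1 p.2 - A₀ p.1 p.2‖ : ℝ) ≤ K * c p.1 * (L * b p.1) := by gcongr
      _ = _ := by ring
  | succ k ih =>
    have h0 := ih (h := h) hh.pred (hA.of_le (by omega)) (hA₀.of_le (by omega))
      (hd.of_le (by omega))
    have h1 := ih hh.fderiv (hA.of_le (by omega)) (hA₀.of_le (by omega)) (hd.of_le (by omega))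
    have h2 := (h1.bilin (ContinuousLinearMap.compL ℝ E F G) hA.fderiv).mul_one_right
    have h3 := (hh.fderiv.1.comp_nhds (hA₀.of_le (by omega)) hl tA₀).bilin
      (ContinuousLinearMap.compL ℝ E F G) hd.fderiv
    refine CkBigO.succ h0.norm_le ?_ (h2.add h3)
    have hdh := hh.1.differentiableAt
    filter_upwards [hA.differentiableAt, hA₀.differentiableAt, (hl.prodMk tA).eventually hdh,
      (hl.prodMk tA₀).eventually hdh] with p p1 p2 p3 p4
    have e1 := p3.hasFDerivAt.comp p.2 p1.hasFDerivAt
    have e2 := p4.hasFDerivAt.comp p.2 p2.hasFDerivAt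
    refine (e1.sub e2).congr_fderiv ?_
    have e3 : _root_.fderiv ℝ (fun x => A p.1 x - A₀ p.1 x) p.2 = _ := fderiv_sub p1 p2
    ext v
    simp [e3]

theorem CkLip.norm_taylor_le {x₀ : F} {h : α → F → G}
    (hd : ∀ᶠ p in l ×ˢ 𝓝 x₀, DifferentiableAt ℝ (h p.1) p.2)
    (hh : CkLip l k x₀ (fun a => _root_.fderiv ℝ (h a)) c) {𝓕 : Filter (α × E)}
    {A A₀ : α → E → F} (hζ : CkBigO 𝓕 k (fun a x => A a x - A₀ a x) b)
    (hl : Tendsto Prod.fst 𝓕 l) (tA : Tendsto (fun p : α × E => A p.1 p.2) 𝓕 (𝓝 x₀))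
    (tA₀ : Tendsto (fun p : α × E => A₀ p.1 p.2) 𝓕 (𝓝 x₀)) :
    ∃ K : ℝ≥0, ∀ᶠ p in 𝓕, ‖h p.1 (A p.1 p.2) - h p.1 (A₀ p.1 p.2) -
      _root_.fderiv ℝ (h p.1) (A₀ p.1 p.2) (A p.1 p.2 - A₀ p.1 p.2)‖ ≤
        K * ((c p.1 * b p.1 ^ 2 : ℝ≥0) : ℝ) := by
  obtain ⟨-, K, hK⟩ := hh.of_le (Nat.zero_le k)
  obtain ⟨L, hL⟩ := hζ.norm_le
  obtain ⟨r, hr, hr1⟩ := eventually_prod_nhds_ball hd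
  obtain ⟨r', hr', hr2⟩ := eventually_prod_nhds_ball hK
  have hball : ∀ ρ > 0, ∀ᶠ p in 𝓕, A p.1 p.2 ∈ Metric.ball x₀ ρ ∧ A₀ p.1 p.2 ∈ Metric.ball x₀ ρ :=
    fun ρ hρ => (tA.eventually (Metric.ball_mem_nhds x₀ hρ)).and
      (tA₀.eventually (Metric.ball_mem_nhds x₀ hρ))
  refine ⟨K * L ^ 2, ?_⟩
  filter_upwards [hL, hball r hr, hball r' hr', hl.eventually hr1, hl.eventually hr2]
    with p h1 h2 h3 h4 h5
  set x := A p.1 p.2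
  set y := A₀ p.1 p.2
  have key := (convex_segment y x).norm_image_sub_le_of_norm_hasFDerivWithin_le' (𝕜 := ℝ)
    (f := h p.1) (f' := _root_.fderiv ℝ (h p.1)) (φ := _root_.fderiv ℝ (h p.1) y)
    (C := K * c p.1 * ‖x - y‖) ?_ ?_ (left_mem_segment ℝ y x) (right_mem_segment ℝ y x)
  · refine key.trans ?_
    push_cast
    calc (K * c p.1 * ‖x - y‖ * ‖x - y‖ : ℝ) ≤ K * c p.1 * (L * b p.1) * (L * b p.1) := by gcongr
      _ = _ := by ring
  · intro w hw
    have : w ∈ Metric.ball x₀ r := (convex_ball x₀ r).segment_subset h2.2 h2.1 hw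
    exact (h4 w this).hasFDerivAt.hasFDerivWithinAt
  · intro w hw
    have hw' : w ∈ Metric.ball x₀ r' := (convex_ball x₀ r').segment_subset h3.2 h3.1 hw
    have := h5 (w, y) (by
      rw [← ball_prod_same]; exact ⟨hw', h3.2⟩)
    rw [norm_iteratedFDeriv_zero_sub] at this
    refine this.trans ?_
    gcongr
    obtain ⟨t, ht, rfl⟩ := (segment_eq_image' ℝ y x).subset hw
    simp only [add_sub_cancel_left, norm_smul, Real.norm_eq_abs, abs_of_nonneg ht.1]
    exact mul_le_of_le_one_left (norm_nonneg _) ht.2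

/-- First-order Taylor expansion of a composition. -/
theorem CkLip.comp_taylor {x₀ : F} {h : α → F → G}
    (hd : ∀ᶠ p in l ×ˢ 𝓝 x₀, DifferentiableAt ℝ (h p.1) p.2)
    (hh : CkLip l k x₀ (fun a => _root_.fderiv ℝ (h a)) c) {𝓕 : Filter (α × E)}
    [SpreadFilter 𝓕] {A A₀ : α → E → F} (hA : CkBigO 𝓕 k A (fun _ => 1))
    (hA₀ : CkBigO 𝓕 k A₀ (fun _ => 1)) (hζ : CkBigO 𝓕 k (fun a x => A a x - A₀ a x) b)
    (hl : Tendsto Prod.fst 𝓕 l) (tA : Tendsto (fun p : α × E => A p.1 p.2) 𝓕 (𝓝 x₀))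
    (tA₀ : Tendsto (fun p : α × E => A₀ p.1 p.2) 𝓕 (𝓝 x₀)) :
    CkBigO 𝓕 k (fun a x => h a (A a x) - h a (A₀ a x) -
      _root_.fderiv ℝ (h a) (A₀ a x) (A a x - A₀ a x)) (fun a => c a * b a ^ 2) := by
  induction k generalizing G with
  | zero =>
    obtain ⟨K, hK⟩ := hh.norm_taylor_le hd hζ hl tA tA₀
    have c1 : ∀ᶠ p in l ×ˢ 𝓝 x₀, ContDiffAt ℝ 0 (h p.1) p.2 := by
      filter_upwards [SpreadFilter.spread _ hd] with p hp
      exact contDiffAt_zero.2 ⟨_, hp, fun y hy =>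
        (DifferentiableAt.continuousAt hy).continuousWithinAt⟩
    have c2 := ((hh.1.comp_nhds hA₀ hl tA₀).bilin (ContinuousLinearMap.id ℝ (F →L[ℝ] G))
      hζ).contDiffAt
    refine ⟨K, ?_⟩
    filter_upwards [hK, (hl.prodMk tA).eventually c1, (hl.prodMk tA₀).eventually c1, c2,
      hA.contDiffAt, hA₀.contDiffAt] with p p1 p2 p3 p4 p5 p6
    refine ⟨((p2.comp p.2 p5).sub (p3.comp p.2 p6)).sub p4, fun j hj => ?_⟩
    obtain rfl : j = 0 := by omega
    rw [norm_iteratedFDeriv_zero]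
    exact p1
  | succ k ih =>
    have hd' := hh.1.differentiableAt
    have ihd := ih (h := fun a => _root_.fderiv ℝ (h a)) hd' hh.fderiv (hA.of_le (by omega))
      (hA₀.of_le (by omega)) (hζ.of_le (by omega))
    have h1 := hh.pred.comp_sub (hA.of_le (by omega)) (hA₀.of_le (by omega))
      (hζ.of_le (by omega)) hl tA tA₀
    have h2 := (ihd.bilin (ContinuousLinearMap.compL ℝ E F G) hA₀.fderiv).mul_one_right
    have h3 := h1.bilin (ContinuousLinearMap.compL ℝ E F G) hζ.fderiv
    have h3' := h3.scale (c := fun a => c a * b a ^ 2) 1 (Eventually.of_forall fun p => by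
      simp only [one_mul, sq, mul_assoc]; exact le_rfl)
    refine CkBigO.succ (hh.norm_taylor_le hd hζ hl tA tA₀) ?_ (h2.add h3')
    filter_upwards [hA.differentiableAt, hA₀.differentiableAt, (hl.prodMk tA).eventually hd,
      (hl.prodMk tA₀).eventually (SpreadFilter.spread _ hd), (hl.prodMk tA₀).eventually hd']
      with p p1 p2 p3 p4 p5
    have e1 := p3.hasFDerivAt.comp p.2 p1.hasFDerivAt
    have e2 := p4.self_of_nhds.hasFDerivAt.comp p.2 p2.hasFDerivAt
    have e3 := p5.hasFDerivAt.comp p.2 p2.hasFDerivAt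
    have e4 : HasFDerivAt (fun x => A p.1 x - A₀ p.1 x) _ p.2 := p1.hasFDerivAt.sub p2.hasFDerivAt
    have e5 := e3.clm_apply e4
    have symm := fun v w => second_derivative_symmetric_of_eventually (f := h p.1)
      (f' := _root_.fderiv ℝ (h p.1)) (p4.mono fun y hy => hy.hasFDerivAt) p5.hasFDerivAt v w
    refine ((e1.sub e2).sub e5).congr_fderiv ?_
    ext v
    simp [e4.fderiv, symm (_root_.fderiv ℝ (A₀ p.1) p.2 v)]
    abel

end CkLip

/-! ### Fixed points depending on parameters -/

section FixedPoint

variable {α E X : Type} [NormedAddCommGroup E] [NormedSpace ℝ E]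
  [NormedAddCommGroup X] [NormedSpace ℝ X] [CompleteSpace X]

theorem eventually_mem_ball_prod (l : Filter α) (z : E) {r : ℝ} (hr : 0 < r) :
    ∀ᶠ p : α × E in l ×ˢ 𝓝 z, p.2 ∈ Metric.ball z r :=
  (eventually_of_mem (Metric.ball_mem_nhds z hr) fun _ h => h).prod_inr l

theorem norm_sub_le_half_of_fderiv_inr {G : E × X → X} {z₀ : E} {x₀ : X} {r : ℝ}
    (hd : ∀ y ∈ Metric.ball (z₀, x₀) r, DifferentiableAt ℝ G y)
    (hb : ∀ y ∈ Metric.ball (z₀, x₀) r,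
      ‖(fderiv ℝ G y).comp (ContinuousLinearMap.inr ℝ E X)‖ ≤ 1 / 2) {z : E}
    (hz : z ∈ Metric.ball z₀ r) {x x' : X} (hx : x ∈ Metric.ball x₀ r)
    (hx' : x' ∈ Metric.ball x₀ r) : ‖G (z, x) - G (z, x')‖ ≤ 1 / 2 * ‖x - x'‖ := by
  have hmem : ∀ w ∈ Metric.ball x₀ r, (z, w) ∈ Metric.ball (z₀, x₀) r := fun w hw => by
    rw [← ball_prod_same]; exact ⟨hz, hw⟩
  refine (convex_ball x₀ r).norm_image_sub_le_of_norm_hasFDerivWithin_le (𝕜 := ℝ)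
    (f := fun w => G (z, w)) (f' := fun w => (fderiv ℝ G (z, w)).comp
      (ContinuousLinearMap.inr ℝ E X)) (fun w hw => ?_) (fun w hw => hb _ (hmem w hw)) hx' hx
  have h1 : HasFDerivAt (fun w : X => (z, w)) (ContinuousLinearMap.inr ℝ E X) w :=
    hasFDerivAt_prodMk_right z w
  exact ((hd _ (hmem w hw)).hasFDerivAt.comp w h1).hasFDerivWithinAt

theorem exists_fixedPoint_closedBall {g : X → X} {x₀ : X} {ρ : ℝ} (hρ : 0 < ρ)
    (hg : ∀ x ∈ Metric.closedBall x₀ ρ, ∀ y ∈ Metric.closedBall x₀ ρ,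
      ‖g x - g y‖ ≤ 1 / 2 * ‖x - y‖) (h0 : ‖g x₀ - x₀‖ ≤ ρ / 2) :
    ∃ x ∈ Metric.closedBall x₀ ρ, g x = x := by
  have hx₀ : x₀ ∈ Metric.closedBall x₀ ρ := Metric.mem_closedBall_self hρ.le
  have hmaps : MapsTo g (Metric.closedBall x₀ ρ) (Metric.closedBall x₀ ρ) := by
    intro x hx
    have h1 := hg x hx x₀ hx₀
    rw [mem_closedBall_iff_norm] at hx ⊢
    calc ‖g x - x₀‖ = ‖(g x - g x₀) + (g x₀ - x₀)‖ := by congr 1; abel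
      _ ≤ ‖g x - g x₀‖ + ‖g x₀ - x₀‖ := norm_add_le _ _
      _ ≤ ρ := by linarith
  have hc : ContractingWith (1 / 2) (hmaps.restrict g _ _) := by
    refine ⟨by rw [← NNReal.coe_lt_coe]; norm_num, ?_⟩
    refine LipschitzWith.of_dist_le_mul fun x y => ?_
    have := hg x x.2 y y.2
    simpa [Subtype.dist_eq, dist_eq_norm] using this
  obtain ⟨x, hx, hfx, -⟩ := hc.exists_fixedPoint' (Metric.isClosed_closedBall.isComplete) hmaps hx₀
    (edist_ne_top _ _)
  exact ⟨x, hx, hfx⟩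

theorem hasFDerivAt_of_fixedPoint {G : E × X → X} {f : E → X} {z : E} {C : ℝ}
    (hG : DifferentiableAt ℝ G (z, f z)) (hf : ∀ᶠ z' in 𝓝 z, G (z', f z') = f z')
    (hL : ‖(fderiv ℝ G (z, f z)).comp (ContinuousLinearMap.inr ℝ E X)‖ < 1)
    (hlip : ∀ᶠ z' in 𝓝 z, ‖f z' - f z‖ ≤ C * ‖z' - z‖) :
    HasFDerivAt f ((Ring.inverse (1 - (fderiv ℝ G (z, f z)).comp
      (ContinuousLinearMap.inr ℝ E X))).comp
      ((fderiv ℝ G (z, f z)).comp (ContinuousLinearMap.inl ℝ E X))) z := by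
  set G' := fderiv ℝ G (z, f z) with hG'
  set L := G'.comp (ContinuousLinearMap.inr ℝ E X) with hLdef
  set A := G'.comp (ContinuousLinearMap.inl ℝ E X) with hAdef
  set T := Ring.inverse (1 - L) with hT
  have hTL : T * (1 - L) = 1 := Ring.inverse_mul_cancel _ (isUnit_one_sub_of_norm_lt_one hL)
  have hcont : Tendsto (fun z' => (z', f z')) (𝓝 z) (𝓝 (z, f z)) := by
    refine tendsto_id.prodMk_nhds ?_
    rw [tendsto_iff_norm_sub_tendsto_zero]
    refine squeeze_zero' (Eventually.of_forall fun _ => norm_nonneg _) hlip ?_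
    have : Continuous fun z' => C * ‖z' - z‖ := by fun_prop
    simpa using this.tendsto z
  have h1 := hG.hasFDerivAt.isLittleO.comp_tendsto hcont
  have h2 : (fun z' => ((z', f z') : E × X) - (z, f z)) =O[𝓝 z] fun z' => z' - z := by
    have h3 : (fun z' => f z' - f z) =O[𝓝 z] fun z' => z' - z :=
      Asymptotics.IsBigO.of_bound C hlip
    exact (Asymptotics.isBigO_refl _ _).prod_left h3
  have h4 := h1.trans_isBigO h2
  refine HasFDerivAt.of_isLittleO ?_
  have h5 := (T.isBigO_comp _ (𝓝 z)).trans_isLittleO h4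
  refine h5.congr' ?_ EventuallyEq.rfl
  filter_upwards [hf] with z' hz'
  have e1 : G' ((z', f z') - (z, f z)) = A (z' - z) + L (f z' - f z) := by
    simp only [hAdef, hLdef, ContinuousLinearMap.comp_apply, ← map_add]
    simp
  have e2 : T ((1 - L) (f z' - f z)) = f z' - f z := by
    have := congrArg (fun S : X →L[ℝ] X => S (f z' - f z)) hTL
    simpa using this
  simp only [Function.comp_apply]
  rw [← hG', e1, hz', hf.self_of_nhds]
  have e3 : f z' - f z - (A (z' - z) + L (f z' - f z)) = (1 - L) (f z' - f z) - A (z' - z) := by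
    simp; abel
  rw [e3, map_sub, e2]
  rfl

variable {l : Filter α} {k : ℕ} {G : α → E × X → X} {z₀ : E} {x₀ : X}

/-- Fixed points of uniformly contracting families of `C^{k+1}` maps depend on the parameters
uniformly in `C^{k+1}`. -/
theorem exists_fixedPoint_family (hG : CkBigO (l ×ˢ 𝓝 (z₀, x₀)) (k + 1) G fun _ => 1)
    (hG0 : Tendsto (fun p : α × (E × X) => G p.1 p.2) (l ×ˢ 𝓝 (z₀, x₀)) (𝓝 x₀))
    (hGx : Tendsto (fun p : α × (E × X) => (fderiv ℝ (G p.1) p.2).comp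
      (ContinuousLinearMap.inr ℝ E X)) (l ×ˢ 𝓝 (z₀, x₀)) (𝓝 0)) :
    ∃ f : α → E → X, (∀ᶠ p in l ×ˢ 𝓝 z₀, G p.1 (p.2, f p.1 p.2) = f p.1 p.2) ∧
      Tendsto (fun p : α × E => f p.1 p.2) (l ×ˢ 𝓝 z₀) (𝓝 x₀) ∧
      CkBigO (l ×ˢ 𝓝 z₀) (k + 1) f (fun _ => 1) ∧
      ∀ᶠ p : α × (E × X) in l ×ˢ 𝓝 (z₀, x₀), G p.1 p.2 = p.2.2 → p.2.2 = f p.1 p.2.1 := by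
  obtain ⟨K, hK⟩ := hG.norm_fderiv_le
  have hsmall := (hGx.norm.eventually_lt_const (u := 1 / 2) (by simp))
  obtain ⟨r, hr, hball⟩ := eventually_prod_nhds_ball ((hG.differentiableAt.and hK).and hsmall)
  have hcontr : ∀ᶠ a in l, ∀ z ∈ Metric.ball z₀ r, ∀ x ∈ Metric.ball x₀ r, ∀ x' ∈ Metric.ball x₀ r,
      ‖G a (z, x) - G a (z, x')‖ ≤ 1 / 2 * ‖x - x'‖ := by
    filter_upwards [hball] with a ha z hz x hx x' hx'
    exact norm_sub_le_half_of_fderiv_inr (fun y hy => (ha y hy).1.1) (fun y hy => (ha y hy).2.le)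
      hz hx hx'
  have huniq : ∀ᶠ a in l, ∀ z ∈ Metric.ball z₀ r, ∀ x ∈ Metric.ball x₀ r, ∀ x' ∈ Metric.ball x₀ r,
      G a (z, x) = x → G a (z, x') = x' → x = x' := by
    filter_upwards [hcontr] with a ha z hz x hx x' hx' h1 h2
    have := ha z hz x hx x' hx'
    rw [h1, h2] at this
    have h3 : ‖x - x'‖ ≤ 0 := by linarith
    exact sub_eq_zero.1 (norm_le_zero_iff.1 h3)
  have hex : ∀ ρ > 0, ρ < r → ∀ᶠ p in l ×ˢ 𝓝 z₀, ∃ x ∈ Metric.closedBall x₀ ρ,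
      G p.1 (p.2, x) = x := by
    intro ρ hρ hρr
    have h1 : Tendsto (fun p : α × E => (p.1, (p.2, x₀))) (l ×ˢ 𝓝 z₀) (l ×ˢ 𝓝 (z₀, x₀)) :=
      tendsto_fst.prodMk (tendsto_snd.prodMk_nhds tendsto_const_nhds)
    have h2 := (hG0.comp h1).eventually (Metric.closedBall_mem_nhds x₀ (half_pos hρ))
    filter_upwards [h2, hcontr.prod_inl (𝓝 z₀), eventually_mem_ball_prod l z₀ hr] with p p1 p2 p3
    have hsub : Metric.closedBall x₀ ρ ⊆ Metric.ball x₀ r := Metric.closedBall_subset_ball hρr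
    exact exists_fixedPoint_closedBall (g := fun x => G p.1 (p.2, x)) hρ
      (fun x hx y hy => p2 p.2 p3 x (hsub hx) y (hsub hy)) (by
        rw [← dist_eq_norm]; exact p1)
  classical
  let f : α → E → X := fun a z =>
    if h : ∃ x ∈ Metric.closedBall x₀ (r / 2), G a (z, x) = x then h.choose else x₀
  have hf1 : ∀ᶠ p in l ×ˢ 𝓝 z₀, f p.1 p.2 ∈ Metric.closedBall x₀ (r / 2) ∧
      G p.1 (p.2, f p.1 p.2) = f p.1 p.2 := by
    filter_upwards [hex (r / 2) (by linarith) (by linarith)] with p hp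
    have : f p.1 p.2 = hp.choose := dif_pos hp
    rw [this]
    exact hp.choose_spec
  have hsub : Metric.closedBall x₀ (r / 2) ⊆ Metric.ball x₀ r :=
    Metric.closedBall_subset_ball (by linarith)
  have hzball : ∀ᶠ p : α × E in l ×ˢ 𝓝 z₀, p.2 ∈ Metric.ball z₀ r :=
    eventually_mem_ball_prod l z₀ hr
  have htend : Tendsto (fun p : α × E => f p.1 p.2) (l ×ˢ 𝓝 z₀) (𝓝 x₀) := by
    rw [Metric.tendsto_nhds]
    intro e he
    set ρ := min (e / 2) (r / 2)
    have hρ : 0 < ρ := lt_min (by linarith) (by linarith)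
    filter_upwards [hex ρ hρ (lt_of_le_of_lt (min_le_right _ _) (by linarith)), hf1, hzball,
      huniq.prod_inl (𝓝 z₀)] with p ⟨x, hx, hGx⟩ p2 p3 p4
    have hx' : x ∈ Metric.closedBall x₀ (r / 2) :=
      Metric.closedBall_subset_closedBall (min_le_right _ _) hx
    rw [p4 p.2 p3 _ (hsub p2.1) x (hsub hx') p2.2 hGx]
    exact lt_of_le_of_lt (Metric.mem_closedBall.1 hx)
      (lt_of_le_of_lt (min_le_left _ _) (by linarith))
  have hpair : Tendsto (fun p : α × E => (p.1, (p.2, f p.1 p.2))) (l ×ˢ 𝓝 z₀)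
      (l ×ˢ 𝓝 (z₀, x₀)) := tendsto_fst.prodMk (tendsto_snd.prodMk_nhds htend)
  have hderiv : ∀ᶠ p in l ×ˢ 𝓝 z₀, HasFDerivAt (f p.1)
      ((Ring.inverse (1 - (fderiv ℝ (G p.1) (p.2, f p.1 p.2)).comp
        (ContinuousLinearMap.inr ℝ E X))).comp
        ((fderiv ℝ (G p.1) (p.2, f p.1 p.2)).comp (ContinuousLinearMap.inl ℝ E X))) p.2 := by
    filter_upwards [SpreadFilter.spread _ hf1, SpreadFilter.spread _ hzball,
      hball.prod_inl (𝓝 z₀)] with p p1 p2 p3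
    have hm : ∀ z ∈ Metric.ball z₀ r, ∀ x ∈ Metric.ball x₀ r, (z, x) ∈ Metric.ball (z₀, x₀) r :=
      fun z hz x hx => by rw [← ball_prod_same]; exact ⟨hz, hx⟩
    have hz := p2.self_of_nhds
    have hx := hsub p1.self_of_nhds.1
    refine hasFDerivAt_of_fixedPoint (C := 2 * K) (p3 _ (hm _ hz _ hx)).1.1
      (p1.mono fun z hz => hz.2) ((p3 _ (hm _ hz _ hx)).2.trans (by norm_num)) ?_
    filter_upwards [p1, p2] with z' h1 h2
    have i1 : ‖G p.1 (z', f p.1 z') - G p.1 (z', f p.1 p.2)‖ ≤ 1 / 2 * ‖f p.1 z' - f p.1 p.2‖ :=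
      norm_sub_le_half_of_fderiv_inr (fun y hy => (p3 y hy).1.1) (fun y hy => (p3 y hy).2.le)
        h2 (hsub h1.1) hx
    have i2 : ‖G p.1 (z', f p.1 p.2) - G p.1 (p.2, f p.1 p.2)‖ ≤ K * ‖z' - p.2‖ := by
      have := (convex_ball (z₀, x₀) r).norm_image_sub_le_of_norm_hasFDerivWithin_le (𝕜 := ℝ)
        (f := G p.1) (f' := fderiv ℝ (G p.1)) (C := K)
        (fun y hy => (p3 y hy).1.1.hasFDerivAt.hasFDerivWithinAt)
        (fun y hy => by simpa using (p3 y hy).1.2) (hm _ hz _ hx) (hm _ h2 _ hx)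
      refine this.trans (le_of_eq ?_)
      simp
    have e : f p.1 z' - f p.1 p.2 = (G p.1 (z', f p.1 z') - G p.1 (z', f p.1 p.2)) +
        (G p.1 (z', f p.1 p.2) - G p.1 (p.2, f p.1 p.2)) := by
      rw [h1.2, p1.self_of_nhds.2]; abel
    have i3 : ‖f p.1 z' - f p.1 p.2‖ ≤ _ := e ▸ norm_add_le _ _
    linarith
  refine ⟨f, hf1.mono fun p hp => hp.2, htend, ?_, ?_⟩
  · have hbd : ∃ K : ℝ≥0, ∀ᶠ p in l ×ˢ 𝓝 z₀, ‖f p.1 p.2‖ ≤ K * ((1 : ℝ≥0) : ℝ) := by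
      refine ⟨‖x₀‖₊ + 1, ?_⟩
      filter_upwards [htend.norm.eventually_lt_const (u := ‖x₀‖ + 1) (by simp)] with p hp
      simpa using hp.le
    have claim : ∀ j ≤ k + 1, CkBigO (l ×ˢ 𝓝 z₀) j f fun _ => 1 := by
      intro j
      induction j with
      | zero =>
        intro _
        obtain ⟨C, hC⟩ := hbd
        refine ⟨C, ?_⟩
        filter_upwards [hC, SpreadFilter.spread _ hderiv] with p p1 p2
        refine ⟨contDiffAt_zero.2 ⟨_, p2, fun y hy =>
          (HasFDerivAt.continuousAt hy).continuousWithinAt⟩, fun i hi => ?_⟩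
        obtain rfl : i = 0 := by omega
        simpa using p1
      | succ j ih =>
        intro hj
        have hD := (hG.fderiv.of_le (m := j) (by omega)).comp
          ((ckBigO_id (k := j)).prodMk (ih (by omega))) hpair
        have hL := hD.clm ((ContinuousLinearMap.compL ℝ X (E × X) X).flip
          (ContinuousLinearMap.inr ℝ E X))
        have hA := hD.clm ((ContinuousLinearMap.compL ℝ E (E × X) X).flip
          (ContinuousLinearMap.inl ℝ E X))
        have h1L := (CkBigO.const_one (𝓕 := l ×ˢ 𝓝 z₀) (k := j) (1 : X →L[ℝ] X)).sub hL
        have htL : Tendsto (fun p : α × E => (1 : X →L[ℝ] X) -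
            (fderiv ℝ (G p.1) (p.2, f p.1 p.2)).comp (ContinuousLinearMap.inr ℝ E X))
            (l ×ˢ 𝓝 z₀) (𝓝 ((1 : (X →L[ℝ] X)ˣ) : X →L[ℝ] X)) := by
          have := (tendsto_const_nhds (x := (1 : X →L[ℝ] X))).sub (hGx.comp hpair)
          simpa using this
        have hinv := CkBigO.comp_fixed (contDiffAt_ringInverse (n := j) ℝ 1) h1L htL
        have hT := (hinv.bilin (ContinuousLinearMap.compL ℝ E X X) hA).mul_one_right
        exact CkBigO.succ hbd hderiv hT
    exact claim _ le_rfl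
  · have hm : ∀ᶠ p : α × (E × X) in l ×ˢ 𝓝 (z₀, x₀), p.2 ∈ Metric.ball (z₀, x₀) r :=
      eventually_mem_ball_prod l (z₀, x₀) hr
    have ht : Tendsto (fun p : α × (E × X) => (p.1, p.2.1)) (l ×ˢ 𝓝 (z₀, x₀)) (l ×ˢ 𝓝 z₀) :=
      tendsto_fst.prodMk ((continuous_fst.tendsto (z₀, x₀)).comp tendsto_snd)
    filter_upwards [hm, huniq.prod_inl _, ht.eventually hf1] with p p1 p2 p3 h
    rw [← ball_prod_same] at p1
    exact p2 p.2.1 p1.1 p.2.2 p1.2 _ (hsub p3.1) h p3.2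

/-- Perturbations of size `b` of an explicit solution. -/
theorem exists_fixedPoint_perturbation {g : α → E × X → X} (ι : E →L[ℝ] X) {b : α → ℝ≥0}
    (hg : CkBigO (l ×ˢ 𝓝 (z₀, ι z₀)) (k + 1) g b) (hb : Tendsto b l (𝓝 0)) :
    ∃ f : α → E → X, (∀ᶠ p in l ×ˢ 𝓝 z₀, f p.1 p.2 = ι p.2 + g p.1 (p.2, f p.1 p.2)) ∧
      Tendsto (fun p : α × E => f p.1 p.2) (l ×ˢ 𝓝 z₀) (𝓝 (ι z₀)) ∧
      CkBigO (l ×ˢ 𝓝 z₀) (k + 1) f (fun _ => 1) ∧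
      CkBigO (l ×ˢ 𝓝 z₀) (k + 1) (fun a z => f a z - ι z) b ∧
      CkBigO (l ×ˢ 𝓝 z₀) (k + 1) (fun a z => g a (z, ι z)) b ∧
      CkBigO (l ×ˢ 𝓝 z₀) k (fun a z => f a z - ι z - g a (z, ι z)) (fun a => b a ^ 2) := by
  have hb1 : ∀ᶠ a in l, b a ≤ 1 * 1 := by
    filter_upwards [hb.eventually_lt_const (u := 1) (by simp)] with a ha
    simpa using ha.le
  have hg1 : CkBigO (l ×ˢ 𝓝 (z₀, ι z₀)) (k + 1) g (fun _ => 1) := hg.scale 1 (hb1.prod_inl _)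
  have hι : CkBigO (l ×ˢ 𝓝 (z₀, ι z₀)) (k + 1) (fun _ y => ι y.1) (fun _ => 1) :=
    ckBigO_id.fst.clm ι
  have hι0 : CkBigO (l ×ˢ 𝓝 z₀) (k + 1) (fun _ y => ι y) (fun _ => 1) := ckBigO_id.clm ι
  have tι : Tendsto (fun p : α × E => ι p.2) (l ×ˢ 𝓝 z₀) (𝓝 (ι z₀)) :=
    (ι.continuous.tendsto z₀).comp tendsto_snd
  obtain ⟨f, h1, h2, h3, -⟩ := exists_fixedPoint_family (G := fun a y => ι y.1 + g a y)
    (hι.add hg1) (by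
      have e1 : Tendsto (fun p : α × (E × X) => ι p.2.1) (l ×ˢ 𝓝 (z₀, ι z₀)) (𝓝 (ι z₀)) :=
        ((ι.continuous.comp continuous_fst).tendsto (z₀, ι z₀)).comp tendsto_snd
      simpa using e1.add (hg.tendsto_zero tendsto_fst hb)) (by
      have e1 := (hg.fderiv.clm ((ContinuousLinearMap.compL ℝ X (E × X) X).flip
          (ContinuousLinearMap.inr ℝ E X))).tendsto_zero tendsto_fst hb
      refine e1.congr' ?_
      filter_upwards [hg.differentiableAt] with p hp
      have e2 : HasFDerivAt (fun y : E × X => ι y.1 + g p.1 y)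
          (ι.comp (ContinuousLinearMap.fst ℝ E X) + fderiv ℝ (g p.1) p.2) p.2 :=
        (ι.comp (ContinuousLinearMap.fst ℝ E X)).hasFDerivAt.add hp.hasFDerivAt
      rw [e2.fderiv]
      ext v
      simp)
  have hpair := (ckBigO_id (l := l) (z := z₀) (k := k + 1)).prodMk h3
  have hpair0 := (ckBigO_id (l := l) (z := z₀) (k := k + 1)).prodMk hι0
  have t1 : Tendsto (fun p : α × E => (p.2, f p.1 p.2)) (l ×ˢ 𝓝 z₀) (𝓝 (z₀, ι z₀)) :=
    tendsto_snd.prodMk_nhds h2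
  have t0 : Tendsto (fun p : α × E => (p.2, ι p.2)) (l ×ˢ 𝓝 z₀) (𝓝 (z₀, ι z₀)) :=
    tendsto_snd.prodMk_nhds tι
  have h4 : CkBigO (l ×ˢ 𝓝 z₀) (k + 1) (fun a z => f a z - ι z) b := by
    refine (hg.comp_nhds hpair tendsto_fst t1).congr ?_
    filter_upwards [h1] with p hp
    rw [eq_sub_iff_add_eq, add_comm]; exact hp
  refine ⟨f, h1.mono fun p hp => hp.symm, h2, h3, h4, hg.comp_nhds hpair0 tendsto_fst t0, ?_⟩
  have h5 := (hg.ckLip).comp_sub (hpair.of_le (by omega)) (hpair0.of_le (by omega)) (b := b) (by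
    have := (h4.of_le (m := k) (by omega)).clm (ContinuousLinearMap.inr ℝ E X)
    refine this.congr (Eventually.of_forall fun p => ?_)
    simp) tendsto_fst t1 t0
  have h6 : CkBigO (l ×ˢ 𝓝 z₀) k (fun a z => f a z - ι z - g a (z, ι z)) (fun a => b a * b a) := by
    refine h5.congr ?_
    filter_upwards [h1] with p hp
    have : f p.1 p.2 - ι p.2 = g p.1 (p.2, f p.1 p.2) := by
      rw [sub_eq_iff_eq_add, add_comm]; exact hp.symm
    rw [this]
  simpa [sq] using h6

end FixedPoint

/-! ### Composition operators on curves -/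

section Nemytskii

variable {α E F G : Type} [NormedAddCommGroup E] [NormedSpace ℝ E]
  [NormedAddCommGroup F] [NormedSpace ℝ F] [NormedAddCommGroup G] [NormedSpace ℝ G]

/-- Curves in `E`, parametrised by the unit interval. -/
abbrev Curve (E : Type) [TopologicalSpace E] : Type := C(unitInterval, E)

open Classical in
/-- The composition operator `Y ↦ h ∘ Y` (zero where `h ∘ Y` is not continuous). -/
def nemytskii (h : E → F) (Y : Curve E) : Curve F :=
  if hc : Continuous (fun t => h (Y t)) then ⟨_, hc⟩ else 0

theorem nemytskii_apply {h : E → F} {Y : Curve E} (hc : ∀ t, ContinuousAt h (Y t))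
    (t : unitInterval) : nemytskii h Y t = h (Y t) := by
  have : Continuous (fun t => h (Y t)) := continuous_iff_continuousAt.2 fun t =>
    (hc t).comp Y.continuous.continuousAt
  simp [nemytskii, dif_pos this]

/-- Pointwise application of a curve of operators. -/
def curveApply : Curve (E →L[ℝ] F) →L[ℝ] Curve E →L[ℝ] Curve F :=
  LinearMap.mkContinuous₂
    (LinearMap.mk₂ ℝ (fun (M : Curve (E →L[ℝ] F)) (Y : Curve E) =>
      (⟨fun t => M t (Y t), by fun_prop⟩ : Curve F))
      (fun _ _ _ => by ext; simp) (fun _ _ _ => by ext; simp) (fun _ _ _ => by ext; simp)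
      (fun _ _ _ => by ext; simp)) 1 fun M Y => by
        rw [ContinuousMap.norm_le _ (by positivity)]
        intro t
        rw [one_mul]
        exact ((M t).le_opNorm _).trans
          (mul_le_mul (M.norm_coe_le_norm t) (Y.norm_coe_le_norm t) (norm_nonneg _) (by positivity))

@[simp] theorem curveApply_apply (M : Curve (E →L[ℝ] F)) (Y : Curve E) (t : unitInterval) :
    curveApply M Y t = M t (Y t) := rfl

/-- The constant curve. -/
def constCurve : E →L[ℝ] Curve E :=
  LinearMap.mkContinuous ⟨⟨fun x => ContinuousMap.const _ x, fun _ _ => rfl⟩, fun _ _ => rfl⟩ 1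
    fun x => by
      rw [ContinuousMap.norm_le _ (by positivity)]
      intro t
      rw [one_mul]
      exact le_rfl

@[simp] theorem constCurve_apply (x : E) (t : unitInterval) : constCurve x t = x := rfl

/-- Evaluation of a curve. -/
def evalCurve (t : unitInterval) : Curve E →L[ℝ] E := ContinuousMap.evalCLM ℝ t

@[simp] theorem evalCurve_apply (t : unitInterval) (Y : Curve E) : evalCurve t Y = Y t := rfl

theorem exists_curve_uniform {h : E → F} {Y : Curve E} (hc : ∀ t, ContinuousAt h (Y t)) {e : ℝ}
    (he : 0 < e) : ∃ δ > 0, ∀ t, ∀ y, ‖y - Y t‖ < δ → ‖h y - h (Y t)‖ < e := by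
  have hK : IsCompact (range Y) := isCompact_range Y.continuous
  have := hK.uniformContinuousAt_of_continuousAt h (by rintro _ ⟨t, rfl⟩; exact hc t)
    (Metric.dist_mem_uniformity he)
  obtain ⟨δ, hδ, h1⟩ := Metric.mem_uniformity_dist.1 this
  refine ⟨δ, hδ, fun t y hy => ?_⟩
  have := h1 (a := Y t) (b := y) (by rwa [dist_comm, dist_eq_norm]) ⟨t, rfl⟩
  rw [← dist_eq_norm, dist_comm]
  exact this

theorem exists_curve_ball {P : E → Prop} {Y : Curve E} (hP : ∀ t, ∀ᶠ y in 𝓝 (Y t), P y) :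
    ∃ δ > 0, ∀ t, ∀ y, ‖y - Y t‖ < δ → P y := by
  have hK : IsCompact (range Y) := isCompact_range Y.continuous
  have h1 : range Y ⊆ interior {y | P y} := by
    rintro _ ⟨t, rfl⟩
    exact mem_interior_iff_mem_nhds.2 (hP t)
  obtain ⟨δ, hδ, h2⟩ := hK.exists_thickening_subset_open isOpen_interior h1
  refine ⟨δ, hδ, fun t y hy => ?_⟩
  have := h2 (Metric.mem_thickening_iff.2 ⟨Y t, ⟨t, rfl⟩, by rwa [dist_eq_norm]⟩)
  exact interior_subset this

theorem continuousAt_nemytskii {h : E → F} {Y : Curve E}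
    (hc : ∀ t, ∀ᶠ y in 𝓝 (Y t), ContinuousAt h y) : ContinuousAt (nemytskii h) Y := by
  rw [Metric.continuousAt_iff]
  intro e he
  obtain ⟨δ, hδ, h1⟩ := exists_curve_uniform (fun t => (hc t).self_of_nhds) (half_pos he)
  obtain ⟨δ', hδ', h2⟩ := exists_curve_ball hc
  refine ⟨min δ δ', lt_min hδ hδ', fun {Z} hZ => ?_⟩
  rw [dist_eq_norm] at hZ ⊢
  have hZt : ∀ t, ‖Z t - Y t‖ < min δ δ' := fun t =>
    ((Z - Y).norm_coe_le_norm t).trans_lt hZ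
  refine lt_of_le_of_lt ((ContinuousMap.norm_le _ (half_pos he).le).2 fun t => ?_) (half_lt_self he)
  rw [ContinuousMap.sub_apply, nemytskii_apply (fun s => h2 s _ ((hZt s).trans_le (min_le_right _ _))),
    nemytskii_apply fun s => (hc s).self_of_nhds]
  exact (h1 t _ ((hZt t).trans_le (min_le_left _ _))).le

theorem hasFDerivAt_nemytskii {h : E → F} {Y : Curve E}
    (hd : ∀ t, ∀ᶠ y in 𝓝 (Y t), DifferentiableAt ℝ h y)
    (hc : ∀ t, ContinuousAt (fderiv ℝ h) (Y t)) :
    HasFDerivAt (nemytskii h) (curveApply (nemytskii (fderiv ℝ h) Y)) Y := by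
  rw [hasFDerivAt_iff_isLittleO_nhds_zero, Asymptotics.isLittleO_iff]
  intro e he
  obtain ⟨δ, hδ, h1⟩ := exists_curve_uniform hc he
  obtain ⟨δ', hδ', h2⟩ := exists_curve_ball hd
  have hmem : Metric.ball (0 : Curve E) (min δ δ') ∈ 𝓝 0 :=
    Metric.ball_mem_nhds _ (lt_min hδ hδ')
  filter_upwards [hmem] with Z hZ
  rw [mem_ball_zero_iff] at hZ
  have hZt : ∀ t, ‖Z t‖ < min δ δ' := fun t => (Z.norm_coe_le_norm t).trans_lt hZ
  rw [ContinuousMap.norm_le _ (by positivity)]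
  intro t
  have e1 : nemytskii h (Y + Z) t = h (Y t + Z t) := nemytskii_apply (fun s =>
    (h2 s _ (by simpa using (hZt s).trans_le (min_le_right _ _))).continuousAt) t
  have e2 : nemytskii h Y t = h (Y t) := nemytskii_apply (fun s =>
    (hd s).self_of_nhds.continuousAt) t
  have e3 : nemytskii (fderiv ℝ h) Y t = fderiv ℝ h (Y t) := nemytskii_apply hc t
  rw [ContinuousMap.sub_apply, ContinuousMap.sub_apply, curveApply_apply, e1, e2, e3]
  have key := (convex_ball (Y t) (min δ δ')).norm_image_sub_le_of_norm_hasFDerivWithin_le' (𝕜 := ℝ)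
    (f := h) (f' := fderiv ℝ h) (φ := fderiv ℝ h (Y t)) (C := e) (x := Y t) (y := Y t + Z t)
    (fun y hy => (h2 t y ((mem_ball_iff_norm.1 hy).trans_le
      (min_le_right _ _))).hasFDerivAt.hasFDerivWithinAt)
    (fun y hy => (h1 t y ((mem_ball_iff_norm.1 hy).trans_le (min_le_left _ _))).le)
    (Metric.mem_ball_self (lt_min hδ hδ')) (by rw [mem_ball_iff_norm]; simpa using hZt t)
  rw [add_sub_cancel_left] at key
  exact key.trans (mul_le_mul_of_nonneg_left (Z.norm_coe_le_norm t) he.le)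

theorem eventually_forall_curve {l : Filter α} {C : Set E} {P : α × E → Prop}
    (h : ∀ᶠ p in l ×ˢ 𝓝ˢ C, P p) :
    ∀ᶠ p : α × Curve E in l ×ˢ 𝓝ˢ {Y | ∀ t, Y t ∈ C}, ∀ t, P (p.1, p.2 t) := by
  obtain ⟨p, hp, q, hq, hpq⟩ := eventually_prod_iff.1 h
  refine eventually_prod_iff.2 ⟨p, hp, fun Y => ∀ t, q (Y t), ?_, fun {x} hx {y} hy t =>
    hpq hx (hy t)⟩
  obtain ⟨U, hU, hsU, hUq⟩ := eventually_nhdsSet_iff_exists.1 hq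
  have ho : IsOpen {Y : Curve E | MapsTo Y univ U} :=
    ContinuousMap.isOpen_setOfPred_mapsTo isCompact_univ hU
  exact eventually_nhdsSet_iff_exists.2 ⟨_, ho, fun Y hY t _ => hsU (hY t), fun Y hY t =>
    hUq _ (hY (mem_univ t))⟩

variable {l : Filter α} {k : ℕ} {h : α → E → F} {b : α → ℝ≥0}

theorem CkBigO.nemytskii {C : Set E} (hh : CkBigO (l ×ˢ 𝓝ˢ C) k h b) :
    CkBigO (l ×ˢ 𝓝ˢ {Y : Curve E | ∀ t, Y t ∈ C}) k (fun a => nemytskii (h a)) b := by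
  have hcont := eventually_forall_curve (SpreadFilter.spread _ hh.contDiffAt)
  have hbd : ∃ K : ℝ≥0, ∀ᶠ p in l ×ˢ 𝓝ˢ {Y : Curve E | ∀ t, Y t ∈ C},
      ‖_root_.nemytskii (h p.1) p.2‖ ≤ K * b p.1 := by
    obtain ⟨K, hK⟩ := hh.norm_le
    refine ⟨K, ?_⟩
    filter_upwards [eventually_forall_curve hK, hcont] with p h1 h2
    rw [ContinuousMap.norm_le _ (by positivity)]
    intro t
    rw [nemytskii_apply fun s => (h2 s).self_of_nhds.continuousAt]
    exact h1 t
  induction k generalizing F with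
  | zero =>
    obtain ⟨K, hK⟩ := hbd
    refine ⟨K, ?_⟩
    filter_upwards [hK, SpreadFilter.spread _ hcont] with p h1 h2
    refine ⟨contDiffAt_zero.2 ⟨_, h2, fun Y hY => (continuousAt_nemytskii fun t =>
      (Filter.Eventually.mono (hY t) fun y hy => ContDiffAt.continuousAt hy)).continuousWithinAt⟩, fun j hj => ?_⟩
    obtain rfl : j = 0 := by omega
    rwa [norm_iteratedFDeriv_zero]
  | succ k ih =>
    have hbd' : ∃ K : ℝ≥0, ∀ᶠ p in l ×ˢ 𝓝ˢ {Y : Curve E | ∀ t, Y t ∈ C},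
        ‖_root_.nemytskii (_root_.fderiv ℝ (h p.1)) p.2‖ ≤ K * b p.1 := by
      obtain ⟨K, hK⟩ := hh.fderiv.norm_le
      refine ⟨K, ?_⟩
      filter_upwards [eventually_forall_curve hK, eventually_forall_curve hh.fderiv.contDiffAt]
        with p h1 h2
      rw [ContinuousMap.norm_le _ (by positivity)]
      intro t
      rw [nemytskii_apply fun s => (h2 s).continuousAt]
      exact h1 t
    have h1 := CkBigO.clm (F := Curve (E →L[ℝ] F)) (G := Curve E →L[ℝ] Curve F) curveApply
      (ih hh.fderiv (eventually_forall_curve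
        (SpreadFilter.spread _ hh.fderiv.contDiffAt)) hbd')
    refine CkBigO.succ hbd ?_ h1
    filter_upwards [eventually_forall_curve (SpreadFilter.spread _ hh.differentiableAt),
      eventually_forall_curve hh.fderiv.contDiffAt] with p p1 p2
    exact hasFDerivAt_nemytskii p1 fun t => (p2 t).continuousAt

theorem setOf_forall_curve_singleton (x : E) :
    {Y : Curve E | ∀ t, Y t ∈ ({x} : Set E)} = {constCurve x} := by
  ext Y
  simp only [mem_singleton_iff, Set.mem_ofPred_eq]
  exact ⟨fun h => by ext t; exact h t, fun h t => by rw [h]; rfl⟩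

theorem CkBigO.nemytskii_const {x : E} (hh : CkBigO (l ×ˢ 𝓝 x) k h b) :
    CkBigO (l ×ˢ 𝓝 (constCurve x)) k (fun a => _root_.nemytskii (h a)) b := by
  rw [← nhdsSet_singleton] at hh ⊢
  rw [← setOf_forall_curve_singleton]
  exact hh.nemytskii

theorem eventually_forall_curve_const {x : E} {P : α × E → Prop} (h : ∀ᶠ p in l ×ˢ 𝓝 x, P p) :
    ∀ᶠ p : α × Curve E in l ×ˢ 𝓝 (constCurve x), ∀ t, P (p.1, p.2 t) := by
  rw [← nhdsSet_singleton] at h ⊢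
  rw [← setOf_forall_curve_singleton]
  exact eventually_forall_curve h

theorem CkLip.nemytskii {x : E} (hh : CkLip l k x h b) :
    CkLip l k (constCurve x) (fun a => nemytskii (h a)) b := by
  induction k generalizing F with
  | zero =>
    refine ⟨hh.1.nemytskii_const, ?_⟩
    obtain ⟨h0, K, hK⟩ := hh
    refine ⟨K, ?_⟩
    have hc := eventually_prod_nhds_prod (eventually_forall_curve_const h0.contDiffAt)
    have hK' : ∀ᶠ p : α × (Curve E × Curve E) in l ×ˢ 𝓝 (constCurve x, constCurve x),
        ∀ t, ‖h p.1 (p.2.1 t) - h p.1 (p.2.2 t)‖ ≤ K * b p.1 * ‖p.2.1 t - p.2.2 t‖ := by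
      obtain ⟨r, hr, h1⟩ := eventually_prod_nhds_ball hK
      have hm : ∀ᶠ p : α × Curve E in l ×ˢ 𝓝 (constCurve x), ∀ t, p.2 t ∈ Metric.ball x r :=
        eventually_forall_curve_const (P := fun p => p.2 ∈ Metric.ball x r)
          (eventually_mem_ball_prod l x hr)
      filter_upwards [eventually_prod_nhds_prod hm, h1.prod_inl _] with p p1 p2 t
      have := p2 (p.2.1 t, p.2.2 t) (by rw [← ball_prod_same]; exact ⟨p1.1 t, p1.2 t⟩)
      rwa [norm_iteratedFDeriv_zero_sub] at this
    filter_upwards [hc, hK'] with p p1 p2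
    rw [norm_iteratedFDeriv_zero_sub, ContinuousMap.norm_le _ (by positivity)]
    intro t
    rw [ContinuousMap.sub_apply, nemytskii_apply fun s => (p1.1 s).continuousAt,
      nemytskii_apply fun s => (p1.2 s).continuousAt]
    refine (p2 t).trans (mul_le_mul_of_nonneg_left ?_ (by positivity))
    exact (p.2.1 - p.2.2).norm_coe_le_norm t
  | succ k ih =>
    refine CkLip.succ hh.1.nemytskii_const ?_
    refine (CkLip.clm (F := Curve (E →L[ℝ] F)) (G := Curve E →L[ℝ] Curve F) curveApply
      (ih hh.fderiv)).congr ?_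
    filter_upwards [eventually_forall_curve_const (SpreadFilter.spread _ hh.1.differentiableAt),
      eventually_forall_curve_const hh.1.fderiv.contDiffAt] with p p1 p2
    exact (hasFDerivAt_nemytskii p1 fun t => (p2 t).continuousAt).fderiv.symm

theorem tendsto_nemytskii_const {x : E} {y : F} (hh : CkBigO (l ×ˢ 𝓝 x) 0 h b)
    (ht : Tendsto (fun p : α × E => h p.1 p.2) (l ×ˢ 𝓝 x) (𝓝 y)) :
    Tendsto (fun p : α × Curve E => nemytskii (h p.1) p.2) (l ×ˢ 𝓝 (constCurve x))
      (𝓝 (constCurve y)) := by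
  rw [Metric.tendsto_nhds]
  intro e he
  filter_upwards [eventually_forall_curve_const hh.contDiffAt, eventually_forall_curve_const
    (ht.eventually (Metric.ball_mem_nhds y (half_pos he)))] with p p1 p2
  refine lt_of_le_of_lt ((ContinuousMap.dist_le (half_pos he).le).2 fun t => ?_) (half_lt_self he)
  rw [nemytskii_apply fun s => (p1 s).continuousAt]
  exact (Metric.mem_ball.1 (p2 t)).le

end Nemytskii

/-! ### Integration of curves -/

section CurveIntegral

variable {E F : Type} [NormedAddCommGroup E] [NormedSpace ℝ E] [CompleteSpace E]
  [NormedAddCommGroup F] [NormedSpace ℝ F]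

/-- The value of a curve at a real parameter, constant outside of the unit interval. -/
def curveVal {F : Type} [TopologicalSpace F] (Y : Curve F) (s : ℝ) : F :=
  Y (projIcc 0 1 zero_le_one s)

theorem continuous_curveVal (Y : Curve F) : Continuous (curveVal Y) :=
  Y.continuous.comp continuous_projIcc

theorem curveVal_of_mem (Y : Curve F) {s : ℝ} (hs : s ∈ Icc (0 : ℝ) 1) :
    curveVal Y s = Y ⟨s, hs⟩ := by rw [curveVal, projIcc_of_mem _ hs]

@[simp] theorem curveVal_zero (Y : Curve F) : curveVal Y 0 = Y 0 := curveVal_of_mem Y ⟨le_rfl, zero_le_one⟩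

@[simp] theorem curveVal_one (Y : Curve F) : curveVal Y 1 = Y 1 := curveVal_of_mem Y ⟨zero_le_one, le_rfl⟩

theorem norm_curveVal_le (Y : Curve F) (s : ℝ) : ‖curveVal Y s‖ ≤ ‖Y‖ := Y.norm_coe_le_norm _

/-- The operator `Y ↦ (t ↦ ∫₀ᵗ w(s) Y(s) ds)`. -/
def curvePrim (w : Curve ℝ) : Curve E →L[ℝ] Curve E :=
  LinearMap.mkContinuous
    { toFun := fun Y => ⟨fun t => ∫ s in (0 : ℝ)..t, curveVal w s • curveVal Y s,
        (intervalIntegral.continuous_primitive (fun a b =>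
          ((continuous_curveVal w).smul (continuous_curveVal Y)).intervalIntegrable a b) 0).comp
          continuous_subtype_val⟩
      map_add' := fun Y Z => by
        ext t
        simp only [ContinuousMap.coe_mk, ContinuousMap.add_apply]
        have := intervalIntegral.integral_add (μ := MeasureTheory.volume)
          (((continuous_curveVal w).smul (continuous_curveVal Y)).intervalIntegrable 0 (t : ℝ))
          (((continuous_curveVal w).smul (continuous_curveVal Z)).intervalIntegrable 0 (t : ℝ))
        refine Eq.trans ?_ this
        congr 1
        ext s
        simp [curveVal]
      map_smul' := fun c Y => by
        ext t
        simp only [ContinuousMap.coe_mk, ContinuousMap.smul_apply, RingHom.id_apply]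
        rw [← intervalIntegral.integral_smul]
        congr 1
        ext s
        simp [curveVal, smul_comm c] }
    (∫ s in (0 : ℝ)..1, |curveVal w s|) fun Y => by
      have h0 : 0 ≤ ∫ s in (0 : ℝ)..1, |curveVal w s| :=
        intervalIntegral.integral_nonneg zero_le_one fun s _ => abs_nonneg _
      rw [ContinuousMap.norm_le _ (by positivity)]
      intro t
      have hc := (continuous_curveVal w).abs
      have h1 : ‖∫ s in (0 : ℝ)..t, curveVal w s • curveVal Y s‖ ≤
          ∫ s in (0 : ℝ)..t, |curveVal w s| * ‖Y‖ := by
        refine intervalIntegral.norm_integral_le_of_norm_le t.2.1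
          (Eventually.of_forall fun s _ => ?_) ((hc.mul continuous_const).intervalIntegrable _ _)
        rw [norm_smul, Real.norm_eq_abs]
        exact mul_le_mul_of_nonneg_left (norm_curveVal_le Y s) (abs_nonneg _)
      refine h1.trans ?_
      rw [intervalIntegral.integral_mul_const]
      refine mul_le_mul_of_nonneg_right ?_ (norm_nonneg _)
      exact intervalIntegral.integral_mono_interval le_rfl t.2.1 t.2.2
        (Eventually.of_forall fun s => abs_nonneg _) (hc.intervalIntegrable _ _)

theorem curvePrim_apply (w : Curve ℝ) (Y : Curve E) (t : unitInterval) :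
    curvePrim w Y t = ∫ s in (0 : ℝ)..t, curveVal w s • curveVal Y s := rfl

@[simp] theorem curvePrim_zero (w : Curve ℝ) (Y : Curve E) : curvePrim w Y 0 = 0 := by
  simp [curvePrim_apply]

theorem norm_curvePrim_le (w : Curve ℝ) :
    ‖(curvePrim w : Curve E →L[ℝ] Curve E)‖ ≤ ∫ s in (0 : ℝ)..1, |curveVal w s| :=
  LinearMap.mkContinuous_norm_le _
    (intervalIntegral.integral_nonneg zero_le_one fun s _ => abs_nonneg _) _

theorem hasDerivWithinAt_curvePrim (w : Curve ℝ) (Y : Curve E) {s : ℝ}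
    (hs : s ∈ Icc (0 : ℝ) 1) :
    HasDerivWithinAt (curveVal (curvePrim w Y)) (curveVal w s • curveVal Y s) (Icc 0 1) s := by
  have hc : Continuous fun s => curveVal w s • curveVal Y s :=
    (continuous_curveVal w).smul (continuous_curveVal Y)
  have h1 : HasDerivAt (fun t => ∫ s in (0 : ℝ)..t, curveVal w s • curveVal Y s)
      (curveVal w s • curveVal Y s) s :=
    intervalIntegral.integral_hasDerivAt_right (hc.intervalIntegrable _ _)
      hc.stronglyMeasurable.stronglyMeasurableAtFilter hc.continuousAt
  refine h1.hasDerivWithinAt.congr (fun t ht => ?_) ?_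
  · rw [curveVal_of_mem _ ht]; rfl
  · rw [curveVal_of_mem _ hs]; rfl

/-- Families of integration operators with small weights. -/
theorem CkBigO.curvePrim {α : Type} {𝓕 : Filter (α × F)} {k : ℕ} {f : α → F → Curve E}
    {b c : α → ℝ≥0} {w : α → Curve ℝ} {K : ℝ≥0}
    (hw : ∀ᶠ p in 𝓕, ∫ s in (0 : ℝ)..1, |curveVal (w p.1) s| ≤ K * b p.1)
    (hf : CkBigO 𝓕 k f c) :
    CkBigO 𝓕 k (fun a x => _root_.curvePrim (w a) (f a x)) (fun a => b a * c a) :=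
  (CkBigO.const (v := fun a => (_root_.curvePrim (w a) : Curve E →L[ℝ] Curve E))
    (hw.mono fun p hp => (norm_curvePrim_le _).trans hp)).bilin
    (ContinuousLinearMap.id ℝ (Curve E →L[ℝ] Curve E)) hf

end CurveIntegral

/-! ### Orbits of the smooth flow -/

namespace SteepFamily

variable {d n : ℕ} {S : SteepFamily d n} {r : ℕ} {ε : ℝ}

/-- The Hamiltonian vector field. -/
def hamField (S : SteepFamily d n) (ε : ℝ) (ρ : Phase d) : Phase d :=
  (ρ.2, -gradient (fun x => S.V x ε) ρ.1)

/-- An orbit leads from `ρ` to `ρ'` and runs in `A` in between. -/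
def OrbitIn (S : SteepFamily d n) (ε : ℝ) (A : Set (Pos d)) (ρ ρ' : Phase d) : Prop :=
  ∃ τ > 0, ∃ γ : ℝ → Phase d, S.IsOrbit ε τ γ ∧ γ 0 = ρ ∧ γ τ = ρ' ∧ ∀ t ∈ Ioo 0 τ, (γ t).1 ∈ A

theorem contDiffAt_gradient {k : ℕ} {f : Pos d → ℝ} {q : Pos d} (h : ContDiffAt ℝ (k + 1) f q) :
    ContDiffAt ℝ k (gradient f) q :=
  (InnerProductSpace.toDual ℝ (Pos d)).symm.contDiff.contDiffAt.comp q
    (h.fderiv_right (m := k) le_rfl)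

theorem IsPotential.contDiffAt_hamField (hV : S.IsPotential r) (hε : ε ∈ Ioo 0 S.ε₀)
    {ρ : Phase d} (hρ : ρ.1 ∈ S.Dt) : ContDiffAt ℝ r (S.hamField ε) ρ := by
  have h1 : ContDiffAt ℝ (r + 1) (fun q => S.V q ε) ρ.1 :=
    (hV.contDiffOn ε hε).contDiffAt (hV.isOpen_dom.mem_nhds hρ)
  have h2 := (contDiffAt_gradient h1).comp ρ contDiffAt_fst
  exact contDiffAt_snd.prodMk h2.neg

theorem IsOrbit.continuousOn {T : ℝ} {γ : ℝ → Phase d} (h : S.IsOrbit ε T γ) :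
    ContinuousOn γ (Icc 0 T) := fun t ht => (h t ht).2.continuousWithinAt

theorem IsOrbit.mono {T T' : ℝ} {γ : ℝ → Phase d} (h : S.IsOrbit ε T γ) (hT : T' ≤ T) :
    S.IsOrbit ε T' γ := fun t ht =>
  ⟨(h t (Icc_subset_Icc_right hT ht)).1, (h t (Icc_subset_Icc_right hT ht)).2.mono
    (Icc_subset_Icc_right hT)⟩

theorem IsOrbit.eqOn (hr : 1 ≤ r) (hV : S.IsPotential r) (hε : ε ∈ Ioo 0 S.ε₀) {T : ℝ}
    {γ γ' : ℝ → Phase d} (h : S.IsOrbit ε T γ) (h' : S.IsOrbit ε T γ') (h0 : γ 0 = γ' 0) :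
    EqOn γ γ' (Icc 0 T) := by
  have hcl : IsClosed ({t | γ t = γ' t} ∩ Icc 0 T) := by
    have h1 : IsClosed (Icc 0 T ∩ (fun t => (γ t, γ' t)) ⁻¹' (diagonal (Phase d))) :=
      (h.continuousOn.prodMk h'.continuousOn).preimage_isClosed_of_isClosed isClosed_Icc
        isClosed_diagonal
    rw [inter_comm]
    exact h1
  refine fun t ht => hcl.Icc_subset_of_forall_mem_nhdsWithin h0 ?_ ht
  rintro t ⟨hteq, ht⟩
  have hteq' : γ t = γ' t := hteq
  have htI : t ∈ Icc 0 T := ⟨ht.1, ht.2.le⟩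
  obtain ⟨K, U, hU, hlip⟩ := ((hV.contDiffAt_hamField hε (h t htI).1).of_le
    (by exact_mod_cast hr : (1 : WithTop ℕ∞) ≤ r)).exists_lipschitzOnWith
  have hR : Icc 0 T ∈ 𝓝[≥] t := by
    refine mem_of_superset (Icc_mem_nhdsGE ht.2) (Icc_subset_Icc_left ht.1)
  have hc1 : ContinuousWithinAt γ (Ici t) t :=
    ((h.continuousOn t htI).mono_of_mem_nhdsWithin hR)
  have hc2 : ContinuousWithinAt γ' (Ici t) t :=
    ((h'.continuousOn t htI).mono_of_mem_nhdsWithin hR)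
  have hN : ∀ᶠ s in 𝓝[≥] t, γ s ∈ U ∧ γ' s ∈ U :=
    (hc1.eventually_mem hU).and (hc2.eventually_mem (by rw [← hteq']; exact hU))
  obtain ⟨u, hu, hsub⟩ := mem_nhdsGE_iff_exists_Icc_subset.1 (inter_mem hN hR)
  have hu' : t < u := hu
  have hde : ∀ {γ : ℝ → Phase d}, S.IsOrbit ε T γ → ∀ s ∈ Ico t u,
      HasDerivWithinAt γ (S.hamField ε (γ s)) (Ici s) s := by
    intro γ h s hs
    have hs' : s ∈ Icc 0 T := (hsub ⟨hs.1, hs.2.le⟩).2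
    have huT : u ≤ T := (hsub ⟨hu'.le, le_rfl⟩).2.2
    refine (h s hs').2.mono_of_mem_nhdsWithin ?_
    exact mem_of_superset (Icc_mem_nhdsGE (hs.2.trans_le huT)) (Icc_subset_Icc_left hs'.1)
  have key := ODE_solution_unique_of_mem_Icc_right (v := fun _ => S.hamField ε) (s := fun _ => U)
    (K := K) (a := t) (b := u) (f := γ) (g := γ') (fun s _ => hlip)
    (h.continuousOn.mono fun s hs => (hsub hs).2) (hde h)
    (fun s hs => (hsub ⟨hs.1, hs.2.le⟩).1.1)
    (h'.continuousOn.mono fun s hs => (hsub hs).2) (hde h')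
    (fun s hs => (hsub ⟨hs.1, hs.2.le⟩).1.2) hteq'
  exact mem_of_superset (Ioc_mem_nhdsGT hu') fun s hs => key ⟨hs.1.le, hs.2⟩

theorem OrbitIn.unique (hr : 1 ≤ r) (hV : S.IsPotential r) (hε : ε ∈ Ioo 0 S.ε₀)
    {A : Set (Pos d)} {ρ ρ' ρ'' : Phase d} (h : S.OrbitIn ε A ρ ρ') (h' : S.OrbitIn ε A ρ ρ'')
    (hA : ρ'.1 ∉ A) (hA' : ρ''.1 ∉ A) : ρ' = ρ'' := by
  obtain ⟨τ, hτ, γ, hγ, h0, h1, h2⟩ := h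
  obtain ⟨τ', hτ', γ', hγ', h0', h1', h2'⟩ := h'
  rcases lt_trichotomy τ τ' with hlt | rfl | hlt
  · have := hγ.eqOn hr hV hε (hγ'.mono hlt.le) (h0.trans h0'.symm) ⟨hτ.le, le_rfl⟩
    exact absurd (h2' τ ⟨hτ, hlt⟩) (by rw [← this, h1]; exact hA)
  · have := hγ.eqOn hr hV hε hγ' (h0.trans h0'.symm) ⟨hτ.le, le_rfl⟩
    rw [← h1, ← h1', this]
  · have := (hγ.mono hlt.le).eqOn hr hV hε hγ' (h0.trans h0'.symm) ⟨hτ'.le, le_rfl⟩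
    exact absurd (h2 τ' ⟨hτ', hlt⟩) (by rw [this, h1']; exact hA')

theorem smoothFlight_iff {A : Set (Pos d)} {ρ ρ' : Phase d} :
    S.SmoothFlight ε A ρ ρ' ↔ S.OrbitIn ε (interior A) ρ ρ' ∧ ρ'.1 ∈ frontier A := by
  constructor
  · rintro ⟨τ, hτ, γ, h1, h2, h3, h4, h5⟩
    exact ⟨⟨τ, hτ, γ, h1, h2, h3, h4⟩, h5⟩
  · rintro ⟨⟨τ, hτ, γ, h1, h2, h3, h4⟩, h5⟩
    exact ⟨τ, hτ, γ, h1, h2, h3, h4, h5⟩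

theorem smoothReflection_iff {A : Set (Pos d)} {ρ ρ' : Phase d} :
    S.SmoothReflection ε A ρ ρ' ↔ S.OrbitIn ε (closure A)ᶜ ρ ρ' ∧ ρ'.1 ∈ frontier A := by
  constructor
  · rintro ⟨τ, hτ, γ, h1, h2, h3, h4, h5⟩
    exact ⟨⟨τ, hτ, γ, h1, h2, h3, h4⟩, h5⟩
  · rintro ⟨⟨τ, hτ, γ, h1, h2, h3, h4⟩, h5⟩
    exact ⟨τ, hτ, γ, h1, h2, h3, h4, h5⟩

theorem smoothPoincare_iff_eq (hr : 1 ≤ r) (hV : S.IsPotential r) (hε : ε ∈ Ioo 0 S.ε₀)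
    {A : Set (Pos d)} {ρ ρ₁ ρ₂ : Phase d} (h1 : S.SmoothFlight ε A ρ ρ₁)
    (h2 : S.SmoothReflection ε A ρ₁ ρ₂) (ρ' : Phase d) : S.SmoothPoincare ε A ρ ρ' ↔ ρ' = ρ₂ := by
  constructor
  · rintro ⟨ρ₁', h1', h2'⟩
    rw [smoothFlight_iff] at h1 h1'
    rw [smoothReflection_iff] at h2 h2'
    obtain rfl : ρ₁ = ρ₁' := h1.1.unique hr hV hε h1'.1 h1.2.2 h1'.2.2
    exact h2'.1.unique hr hV hε h2.1 (not_not.2 (frontier_subset_closure h2'.2))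
      (not_not.2 (frontier_subset_closure h2.2))
  · rintro rfl
    exact ⟨ρ₁, h1, h2⟩

theorem OrbitIn.trans {A : Set (Pos d)} {ρ₀ ρ₁ ρ₂ : Phase d} (h : S.OrbitIn ε A ρ₀ ρ₁)
    (hA : ρ₁.1 ∈ A) (h' : S.OrbitIn ε A ρ₁ ρ₂) : S.OrbitIn ε A ρ₀ ρ₂ := by
  obtain ⟨τ, hτ, γ, hγ, h0, h1, h2⟩ := h
  obtain ⟨τ', hτ', γ', hγ', h0', h1', h2'⟩ := h'
  set δ : ℝ → Phase d := fun t => if t ≤ τ then γ t else γ' (t - τ) with hδ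
  have e1 : EqOn δ γ (Icc 0 τ) := fun t ht => if_pos ht.2
  have e2 : EqOn δ (fun t => γ' (t - τ)) (Icc τ (τ + τ')) := fun t ht => by
    rcases ht.1.eq_or_lt with rfl | hlt
    · simp [hδ, h1, h0']
    · exact if_neg (not_le.2 hlt)
  have hd1 : ∀ t ∈ Icc 0 τ, HasDerivWithinAt δ (S.hamField ε (δ t)) (Icc 0 τ) t := fun t ht => by
    rw [e1 ht]
    exact (hγ t ht).2.congr e1 (e1 ht)
  have hmem2 : ∀ t ∈ Icc τ (τ + τ'), t - τ ∈ Icc 0 τ' := fun t ht =>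
    ⟨by linarith [ht.1], by linarith [ht.2]⟩
  have hd2 : ∀ t ∈ Icc τ (τ + τ'), HasDerivWithinAt δ (S.hamField ε (δ t)) (Icc τ (τ + τ')) t :=
    fun t ht => by
      rw [e2 ht]
      have h3 : HasDerivWithinAt (fun t : ℝ => t - τ) 1 (Icc τ (τ + τ')) t :=
        ((hasDerivAt_id t).sub_const τ).hasDerivWithinAt
      have h4 := (hγ' _ (hmem2 t ht)).2.scomp t h3 hmem2
      rw [one_smul] at h4
      exact h4.congr e2 (e2 ht)
  have hun : Icc 0 (τ + τ') = Icc 0 τ ∪ Icc τ (τ + τ') :=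
    (Icc_union_Icc_eq_Icc hτ.le (by linarith)).symm
  refine ⟨τ + τ', by linarith, δ, fun t ht => ?_, ?_, ?_, fun t ht => ?_⟩
  · have hD : (δ t).1 ∈ S.Dt := by
      rcases le_total t τ with h | h
      · rw [e1 ⟨ht.1, h⟩]; exact (hγ t ⟨ht.1, h⟩).1
      · rw [e2 ⟨h, ht.2⟩]; exact (hγ' _ (hmem2 t ⟨h, ht.2⟩)).1
    refine ⟨hD, ?_⟩
    rw [hun]
    rcases lt_trichotomy t τ with h | rfl | h
    · refine (hd1 t ⟨ht.1, h.le⟩).mono_of_mem_nhdsWithin ?_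
      refine mem_nhdsWithin.2 ⟨Iio τ, isOpen_Iio, h, fun s hs => ?_⟩
      rcases hs.2 with h' | h'
      · exact h'
      · exact absurd hs.1 (not_lt.2 h'.1)
    · exact (hd1 t ⟨ht.1, le_rfl⟩).union (hd2 t ⟨le_rfl, ht.2⟩)
    · refine (hd2 t ⟨h.le, ht.2⟩).mono_of_mem_nhdsWithin ?_
      refine mem_nhdsWithin.2 ⟨Ioi τ, isOpen_Ioi, h, fun s hs => ?_⟩
      rcases hs.2 with h' | h'
      · exact absurd hs.1 (not_lt.2 h'.2)
      · exact h'
  · rw [e1 ⟨le_rfl, hτ.le⟩, h0]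
  · rw [e2 ⟨by linarith, le_rfl⟩]
    simp [h1']
  · rcases lt_trichotomy t τ with h | rfl | h
    · rw [e1 ⟨ht.1.le, h.le⟩]; exact h2 t ⟨ht.1, h⟩
    · rw [e1 ⟨ht.1.le, le_rfl⟩, h1]; exact hA
    · rw [e2 ⟨h.le, ht.2.le⟩]; exact h2' _ ⟨by linarith, by linarith [ht.2]⟩

theorem exists_timeChange (c : Curve ℝ) (hc : ∀ t, 0 < c t) :
    ∃ T > 0, ∃ g : ℝ → ℝ, g 0 = 0 ∧ g T = 1 ∧ (∀ t ∈ Ioo 0 T, g t ∈ Ioo (0 : ℝ) 1) ∧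
      (∀ t ∈ Icc 0 T, g t ∈ Icc (0 : ℝ) 1) ∧
      ∀ t, HasDerivAt g (curveVal c (g t))⁻¹ t := by
  have hcc := continuous_curveVal c
  set θ : ℝ → ℝ := fun s => ∫ u in (0 : ℝ)..s, curveVal c u with hθ
  have hθd : ∀ s, HasDerivAt θ (curveVal c s) s := fun s =>
    intervalIntegral.integral_hasDerivAt_right (hcc.intervalIntegrable _ _)
      hcc.stronglyMeasurable.stronglyMeasurableAtFilter hcc.continuousAt
  have hθc : Continuous θ := continuous_iff_continuousAt.2 fun s => (hθd s).continuousAt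
  have hmono : StrictMono θ := strictMono_of_deriv_pos fun s => by
    rw [(hθd s).deriv]; exact hc _
  obtain ⟨t₀, -, ht₀⟩ := isCompact_univ.exists_isMinOn (univ_nonempty) c.continuous.continuousOn
  have hm : ∀ s, c t₀ ≤ curveVal c s := fun s => ht₀ (mem_univ _)
  have hmon : Monotone fun s => θ s - c t₀ * s := by
    have hd : ∀ s, HasDerivAt (fun s => θ s - c t₀ * s) (curveVal c s - c t₀) s := fun s =>
      ((hθd s).sub ((hasDerivAt_id s).const_mul (c t₀))).congr_deriv (by simp)
    refine monotone_of_deriv_nonneg (fun s => (hd s).differentiableAt) fun s => ?_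
    rw [(hd s).deriv]
    linarith [hm s]
  have hθ0 : θ 0 = 0 := by simp [hθ]
  have htop : Tendsto θ atTop atTop := by
    refine tendsto_atTop_mono' atTop (f₁ := fun s => c t₀ * s) ?_
      (tendsto_id.const_mul_atTop (hc t₀))
    filter_upwards [eventually_ge_atTop 0] with s hs
    have : θ 0 - c t₀ * 0 ≤ θ s - c t₀ * s := hmon hs
    rw [hθ0] at this
    linarith
  have hbot : Tendsto θ atBot atBot := by
    refine tendsto_atBot_mono' atBot (f₁ := fun s => c t₀ * s) ?_
      (tendsto_id.const_mul_atBot (hc t₀))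
    filter_upwards [eventually_le_atBot 0] with s hs
    have : θ s - c t₀ * s ≤ θ 0 - c t₀ * 0 := hmon hs
    rw [hθ0] at this
    linarith
  have hsurj := hθc.surjective htop hbot
  set Θ := StrictMono.orderIsoOfSurjective θ hmono hsurj with hΘ
  have hΘθ : ∀ s, Θ s = θ s := fun s => rfl
  have hg0 : Θ.symm 0 = 0 := by rw [Θ.symm_apply_eq, hΘθ, hθ0]
  have hT : 0 < θ 1 := by rw [← hθ0]; exact hmono zero_lt_one
  have hg1 : Θ.symm (θ 1) = 1 := by rw [Θ.symm_apply_eq, hΘθ]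
  refine ⟨θ 1, hT, Θ.symm, hg0, hg1, fun t ht => ⟨?_, ?_⟩, fun t ht => ⟨?_, ?_⟩, fun t => ?_⟩
  · rw [← hg0]; exact Θ.symm.strictMono ht.1
  · rw [← hg1]; exact Θ.symm.strictMono ht.2
  · rw [← hg0]; exact Θ.symm.monotone ht.1
  · rw [← hg1]; exact Θ.symm.monotone ht.2
  · exact HasDerivAt.of_local_left_inverse Θ.symm.continuous.continuousAt (hθd _) (hc _).ne'
      (Eventually.of_forall fun y => Θ.apply_symm_apply y)

/-- A reparametrised solution of the Hamiltonian equations is an orbit. -/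
theorem orbitIn_of_reparam {A : Set (Pos d)} {Y : ℝ → Phase d} (c : Curve ℝ) (hc : ∀ t, 0 < c t)
    (hD : ∀ s ∈ Icc (0 : ℝ) 1, (Y s).1 ∈ S.Dt)
    (hY : ∀ s ∈ Icc (0 : ℝ) 1,
      HasDerivWithinAt Y (curveVal c s • S.hamField ε (Y s)) (Icc 0 1) s)
    (hA : ∀ s ∈ Ioo (0 : ℝ) 1, (Y s).1 ∈ A) : S.OrbitIn ε A (Y 0) (Y 1) := by
  obtain ⟨T, hT, g, g0, g1, g2, g3, g4⟩ := exists_timeChange c hc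
  refine ⟨T, hT, fun t => Y (g t), fun t ht => ⟨hD _ (g3 t ht), ?_⟩, by simp [g0], by simp [g1],
    fun t ht => hA _ (g2 t ht)⟩
  have := (hY _ (g3 t ht)).scomp t (g4 t).hasDerivWithinAt g3
  rw [smul_smul, inv_mul_cancel₀ (show curveVal c (g t) ≠ 0 from (hc _).ne'), one_smul] at this
  exact this

end SteepFamily

/-! ### The pattern function near a regular boundary point -/

namespace SteepFamily

variable {d n : ℕ} {S : SteepFamily d n} {r : ℕ} {i : Fin n} {x : Pos d}

/-- The pattern function normalised such that it vanishes on `Γ_i` and is positive inside. -/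
def depth (S : SteepFamily d n) (i : Fin n) (ε : ℝ) (q : Pos d) : ℝ :=
  S.σ i * (S.Q q ε - S.Qc i)

theorem BoundaryLevels.sign_mul_self (h : S.BoundaryLevels r) (i : Fin n) : S.σ i * S.σ i = 1 := by
  rcases h.sign i with h | h <;> rw [h] <;> norm_num

theorem BoundaryLevels.abs_sign (h : S.BoundaryLevels r) (i : Fin n) : |S.σ i| = 1 := by
  rcases h.sign i with h | h <;> rw [h] <;> norm_num

theorem BoundaryLevels.sub_eq (h : S.BoundaryLevels r) (i : Fin n) (ε : ℝ) (q : Pos d) :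
    S.Q q ε - S.Qc i = S.σ i * S.depth i ε q := by
  rw [depth, ← mul_assoc, h.sign_mul_self, one_mul]

theorem IsAdmissible.mem_nbhd (hS : S.IsAdmissible r) (hx : x ∈ S.Γ i \ S.cornerSet r) :
    S.N i ∈ 𝓝 x := (hS.barrier.isOpen i).mem_nhds ((hS.barrier.subset i).1 hx)

theorem IsAdmissible.mem_dom (hS : S.IsAdmissible r) (hx : x ∈ S.Γ i \ S.cornerSet r) :
    S.Dt ∈ 𝓝 x := mem_of_superset (hS.mem_nbhd hx) (hS.barrier.subset i).2

theorem tendsto_prod_nhdsGT (x : Pos d) (hD : S.Dt ∈ 𝓝 x) (h0 : 0 < S.ε₀) :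
    Tendsto (fun p : ℝ × Pos d => p) (𝓝[>] 0 ×ˢ 𝓝 x) (𝓝[Ico 0 S.ε₀ ×ˢ S.Dt] (0, x)) := by
  rw [nhdsWithin_prod_eq]
  refine Tendsto.prodMap (f := fun a : ℝ => a) (g := fun a : Pos d => a) ?_ ?_
  · exact tendsto_nhdsWithin_iff.2 ⟨tendsto_nhdsWithin_of_tendsto_nhds tendsto_id, by
      filter_upwards [Ioo_mem_nhdsGT h0] with a ha using ⟨ha.1.le, ha.2⟩⟩
  · exact tendsto_nhdsWithin_iff.2 ⟨tendsto_id, hD⟩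

theorem IsAdmissible.eventually_param (hS : S.IsAdmissible r) :
    ∀ᶠ ε in 𝓝[>] (0 : ℝ), ε ∈ Ioo 0 S.ε₀ := Ioo_mem_nhdsGT hS.potential.pos

theorem IsAdmissible.tendsto_iteratedFDeriv (hS : S.IsAdmissible r) (hD : S.Dt ∈ 𝓝 x)
    {j : ℕ} (hj : j ≤ r + 1) :
    Tendsto (fun p : ℝ × Pos d => iteratedFDeriv ℝ j (fun y => S.Q y p.1) p.2) (𝓝[>] 0 ×ˢ 𝓝 x)
      (𝓝 (iteratedFDeriv ℝ j (fun y => S.Q y 0) x)) :=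
  (hS.pattern.continuousOn j hj (0, x) ⟨⟨le_rfl, hS.potential.pos⟩, mem_of_mem_nhds hD⟩).tendsto.comp
    (tendsto_prod_nhdsGT x hD hS.potential.pos)

theorem IsAdmissible.ckBigO_pattern (hS : S.IsAdmissible r) (hD : S.Dt ∈ 𝓝 x) :
    CkBigO (𝓝[>] (0 : ℝ) ×ˢ 𝓝 x) (r + 1) (fun ε q => S.Q q ε) (fun _ => 1) := by
  refine ⟨∑ j ∈ Finset.range (r + 2), (‖iteratedFDeriv ℝ j (fun y => S.Q y 0) x‖₊ + 1), ?_⟩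
  have h1 : ∀ᶠ p : ℝ × Pos d in 𝓝[>] (0 : ℝ) ×ˢ 𝓝 x,
      ContDiffAt ℝ (r + 1 : ℕ) (fun y => S.Q y p.1) p.2 := by
    filter_upwards [hS.eventually_param.prod_inl (𝓝 x),
      (eventually_of_mem hD fun _ h => h).prod_inr (𝓝[>] (0 : ℝ))] with p p1 p2
    exact_mod_cast (hS.pattern.contDiffOn p.1 ⟨p1.1.le, p1.2⟩).contDiffAt
      (hS.potential.isOpen_dom.mem_nhds p2)
  have h2 : ∀ᶠ p : ℝ × Pos d in 𝓝[>] (0 : ℝ) ×ˢ 𝓝 x, ∀ j ∈ Finset.range (r + 2),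
      ‖iteratedFDeriv ℝ j (fun y => S.Q y p.1) p.2‖ <
        ‖iteratedFDeriv ℝ j (fun y => S.Q y 0) x‖ + 1 := by
    rw [eventually_all_finset]
    intro j hj
    have hj' := Finset.mem_range_succ_iff.1 hj
    exact (hS.tendsto_iteratedFDeriv hD hj').norm.eventually_lt_const (by simp)
  filter_upwards [h1, h2] with p p1 p2
  refine ⟨p1, fun j hj => ?_⟩
  have hj' : j ∈ Finset.range (r + 2) := Finset.mem_range_succ_iff.2 hj
  refine (p2 j hj').le.trans ?_
  have := Finset.single_le_sum (f := fun j => ‖iteratedFDeriv ℝ j (fun y => S.Q y 0) x‖₊ + 1)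
    (fun _ _ => zero_le) hj'
  simpa using NNReal.coe_le_coe.2 this

theorem IsAdmissible.ckLip_pattern (hS : S.IsAdmissible r) (hx : x ∈ S.Γ i \ S.cornerSet r) :
    CkLip (𝓝[>] (0 : ℝ)) (r + 1) x (fun ε q => S.Q q ε) (fun _ => 1) := by
  refine ⟨hS.ckBigO_pattern (hS.mem_dom hx), ?_⟩
  obtain ⟨L, U, hU, hL⟩ := hS.pattern.lipschitz i x hx
  refine ⟨L, ?_⟩
  have hU' : ∀ᶠ p : ℝ × Pos d in 𝓝[>] (0 : ℝ) ×ˢ 𝓝 x, p.2 ∈ U :=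
    (eventually_of_mem hU fun _ h => h).prod_inr _
  filter_upwards [hL.prod_inl _, eventually_prod_nhds_prod hU'] with p p1 p2
  simpa [dist_eq_norm] using p1.dist_le_mul _ p2.1 _ p2.2

theorem IsAdmissible.ckLip_depth (hS : S.IsAdmissible r) (hx : x ∈ S.Γ i \ S.cornerSet r) :
    CkLip (𝓝[>] (0 : ℝ)) (r + 1) x (S.depth i) (fun _ => 1) := by
  have h1 := (hS.ckLip_pattern hx).sub (CkLip.const (v := fun _ : ℝ => S.Qc i)
    (b := fun _ => 1) (K := ‖S.Qc i‖₊) (by simp))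
  exact h1.clm (S.σ i • ContinuousLinearMap.id ℝ ℝ)

theorem IsAdmissible.tendsto_depth (hS : S.IsAdmissible r) (hx : x ∈ S.Γ i \ S.cornerSet r) :
    Tendsto (fun p : ℝ × Pos d => S.depth i p.1 p.2) (𝓝[>] 0 ×ˢ 𝓝 x) (𝓝 0) := by
  have h1 := hS.tendsto_iteratedFDeriv (hS.mem_dom hx) (Nat.zero_le _)
  have h2 := ((ContinuousMultilinearMap.apply ℝ (fun _ : Fin 0 => Pos d) ℝ 0).continuous.tendsto
    _).comp h1
  simp only [Function.comp_def, ContinuousMultilinearMap.apply_apply, iteratedFDeriv_zero_apply]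
    at h2
  have h3 := (h2.sub_const (S.Qc i)).const_mul (S.σ i)
  rw [hS.levels.level i x hx, sub_self, mul_zero] at h3
  exact h3

theorem gradient_depth (i : Fin n) (ε : ℝ) (q : Pos d) (hQ : DifferentiableAt ℝ (fun y => S.Q y ε) q) :
    gradient (S.depth i ε) q = S.σ i • gradient (fun y => S.Q y ε) q := by
  have h1 : HasFDerivAt (S.depth i ε) (S.σ i • fderiv ℝ (fun y => S.Q y ε) q) q :=
    (hQ.hasFDerivAt.sub_const (S.Qc i)).const_mul (S.σ i)
  rw [gradient, h1.fderiv, gradient]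
  simp

/-- The Riesz isomorphism, as a real-linear map from derivatives to gradients. -/
def riesz : (Pos d →L[ℝ] ℝ) →L[ℝ] Pos d :=
  LinearMap.mkContinuous
    { toFun := fun L => (InnerProductSpace.toDual ℝ (Pos d)).symm L
      map_add' := fun _ _ => map_add _ _ _
      map_smul' := fun c L => by simp } 1 fun L => by simp

theorem riesz_fderiv (f : Pos d → ℝ) (q : Pos d) : riesz (fderiv ℝ f q) = gradient f q := rfl

theorem ckLip_gradient {α : Type} {l : Filter α} {k : ℕ} {f : α → Pos d → ℝ} {b : α → ℝ≥0}
    (h : CkLip l (k + 1) x f b) : CkLip l k x (fun a => gradient (f a)) b :=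
  h.fderiv.clm riesz

theorem ckBigO_gradient {α : Type} {𝓕 : Filter (α × Pos d)} {k : ℕ} {f : α → Pos d → ℝ}
    {b : α → ℝ≥0} (h : CkBigO 𝓕 (k + 1) f b) : CkBigO 𝓕 k (fun a => gradient (f a)) b :=
  h.fderiv.clm riesz

theorem IsAdmissible.tendsto_gradient_pattern (hS : S.IsAdmissible r) (hD : S.Dt ∈ 𝓝 x) :
    Tendsto (fun p : ℝ × Pos d => gradient (fun y => S.Q y p.1) p.2) (𝓝[>] 0 ×ˢ 𝓝 x)
      (𝓝 (gradient (fun y => S.Q y 0) x)) := by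
  have h1 := hS.tendsto_iteratedFDeriv hD (j := 1) (by omega)
  have h2 := ((continuousMultilinearCurryFin1 ℝ (Pos d) ℝ).continuous.tendsto _).comp h1
  have h3 := (((InnerProductSpace.toDual ℝ (Pos d)).symm).continuous.tendsto _).comp h2
  have e : ∀ (f : Pos d → ℝ) (q : Pos d),
      continuousMultilinearCurryFin1 ℝ (Pos d) ℝ (iteratedFDeriv ℝ 1 f q) = fderiv ℝ f q := by
    intro f q
    ext v
    simp [iteratedFDeriv_one_apply]
  simp only [Function.comp_def, e] at h3
  exact h3

theorem IsAdmissible.differentiableAt_pattern (hS : S.IsAdmissible r) (hD : S.Dt ∈ 𝓝 x) :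
    ∀ᶠ p : ℝ × Pos d in 𝓝[>] 0 ×ˢ 𝓝 x, DifferentiableAt ℝ (fun y => S.Q y p.1) p.2 :=
  (hS.ckBigO_pattern hD).differentiableAt

theorem IsAdmissible.tendsto_gradient_depth (hS : S.IsAdmissible r)
    (hx : x ∈ S.Γ i \ S.cornerSet r) :
    Tendsto (fun p : ℝ × Pos d => gradient (S.depth i p.1) p.2) (𝓝[>] 0 ×ˢ 𝓝 x)
      (𝓝 (S.σ i • gradient (fun y => S.Q y 0) x)) := by
  refine ((hS.tendsto_gradient_pattern (hS.mem_dom hx)).const_smul (S.σ i)).congr' ?_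
  filter_upwards [hS.differentiableAt_pattern (hS.mem_dom hx)] with p hp
  rw [gradient_depth _ _ _ hp]

theorem IsAdmissible.gradient_ne (hS : S.IsAdmissible r) (hx : x ∈ S.Γ i \ S.cornerSet r) :
    gradient (fun y => S.Q y 0) x ≠ 0 :=
  hS.nonvanishing.gradient_ne i 0 ⟨le_rfl, hS.potential.pos⟩ x ((hS.barrier.subset i).1 hx)

theorem normal_zero_eq (i : Fin n) (x : Pos d) : S.normal i 0 x =
    ‖gradient (fun y => S.Q y 0) x‖⁻¹ • (S.σ i • gradient (fun y => S.Q y 0) x) := by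
  rw [normal, smul_smul, div_eq_inv_mul]

/-! ### Regions bounded by level surfaces -/

theorem frontier_level_iff {A : Set (Pos d)} {f : Pos d → ℝ} {q : Pos d}
    (hA : ∀ᶠ y in 𝓝 q, (y ∈ A ↔ 0 ≤ f y)) (hf : DifferentiableAt ℝ f q)
    (hg : fderiv ℝ f q ≠ 0) : (0 < f q → q ∈ interior A) ∧ (f q < 0 → q ∉ closure A) ∧
      (q ∈ frontier A ↔ f q = 0) := by
  have hpos : 0 < f q → q ∈ interior A := fun h => by
    rw [mem_interior_iff_mem_nhds]
    filter_upwards [hA, hf.continuousAt.eventually_const_lt h] with y h1 h2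
    exact h1.2 h2.le
  have hneg : f q < 0 → q ∉ closure A := fun h => by
    rw [mem_closure_iff_frequently, not_frequently]
    filter_upwards [hA, hf.continuousAt.eventually_lt_const h] with y h1 h2
    exact fun h3 => absurd (h1.1 h3) (not_le.2 h2)
  refine ⟨hpos, hneg, fun h => ?_, fun h => ?_⟩
  · rcases lt_trichotomy (f q) 0 with h1 | h1 | h1
    · exact absurd (frontier_subset_closure h) (hneg h1)
    · exact h1
    · exact absurd (hpos h1) h.2
  · refine ⟨subset_closure (hA.self_of_nhds.2 h.ge), fun hint => hg ?_⟩
    have hmin : IsLocalMin f q := by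
      filter_upwards [hA, mem_interior_iff_mem_nhds.1 hint] with y h1 h2
      rw [h]
      exact h1.1 h2
    exact hmin.fderiv_eq_zero

theorem IsAdmissible.eventually_region (hS : S.IsAdmissible r) (hx : x ∈ S.Γ i \ S.cornerSet r)
    {s : Fin n → ℝ → ℝ} {A : ℝ → Set (Pos d)} (hA : S.IsLevelRegion r s A) :
    ∀ᶠ p : ℝ × Pos d in 𝓝[>] 0 ×ˢ 𝓝 x,
      (S.σ i * s i p.1 < S.depth i p.1 p.2 → p.2 ∈ interior (A p.1)) ∧
      (S.depth i p.1 p.2 < S.σ i * s i p.1 → p.2 ∉ closure (A p.1)) ∧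
      (p.2 ∈ frontier (A p.1) ↔ S.depth i p.1 p.2 = S.σ i * s i p.1) := by
  obtain ⟨U, hU, hA⟩ := hA.boundary i x hx
  have h1 : ∀ᶠ p : ℝ × Pos d in 𝓝[>] (0 : ℝ) ×ˢ 𝓝 x,
      (p.2 ∈ A p.1 ↔ 0 ≤ S.depth i p.1 p.2 - S.σ i * s i p.1) := by
    filter_upwards [hA.prod_inl _, (eventually_of_mem hU fun _ h => h).prod_inr _] with p p1 p2
    rw [p1 p.2 p2, depth]
    ring_nf
  have hne : S.σ i • gradient (fun y => S.Q y 0) x ≠ 0 := by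
    refine smul_ne_zero ?_ (hS.gradient_ne hx)
    intro h0
    have := hS.levels.sign_mul_self i
    rw [h0] at this
    norm_num at this
  filter_upwards [SpreadFilter.spread _ h1, (hS.ckLip_depth hx).1.differentiableAt,
    (hS.tendsto_gradient_depth hx).eventually_ne hne] with p p1 p2 p3
  have h4 : HasFDerivAt (fun y => S.depth i p.1 y - S.σ i * s i p.1) _ p.2 :=
    p2.hasFDerivAt.sub_const _
  have := frontier_level_iff (f := fun y => S.depth i p.1 y - S.σ i * s i p.1) p1
    h4.differentiableAt (by
      rw [h4.fderiv]
      intro h0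
      apply p3
      rw [gradient, h0, map_zero])
  simpa [sub_pos, sub_neg, sub_eq_zero] using this

end SteepFamily

/-! ### Hitting times of level surfaces along lines -/

section HittingTime

theorem tendsto_clm_apply {α E F : Type} [NormedAddCommGroup E] [NormedSpace ℝ E]
    [NormedAddCommGroup F] [NormedSpace ℝ F] {𝓕 : Filter α} {L : α → E →L[ℝ] F} {v : α → E}
    {L₀ : E →L[ℝ] F} {v₀ : E} (hL : Tendsto L 𝓕 (𝓝 L₀)) (hv : Tendsto v 𝓕 (𝓝 v₀)) :
    Tendsto (fun a => L a (v a)) 𝓕 (𝓝 (L₀ v₀)) :=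
  (isBoundedBilinearMap_apply.continuous.tendsto (L₀, v₀)).comp (hL.prodMk_nhds hv)

variable {d : ℕ} {l : Filter ℝ} {k : ℕ} {D : ℝ → Pos d → ℝ} {x : Pos d} {z₀ : Phase d} {T₀ : ℝ}
  {L : Pos d →L[ℝ] ℝ}

/-- The time at which the line `A + t p` meets the level `u` of `D`, depending on `(u, (A, p))`. -/
theorem exists_levelTime (hD : CkBigO (l ×ˢ 𝓝 x) (k + 1) D fun _ => 1)
    (hD0 : Tendsto (fun p : ℝ × Pos d => D p.1 p.2) (l ×ˢ 𝓝 x) (𝓝 0))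
    (hD1 : Tendsto (fun p : ℝ × Pos d => fderiv ℝ (D p.1) p.2) (l ×ˢ 𝓝 x) (𝓝 L))
    (hz : z₀.1 + T₀ • z₀.2 = x) (hL : L z₀.2 ≠ 0) :
    ∃ τ : ℝ → ℝ × Phase d → ℝ,
      (∀ᶠ p in l ×ˢ 𝓝 ((0 : ℝ), z₀), D p.1 (p.2.2.1 + τ p.1 p.2 • p.2.2.2) = p.2.1) ∧
      Tendsto (fun p : ℝ × (ℝ × Phase d) => τ p.1 p.2) (l ×ˢ 𝓝 ((0 : ℝ), z₀)) (𝓝 T₀) ∧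
      CkBigO (l ×ˢ 𝓝 ((0 : ℝ), z₀)) (k + 1) τ (fun _ => 1) ∧
      ∀ᶠ p : ℝ × ((ℝ × Phase d) × ℝ) in l ×ˢ 𝓝 (((0 : ℝ), z₀), T₀),
        D p.1 (p.2.1.2.1 + p.2.2 • p.2.1.2.2) = p.2.1.1 → p.2.2 = τ p.1 p.2.1 := by
  set m : (ℝ × Phase d) × ℝ → Pos d := fun y => y.1.2.1 + y.2 • y.1.2.2 with hm
  have hmc : ContDiff ℝ (k + 1 : ℕ) m := by fun_prop
  set c : ℝ := (L z₀.2)⁻¹ with hc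
  have hm0 : m ((0, z₀), T₀) = x := hz
  have tm : Tendsto (fun p : ℝ × ((ℝ × Phase d) × ℝ) => m p.2) (l ×ˢ 𝓝 (((0 : ℝ), z₀), T₀))
      (𝓝 x) := by
    have := (hmc.continuous.tendsto ((0, z₀), T₀)).comp (tendsto_snd (f := l))
    rwa [hm0] at this
  have hDm : CkBigO (l ×ˢ 𝓝 (((0 : ℝ), z₀), T₀)) (k + 1) (fun a y => D a (m y)) (fun _ => 1) :=
    hD.comp_nhds (ckBigO_of_contDiffAt hmc.contDiffAt) tendsto_fst tm
  have t2 : Tendsto (fun p : ℝ × ((ℝ × Phase d) × ℝ) => p.2.2) (l ×ˢ 𝓝 (((0 : ℝ), z₀), T₀))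
      (𝓝 T₀) := (continuous_snd.tendsto (((0 : ℝ), z₀), T₀)).comp tendsto_snd
  have t1 : Tendsto (fun p : ℝ × ((ℝ × Phase d) × ℝ) => p.2.1.1) (l ×ˢ 𝓝 (((0 : ℝ), z₀), T₀))
      (𝓝 0) := (continuous_fst.fst.tendsto (((0 : ℝ), z₀), T₀)).comp tendsto_snd
  have tp : Tendsto (fun p : ℝ × ((ℝ × Phase d) × ℝ) => p.2.1.2.2) (l ×ˢ 𝓝 (((0 : ℝ), z₀), T₀))
      (𝓝 z₀.2) := (continuous_fst.snd.snd.tendsto (((0 : ℝ), z₀), T₀)).comp tendsto_snd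
  have tD : Tendsto (fun p : ℝ × ((ℝ × Phase d) × ℝ) => D p.1 (m p.2))
      (l ×ˢ 𝓝 (((0 : ℝ), z₀), T₀)) (𝓝 0) := hD0.comp (tendsto_fst.prodMk tm)
  have hG : CkBigO (l ×ˢ 𝓝 (((0 : ℝ), z₀), T₀)) (k + 1)
      (fun a (y : (ℝ × Phase d) × ℝ) => y.2 - c * (D a (m y) - y.1.1)) (fun _ => 1) := by
    have h1 := (ckBigO_id (l := l) (k := k + 1) (z := (((0 : ℝ), z₀), T₀)))
    have h2 := (hDm.sub h1.fst.fst).clm (c • ContinuousLinearMap.id ℝ ℝ)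
    exact h1.snd.sub h2
  obtain ⟨τ, h1, h2, h3, h4⟩ := exists_fixedPoint_family hG
    (by simpa using t2.sub ((tD.sub t1).const_mul c)) (by
      have e1 : Tendsto (fun p : ℝ × ((ℝ × Phase d) × ℝ) =>
          (1 - c * fderiv ℝ (D p.1) (m p.2) p.2.1.2.2) • ContinuousLinearMap.id ℝ ℝ)
          (l ×ˢ 𝓝 (((0 : ℝ), z₀), T₀)) (𝓝 0) := by
        have := ((tendsto_const_nhds (x := (1 : ℝ))).sub ((tendsto_clm_apply (hD1.comp (tendsto_fst.prodMk tm))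
          tp).const_mul c)).smul_const (ContinuousLinearMap.id ℝ ℝ)
        simpa [hc, inv_mul_cancel₀ hL] using this
      refine e1.congr' ?_
      filter_upwards [(tendsto_fst.prodMk tm).eventually hD.differentiableAt] with p hp
      have d1 : HasFDerivAt (fun y : (ℝ × Phase d) × ℝ => D p.1 (m y))
          ((fderiv ℝ (D p.1) (m p.2)).comp (fderiv ℝ m p.2)) p.2 :=
        HasFDerivAt.comp p.2 hp.hasFDerivAt (hmc.differentiable (by simp) p.2).hasFDerivAt
      have d2 : HasFDerivAt (fun y : (ℝ × Phase d) × ℝ => y.2 - c * (D p.1 (m y) - y.1.1)) _ p.2 :=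
        hasFDerivAt_snd.sub ((d1.sub (hasFDerivAt_fst.fst)).const_mul c)
      rw [d2.fderiv]
      have d4 : HasFDerivAt (fun y : (ℝ × Phase d) × ℝ => y.1.2.2) _ p.2 :=
        ((ContinuousLinearMap.snd ℝ (Pos d) (Pos d)).comp ((ContinuousLinearMap.snd ℝ ℝ (Phase d)).comp
          (ContinuousLinearMap.fst ℝ (ℝ × Phase d) ℝ))).hasFDerivAt
      have d5 : HasFDerivAt (fun y : (ℝ × Phase d) × ℝ => y.1.2.1) _ p.2 :=
        ((ContinuousLinearMap.fst ℝ (Pos d) (Pos d)).comp ((ContinuousLinearMap.snd ℝ ℝ (Phase d)).comp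
          (ContinuousLinearMap.fst ℝ (ℝ × Phase d) ℝ))).hasFDerivAt
      have d3 : HasFDerivAt (fun y : (ℝ × Phase d) × ℝ => y.1.2.1 + y.2 • y.1.2.2) _ p.2 :=
        d5.add (hasFDerivAt_snd.fun_smul d4)
      rw [show fderiv ℝ m p.2 = _ from d3.fderiv]
      ext
      simp)
  refine ⟨τ, ?_, h2, h3, ?_⟩
  · filter_upwards [h1] with p hp
    have : c * (D p.1 (p.2.2.1 + τ p.1 p.2 • p.2.2.2) - p.2.1) = 0 := by simpa [hm] using hp
    rcases mul_eq_zero.1 this with h | h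
    · exact absurd h (inv_ne_zero hL)
    · exact sub_eq_zero.1 h
  · filter_upwards [h4] with p hp h
    apply hp
    simp [hm, h]

theorem exists_strictMonoOn_line (hD : CkBigO (l ×ˢ 𝓝 x) (k + 1) D fun _ => 1)
    (hD1 : Tendsto (fun p : ℝ × Pos d => fderiv ℝ (D p.1) p.2) (l ×ˢ 𝓝 x) (𝓝 L))
    (hz : z₀.1 + T₀ • z₀.2 = x) (hL : 0 < L z₀.2) :
    ∃ ρ > 0, ∀ᶠ ε in l, ∀ z ∈ Metric.ball z₀ ρ,
      StrictMonoOn (fun t => D ε (z.1 + t • z.2)) (Ioo (T₀ - ρ) (T₀ + ρ)) := by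
  set m : Phase d × ℝ → Pos d := fun y => y.1.1 + y.2 • y.1.2 with hm
  have hmc : Continuous m := by fun_prop
  have tm : Tendsto (fun p : ℝ × (Phase d × ℝ) => (p.1, m p.2)) (l ×ˢ 𝓝 (z₀, T₀)) (l ×ˢ 𝓝 x) := by
    have := (hmc.tendsto (z₀, T₀)).comp (tendsto_snd (f := l))
    rw [show m (z₀, T₀) = x from hz] at this
    exact tendsto_fst.prodMk this
  have tp : Tendsto (fun p : ℝ × (Phase d × ℝ) => p.2.1.2) (l ×ˢ 𝓝 (z₀, T₀))
      (𝓝 z₀.2) := (continuous_fst.snd.tendsto (z₀, T₀)).comp tendsto_snd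
  have h1 := (tendsto_clm_apply (hD1.comp tm) tp).eventually_const_lt hL
  obtain ⟨ρ, hρ, h2⟩ := eventually_prod_nhds_ball (h1.and (tm.eventually hD.differentiableAt))
  refine ⟨ρ, hρ, h2.mono fun ε hε z hz => ?_⟩
  have hmem : ∀ t ∈ Ioo (T₀ - ρ) (T₀ + ρ), (z, t) ∈ Metric.ball (z₀, T₀) ρ := fun t ht => by
    rw [← ball_prod_same, Real.ball_eq_Ioo]; exact ⟨hz, ht⟩
  have hd : ∀ t ∈ Ioo (T₀ - ρ) (T₀ + ρ),
      HasDerivAt (fun t => D ε (z.1 + t • z.2)) (fderiv ℝ (D ε) (z.1 + t • z.2) z.2) t := by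
    intro t ht
    have e1 : HasDerivAt (fun t : ℝ => z.1 + t • z.2) z.2 t := by
      simpa using ((hasDerivAt_id t).smul_const z.2).const_add z.1
    exact (hε _ (hmem t ht)).2.hasFDerivAt.comp_hasDerivAt t e1
  refine strictMonoOn_of_deriv_pos (convex_Ioo _ _)
    (fun t ht => (hd t ht).continuousAt.continuousWithinAt) fun t ht => ?_
  rw [interior_Ioo] at ht
  rw [(hd t ht).deriv]
  exact (hε _ (hmem t ht)).1

end HittingTime

/-! ### Extension of functions of one variable -/

theorem ContDiffAt.deriv_succ {k : ℕ} {f : ℝ → ℝ} {x : ℝ} (h : ContDiffAt ℝ (k + 1 : ℕ) f x) :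
    ContDiffAt ℝ k (deriv f) x := by
  have h1 : ContDiffAt ℝ k (fderiv ℝ f) x := h.fderiv_right (by push_cast; exact le_rfl)
  have h2 : deriv f = fun y => ContinuousLinearMap.apply ℝ ℝ (1 : ℝ) (fderiv ℝ f y) := by
    ext y; simp
  rw [h2]
  exact h1.continuousLinearMap_comp _

/-- A `C^k` function on an interval extends to the line, with control of its derivatives. -/
theorem exists_contDiff_extension (k : ℕ) {c e B : ℝ} (hce : c ≤ e) (f : ℝ → ℝ)
    (hf : ∀ v ∈ Icc c e, ContDiffAt ℝ k f v)
    (hB : ∀ j ≤ k, ∀ v ∈ Icc c e, |iteratedDeriv j f v| ≤ B) :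
    ∃ g : ℝ → ℝ, ContDiff ℝ k g ∧ EqOn g f (Icc c e) ∧
      ∀ j ≤ k, ∀ v, |iteratedDeriv j g v| ≤ B * (1 + |v - c|) ^ k := by
  induction k generalizing f with
  | zero =>
    have hc : ContinuousOn f (Icc c e) := fun v hv =>
      (contDiffAt_zero.1 (hf v hv)).elim fun u hu =>
        (hu.2.continuousAt hu.1).continuousWithinAt
    refine ⟨IccExtend hce ((Icc c e).domRestrict f), ?_, fun v hv => IccExtend_of_mem hce _ hv, ?_⟩
    · exact contDiff_zero.2 ((continuousOn_iff_continuous_domRestrict.1 hc).Icc_extend')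
    · intro j hj v
      obtain rfl : j = 0 := by omega
      simpa [IccExtend] using hB 0 le_rfl _ (projIcc c e hce v).2
  | succ k ih =>
    obtain ⟨g, g1, g2, g3⟩ := ih (deriv f) (fun v hv => (hf v hv).deriv_succ) (fun j hj v hv => by
      rw [← iteratedDeriv_succ']
      exact hB _ (by omega) v hv)
    have hB0 : 0 ≤ B := (abs_nonneg _).trans (hB 0 (by omega) c ⟨le_rfl, hce⟩)
    have gd : ∀ v, HasDerivAt (fun v => f c + ∫ u in c..v, g u) (g v) v := fun v =>
      (intervalIntegral.integral_hasDerivAt_right (g1.continuous.intervalIntegrable _ _)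
        g1.continuous.stronglyMeasurable.stronglyMeasurableAtFilter
        g1.continuous.continuousAt).const_add _
    have hderiv : deriv (fun v => f c + ∫ u in c..v, g u) = g := funext fun v => (gd v).deriv
    refine ⟨fun v => f c + ∫ u in c..v, g u, ?_, ?_, ?_⟩
    · push_cast
      rw [contDiff_succ_iff_deriv, hderiv]
      exact ⟨fun v => (gd v).differentiableAt, by simp, g1⟩
    · intro v hv
      have h1 : ∫ u in c..v, g u = f v - f c := by
        refine intervalIntegral.integral_eq_sub_of_hasDerivAt (fun u hu => ?_)
          (g1.continuous.intervalIntegrable _ _)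
        rw [uIcc_of_le hv.1] at hu
        have hu' : u ∈ Icc c e := ⟨hu.1, hu.2.trans hv.2⟩
        rw [g2 hu']
        exact ((hf u hu').differentiableAt (by simp)).hasDerivAt
      simp [h1]
    · intro j hj v
      have hmono : (1 + |v - c|) ^ k ≤ (1 + |v - c|) ^ (k + 1) :=
        pow_le_pow_right₀ (by linarith [abs_nonneg (v - c)]) (Nat.le_succ k)
      cases j with
      | succ j =>
        rw [iteratedDeriv_succ', hderiv]
        exact (g3 j (by omega) v).trans (mul_le_mul_of_nonneg_left hmono hB0)
      | zero =>
        have h1 : ‖∫ u in c..v, g u‖ ≤ B * (1 + |v - c|) ^ k * |v - c| := by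
          refine intervalIntegral.norm_integral_le_of_norm_le_const fun u hu => ?_
          have h2 := g3 0 (Nat.zero_le _) u
          rw [iteratedDeriv_zero] at h2
          refine h2.trans ?_
          have h3 : |u - c| ≤ |v - c| := by
            have := abs_sub_left_of_mem_uIcc (uIoc_subset_uIcc hu)
            simpa [abs_sub_comm] using this
          gcongr
        have h2 : |f c| ≤ B := by simpa using hB 0 (by omega) c ⟨le_rfl, hce⟩
        rw [iteratedDeriv_zero]
        have h4 : 1 ≤ (1 + |v - c|) ^ k := one_le_pow₀ (by linarith [abs_nonneg (v - c)])
        calc |f c + ∫ u in c..v, g u| ≤ |f c| + |∫ u in c..v, g u| := abs_add_le _ _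
          _ ≤ B * (1 + |v - c|) ^ k + B * (1 + |v - c|) ^ k * |v - c| := by
            have : |∫ u in c..v, g u| ≤ B * (1 + |v - c|) ^ k * |v - c| := h1
            nlinarith
          _ = B * (1 + |v - c|) ^ (k + 1) := by ring

namespace SteepFamily

variable {d n : ℕ} {S : SteepFamily d n} {r : ℕ} {i : Fin n}
  {ν : Fin n → ℝ → ℝ} {Dε Dint : ℝ → Set (Pos d)} {b : ℝ → ℝ≥0}

/-- The regions `D^ε` and `D^ε_int` of a family of steep potentials, with a bound `b` for the error
of the approximation by the billiard in `D^ε`. -/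
structure Approximates (S : SteepFamily d n) (r : ℕ) (ν : Fin n → ℝ → ℝ)
    (Dε Dint : ℝ → Set (Pos d)) (b : ℝ → ℝ≥0) : Prop where
  adm : S.IsAdmissible r
  ν_pos : ∀ i, ∀ᶠ ε in 𝓝[>] (0 : ℝ), 0 < ν i ε
  ν_mem : ∀ i, ∀ᶠ ε in 𝓝[>] (0 : ℝ), ν i ε ∈ (fun s => S.W i s ε) '' Ioo (-S.a) S.a
  ν_le : ∀ i, ∀ᶠ ε in 𝓝[>] (0 : ℝ), ν i ε ≤ b ε
  region : S.IsLevelRegion r (fun i ε => S.invBarrier i (ν i ε) ε) Dε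
  subset_inner : ∀ K : Set (Pos d), IsCompact K → K ⊆ interior S.D → ∀ᶠ ε in 𝓝[>] (0 : ℝ), K ⊆ Dint ε
  small : Tendsto b (𝓝[>] 0) (𝓝 0)
  m_le : ∀ᶠ ε in 𝓝[>] (0 : ℝ), S.mSup r (Dint ε) ε ≤ b ε
  M_le : ∀ i, ∀ᶠ ε in 𝓝[>] (0 : ℝ), S.MSup r i (ν i ε) ε ≤ b ε

/-- The barrier as a function of the depth. -/
def barrier (S : SteepFamily d n) (i : Fin n) (ε u : ℝ) : ℝ := S.W i (S.σ i * u) ε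

theorem BoundaryLevels.sign_mul_mem (h : S.BoundaryLevels r) (i : Fin n) {u : ℝ}
    (hu : u ∈ Ioo (-S.a) S.a) : S.σ i * u ∈ Ioo (-S.a) S.a := by
  rcases h.sign i with h | h
  · rw [h, one_mul]; exact hu
  · rw [h, neg_one_mul]; exact ⟨by linarith [hu.2], by linarith [hu.1]⟩

theorem IsAdmissible.contDiffAt_barrierFun (hS : S.IsAdmissible r) {ε : ℝ} (hε : ε ∈ Ioo 0 S.ε₀)
    {s : ℝ} (hs : s ∈ Ioo (-S.a) S.a) : ContDiffAt ℝ (r + 1 : ℕ) (fun s => S.W i s ε) s := by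
  exact_mod_cast (hS.barrier.contDiffOn i ε hε).contDiffAt (isOpen_Ioo.mem_nhds hs)

theorem IsAdmissible.hasDerivAt_barrier (hS : S.IsAdmissible r) {ε : ℝ} (hε : ε ∈ Ioo 0 S.ε₀)
    {u : ℝ} (hu : u ∈ Ioo (-S.a) S.a) : HasDerivAt (S.barrier i ε)
      (S.σ i * deriv (fun s => S.W i s ε) (S.σ i * u)) u := by
  have h1 : HasDerivAt (fun s => S.W i s ε) _ (S.σ i * u) := ((hS.contDiffAt_barrierFun hε
    (hS.levels.sign_mul_mem i hu)).differentiableAt (by simp)).hasDerivAt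
  have h2 : HasDerivAt (fun u => S.σ i * u) (S.σ i) u := by
    simpa using (hasDerivAt_id u).const_mul (S.σ i)
  have := h1.comp u h2
  rw [mul_comm]
  exact this

theorem IsAdmissible.barrier_nonneg (hS : S.IsAdmissible r) {ε : ℝ} (hε : ε ∈ Ioo 0 S.ε₀)
    {u : ℝ} (hu : u ∈ Ioo (-S.a) S.a) : 0 ≤ S.barrier i ε u :=
  hS.growth.nonneg i ε hε _ (hS.levels.sign_mul_mem i hu)

theorem IsAdmissible.tendsto_barrier_inside (hS : S.IsAdmissible r) {u : ℝ} (h0 : 0 < u)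
    (h1 : u < S.a) : Tendsto (fun ε => S.barrier i ε u) (𝓝[>] 0) (𝓝 0) := by
  refine hS.growth.inside i _ (hS.levels.sign_mul_mem i ⟨by linarith, h1⟩) ?_
  rwa [← mul_assoc, hS.levels.sign_mul_self, one_mul]

theorem IsAdmissible.eventually_barrier_outside (hS : S.IsAdmissible r) {u : ℝ} (h0 : u < 0)
    (h1 : -S.a < u) : ∀ᶠ ε in 𝓝[>] 0, 1 / 2 < S.barrier i ε u := by
  have := hS.growth.outside i _ (hS.levels.sign_mul_mem i (u := u) ⟨h1, by linarith⟩) (by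
    rwa [← mul_assoc, hS.levels.sign_mul_self, one_mul])
  filter_upwards [this.eventually_const_lt hS.growth.energy_lt] with ε hε
  exact EReal.coe_lt_coe_iff.1 hε

/-- For small `ε` the barrier decreases strictly in the depth. -/
theorem IsAdmissible.eventually_deriv_barrier_neg (hS : S.IsAdmissible r) (i : Fin n) :
    ∀ᶠ ε in 𝓝[>] (0 : ℝ), ∀ u ∈ Ioo (-S.a) S.a,
      S.σ i * deriv (fun s => S.W i s ε) (S.σ i * u) < 0 := by
  have ha := hS.barrier.pos
  filter_upwards [hS.eventually_param, hS.eventually_barrier_outside (i := i) (u := -(S.a / 2))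
    (by linarith) (by linarith), (hS.tendsto_barrier_inside (i := i) (u := S.a / 2) (by linarith)
    (by linarith)).eventually_lt_const (u := 1 / 2) (by norm_num)] with ε hε h1 h2
  have hne : ∀ u ∈ Ioo (-S.a) S.a, S.σ i * deriv (fun s => S.W i s ε) (S.σ i * u) ≠ 0 := by
    intro u hu
    refine mul_ne_zero (fun h => ?_)
      (hS.nonvanishing.deriv_ne i ε hε _ (hS.levels.sign_mul_mem i hu))
    have := hS.levels.sign_mul_self i
    simp [h] at this
  rcases hasDerivWithinAt_forall_lt_or_forall_gt_of_forall_ne (convex_Ioo (-S.a) S.a)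
    (fun u hu => (hS.hasDerivAt_barrier (i := i) hε hu).hasDerivWithinAt) hne with h | h
  · exact h
  · exfalso
    have hmono : StrictMonoOn (S.barrier i ε) (Ioo (-S.a) S.a) :=
      strictMonoOn_of_deriv_pos (convex_Ioo _ _)
        (fun u hu => (hS.hasDerivAt_barrier hε hu).continuousAt.continuousWithinAt) fun u hu => by
          rw [interior_Ioo] at hu
          rw [(hS.hasDerivAt_barrier hε hu).deriv]
          exact h u hu
    have := hmono (a := -(S.a / 2)) (b := S.a / 2) ⟨by linarith, by linarith⟩
      ⟨by linarith, by linarith⟩ (by linarith)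
    linarith

theorem IsAdmissible.strictAntiOn_barrier (hS : S.IsAdmissible r) {ε : ℝ} (hε : ε ∈ Ioo 0 S.ε₀)
    (h : ∀ u ∈ Ioo (-S.a) S.a, S.σ i * deriv (fun s => S.W i s ε) (S.σ i * u) < 0) :
    StrictAntiOn (S.barrier i ε) (Ioo (-S.a) S.a) :=
  strictAntiOn_of_deriv_neg (convex_Ioo _ _)
    (fun u hu => (hS.hasDerivAt_barrier hε hu).continuousAt.continuousWithinAt) fun u hu => by
      rw [interior_Ioo] at hu
      rw [(hS.hasDerivAt_barrier hε hu).deriv]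
      exact h u hu

theorem IsAdmissible.injOn_barrierFun (hS : S.IsAdmissible r) {ε : ℝ} (hε : ε ∈ Ioo 0 S.ε₀)
    (h : ∀ u ∈ Ioo (-S.a) S.a, S.σ i * deriv (fun s => S.W i s ε) (S.σ i * u) < 0) :
    InjOn (fun s => S.W i s ε) (Ioo (-S.a) S.a) := by
  intro s hs t ht hst
  have e : ∀ s, S.W i s ε = S.barrier i ε (S.σ i * s) := fun s => by
    rw [SteepFamily.barrier, ← mul_assoc, hS.levels.sign_mul_self, one_mul]
  simp only [e] at hst
  have := (hS.strictAntiOn_barrier hε h).injOn (hS.levels.sign_mul_mem i hs)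
    (hS.levels.sign_mul_mem i ht) hst
  have h2 := congrArg (S.σ i * ·) this
  simpa only [← mul_assoc, hS.levels.sign_mul_self, one_mul] using h2

theorem invBarrier_mem {ε w : ℝ} (hw : w ∈ (fun s => S.W i s ε) '' Ioo (-S.a) S.a) :
    S.invBarrier i w ε ∈ Ioo (-S.a) S.a := Function.invFunOn_mem hw

theorem apply_invBarrier {ε w : ℝ} (hw : w ∈ (fun s => S.W i s ε) '' Ioo (-S.a) S.a) :
    S.W i (S.invBarrier i w ε) ε = w := Function.invFunOn_eq hw

theorem invBarrier_apply {ε s : ℝ} (h : InjOn (fun s => S.W i s ε) (Ioo (-S.a) S.a))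
    (hs : s ∈ Ioo (-S.a) S.a) : S.invBarrier i (S.W i s ε) ε = s :=
  h (invBarrier_mem ⟨s, hs, rfl⟩) hs (apply_invBarrier ⟨s, hs, rfl⟩)

theorem IsAdmissible.contDiffAt_invBarrier (hS : S.IsAdmissible r) {ε w : ℝ} (hε : ε ∈ Ioo 0 S.ε₀)
    (h : InjOn (fun s => S.W i s ε) (Ioo (-S.a) S.a))
    (hw : w ∈ (fun s => S.W i s ε) '' Ioo (-S.a) S.a) :
    ContDiffAt ℝ (r + 1 : ℕ) (fun w => S.invBarrier i w ε) w ∧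
    HasDerivAt (fun w => S.invBarrier i w ε)
      (deriv (fun s => S.W i s ε) (S.invBarrier i w ε))⁻¹ w := by
  obtain ⟨s, hs, rfl⟩ := hw
  have hc := hS.contDiffAt_barrierFun (i := i) hε hs
  have hne := hS.nonvanishing.deriv_ne i ε hε s hs
  have hinv : ∀ᶠ t in 𝓝 s, S.invBarrier i (S.W i t ε) ε = t := by
    filter_upwards [isOpen_Ioo.mem_nhds hs] with t ht using invBarrier_apply h ht
  have hd := hc.hasStrictDerivAt (by simp)
  have hsd := hd.to_local_left_inverse hne hinv
  simp only [invBarrier_apply h hs]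
  refine ⟨?_, hsd.hasDerivAt⟩
  have hf' := (hd.hasStrictFDerivAt_equiv hne)
  have h1 := hc.to_localInverse hf'.hasFDerivAt (by simp)
  refine h1.congr_of_eventuallyEq ?_
  exact HasStrictFDerivAt.localInverse_unique (hf := hc.hasStrictFDerivAt' hf'.hasFDerivAt (by simp))
    hinv

theorem Approximates.eventually_mem_image (h : S.Approximates r ν Dε Dint b) (i : Fin n) :
    ∀ᶠ ε in 𝓝[>] (0 : ℝ), Icc (ν i ε) (1 / 2) ⊆ (fun s => S.W i s ε) '' Ioo (-S.a) S.a := by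
  have ha := h.adm.barrier.pos
  filter_upwards [h.adm.eventually_param, h.adm.eventually_barrier_outside (i := i)
    (u := -(S.a / 2)) (by linarith) (by linarith), h.ν_mem i] with ε hε h1 h2
  have hpre : IsPreconnected ((fun s => S.W i s ε) '' Ioo (-S.a) S.a) :=
    isPreconnected_Ioo.image _ (h.adm.barrier.contDiffOn i ε hε).continuousOn
  have h3 : S.barrier i ε (-(S.a / 2)) ∈ (fun s => S.W i s ε) '' Ioo (-S.a) S.a :=
    ⟨_, h.adm.levels.sign_mul_mem i (u := -(S.a / 2)) ⟨by linarith, by linarith⟩, rfl⟩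
  exact (Icc_subset_Icc_right h1.le).trans (hpre.ordConnected.out h2 h3)

theorem Approximates.tendsto_ν (h : S.Approximates r ν Dε Dint b) (i : Fin n) :
    Tendsto (ν i) (𝓝[>] 0) (𝓝 0) := by
  refine tendsto_of_tendsto_of_tendsto_of_le_of_le' tendsto_const_nhds
    (NNReal.tendsto_coe.2 h.small) ?_ (h.ν_le i)
  filter_upwards [h.ν_pos i] with ε hε using hε.le

theorem Approximates.abs_iteratedDeriv_invBarrier_le (h : S.Approximates r ν Dε Dint b)
    (i : Fin n) : ∀ᶠ ε in 𝓝[>] (0 : ℝ), ∀ j ≤ r + 1, ∀ w ∈ Icc (ν i ε) (1 / 2),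
      |iteratedDeriv j (fun u => S.invBarrier i u ε) w| ≤ b ε := by
  filter_upwards [h.M_le i] with ε hε j hj w hw
  have h1 : ‖iteratedDeriv j (fun u => S.invBarrier i u ε) w‖ₑ ≤ b ε := by
    refine le_trans ?_ hε
    refine le_trans ?_ (le_iSup₂ (f := fun l (_ : l ∈ Icc 0 (r + 1)) => ⨆ w ∈ Icc (ν i ε) (1 / 2),
      ‖iteratedDeriv l (fun u => S.invBarrier i u ε) w‖ₑ) j ⟨Nat.zero_le _, hj⟩)
    exact le_iSup₂ (f := fun w (_ : w ∈ Icc (ν i ε) (1 / 2)) =>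
      ‖iteratedDeriv j (fun u => S.invBarrier i u ε) w‖ₑ) w hw
  rw [enorm_le_coe] at h1
  exact_mod_cast h1

/-- The derivative of the inverse barrier, extended to all heights. -/
theorem Approximates.exists_extension (h : S.Approximates r ν Dε Dint b) (i : Fin n) :
    ∃ f : ℝ → ℝ → ℝ, (∀ w₀, CkBigO (𝓝[>] (0 : ℝ) ×ˢ 𝓝 w₀) r f b) ∧
      ∀ᶠ ε in 𝓝[>] (0 : ℝ), EqOn (f ε) (deriv fun w => S.invBarrier i w ε) (Icc (ν i ε) (1 / 2)) := by
  have key : ∀ᶠ ε in 𝓝[>] (0 : ℝ), ∃ g : ℝ → ℝ, ContDiff ℝ r g ∧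
      EqOn g (deriv fun w => S.invBarrier i w ε) (Icc (ν i ε) (1 / 2)) ∧
      ∀ j ≤ r, ∀ v, |iteratedDeriv j g v| ≤ b ε * (1 + |v - ν i ε|) ^ r := by
    filter_upwards [h.abs_iteratedDeriv_invBarrier_le i, h.adm.eventually_param,
      h.eventually_mem_image i, h.adm.eventually_deriv_barrier_neg i,
      (h.tendsto_ν i).eventually_lt_const (u := 1 / 2) (by norm_num)] with ε h1 hε h2 h3 h4
    refine exists_contDiff_extension r h4.le _ (fun v hv => ?_) fun j hj v hv => ?_
    · exact (h.adm.contDiffAt_invBarrier hε (h.adm.injOn_barrierFun hε h3) (h2 hv)).1.deriv_succ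
    · rw [← iteratedDeriv_succ']
      exact h1 _ (by omega) v hv
  obtain ⟨f, hf⟩ := key.choice
  refine ⟨f, fun w₀ => ⟨(1 + (|w₀| + 2).toNNReal) ^ r, ?_⟩, hf.mono fun ε hε => hε.2.1⟩
  filter_upwards [hf.prod_inl (𝓝 w₀), eventually_mem_ball_prod (𝓝[>] (0 : ℝ)) w₀ one_pos,
    ((h.tendsto_ν i).norm.eventually_lt_const (u := 1) (by simp)).prod_inl (𝓝 w₀)] with p p1 p2 p3
  refine ⟨p1.1.contDiffAt, fun j hj => ?_⟩
  rw [norm_iteratedFDeriv_eq_norm_iteratedDeriv, mul_comm]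
  refine (p1.2.2 j hj p.2).trans ?_
  have h5 : |p.2 - ν i p.1| ≤ |w₀| + 2 := by
    rw [mem_ball_iff_norm] at p2
    have e : p.2 - ν i p.1 = (p.2 - w₀) + w₀ - ν i p.1 := by ring
    rw [e]
    have := abs_sub ((p.2 - w₀) + w₀) (ν i p.1)
    have := abs_add_le (p.2 - w₀) w₀
    rw [Real.norm_eq_abs] at p2 p3
    linarith
  have h6 : ((1 + (|w₀| + 2).toNNReal : ℝ≥0) : ℝ) = 1 + (|w₀| + 2) := by
    push_cast
    rw [Real.coe_toNNReal _ (by positivity)]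
  rw [NNReal.coe_pow, h6]
  gcongr

/-- The level of the surface `Γ_i^ε` tends to zero. -/
theorem Approximates.tendsto_level (h : S.Approximates r ν Dε Dint b) (i : Fin n) :
    Tendsto (fun ε => S.σ i * S.invBarrier i (ν i ε) ε) (𝓝[>] 0) (𝓝 0) := by
  refine squeeze_zero_norm' ?_ (NNReal.tendsto_coe.2 h.small)
  filter_upwards [h.abs_iteratedDeriv_invBarrier_le i,
    (h.tendsto_ν i).eventually_lt_const (u := 1 / 2) (by norm_num)] with ε h1 h2
  have := h1 0 (Nat.zero_le _) _ ⟨le_rfl, h2.le⟩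
  rw [norm_mul, Real.norm_eq_abs, h.adm.levels.abs_sign, one_mul]
  simpa using this

end SteepFamily

/-! ### Composition operators along families of curves -/

section CurveFamilies

variable {α E F G : Type} [NormedAddCommGroup E] [NormedSpace ℝ E]
  [NormedAddCommGroup F] [NormedSpace ℝ F] [NormedAddCommGroup G] [NormedSpace ℝ G]
  {l : Filter α} {𝓕 : Filter (α × G)} {k : ℕ} {h : α → E → F} {b : α → ℝ≥0} {C : Set E}
  {Y : α → G → Curve E}

theorem tendsto_nhdsSet_curve (hl : Tendsto Prod.fst 𝓕 l)
    (hC : ∀ᶠ p in 𝓕, ∀ t, Y p.1 p.2 t ∈ C) :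
    Tendsto (fun p : α × G => (p.1, Y p.1 p.2)) 𝓕 (l ×ˢ 𝓝ˢ {Y : Curve E | ∀ t, Y t ∈ C}) :=
  hl.prodMk ((tendsto_principal.2 hC).mono_right principal_le_nhdsSet)

theorem CkBigO.nemytskii_comp (hh : CkBigO (l ×ˢ 𝓝ˢ C) k h b) (hY : CkBigO 𝓕 k Y fun _ => 1)
    (hl : Tendsto Prod.fst 𝓕 l) (hC : ∀ᶠ p in 𝓕, ∀ t, Y p.1 p.2 t ∈ C) :
    CkBigO 𝓕 k (fun a x => _root_.nemytskii (h a) (Y a x)) b :=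
  hh.nemytskii.comp hY (tendsto_nhdsSet_curve hl hC)

/-- The curve of pairs. -/
def curvePair : Curve E × Curve F →L[ℝ] Curve (E × F) :=
  LinearMap.mkContinuous
    { toFun := fun Y => Y.1.prodMk Y.2
      map_add' := fun _ _ => rfl
      map_smul' := fun _ _ => rfl } 1 fun Y => by
    rw [one_mul, ContinuousMap.norm_le _ (norm_nonneg _)]
    intro t
    exact max_le ((Y.1.norm_coe_le_norm t).trans (le_max_left _ _))
      ((Y.2.norm_coe_le_norm t).trans (le_max_right _ _))

@[simp] theorem curvePair_apply (Y : Curve E) (Z : Curve F) (t : unitInterval) :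
    curvePair (Y, Z) t = (Y t, Z t) := rfl

/-- The affine curve from `x` to `y`. -/
def affineCurve : ℝ × ℝ →L[ℝ] Curve ℝ :=
  (constCurve : ℝ →L[ℝ] Curve ℝ).comp (ContinuousLinearMap.fst ℝ ℝ ℝ) +
    ((curvePrim 1).comp (constCurve : ℝ →L[ℝ] Curve ℝ)).comp
      (ContinuousLinearMap.snd ℝ ℝ ℝ - ContinuousLinearMap.fst ℝ ℝ ℝ)

theorem affineCurve_apply (x y : ℝ) (t : unitInterval) :
    affineCurve (x, y) t = x + t * (y - x) := by
  have : curvePrim 1 (constCurve (y - x)) t = t * (y - x) := by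
    rw [curvePrim_apply]
    simp [curveVal]
    ring
  simp [affineCurve, ← this]

theorem affineCurve_mem {x y : ℝ} {s : Set ℝ} (hs : Convex ℝ s) (hx : x ∈ s) (hy : y ∈ s)
    (t : unitInterval) : affineCurve (x, y) t ∈ s := by
  rw [affineCurve_apply]
  have := hs.add_smul_sub_mem hx hy t.2
  simpa using this

theorem CkBigO.constCurve {f : α → G → E} (hf : CkBigO 𝓕 k f b) :
    CkBigO 𝓕 k (fun a x => (_root_.constCurve (f a x) : Curve E)) b :=
  hf.clm _root_.constCurve

theorem CkBigO.curvePair {f : α → G → Curve E} {g : α → G → Curve F} (hf : CkBigO 𝓕 k f b)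
    (hg : CkBigO 𝓕 k g b) : CkBigO 𝓕 k (fun a x => _root_.curvePair (f a x, g a x)) b :=
  (hf.prodMk hg).clm _root_.curvePair

theorem CkBigO.affineCurve {f g : α → G → ℝ} (hf : CkBigO 𝓕 k f b)
    (hg : CkBigO 𝓕 k g b) : CkBigO 𝓕 k (fun a x => _root_.affineCurve (f a x, g a x)) b :=
  (hf.prodMk hg).clm _root_.affineCurve

end CurveFamilies

namespace SteepFamily

variable {d n : ℕ} {S : SteepFamily d n} {r k : ℕ} {i : Fin n} {ε : ℝ}
  {b : ℝ → ℝ≥0} {A : ℝ → Set (Pos d)} {z₀ : Phase d}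

/-! ### Orbits in coordinates of lines -/

/-- The phase point at time `t` on the straight line of `Z`. -/
def linePoint (t : ℝ) (Z : Phase d) : Phase d := (Z.1 + t • Z.2, Z.2)

/-- The vector field by which the smooth flow moves the straight line tangent to an orbit. -/
def lineForce (S : SteepFamily d n) (ε t : ℝ) (Z : Phase d) : Phase d :=
  (t • gradient (fun x => S.V x ε) (Z.1 + t • Z.2), -gradient (fun x => S.V x ε) (Z.1 + t • Z.2))

theorem orbitIn_of_line {B : Set (Pos d)} {X : ℝ → Phase d} {t : ℝ → ℝ} (c : Curve ℝ)
    (hc : ∀ s, 0 < c s) (ht : ∀ s ∈ Icc (0 : ℝ) 1, HasDerivWithinAt t (curveVal c s) (Icc 0 1) s)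
    (hX : ∀ s ∈ Icc (0 : ℝ) 1,
      HasDerivWithinAt X (curveVal c s • S.lineForce ε (t s) (X s)) (Icc 0 1) s)
    (hD : ∀ s ∈ Icc (0 : ℝ) 1, (linePoint (t s) (X s)).1 ∈ S.Dt)
    (hB : ∀ s ∈ Ioo (0 : ℝ) 1, (linePoint (t s) (X s)).1 ∈ B) :
    S.OrbitIn ε B (linePoint (t 0) (X 0)) (linePoint (t 1) (X 1)) := by
  refine orbitIn_of_reparam (Y := fun s => linePoint (t s) (X s)) c hc hD (fun s hs => ?_) hB
  have h1 : HasDerivWithinAt (fun s => (X s).1) _ (Icc 0 1) s := (hX s hs).fst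
  have h2 : HasDerivWithinAt (fun s => (X s).2) _ (Icc 0 1) s := (hX s hs).snd
  have h3 : HasDerivWithinAt (fun s => (X s).1 + t s • (X s).2) _ (Icc 0 1) s :=
    h1.add ((ht s hs).smul h2)
  have h4 := h3.prodMk h2
  refine h4.congr_deriv ?_
  simp only [hamField, linePoint, lineForce, Prod.smul_mk, Prod.mk.injEq, and_true]
  simp only [smul_neg, smul_smul, mul_comm (t s)]
  abel

/-! ### Stages of a flight -/

/-- `G` describes how the smooth flow moves the lines near `z₀` from their point at the time `θ₀` to
their point at the time `θ₁`, with a first-order approximation. -/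
structure FlightStage (S : SteepFamily d n) (k : ℕ) (b : ℝ → ℝ≥0) (A : ℝ → Set (Pos d))
    (z₀ : Phase d) (θ₀ θ₁ : ℝ → Phase d → ℝ) (G : ℝ → Phase d → Phase d) : Prop where
  close : CkBigO (𝓝[>] (0 : ℝ) ×ˢ 𝓝 z₀) (k + 1) (fun ε z => G ε z - z) b
  first : CkBigO (𝓝[>] (0 : ℝ) ×ˢ 𝓝 z₀) (k + 1)
    (fun ε z => ∫ t in θ₀ ε z..θ₁ ε z, S.lineForce ε t z) b
  second : CkBigO (𝓝[>] (0 : ℝ) ×ˢ 𝓝 z₀) k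
    (fun ε z => G ε z - z - ∫ t in θ₀ ε z..θ₁ ε z, S.lineForce ε t z) (fun ε => b ε ^ 2)
  integrable : ∀ᶠ p in 𝓝[>] (0 : ℝ) ×ˢ 𝓝 z₀, IntervalIntegrable (fun t => S.lineForce p.1 t p.2)
    MeasureTheory.volume (θ₀ p.1 p.2) (θ₁ p.1 p.2)
  orbit : ∀ᶠ p in 𝓝[>] (0 : ℝ) ×ˢ 𝓝 z₀, S.OrbitIn p.1 (A p.1) (linePoint (θ₀ p.1 p.2) p.2)
    (linePoint (θ₁ p.1 (G p.1 p.2)) (G p.1 p.2))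

theorem exists_flightStage {g : ℝ → Phase d × Curve (Phase d) → Curve (Phase d)}
    {θ₀ θ₁ : ℝ → Phase d → ℝ} (hb : Tendsto b (𝓝[>] 0) (𝓝 0))
    (hg : CkBigO (𝓝[>] (0 : ℝ) ×ˢ 𝓝 (z₀, constCurve z₀)) (k + 1) g b)
    (horb : ∀ᶠ p : ℝ × (Phase d × Curve (Phase d)) in 𝓝[>] (0 : ℝ) ×ˢ 𝓝 (z₀, constCurve z₀),
      p.2.2 = constCurve p.2.1 + g p.1 p.2 → S.OrbitIn p.1 (A p.1)
        (linePoint (θ₀ p.1 p.2.1) p.2.1) (linePoint (θ₁ p.1 (p.2.2 1)) (p.2.2 1)))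
    (hint : ∀ᶠ p : ℝ × Phase d in 𝓝[>] (0 : ℝ) ×ˢ 𝓝 z₀,
      IntervalIntegrable (fun t => S.lineForce p.1 t p.2) MeasureTheory.volume
        (θ₀ p.1 p.2) (θ₁ p.1 p.2) ∧
      ∫ t in θ₀ p.1 p.2..θ₁ p.1 p.2, S.lineForce p.1 t p.2 = g p.1 (p.2, constCurve p.2) 1) :
    ∃ G : ℝ → Phase d → Phase d, S.FlightStage k b A z₀ θ₀ θ₁ G := by
  obtain ⟨X, h1, h2, h3, h4, h5, h6⟩ := exists_fixedPoint_perturbation (l := 𝓝[>] (0 : ℝ))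
    (constCurve : Phase d →L[ℝ] Curve (Phase d)) (z₀ := z₀) (k := k) (b := b) hg hb
  refine ⟨fun ε z => X ε z 1, ?_, ?_, ?_, hint.mono fun p hp => hp.1, ?_⟩
  · exact h4.clm (evalCurve 1)
  · refine (h5.clm (evalCurve 1)).congr ?_
    filter_upwards [hint] with p hp
    exact hp.2.symm
  · refine (h6.clm (evalCurve 1)).congr ?_
    filter_upwards [hint] with p hp
    rw [hp.2]
    rfl
  · have t1 : Tendsto (fun p : ℝ × Phase d => (p.1, (p.2, X p.1 p.2))) (𝓝[>] (0 : ℝ) ×ˢ 𝓝 z₀)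
        (𝓝[>] (0 : ℝ) ×ˢ 𝓝 (z₀, constCurve z₀)) :=
      tendsto_fst.prodMk (tendsto_snd.prodMk_nhds h2)
    filter_upwards [t1.eventually horb, h1] with p p1 p2
    exact p1 p2

theorem tendsto_of_near_id {G : ℝ → Phase d → Phase d} (hb : Tendsto b (𝓝[>] 0) (𝓝 0))
    (h : CkBigO (𝓝[>] (0 : ℝ) ×ˢ 𝓝 z₀) k (fun ε z => G ε z - z) b) :
    Tendsto (fun p : ℝ × Phase d => G p.1 p.2) (𝓝[>] (0 : ℝ) ×ˢ 𝓝 z₀) (𝓝 z₀) := by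
  have := (h.tendsto_zero tendsto_fst hb).add (tendsto_snd (f := 𝓝[>] (0 : ℝ)) (g := 𝓝 z₀))
  simpa using this

theorem ckBigO_one_of_near_id {G : ℝ → Phase d → Phase d} (hb : Tendsto b (𝓝[>] 0) (𝓝 0))
    (h : CkBigO (𝓝[>] (0 : ℝ) ×ˢ 𝓝 z₀) k (fun ε z => G ε z - z) b) :
    CkBigO (𝓝[>] (0 : ℝ) ×ˢ 𝓝 z₀) k G (fun _ => 1) := by
  have hb1 : ∀ᶠ a in 𝓝[>] (0 : ℝ), b a ≤ 1 * 1 := by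
    filter_upwards [hb.eventually_lt_const (u := 1) (by simp)] with a ha
    simpa using ha.le
  have := (h.scale 1 (hb1.prod_inl (𝓝 z₀))).add (b := fun _ => 1) ckBigO_id
  simpa using this

theorem FlightStage.comp {θ₀ θ₁ θ₂ : ℝ → Phase d → ℝ} {G H : ℝ → Phase d → Phase d}
    (hb : Tendsto b (𝓝[>] 0) (𝓝 0)) (hG : S.FlightStage k b A z₀ θ₀ θ₁ G)
    (hH : S.FlightStage k b A z₀ θ₁ θ₂ H)
    (hA : ∀ᶠ p in 𝓝[>] (0 : ℝ) ×ˢ 𝓝 z₀, (linePoint (θ₁ p.1 p.2) p.2).1 ∈ A p.1) :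
    S.FlightStage k b A z₀ θ₀ θ₂ (fun ε z => H ε (G ε z)) := by
  have tG := tendsto_of_near_id hb hG.close
  have G1 := ckBigO_one_of_near_id hb hG.close
  have tG' : Tendsto (fun p : ℝ × Phase d => (p.1, G p.1 p.2)) (𝓝[>] (0 : ℝ) ×ˢ 𝓝 z₀)
      (𝓝[>] (0 : ℝ) ×ˢ 𝓝 z₀) := tendsto_fst.prodMk tG
  have hsum : ∀ᶠ p in 𝓝[>] (0 : ℝ) ×ˢ 𝓝 z₀,
      (∫ t in θ₀ p.1 p.2..θ₁ p.1 p.2, S.lineForce p.1 t p.2) +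
        (∫ t in θ₁ p.1 p.2..θ₂ p.1 p.2, S.lineForce p.1 t p.2) =
        ∫ t in θ₀ p.1 p.2..θ₂ p.1 p.2, S.lineForce p.1 t p.2 := by
    filter_upwards [hG.integrable, hH.integrable] with p h1 h2
    exact intervalIntegral.integral_add_adjacent_intervals h1 h2
  refine ⟨?_, (hG.first.add hH.first).congr hsum, ?_, ?_, ?_⟩
  · refine ((hH.close.comp_nhds G1 tendsto_fst tG).add hG.close).congr
      (Eventually.of_forall fun p => ?_)
    simp
  · have e1 := hH.second.comp_nhds (G1.of_le (Nat.le_succ k)) tendsto_fst tG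
    have e2 := hH.first.ckLip.comp_sub (G1.of_le (Nat.le_succ k)) ckBigO_id
      (hG.close.of_le (Nat.le_succ k)) tendsto_fst tG tendsto_snd
    have e2' : CkBigO (𝓝[>] (0 : ℝ) ×ˢ 𝓝 z₀) k _ (fun ε => b ε ^ 2) :=
      e2.scale 1 (Eventually.of_forall fun p => by simp [sq])
    refine ((e1.add e2').add hG.second).congr ?_
    filter_upwards [hsum] with p hp
    rw [← hp]
    abel
  · filter_upwards [hG.integrable, hH.integrable] with p h1 h2 using h1.trans h2
  · filter_upwards [hG.orbit, tG'.eventually hH.orbit, tG'.eventually hA] with p h1 h2 h3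
    exact h1.trans h3 h2

end SteepFamily

namespace SteepFamily

variable {d n : ℕ} {S : SteepFamily d n} {r k : ℕ} {i : Fin n} {ε : ℝ} {x : Pos d}
  {ν : Fin n → ℝ → ℝ} {Dε Dint : ℝ → Set (Pos d)} {b : ℝ → ℝ≥0} {z₀ : Phase d} {T₀ : ℝ}

/-! ### The potential near the boundary -/

theorem IsAdmissible.contDiffAt_depth (hS : S.IsAdmissible r) (hε : ε ∈ Ioo 0 S.ε₀) {q : Pos d}
    (hq : q ∈ S.Dt) : ContDiffAt ℝ (r + 1) (S.depth i ε) q := by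
  have h1 : ContDiffAt ℝ (r + 1) (fun q => S.Q q ε) q :=
    (hS.pattern.contDiffOn ε ⟨hε.1.le, hε.2⟩).contDiffAt (hS.potential.isOpen_dom.mem_nhds hq)
  exact contDiffAt_const.mul (h1.sub contDiffAt_const)

theorem IsAdmissible.potential_eq (hS : S.IsAdmissible r) (hε : ε ∈ Ioo 0 S.ε₀) {q : Pos d}
    (hq : q ∈ S.N i) : S.V q ε = S.barrier i ε (S.depth i ε q) := by
  rw [hS.barrier.eq i ε hε q hq, hS.levels.sub_eq, SteepFamily.barrier]

/-- The derivative of the barrier as a function of the depth. -/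
def barrierDeriv (S : SteepFamily d n) (i : Fin n) (ε u : ℝ) : ℝ :=
  S.σ i * deriv (fun s => S.W i s ε) (S.σ i * u)

theorem IsAdmissible.continuousOn_barrierDeriv (hS : S.IsAdmissible r) (hε : ε ∈ Ioo 0 S.ε₀) :
    ContinuousOn (S.barrierDeriv i ε) (Ioo (-S.a) S.a) := by
  intro u hu
  have h1 : ContDiffAt ℝ r (deriv fun s => S.W i s ε) (S.σ i * u) :=
    (hS.contDiffAt_barrierFun hε (hS.levels.sign_mul_mem i hu)).deriv_succ
  have h2 : ContinuousAt (fun u => S.σ i * u) u := by fun_prop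
  exact (continuousAt_const.mul
    (ContinuousAt.comp (f := fun u => S.σ i * u) h1.continuousAt h2)).continuousWithinAt

theorem IsAdmissible.gradient_potential (hS : S.IsAdmissible r) (hε : ε ∈ Ioo 0 S.ε₀) {q : Pos d}
    (hq : q ∈ S.N i) (hu : S.depth i ε q ∈ Ioo (-S.a) S.a) :
    gradient (fun y => S.V y ε) q = S.barrierDeriv i ε (S.depth i ε q) •
      gradient (S.depth i ε) q := by
  have h1 := ((hS.contDiffAt_depth (i := i) hε ((hS.barrier.subset i).2 hq)).differentiableAt
    (by simp)).hasFDerivAt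
  have h2 := (hS.hasDerivAt_barrier (i := i) hε hu).comp_hasFDerivAt q h1
  have h3 : HasFDerivAt (fun y => S.V y ε) _ q := h2.congr_of_eventuallyEq (by
    filter_upwards [(hS.barrier.isOpen i).mem_nhds hq] with y hy using hS.potential_eq hε hy)
  rw [← riesz_fderiv, h3.fderiv, ← riesz_fderiv, map_smul]
  rfl

theorem inner_gradient {f : Pos d → ℝ} (q v : Pos d) :
    inner ℝ (gradient f q) v = fderiv ℝ f q v := by
  rw [gradient, InnerProductSpace.toDual_symm_apply]

theorem fderiv_eq_innerSL (f : Pos d → ℝ) (q : Pos d) :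
    fderiv ℝ f q = innerSL ℝ (gradient f q) := by
  ext v
  rw [innerSL_apply_apply, inner_gradient]

/-- The depth of the surface `Γ_i^ε`. -/
def levelDepth (S : SteepFamily d n) (ν : Fin n → ℝ → ℝ) (i : Fin n) (ε : ℝ) : ℝ :=
  S.σ i * S.invBarrier i (ν i ε) ε

/-- The gradient of the depth in the limit. -/
def limitGradient (S : SteepFamily d n) (i : Fin n) (x : Pos d) : Pos d :=
  S.σ i • gradient (fun y => S.Q y 0) x

theorem IsAdmissible.tendsto_fderiv_depth (hS : S.IsAdmissible r)
    (hx : x ∈ S.Γ i \ S.cornerSet r) :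
    Tendsto (fun p : ℝ × Pos d => fderiv ℝ (S.depth i p.1) p.2) (𝓝[>] 0 ×ˢ 𝓝 x)
      (𝓝 (innerSL ℝ (S.limitGradient i x))) := by
  have := ((innerSL ℝ (E := Pos d)).continuous.tendsto _).comp (hS.tendsto_gradient_depth hx)
  refine this.congr fun p => ?_
  rw [fderiv_eq_innerSL]
  rfl

/-! ### Hitting times of the level surfaces near the boundary -/

/-- `τ` is the time at which the line `Z` near `z₀` meets the level surface `u` of the depth. -/
structure IsLevelTime (S : SteepFamily d n) (i : Fin n) (k : ℕ) (z₀ : Phase d) (T₀ : ℝ)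
    (τ : ℝ → ℝ × Phase d → ℝ) : Prop where
  level : ∀ᶠ p in 𝓝[>] (0 : ℝ) ×ˢ 𝓝 ((0 : ℝ), z₀),
    S.depth i p.1 (linePoint (τ p.1 p.2) p.2.2).1 = p.2.1
  tendsto : Tendsto (fun p : ℝ × (ℝ × Phase d) => τ p.1 p.2) (𝓝[>] (0 : ℝ) ×ˢ 𝓝 ((0 : ℝ), z₀))
    (𝓝 T₀)
  ckBigO : CkBigO (𝓝[>] (0 : ℝ) ×ˢ 𝓝 ((0 : ℝ), z₀)) (k + 1) τ (fun _ => 1)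
  unique : ∀ᶠ p : ℝ × ((ℝ × Phase d) × ℝ) in 𝓝[>] (0 : ℝ) ×ˢ 𝓝 (((0 : ℝ), z₀), T₀),
    S.depth i p.1 (linePoint p.2.2 p.2.1.2).1 = p.2.1.1 → p.2.2 = τ p.1 p.2.1

theorem IsAdmissible.exists_isLevelTime (hS : S.IsAdmissible r) (hx : x ∈ S.Γ i \ S.cornerSet r)
    (hz : (linePoint T₀ z₀).1 = x) (hL : inner ℝ (S.limitGradient i x) z₀.2 ≠ 0) :
    ∃ τ, S.IsLevelTime i r z₀ T₀ τ := by
  obtain ⟨τ, h1, h2, h3, h4⟩ := exists_levelTime (hS.ckLip_depth hx).1 (hS.tendsto_depth hx)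
    (hS.tendsto_fderiv_depth hx) hz hL
  exact ⟨τ, h1, h2, h3, h4⟩

/-- The point at which the line meets the level surface. -/
def levelPoint (τ : ℝ → ℝ × Phase d → ℝ) (ε : ℝ) (y : ℝ × Phase d) : Pos d :=
  (linePoint (τ ε y) y.2).1

theorem IsLevelTime.ckBigO_levelPoint {τ : ℝ → ℝ × Phase d → ℝ} (hτ : S.IsLevelTime i k z₀ T₀ τ) :
    CkBigO (𝓝[>] (0 : ℝ) ×ˢ 𝓝 ((0 : ℝ), z₀)) (k + 1) (levelPoint τ) (fun _ => 1) := by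
  have h1 := (ckBigO_id (l := 𝓝[>] (0 : ℝ)) (k := k + 1) (z := ((0 : ℝ), z₀))).snd
  exact h1.fst.add (hτ.ckBigO.smul h1.snd).mul_one_right

theorem IsLevelTime.tendsto_levelPoint {τ : ℝ → ℝ × Phase d → ℝ}
    (hτ : S.IsLevelTime i k z₀ T₀ τ) :
    Tendsto (fun p : ℝ × (ℝ × Phase d) => levelPoint τ p.1 p.2)
      (𝓝[>] (0 : ℝ) ×ˢ 𝓝 ((0 : ℝ), z₀)) (𝓝 (linePoint T₀ z₀).1) := by
  have t1 : Tendsto (fun p : ℝ × (ℝ × Phase d) => p.2.2) (𝓝[>] (0 : ℝ) ×ˢ 𝓝 ((0 : ℝ), z₀))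
      (𝓝 z₀) := (continuous_snd.tendsto ((0 : ℝ), z₀)).comp tendsto_snd
  exact (t1.fst_nhds).add (hτ.tendsto.smul t1.snd_nhds)

/-- The gradient of the depth at the point of intersection, relative to its speed. -/
def levelForce (S : SteepFamily d n) (i : Fin n) (τ : ℝ → ℝ × Phase d → ℝ) (ε : ℝ)
    (y : ℝ × Phase d) : Phase d :=
  (inner ℝ (gradient (S.depth i ε) (levelPoint τ ε y)) y.2.2)⁻¹ •
    (τ ε y • gradient (S.depth i ε) (levelPoint τ ε y), -gradient (S.depth i ε) (levelPoint τ ε y))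

theorem IsAdmissible.ckBigO_levelForce (hS : S.IsAdmissible r) (hx : x ∈ S.Γ i \ S.cornerSet r)
    (hz : (linePoint T₀ z₀).1 = x) (hL : inner ℝ (S.limitGradient i x) z₀.2 ≠ 0)
    {τ : ℝ → ℝ × Phase d → ℝ} (hτ : S.IsLevelTime i r z₀ T₀ τ) :
    CkBigO (𝓝[>] (0 : ℝ) ×ˢ 𝓝 ((0 : ℝ), z₀)) r (S.levelForce i τ) (fun _ => 1) ∧
    Tendsto (fun p : ℝ × (ℝ × Phase d) =>
      inner ℝ (gradient (S.depth i p.1) (levelPoint τ p.1 p.2)) p.2.2.2)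
      (𝓝[>] (0 : ℝ) ×ˢ 𝓝 ((0 : ℝ), z₀)) (𝓝 (inner ℝ (S.limitGradient i x) z₀.2)) := by
  have h1 : CkBigO (𝓝[>] (0 : ℝ) ×ˢ 𝓝 ((0 : ℝ), z₀)) r (fun _ (y : ℝ × Phase d) => y.2.2)
      (fun _ => 1) := (ckBigO_id.snd).snd
  have tq := hτ.tendsto_levelPoint
  rw [hz] at tq
  have hg : CkBigO (𝓝[>] (0 : ℝ) ×ˢ 𝓝 ((0 : ℝ), z₀)) r
      (fun ε y => gradient (S.depth i ε) (levelPoint τ ε y)) (fun _ => 1) := (ckBigO_gradient (hS.ckLip_depth hx).1).comp_nhds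
    (hτ.ckBigO_levelPoint.of_le (Nat.le_succ r)) tendsto_fst tq
  have tg : Tendsto (fun p : ℝ × (ℝ × Phase d) => gradient (S.depth i p.1) (levelPoint τ p.1 p.2))
      (𝓝[>] (0 : ℝ) ×ˢ 𝓝 ((0 : ℝ), z₀)) (𝓝 (S.limitGradient i x)) :=
    Tendsto.comp (g := fun p : ℝ × Pos d => gradient (S.depth i p.1) p.2)
      (f := fun p : ℝ × (ℝ × Phase d) => (p.1, levelPoint τ p.1 p.2))
      (hS.tendsto_gradient_depth hx) (tendsto_fst.prodMk tq)
  have t1 : Tendsto (fun p : ℝ × (ℝ × Phase d) => p.2.2.2) (𝓝[>] (0 : ℝ) ×ˢ 𝓝 ((0 : ℝ), z₀))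
      (𝓝 z₀.2) := (continuous_snd.snd.tendsto ((0 : ℝ), z₀)).comp tendsto_snd
  have ti : Tendsto (fun p : ℝ × (ℝ × Phase d) =>
      inner ℝ (gradient (S.depth i p.1) (levelPoint τ p.1 p.2)) p.2.2.2)
      (𝓝[>] (0 : ℝ) ×ˢ 𝓝 ((0 : ℝ), z₀)) (𝓝 (inner ℝ (S.limitGradient i x) z₀.2)) := tg.inner (𝕜 := ℝ) t1
  refine ⟨?_, ti⟩
  have hi : CkBigO (𝓝[>] (0 : ℝ) ×ˢ 𝓝 ((0 : ℝ), z₀)) r (fun ε (y : ℝ × Phase d) =>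
      inner ℝ (gradient (S.depth i ε) (levelPoint τ ε y)) y.2.2) (fun _ => 1) :=
    (hg.bilin (innerSL ℝ) h1).mul_one_right
  have hinv : CkBigO (𝓝[>] (0 : ℝ) ×ˢ 𝓝 ((0 : ℝ), z₀)) r (fun ε (y : ℝ × Phase d) =>
      (inner ℝ (gradient (S.depth i ε) (levelPoint τ ε y)) y.2.2)⁻¹) (fun _ => 1) :=
    CkBigO.comp_fixed (contDiffAt_inv ℝ hL) hi ti
  have hp1 : CkBigO (𝓝[>] (0 : ℝ) ×ˢ 𝓝 ((0 : ℝ), z₀)) r (fun ε (y : ℝ × Phase d) =>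
      τ ε y • gradient (S.depth i ε) (levelPoint τ ε y)) (fun _ => 1) :=
    ((hτ.ckBigO.of_le (Nat.le_succ r)).smul hg).mul_one_right
  have hp : CkBigO (𝓝[>] (0 : ℝ) ×ˢ 𝓝 ((0 : ℝ), z₀)) r (fun ε (y : ℝ × Phase d) =>
      (τ ε y • gradient (S.depth i ε) (levelPoint τ ε y),
        -gradient (S.depth i ε) (levelPoint τ ε y))) (fun _ => 1) := hp1.prodMk hg.neg
  exact (hinv.smul hp).mul_one_right

/-! ### The passage through a boundary layer -/

/-- What is needed of a line and a level in a boundary layer for a fixed value of `ε`. -/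
structure IsLayerPoint (S : SteepFamily d n) (i : Fin n) (τ : ℝ → ℝ × Phase d → ℝ) (c₀ : ℝ) (ε : ℝ)
    (y : ℝ × Phase d) : Prop where
  level : S.depth i ε (levelPoint τ ε y) = y.1
  diff : DifferentiableAt ℝ (τ ε) y
  mem : levelPoint τ ε y ∈ S.N i
  height : y.1 ∈ Ioo (-S.a) S.a
  angle : 0 < inner ℝ (gradient (S.depth i ε) (levelPoint τ ε y)) y.2.2 * c₀
  force : ContinuousAt (S.levelForce i τ ε) y

variable {τ : ℝ → ℝ × Phase d → ℝ} {c₀ : ℝ}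

theorem IsLayerPoint.continuousAt_angle (hS : S.IsAdmissible r) (hε : ε ∈ Ioo 0 S.ε₀)
    {y : ℝ × Phase d} (hy : S.IsLayerPoint i τ c₀ ε y) : ContinuousAt (fun y : ℝ × Phase d =>
      inner ℝ (gradient (S.depth i ε) (levelPoint τ ε y)) y.2.2) y := by
  have h1 : ContinuousAt (gradient (S.depth i ε)) (levelPoint τ ε y) :=
    (contDiffAt_gradient (hS.contDiffAt_depth hε ((hS.barrier.subset i).2 hy.mem))).continuousAt
  have h2 : ContinuousAt (levelPoint τ ε) y := by
    have := hy.diff.continuousAt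
    unfold levelPoint linePoint
    fun_prop
  exact (ContinuousAt.comp (f := levelPoint τ ε) h1 h2).inner (𝕜 := ℝ)
    (g := fun y : ℝ × Phase d => y.2.2) (by fun_prop)

theorem IsLayerPoint.force_eq (hS : S.IsAdmissible r) (hε : ε ∈ Ioo 0 S.ε₀)
    {y : ℝ × Phase d} (hy : S.IsLayerPoint i τ c₀ ε y) (v : ℝ) :
    (S.barrierDeriv i ε y.1 * v) • S.levelForce i τ ε y =
      (v / inner ℝ (gradient (S.depth i ε) (levelPoint τ ε y)) y.2.2) •
        S.lineForce ε (τ ε y) y.2 := by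
  have h1 := hS.gradient_potential hε hy.mem (by rw [hy.level]; exact hy.height)
  rw [hy.level] at h1
  have h2 : S.lineForce ε (τ ε y) y.2 = S.barrierDeriv i ε y.1 •
      (τ ε y • gradient (S.depth i ε) (levelPoint τ ε y),
        -gradient (S.depth i ε) (levelPoint τ ε y)) := by
    rw [lineForce]
    change (τ ε y • gradient (fun y => S.V y ε) (levelPoint τ ε y),
      -gradient (fun y => S.V y ε) (levelPoint τ ε y)) = _
    rw [h1, Prod.smul_mk, smul_neg, smul_comm]
  rw [h2, levelForce, smul_smul, smul_smul]
  congr 1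
  rw [div_eq_mul_inv]
  ring

/-- The speed at which the level changes along a line that is moved by a force. -/
theorem IsLayerPoint.hasDerivWithinAt_time (hS : S.IsAdmissible r) (hε : ε ∈ Ioo 0 S.ε₀)
    {u : ℝ → ℝ} {X : ℝ → Phase d} {s v w : ℝ} {I : Set ℝ} (hI : UniqueDiffWithinAt ℝ I s)
    (hsI : s ∈ I) (hy : ∀ᶠ s in 𝓝[I] s, S.IsLayerPoint i τ c₀ ε (u s, X s))
    (hu : HasDerivWithinAt u v I s)
    (hX : HasDerivWithinAt X (w • S.levelForce i τ ε (u s, X s)) I s) :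
    HasDerivWithinAt (fun s => τ ε (u s, X s))
      (v / inner ℝ (gradient (S.depth i ε) (levelPoint τ ε (u s, X s))) (X s).2) I s := by
  have hy0 := hy.self_of_nhdsWithin hsI
  have h1 := hy0.diff.hasFDerivAt.comp_hasDerivWithinAt s (hu.prodMk hX)
  set t' := fderiv ℝ (τ ε) (u s, X s) (v, w • S.levelForce i τ ε (u s, X s)) with ht'
  have h1' : HasDerivWithinAt (fun s => τ ε (u s, X s)) t' I s := h1
  have hX1 : HasDerivWithinAt (fun s => (X s).1) _ I s := hX.fst
  have hX2 : HasDerivWithinAt (fun s => (X s).2) _ I s := hX.snd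
  have hq : HasDerivWithinAt (fun s => levelPoint τ ε (u s, X s)) (t' • (X s).2) I s := by
    have h2 : HasDerivWithinAt (fun s => (X s).1 + τ ε (u s, X s) • (X s).2) _ I s :=
      hX1.add (h1'.smul hX2)
    refine h2.congr_deriv ?_
    simp only [levelForce, Prod.smul_fst, Prod.smul_snd, smul_neg, smul_smul]
    rw [show τ ε (u s, X s) * (w * (inner ℝ (gradient (S.depth i ε)
      (levelPoint τ ε (u s, X s))) (X s).2)⁻¹) = w * (inner ℝ (gradient (S.depth i ε)
      (levelPoint τ ε (u s, X s))) (X s).2)⁻¹ * τ ε (u s, X s) by ring]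
    abel
  have hD := ((hS.contDiffAt_depth (i := i) hε ((hS.barrier.subset i).2 hy0.mem)).differentiableAt
    (by simp)).hasFDerivAt.comp_hasDerivWithinAt s hq
  have hD' : HasDerivWithinAt u (fderiv ℝ (S.depth i ε) (levelPoint τ ε (u s, X s))
      (t' • (X s).2)) I s := by
    refine hD.congr_of_eventuallyEq ?_ hy0.level.symm
    filter_upwards [hy] with s hs using hs.level.symm
  have e := hI.eq_deriv _ hu hD'
  rw [map_smul, ← inner_gradient, smul_eq_mul] at e
  have hne : inner ℝ (gradient (S.depth i ε) (levelPoint τ ε (u s, X s))) (X s).2 ≠ 0 :=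
    fun h => by
      have := hy0.angle
      simp [h] at this
  rwa [e, mul_div_cancel_right₀ _ hne]

end SteepFamily

namespace SteepFamily

variable {d n : ℕ} {S : SteepFamily d n} {r k : ℕ} {i : Fin n} {ε : ℝ} {x : Pos d}
  {ν : Fin n → ℝ → ℝ} {Dε Dint : ℝ → Set (Pos d)} {b : ℝ → ℝ≥0} {z₀ : Phase d} {T₀ : ℝ}
  {τ : ℝ → ℝ × Phase d → ℝ} {c₀ : ℝ}

/-! ### Integrals over a boundary layer -/

/-- The level that moves uniformly from `u₀` to `u₁`. -/
theorem affine_mem_Icc {u₀ u₁ s ρ : ℝ} (h0 : u₀ ∈ Ioo (-ρ) ρ) (h1 : u₁ ∈ Ioo (-ρ) ρ)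
    (hs : s ∈ Icc (0 : ℝ) 1) : u₀ + s * (u₁ - u₀) ∈ Ioo (-ρ) ρ := by
  have := (convex_Ioo (-ρ) ρ).add_smul_sub_mem h0 h1 hs
  simpa using this

theorem hasDerivAt_affine (u₀ u₁ s : ℝ) :
    HasDerivAt (fun s : ℝ => u₀ + s * (u₁ - u₀)) (u₁ - u₀) s := by
  simpa using ((hasDerivAt_id s).mul_const (u₁ - u₀)).const_add u₀

/-- The line integral of the force over a boundary layer. -/
theorem integral_lineForce_layer (hS : S.IsAdmissible r) (hε : ε ∈ Ioo 0 S.ε₀) {U : Set (ℝ × Phase d)}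
    (hU : IsOpen U) (hy : ∀ y ∈ U, S.IsLayerPoint i τ c₀ ε y) {Z : Phase d} {u₀ u₁ : ℝ}
    (hmem : ∀ s ∈ Icc (0 : ℝ) 1, (u₀ + s * (u₁ - u₀), Z) ∈ U) :
    IntervalIntegrable (fun t => S.lineForce ε t Z) MeasureTheory.volume (τ ε (u₀, Z)) (τ ε (u₁, Z)) ∧
    ∫ t in τ ε (u₀, Z)..τ ε (u₁, Z), S.lineForce ε t Z =
      ∫ s in (0 : ℝ)..1, (S.barrierDeriv i ε (u₀ + s * (u₁ - u₀)) * (u₁ - u₀)) •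
        S.levelForce i τ ε (u₀ + s * (u₁ - u₀), Z) := by
  set f : ℝ → ℝ := fun s => τ ε (u₀ + s * (u₁ - u₀), Z) with hf
  set f' : ℝ → ℝ := fun s => (u₁ - u₀) / inner ℝ (gradient (S.depth i ε)
    (levelPoint τ ε (u₀ + s * (u₁ - u₀), Z))) Z.2 with hf'
  have hc : Continuous fun s : ℝ => (u₀ + s * (u₁ - u₀), Z) := by fun_prop
  have hd : ∀ s ∈ uIcc (0 : ℝ) 1, HasDerivAt f (f' s) s := by
    intro s hs
    rw [uIcc_of_le zero_le_one] at hs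
    have h1 : ∀ᶠ s in 𝓝[univ] s, S.IsLayerPoint i τ c₀ ε (u₀ + s * (u₁ - u₀), Z) := by
      rw [nhdsWithin_univ]
      filter_upwards [hc.continuousAt.eventually (hU.mem_nhds (hmem s hs))] with s hs using hy _ hs
    have := IsLayerPoint.hasDerivWithinAt_time hS hε (X := fun _ => Z) (w := 0) uniqueDiffWithinAt_univ
      (mem_univ s) h1 (hasDerivAt_affine u₀ u₁ s).hasDerivWithinAt (by
        rw [zero_smul]; exact hasDerivWithinAt_const _ _ _)
    exact hasDerivWithinAt_univ.1 this
  have hcf : ContinuousOn f (uIcc 0 1) := fun s hs => (hd s hs).continuousAt.continuousWithinAt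
  have hcf' : ContinuousOn f' (uIcc 0 1) := by
    intro s hs
    rw [uIcc_of_le zero_le_one] at hs
    have h1 := hy _ (hmem s hs)
    have h2 : ContinuousAt (fun s : ℝ => inner ℝ (gradient (S.depth i ε)
        (levelPoint τ ε (u₀ + s * (u₁ - u₀), Z))) Z.2) s :=
      ContinuousAt.comp (g := fun y : ℝ × Phase d =>
        inner ℝ (gradient (S.depth i ε) (levelPoint τ ε y)) y.2.2)
        (f := fun s : ℝ => (u₀ + s * (u₁ - u₀), Z)) (h1.continuousAt_angle hS hε) hc.continuousAt
    refine (continuousAt_const.div h2 fun h => ?_).continuousWithinAt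
    have := h1.angle
    simp [h] at this
  have hforce : ∀ s ∈ Icc (0 : ℝ) 1, ContinuousAt (fun t => S.lineForce ε t Z) (f s) := by
    intro s hs
    have h1 := (hy _ (hmem s hs)).mem
    have h2 : ContDiffAt ℝ (r + 1) (fun q => S.V q ε) (Z.1 + f s • Z.2) :=
      (hS.potential.contDiffOn ε hε).contDiffAt
        (hS.potential.isOpen_dom.mem_nhds ((hS.barrier.subset i).2 h1))
    have h3 : ContinuousAt (fun t : ℝ => gradient (fun y => S.V y ε) (Z.1 + t • Z.2)) (f s) :=
      ContinuousAt.comp (g := gradient fun y => S.V y ε) (f := fun t : ℝ => Z.1 + t • Z.2)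
        (contDiffAt_gradient h2).continuousAt (by fun_prop)
    exact (continuousAt_id.smul h3).prodMk h3.neg
  have himg : ContinuousOn (fun t => S.lineForce ε t Z) (f '' uIcc 0 1) := by
    rintro _ ⟨s, hs, rfl⟩
    rw [uIcc_of_le zero_le_one] at hs
    exact (hforce s hs).continuousWithinAt
  have e0 : f 0 = τ ε (u₀, Z) := by simp [hf]
  have e1 : f 1 = τ ε (u₁, Z) := by simp [hf]
  rw [← e0, ← e1]
  refine ⟨(himg.mono (intermediate_value_uIcc hcf)).intervalIntegrable, ?_⟩
  rw [← intervalIntegral.integral_deriv_smul_comp' hd hcf' himg]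
  refine intervalIntegral.integral_congr fun s hs => ?_
  rw [uIcc_of_le zero_le_one] at hs
  exact ((hy _ (hmem s hs)).force_eq hS hε _).symm

open Classical in
/-- The weight with which the force acts in a boundary layer. -/
def layerWeight (S : SteepFamily d n) (i : Fin n) (ε u₀ u₁ : ℝ) : Curve ℝ :=
  if h : Continuous fun s : unitInterval =>
    S.barrierDeriv i ε (affineCurve (u₀, u₁) s) * (u₁ - u₀) then ⟨_, h⟩ else 0

theorem layerWeight_val (hS : S.IsAdmissible r) (hε : ε ∈ Ioo 0 S.ε₀) {u₀ u₁ : ℝ}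
    (h0 : u₀ ∈ Ioo (-S.a) S.a) (h1 : u₁ ∈ Ioo (-S.a) S.a) {s : ℝ} (hs : s ∈ Icc (0 : ℝ) 1) :
    curveVal (S.layerWeight i ε u₀ u₁) s =
      S.barrierDeriv i ε (u₀ + s * (u₁ - u₀)) * (u₁ - u₀) := by
  have h : Continuous fun s : unitInterval =>
      S.barrierDeriv i ε (affineCurve (u₀, u₁) s) * (u₁ - u₀) := by
    refine Continuous.mul ?_ continuous_const
    exact (hS.continuousOn_barrierDeriv hε).comp_continuous (affineCurve (u₀, u₁)).continuous
      fun t => affineCurve_mem (convex_Ioo _ _) h0 h1 t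
  rw [curveVal_of_mem _ hs, layerWeight, dif_pos h]
  simp [affineCurve_apply]

theorem integral_layerWeight_le (hS : S.IsAdmissible r) (hε : ε ∈ Ioo 0 S.ε₀)
    (hneg : ∀ u ∈ Ioo (-S.a) S.a, S.barrierDeriv i ε u < 0) {u₀ u₁ m : ℝ}
    (h0 : u₀ ∈ Ioo (-S.a) S.a) (h1 : u₁ ∈ Ioo (-S.a) S.a) (hm0 : S.barrier i ε u₀ ≤ m)
    (hm1 : S.barrier i ε u₁ ≤ m) :
    ∫ s in (0 : ℝ)..1, |curveVal (S.layerWeight i ε u₀ u₁) s| ≤ m := by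
  have hftc : ∫ s in (0 : ℝ)..1, curveVal (S.layerWeight i ε u₀ u₁) s =
      S.barrier i ε u₁ - S.barrier i ε u₀ := by
    have hd : ∀ s ∈ uIcc (0 : ℝ) 1, HasDerivAt (fun s => S.barrier i ε (u₀ + s * (u₁ - u₀)))
        (curveVal (S.layerWeight i ε u₀ u₁) s) s := by
      intro s hs
      rw [uIcc_of_le zero_le_one] at hs
      rw [layerWeight_val hS hε h0 h1 hs]
      exact HasDerivAt.comp (h₂ := S.barrier i ε) s
        (hS.hasDerivAt_barrier hε (affine_mem_Icc h0 h1 hs)) (hasDerivAt_affine u₀ u₁ s)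
    rw [intervalIntegral.integral_eq_sub_of_hasDerivAt hd
      ((continuous_curveVal _).intervalIntegrable _ _)]
    simp
  have hb0 := hS.barrier_nonneg (i := i) hε h0
  have hb1 := hS.barrier_nonneg (i := i) hε h1
  rcases le_total u₀ u₁ with h | h
  · have : ∫ s in (0 : ℝ)..1, |curveVal (S.layerWeight i ε u₀ u₁) s| =
        -∫ s in (0 : ℝ)..1, curveVal (S.layerWeight i ε u₀ u₁) s := by
      rw [← intervalIntegral.integral_neg]
      refine intervalIntegral.integral_congr fun s hs => ?_
      rw [uIcc_of_le zero_le_one] at hs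
      have := hneg _ (affine_mem_Icc h0 h1 hs)
      simp only [layerWeight_val hS hε h0 h1 hs]
      exact abs_of_nonpos (mul_nonpos_of_nonpos_of_nonneg this.le (by linarith))
    rw [this, hftc]
    linarith
  · have : ∫ s in (0 : ℝ)..1, |curveVal (S.layerWeight i ε u₀ u₁) s| =
        ∫ s in (0 : ℝ)..1, curveVal (S.layerWeight i ε u₀ u₁) s := by
      refine intervalIntegral.integral_congr fun s hs => ?_
      rw [uIcc_of_le zero_le_one] at hs
      have := hneg _ (affine_mem_Icc h0 h1 hs)
      simp only [layerWeight_val hS hε h0 h1 hs]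
      exact abs_of_nonneg (mul_nonneg_of_nonpos_of_nonpos this.le (by linarith))
    rw [this, hftc]
    linarith

/-! ### Orbits in a boundary layer -/

theorem orbitIn_layer (hS : S.IsAdmissible r) (hε : ε ∈ Ioo 0 S.ε₀) {U : Set (ℝ × Phase d)}
    (hy : ∀ y ∈ U, S.IsLayerPoint i τ c₀ ε y) {B : Set (Pos d)} {u₀ u₁ : ℝ}
    (h0 : u₀ ∈ Ioo (-S.a) S.a) (h1 : u₁ ∈ Ioo (-S.a) S.a) (hc₀ : 0 < (u₁ - u₀) * c₀)
    {z : Phase d} {X : Curve (Phase d)}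
    (hmem : ∀ t, (curvePair (affineCurve (u₀, u₁), X)) t ∈ U)
    (hX : X = constCurve z + curvePrim (S.layerWeight i ε u₀ u₁)
      (nemytskii (S.levelForce i τ ε) (curvePair (affineCurve (u₀, u₁), X))))
    (hB : ∀ s ∈ Ioo (0 : ℝ) 1, levelPoint τ ε (u₀ + s * (u₁ - u₀), curveVal X s) ∈ B) :
    S.OrbitIn ε B (linePoint (τ ε (u₀, z)) z) (linePoint (τ ε (u₁, X 1)) (X 1)) := by
  have hm : ∀ s ∈ Icc (0 : ℝ) 1, (u₀ + s * (u₁ - u₀), curveVal X s) ∈ U := by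
    intro s hs
    have := hmem ⟨s, hs⟩
    rwa [curvePair_apply, affineCurve_apply, ← curveVal_of_mem X hs] at this
  have hcX := continuous_curveVal X
  have hY : ∀ t : unitInterval, S.IsLayerPoint i τ c₀ ε (u₀ + t * (u₁ - u₀), X t) := by
    intro t
    have := hy _ (hmem t)
    rwa [curvePair_apply, affineCurve_apply] at this
  have hcc : Continuous fun t : unitInterval => (u₁ - u₀) / inner ℝ (gradient (S.depth i ε)
      (levelPoint τ ε (u₀ + t * (u₁ - u₀), X t))) (X t).2 := by
    rw [continuous_iff_continuousAt]
    intro t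
    have hct : ContinuousAt (fun t : unitInterval => ((u₀ + t * (u₁ - u₀), X t) : ℝ × Phase d)) t :=
      by fun_prop
    have h2 := ContinuousAt.comp (g := fun y : ℝ × Phase d =>
        inner ℝ (gradient (S.depth i ε) (levelPoint τ ε y)) y.2.2)
        (f := fun t : unitInterval => ((u₀ + t * (u₁ - u₀), X t) : ℝ × Phase d))
        ((hY t).continuousAt_angle hS hε) hct
    refine continuousAt_const.div h2 fun h => ?_
    have := (hY t).angle
    simp [h] at this
  set c : Curve ℝ := ⟨_, hcc⟩ with hc
  have hcv : ∀ s ∈ Icc (0 : ℝ) 1, curveVal c s = (u₁ - u₀) / inner ℝ (gradient (S.depth i ε)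
      (levelPoint τ ε (u₀ + s * (u₁ - u₀), curveVal X s))) (curveVal X s).2 := by
    intro s hs
    rw [curveVal_of_mem _ hs, curveVal_of_mem _ hs]
    rfl
  have hdX : ∀ s ∈ Icc (0 : ℝ) 1, HasDerivWithinAt (curveVal X)
      (curveVal (S.layerWeight i ε u₀ u₁) s •
        S.levelForce i τ ε (u₀ + s * (u₁ - u₀), curveVal X s)) (Icc 0 1) s := by
    intro s hs
    have e1 : ∀ s, curveVal X s = z + curveVal (curvePrim (S.layerWeight i ε u₀ u₁)
        (nemytskii (S.levelForce i τ ε) (curvePair (affineCurve (u₀, u₁), X)))) s := by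
      intro s
      conv_lhs => rw [hX]
      rfl
    have h3 := (hasDerivWithinAt_curvePrim (S.layerWeight i ε u₀ u₁)
      (nemytskii (S.levelForce i τ ε) (curvePair (affineCurve (u₀, u₁), X))) hs).const_add z
    have e2 : curveVal (nemytskii (S.levelForce i τ ε) (curvePair (affineCurve (u₀, u₁), X))) s =
        S.levelForce i τ ε (u₀ + s * (u₁ - u₀), curveVal X s) := by
      rw [curveVal_of_mem _ hs, nemytskii_apply fun t => (hy _ (hmem t)).force, curvePair_apply,
        affineCurve_apply, ← curveVal_of_mem X hs]
    rw [e2] at h3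
    exact h3.congr (fun s _ => e1 s) (e1 s)
  have key := orbitIn_of_line (S := S) (ε := ε) (B := B) (X := curveVal X)
    (t := fun s => τ ε (u₀ + s * (u₁ - u₀), curveVal X s)) c ?_ ?_ ?_ ?_ hB
  · have e0 : X 0 = z := by
      have := congrArg (fun Y : Curve (Phase d) => Y 0) hX
      simpa using this
    simpa [e0] using key
  · intro t
    have h5 := (hY t).angle
    change 0 < (u₁ - u₀) / _
    have h6 := mul_pos hc₀ h5
    rw [div_eq_mul_inv]
    set a := inner ℝ (gradient (S.depth i ε) (levelPoint τ ε (u₀ + t * (u₁ - u₀), X t))) (X t).2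
    rcases pos_and_pos_or_neg_and_neg_of_mul_pos hc₀ with ⟨p1, p2⟩ | ⟨p1, p2⟩
    · exact mul_pos p1 (inv_pos.2 (pos_of_mul_pos_left h5 p2.le))
    · exact mul_pos_of_neg_of_neg p1 (inv_lt_zero.2 (neg_of_mul_pos_left h5 p2.le))
  · intro s hs
    rw [hcv s hs]
    refine IsLayerPoint.hasDerivWithinAt_time (c₀ := c₀) hS hε (u := fun s => u₀ + s * (u₁ - u₀)) (X := curveVal X)
      (uniqueDiffOn_Icc zero_lt_one s hs) hs ?_ (hasDerivAt_affine u₀ u₁ s).hasDerivWithinAt (hdX s hs)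
    filter_upwards [self_mem_nhdsWithin] with s hs using hy _ (hm s hs)
  · intro s hs
    refine (hdX s hs).congr_deriv ?_
    rw [hcv s hs, layerWeight_val hS hε h0 h1 hs]
    exact (hy _ (hm s hs)).force_eq hS hε _
  · intro s hs
    exact (hS.barrier.subset i).2 (hy _ (hm s hs)).mem

end SteepFamily

namespace SteepFamily

variable {d n : ℕ} {S : SteepFamily d n} {r k : ℕ} {i : Fin n} {ε : ℝ} {x : Pos d}
  {ν : Fin n → ℝ → ℝ} {Dε Dint : ℝ → Set (Pos d)} {b : ℝ → ℝ≥0} {z₀ : Phase d} {T₀ : ℝ}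
  {τ : ℝ → ℝ × Phase d → ℝ}

theorem Approximates.eventually_level (H : S.Approximates r ν Dε Dint b) (i : Fin n) :
    ∀ᶠ ε in 𝓝[>] (0 : ℝ), S.levelDepth ν i ε ∈ Ioo (-S.a) S.a ∧
      S.barrier i ε (S.levelDepth ν i ε) = ν i ε := by
  filter_upwards [H.ν_mem i] with ε hε
  refine ⟨H.adm.levels.sign_mul_mem i (invBarrier_mem hε), ?_⟩
  rw [SteepFamily.barrier, levelDepth, ← mul_assoc, H.adm.levels.sign_mul_self, one_mul,
    apply_invBarrier hε]

theorem Approximates.eventually_barrier_le (H : S.Approximates r ν Dε Dint b) (i : Fin n) :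
    ∀ᶠ ε in 𝓝[>] (0 : ℝ), ∀ u ∈ Ioo (-S.a) S.a, S.levelDepth ν i ε ≤ u →
      S.barrier i ε u ≤ ν i ε := by
  filter_upwards [H.eventually_level i, H.adm.eventually_param,
    H.adm.eventually_deriv_barrier_neg i] with ε h1 h2 h3 u hu hle
  rw [← h1.2]
  exact (H.adm.strictAntiOn_barrier h2 h3).antitoneOn h1.1 hu hle

theorem IsAdmissible.eventually_isLayerPoint (hS : S.IsAdmissible r) (hx : x ∈ S.Γ i \ S.cornerSet r)
    (hz : (linePoint T₀ z₀).1 = x) (hL : inner ℝ (S.limitGradient i x) z₀.2 ≠ 0)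
    (hτ : S.IsLevelTime i r z₀ T₀ τ) :
    ∀ᶠ p in 𝓝[>] (0 : ℝ) ×ˢ 𝓝 ((0 : ℝ), z₀),
      S.IsLayerPoint i τ (inner ℝ (S.limitGradient i x) z₀.2) p.1 p.2 := by
  obtain ⟨h1, h2⟩ := hS.ckBigO_levelForce hx hz hL hτ
  have tq := hτ.tendsto_levelPoint
  rw [hz] at tq
  have h3 := (h2.mul_const (inner ℝ (S.limitGradient i x) z₀.2)).eventually_const_lt
    (mul_self_pos.2 hL)
  have t1 : Tendsto (fun p : ℝ × (ℝ × Phase d) => p.2.1) (𝓝[>] (0 : ℝ) ×ˢ 𝓝 ((0 : ℝ), z₀))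
      (𝓝 0) := (continuous_fst.tendsto ((0 : ℝ), z₀)).comp tendsto_snd
  have ha := hS.barrier.pos
  filter_upwards [hτ.level, hτ.ckBigO.differentiableAt, tq.eventually (hS.mem_nbhd hx),
    t1.eventually (Ioo_mem_nhds (a := -S.a) (by linarith) ha), h3, h1.contDiffAt] with p p1 p2 p3 p4 p5 p6
  exact ⟨p1, p2, p3, p4, p5, p6.continuousAt⟩

/-- The passage of the smooth flow through the boundary layer between two small levels. -/
theorem Approximates.exists_layerStage (H : S.Approximates (k + 1) ν Dε Dint b)
    (hx : x ∈ S.Γ i \ S.cornerSet (k + 1)) (hz : (linePoint T₀ z₀).1 = x)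
    (hL : inner ℝ (S.limitGradient i x) z₀.2 ≠ 0) (hτ : S.IsLevelTime i (k + 1) z₀ T₀ τ) :
    ∃ ρ > 0, ∀ u₀ u₁ : ℝ → ℝ, (∀ᶠ ε in 𝓝[>] (0 : ℝ), (u₀ ε ∈ Ioo (-ρ) ρ ∧ u₁ ε ∈ Ioo (-ρ) ρ) ∧
      (S.levelDepth ν i ε ≤ u₀ ε ∧ S.levelDepth ν i ε ≤ u₁ ε) ∧
      0 < (u₁ ε - u₀ ε) * inner ℝ (S.limitGradient i x) z₀.2) →
      ∃ G, S.FlightStage k b (fun ε => interior (Dε ε)) z₀ (fun ε Z => τ ε (u₀ ε, Z))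
        (fun ε Z => τ ε (u₁ ε, Z)) G := by
  obtain ⟨⟨K, hK⟩, -⟩ := H.adm.ckBigO_levelForce hx hz hL hτ
  have tq := hτ.tendsto_levelPoint
  rw [hz] at tq
  obtain ⟨R, hR, hball⟩ := eventually_prod_nhds_ball
    ((hK.and (H.adm.eventually_isLayerPoint hx hz hL hτ)).and
      ((tendsto_fst.prodMk tq).eventually (H.adm.eventually_region hx H.region)))
  set ρ := min (R / 2) (S.a / 2) with hρ
  have ha := H.adm.barrier.pos
  have hρ0 : 0 < ρ := lt_min (by linarith) (by linarith)
  have hρR : ρ < R := (min_le_left _ _).trans_lt (by linarith)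
  have hρa : ρ < S.a := (min_le_right _ _).trans_lt (by linarith)
  have hsub : Icc (-ρ) ρ ×ˢ Metric.closedBall z₀ ρ ⊆ Metric.ball ((0 : ℝ), z₀) R := by
    rintro ⟨u, Z⟩ ⟨h1, h2⟩
    rw [← ball_prod_same]
    refine ⟨?_, Metric.closedBall_subset_ball hρR h2⟩
    rw [Real.ball_eq_Ioo]
    exact ⟨by linarith [h1.1], by linarith [h1.2]⟩
  set C : Set (ℝ × Phase d) := Icc (-ρ) ρ ×ˢ Metric.closedBall z₀ ρ with hC
  have hforce : CkBigO (𝓝[>] (0 : ℝ) ×ˢ 𝓝ˢ C) (k + 1) (S.levelForce i τ) (fun _ => 1) := by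
    refine ⟨K, ?_⟩
    have h1 : Metric.ball ((0 : ℝ), z₀) R ∈ 𝓝ˢ C := Metric.isOpen_ball.mem_nhdsSet.2 hsub
    filter_upwards [hball.prod_inl _, (eventually_of_mem h1 fun _ h => h).prod_inr _] with p p1 p2
    exact (p1 p.2 p2).1.1
  refine ⟨ρ, hρ0, fun u₀ u₁ hu => ?_⟩
  set Y : ℝ → Phase d × Curve (Phase d) → Curve (ℝ × Phase d) := fun ε y =>
    curvePair (affineCurve (u₀ ε, u₁ ε), y.2) with hY
  have hYC : ∀ᶠ p : ℝ × (Phase d × Curve (Phase d)) in 𝓝[>] (0 : ℝ) ×ˢ 𝓝 (z₀, constCurve z₀),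
      ∀ t, Y p.1 p.2 t ∈ C := by
    have t2 : Tendsto (fun p : ℝ × (Phase d × Curve (Phase d)) => p.2.2)
        (𝓝[>] (0 : ℝ) ×ˢ 𝓝 (z₀, constCurve z₀)) (𝓝 (constCurve z₀)) :=
      (continuous_snd.tendsto (z₀, constCurve z₀)).comp tendsto_snd
    filter_upwards [hu.prod_inl _, t2.eventually (Metric.closedBall_mem_nhds _ hρ0)] with p p1 p2 t
    refine ⟨affineCurve_mem (convex_Icc _ _) (Ioo_subset_Icc_self p1.1.1)
      (Ioo_subset_Icc_self p1.1.2) t, ?_⟩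
    exact (ContinuousMap.dist_apply_le_dist (f := p.2.2) (g := constCurve z₀) t).trans p2
  have hY1 : CkBigO (𝓝[>] (0 : ℝ) ×ˢ 𝓝 (z₀, (constCurve z₀ : Curve (Phase d)))) (k + 1) Y
      (fun _ => 1) := by
    have h1 : CkBigO (𝓝[>] (0 : ℝ) ×ˢ 𝓝 (z₀, (constCurve z₀ : Curve (Phase d)))) (k + 1)
        (fun ε _ => (u₀ ε, u₁ ε)) (fun _ => 1) := by
      refine CkBigO.const (K := ⟨ρ, hρ0.le⟩) ?_
      filter_upwards [hu.prod_inl _] with p hp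
      have e1 := abs_le.2 ⟨hp.1.1.1.le, hp.1.1.2.le⟩
      have e2 := abs_le.2 ⟨hp.1.2.1.le, hp.1.2.2.le⟩
      simpa [Prod.norm_def] using ⟨e1, e2⟩
    exact ((h1.clm affineCurve).prodMk ckBigO_id.snd).clm curvePair
  have hg : CkBigO (𝓝[>] (0 : ℝ) ×ˢ 𝓝 (z₀, (constCurve z₀ : Curve (Phase d)))) (k + 1)
      (fun ε y => curvePrim (S.layerWeight i ε (u₀ ε) (u₁ ε))
        (nemytskii (S.levelForce i τ ε) (Y ε y))) b := by
    refine (CkBigO.curvePrim (K := 1) ?_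
      (hforce.nemytskii_comp hY1 tendsto_fst hYC)).mul_one_right
    filter_upwards [hu.prod_inl _, H.adm.eventually_param.prod_inl _,
      (H.adm.eventually_deriv_barrier_neg i).prod_inl _, (H.eventually_barrier_le i).prod_inl _,
      (H.ν_le i).prod_inl _] with p e1 e2 e3 e4 e5
    have hI : Ioo (-ρ) ρ ⊆ Ioo (-S.a) S.a := Ioo_subset_Ioo (by linarith) hρa.le
    rw [NNReal.coe_one, one_mul]
    exact (integral_layerWeight_le H.adm e2 e3 (hI e1.1.1) (hI e1.1.2)
      (e4 _ (hI e1.1.1) e1.2.1.1) (e4 _ (hI e1.1.2) e1.2.1.2)).trans e5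
  refine exists_flightStage H.small hg ?_ ?_
  · filter_upwards [hYC, hu.prod_inl _, hball.prod_inl _, H.adm.eventually_param.prod_inl _]
      with p p1 p2 p3 p4 hX
    have hI : Ioo (-ρ) ρ ⊆ Ioo (-S.a) S.a := Ioo_subset_Ioo (by linarith) hρa.le
    refine orbitIn_layer H.adm p4 (fun y hy => (p3 y hy).1.2) (hI p2.1.1) (hI p2.1.2) p2.2.2
      (fun t => hsub (p1 t)) hX fun s hs => ?_
    have hsI := Ioo_subset_Icc_self hs
    have hm := p1 ⟨s, hsI⟩
    rw [hY, curvePair_apply, affineCurve_apply, ← curveVal_of_mem p.2.2 hsI] at hm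
    have h1 := p3 _ (hsub hm)
    refine h1.2.1 ?_
    have h2 := h1.1.2.level
    rw [show S.depth i p.1 (levelPoint τ p.1 (u₀ p.1 + s * (u₁ p.1 - u₀ p.1),
      curveVal p.2.2 s)) = _ from h2]
    change S.levelDepth ν i p.1 < _
    have hne : u₁ p.1 - u₀ p.1 ≠ 0 := fun h => by
      have := p2.2.2
      simp [h] at this
    rcases lt_or_gt_of_ne hne with h | h
    · nlinarith [p2.2.1.2, hs.1, hs.2, mul_pos_of_neg_of_neg h (sub_neg.2 hs.2)]
    · nlinarith [p2.2.1.1, hs.1, mul_pos hs.1 h]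
  · have hcz : Tendsto (fun p : ℝ × Phase d => (p.1, (p.2, (constCurve p.2 : Curve (Phase d)))))
        (𝓝[>] (0 : ℝ) ×ˢ 𝓝 z₀) (𝓝[>] (0 : ℝ) ×ˢ 𝓝 (z₀, constCurve z₀)) :=
      tendsto_fst.prodMk (tendsto_snd.prodMk_nhds
        (((constCurve : Phase d →L[ℝ] Curve (Phase d)).continuous.tendsto z₀).comp tendsto_snd))
    filter_upwards [hcz.eventually hYC, hu.prod_inl _, hball.prod_inl _,
      H.adm.eventually_param.prod_inl _] with p p1 p2 p3 p4
    have hI : Ioo (-ρ) ρ ⊆ Ioo (-S.a) S.a := Ioo_subset_Ioo (by linarith) hρa.le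
    have hmem : ∀ s ∈ Icc (0 : ℝ) 1, (u₀ p.1 + s * (u₁ p.1 - u₀ p.1), p.2) ∈
        Metric.ball ((0 : ℝ), z₀) R := by
      intro s hs
      have hm := p1 ⟨s, hs⟩
      rw [hY, curvePair_apply, affineCurve_apply, constCurve_apply] at hm
      exact hsub hm
    obtain ⟨i1, i2⟩ := integral_lineForce_layer H.adm p4 Metric.isOpen_ball
      (fun y hy => (p3 y hy).1.2) hmem
    refine ⟨i1, i2.trans ?_⟩
    rw [curvePrim_apply]
    refine intervalIntegral.integral_congr fun s hs => ?_
    rw [uIcc_of_le zero_le_one] at hs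
    rw [layerWeight_val H.adm p4 (hI p2.1.1) (hI p2.1.2) hs, curveVal_of_mem _ hs,
      nemytskii_apply fun t => (p3 _ (hsub (p1 t))).1.2.force, hY, curvePair_apply,
      affineCurve_apply, constCurve_apply]

end SteepFamily

theorem ckBigO_evalCurve_snd {α E F : Type} [NormedAddCommGroup E] [NormedSpace ℝ E]
    [NormedAddCommGroup F] [NormedSpace ℝ F] {l : Filter α} {k : ℕ} {z : E × Curve F}
    (t : unitInterval) :
    CkBigO (l ×ˢ 𝓝 z) k (fun _ (y : E × Curve F) => evalCurve t y.2) (fun _ => 1) :=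
  (ckBigO_id (l := l) (k := k) (z := z)).snd.clm (evalCurve t)

namespace SteepFamily

variable {d n : ℕ} {S : SteepFamily d n} {r k : ℕ} {i : Fin n} {ε : ℝ} {x : Pos d}
  {ν : Fin n → ℝ → ℝ} {Dε Dint : ℝ → Set (Pos d)} {b : ℝ → ℝ≥0} {z₀ : Phase d} {T₀ : ℝ}

/-! ### The flight through the interior of the table -/

theorem IsAdmissible.interior_subset_dom (hS : S.IsAdmissible r) : interior S.D ⊆ S.Dt := by
  intro q hq
  refine hS.potential.subset_dom ⟨interior_subset hq, fun hc => ?_⟩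
  obtain ⟨i, hi⟩ := mem_iUnion.1 hc
  have : q ∈ frontier S.D := by
    rw [hS.table.frontier_eq]
    exact mem_iUnion.2 ⟨i, hi.1⟩
  exact this.2 hq

theorem Approximates.eventually_interior (H : S.Approximates r ν Dε Dint b) {K : Set (Pos d)}
    (hK : IsCompact K) (hD : K ⊆ interior S.D) :
    ∀ᶠ ε in 𝓝[>] (0 : ℝ), K ⊆ interior (Dε ε) := by
  obtain ⟨K', hK', h1, h2⟩ := exists_compact_between hK isOpen_interior hD
  filter_upwards [H.region.inner K' hK' h2] with ε hε
  exact h1.trans (interior_mono hε)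

theorem Approximates.ckBigO_gradient_interior (H : S.Approximates r ν Dε Dint b) {q : Pos d}
    (hq : q ∈ interior S.D) : CkBigO (𝓝[>] (0 : ℝ) ×ˢ 𝓝 q) r
      (fun ε => gradient fun y => S.V y ε) b := by
  suffices h : CkBigO (𝓝[>] (0 : ℝ) ×ˢ 𝓝 q) r (fun ε => fderiv ℝ fun y => S.V y ε) b from
    h.clm riesz
  obtain ⟨ρ, hρ, hsub⟩ := Metric.nhds_basis_closedBall.mem_iff.1 (isOpen_interior.mem_nhds hq)
  refine ⟨1, ?_⟩
  filter_upwards [(H.subset_inner _ (isCompact_closedBall q ρ) hsub).prod_inl _,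
    eventually_mem_ball_prod (𝓝[>] (0 : ℝ)) q hρ, H.m_le.prod_inl _,
    H.adm.eventually_param.prod_inl _] with p p1 p2 p3 p4
  have hp2 := Metric.ball_subset_closedBall p2
  have hc : ContDiffAt ℝ (r + 1) (fun y => S.V y p.1) p.2 :=
    (H.adm.potential.contDiffOn p.1 p4).contDiffAt (H.adm.potential.isOpen_dom.mem_nhds
      (H.adm.interior_subset_dom (hsub hp2)))
  refine ⟨hc.fderiv_right le_rfl, fun j hj => ?_⟩
  rw [norm_iteratedFDeriv_fderiv, NNReal.coe_one, one_mul]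
  have h1 : ‖iteratedFDeriv ℝ (j + 1) (fun y => S.V y p.1) p.2‖ₑ ≤ b p.1 := by
    refine le_trans ?_ p3
    refine le_trans ?_ (le_iSup₂ (f := fun l (_ : l ∈ Icc 1 (r + 1)) => ⨆ q ∈ Dint p.1,
      ‖iteratedFDeriv ℝ l (fun x => S.V x p.1) q‖ₑ) (j + 1) ⟨by omega, by omega⟩)
    exact le_iSup₂ (f := fun q (_ : q ∈ Dint p.1) =>
      ‖iteratedFDeriv ℝ (j + 1) (fun x => S.V x p.1) q‖ₑ) p.2 (p1 hp2)
  rw [enorm_le_coe] at h1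
  exact_mod_cast h1

theorem Approximates.ckBigO_lineForce (H : S.Approximates r ν Dε Dint b) {t : ℝ}
    {Z : Phase d} (hq : (linePoint t Z).1 ∈ interior S.D) : CkBigO (𝓝[>] (0 : ℝ) ×ˢ 𝓝 (t, Z)) r
      (fun ε y => S.lineForce ε y.1 y.2) b := by
  have h1 : CkBigO (𝓝[>] (0 : ℝ) ×ˢ 𝓝 (t, Z)) r (fun _ (y : ℝ × Phase d) => (linePoint y.1 y.2).1)
      (fun _ => 1) := ckBigO_of_contDiffAt (by unfold linePoint; fun_prop)
  have h2 : CkBigO (𝓝[>] (0 : ℝ) ×ˢ 𝓝 (t, Z)) r (fun _ (y : ℝ × Phase d) => y.1) (fun _ => 1) :=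
    ckBigO_of_contDiffAt (by fun_prop)
  have t1 : Tendsto (fun p : ℝ × (ℝ × Phase d) => (linePoint p.2.1 p.2.2).1)
      (𝓝[>] (0 : ℝ) ×ˢ 𝓝 (t, Z)) (𝓝 (linePoint t Z).1) := by
    have : Continuous fun y : ℝ × Phase d => (linePoint y.1 y.2).1 := by
      unfold linePoint; fun_prop
    exact (this.tendsto (t, Z)).comp tendsto_snd
  have h3 : CkBigO (𝓝[>] (0 : ℝ) ×ˢ 𝓝 (t, Z)) r
      (fun ε (y : ℝ × Phase d) => gradient (fun x => S.V x ε) (linePoint y.1 y.2).1) b :=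
    (H.ckBigO_gradient_interior hq).comp_nhds h1 tendsto_fst t1
  exact (h2.smul h3).one_mul_left.prodMk h3.neg

theorem exists_interior_tube {U : Set (Pos d)} (hU : IsOpen U) {t₀ t₁ : ℝ}
    (h : ∀ t ∈ Icc t₀ t₁, (linePoint t z₀).1 ∈ U) :
    ∃ ρ > 0, ∀ t ∈ Icc t₀ t₁, ∀ Z ∈ Metric.closedBall z₀ ρ, (linePoint t Z).1 ∈ U := by
  have hc : Continuous fun y : ℝ × Phase d => (linePoint y.1 y.2).1 := by
    unfold linePoint; fun_prop
  obtain ⟨u, v, -, hv, hu, hzv, huv⟩ := generalized_tube_lemma isCompact_Icc isCompact_singleton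
    (hU.preimage hc) (s := Icc t₀ t₁) (t := {z₀}) (by
      rintro ⟨t, Z⟩ ⟨ht, hZ⟩
      rw [mem_singleton_iff] at hZ
      subst hZ
      exact h t ht)
  obtain ⟨ρ, hρ, hsub⟩ := Metric.nhds_basis_closedBall.mem_iff.1
    (hv.mem_nhds (hzv (mem_singleton z₀)))
  exact ⟨ρ, hρ, fun t ht Z hZ => huv (mk_mem_prod (hu ht) (hsub hZ))⟩

theorem IsAdmissible.continuousAt_smul_lineForce (hS : S.IsAdmissible r) (hε : ε ∈ Ioo 0 S.ε₀)
    {y : ℝ × (ℝ × Phase d)} (hy : (linePoint y.2.1 y.2.2).1 ∈ S.Dt) : ContinuousAt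
      (fun y : ℝ × (ℝ × Phase d) => y.1 • S.lineForce ε y.2.1 y.2.2) y := by
  have h2 : ContDiffAt ℝ (r + 1) (fun q => S.V q ε) (linePoint y.2.1 y.2.2).1 :=
    (hS.potential.contDiffOn ε hε).contDiffAt (hS.potential.isOpen_dom.mem_nhds hy)
  have h3 : ContinuousAt (fun y : ℝ × (ℝ × Phase d) =>
      gradient (fun y => S.V y ε) (linePoint y.2.1 y.2.2).1) y :=
    ContinuousAt.comp (g := gradient fun y => S.V y ε)
      (f := fun y : ℝ × (ℝ × Phase d) => (linePoint y.2.1 y.2.2).1)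
      (contDiffAt_gradient h2).continuousAt (by unfold linePoint; fun_prop)
  exact continuousAt_fst.smul ((continuousAt_snd.fst.smul h3).prodMk h3.neg)

theorem orbitIn_interior (hS : S.IsAdmissible r) (hε : ε ∈ Ioo 0 S.ε₀) {U : Set (ℝ × Phase d)}
    (hU : ∀ y ∈ U, (linePoint y.1 y.2).1 ∈ S.Dt) {B : Set (Pos d)} {s₀ s₁ : ℝ} (hs : s₀ < s₁)
    {z : Phase d} {X : Curve (Phase d)}
    (hmem : ∀ t : unitInterval, (affineCurve (s₀, s₁) t, X t) ∈ U)
    (hX : X = constCurve z + curvePrim 1 (nemytskii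
      (fun y : ℝ × (ℝ × Phase d) => y.1 • S.lineForce ε y.2.1 y.2.2)
      (curvePair (constCurve (s₁ - s₀), curvePair (affineCurve (s₀, s₁), X)))))
    (hB : ∀ y ∈ U, (linePoint y.1 y.2).1 ∈ B) :
    S.OrbitIn ε B (linePoint s₀ z) (linePoint s₁ (X 1)) := by
  have hm : ∀ s ∈ Icc (0 : ℝ) 1, (s₀ + s * (s₁ - s₀), curveVal X s) ∈ U := by
    intro s hs
    have := hmem ⟨s, hs⟩
    rwa [affineCurve_apply, ← curveVal_of_mem X hs] at this
  have hdX : ∀ s ∈ Icc (0 : ℝ) 1, HasDerivWithinAt (curveVal X)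
      ((s₁ - s₀) • S.lineForce ε (s₀ + s * (s₁ - s₀)) (curveVal X s)) (Icc 0 1) s := by
    intro s hs
    set Y := curvePair (constCurve (s₁ - s₀), curvePair (affineCurve (s₀, s₁), X)) with hY
    have e1 : ∀ s, curveVal X s = z + curveVal (curvePrim 1 (nemytskii
        (fun y : ℝ × (ℝ × Phase d) => y.1 • S.lineForce ε y.2.1 y.2.2) Y)) s := by
      intro s
      conv_lhs => rw [hX]
      rfl
    have h3 := (hasDerivWithinAt_curvePrim 1 (nemytskii
        (fun y : ℝ × (ℝ × Phase d) => y.1 • S.lineForce ε y.2.1 y.2.2) Y) hs).const_add z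
    have e2 : curveVal (nemytskii
        (fun y : ℝ × (ℝ × Phase d) => y.1 • S.lineForce ε y.2.1 y.2.2) Y) s =
        (s₁ - s₀) • S.lineForce ε (s₀ + s * (s₁ - s₀)) (curveVal X s) := by
      rw [curveVal_of_mem _ hs, nemytskii_apply fun t =>
        hS.continuousAt_smul_lineForce hε (y := (s₁ - s₀, _)) (hU _ (hmem t))]
      simp only [hY, curvePair_apply, affineCurve_apply, constCurve_apply]
      rw [← curveVal_of_mem X hs]
    have e3 : curveVal (1 : Curve ℝ) s = 1 := rfl
    rw [e2, e3, one_smul] at h3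
    exact h3.congr (fun s _ => e1 s) (e1 s)
  have key := orbitIn_of_line (S := S) (ε := ε) (B := B) (X := curveVal X)
    (t := fun s => s₀ + s * (s₁ - s₀)) (constCurve (s₁ - s₀)) (fun s => sub_pos.2 hs)
    (fun s hs => (hasDerivAt_affine s₀ s₁ s).hasDerivWithinAt) hdX
    (fun s hs => hU _ (hm s hs)) (fun s hs => hB _ (hm s (Ioo_subset_Icc_self hs)))
  have e0 : X 0 = z := by
    have := congrArg (fun Y : Curve (Phase d) => Y 0) hX
    simpa using this
  simpa [e0] using key

theorem integral_lineForce_interior (hS : S.IsAdmissible r) (hε : ε ∈ Ioo 0 S.ε₀) {s₀ s₁ : ℝ}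
    (hs : s₀ < s₁) {z : Phase d} 
    (hU : ∀ s ∈ Icc (0 : ℝ) 1, (linePoint (s₀ + s * (s₁ - s₀)) z).1 ∈ S.Dt) :
    IntervalIntegrable (fun t => S.lineForce ε t z) MeasureTheory.volume s₀ s₁ ∧
    ∫ t in s₀..s₁, S.lineForce ε t z =
      ∫ s in (0 : ℝ)..1, (s₁ - s₀) • S.lineForce ε (s₀ + s * (s₁ - s₀)) z := by
  have hU' : ∀ t ∈ Icc s₀ s₁, (linePoint t z).1 ∈ S.Dt := by
    intro t ht
    have hpos : 0 < s₁ - s₀ := sub_pos.2 hs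
    have := hU ((t - s₀) / (s₁ - s₀)) ⟨div_nonneg (by linarith [ht.1]) hpos.le, by
      rw [div_le_one hpos]; linarith [ht.2]⟩
    rwa [div_mul_cancel₀ _ hpos.ne', add_sub_cancel] at this
  have hc : ContinuousOn (fun t => S.lineForce ε t z) (Icc s₀ s₁) := by
    intro t ht
    have h2 : ContDiffAt ℝ (r + 1) (fun q => S.V q ε) (z.1 + t • z.2) :=
      (hS.potential.contDiffOn ε hε).contDiffAt (hS.potential.isOpen_dom.mem_nhds (hU' t ht))
    have h3 : ContinuousAt (fun t : ℝ => gradient (fun y => S.V y ε) (z.1 + t • z.2)) t :=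
      ContinuousAt.comp (g := gradient fun y => S.V y ε) (f := fun t : ℝ => z.1 + t • z.2)
        (contDiffAt_gradient h2).continuousAt (by fun_prop)
    exact ((continuousAt_id.smul h3).prodMk h3.neg).continuousWithinAt
  rw [← uIcc_of_le hs.le] at hc
  refine ⟨hc.intervalIntegrable, ?_⟩
  have himg : (fun s => s₀ + s * (s₁ - s₀)) '' uIcc 0 1 ⊆ uIcc s₀ s₁ := by
    rintro _ ⟨s, hs', rfl⟩
    rw [uIcc_of_le zero_le_one] at hs'
    rw [uIcc_of_le hs.le]
    constructor <;> nlinarith [hs'.1, hs'.2, mul_nonneg hs'.1 (sub_nonneg.2 hs.le),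
      mul_nonneg (sub_nonneg.2 hs'.2) (sub_nonneg.2 hs.le)]
  have := intervalIntegral.integral_deriv_smul_comp' (a := 0) (b := 1)
    (fun s _ => hasDerivAt_affine s₀ s₁ s) continuousOn_const (hc.mono himg)
  simp only [zero_mul, add_zero, one_mul, add_sub_cancel] at this
  exact this.symm

/-- The flight of the smooth flow through the interior of the table. -/
theorem Approximates.exists_interiorStage (H : S.Approximates (k + 1) ν Dε Dint b) {t₀ t₁ c : ℝ}
    (hD : ∀ t ∈ Icc t₀ t₁, (linePoint t z₀).1 ∈ interior S.D) {θ₀ θ₁ : ℝ → Phase d → ℝ}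
    (hθ₀ : CkBigO (𝓝[>] (0 : ℝ) ×ˢ 𝓝 z₀) (k + 1) θ₀ fun _ => 1)
    (hθ₁ : CkBigO (𝓝[>] (0 : ℝ) ×ˢ 𝓝 z₀) (k + 1) θ₁ fun _ => 1)
    (h₀ : ∀ᶠ p : ℝ × Phase d in 𝓝[>] (0 : ℝ) ×ˢ 𝓝 z₀, θ₀ p.1 p.2 ∈ Icc t₀ c)
    (h₁ : ∀ᶠ p : ℝ × Phase d in 𝓝[>] (0 : ℝ) ×ˢ 𝓝 z₀, θ₁ p.1 p.2 ∈ Ioc c t₁) :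
    ∃ G, S.FlightStage k b (fun ε => interior (Dε ε)) z₀ θ₀ θ₁ G := by
  obtain ⟨ρ, hρ, htube⟩ := exists_interior_tube isOpen_interior hD
  set C₁ : Set (ℝ × Phase d) := Icc t₀ t₁ ×ˢ Metric.closedBall z₀ ρ with hC₁
  set C : Set (ℝ × (ℝ × Phase d)) := Icc 0 (t₁ - t₀) ×ˢ C₁ with hC
  have hC₁c : IsCompact C₁ := isCompact_Icc.prod (isCompact_closedBall z₀ ρ)
  have hD₁ : ∀ y ∈ C₁, (linePoint y.1 y.2).1 ∈ interior S.D := fun y hy => htube _ hy.1 _ hy.2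
  have hforce : CkBigO (𝓝[>] (0 : ℝ) ×ˢ 𝓝ˢ C) (k + 1)
      (fun ε (y : ℝ × (ℝ × Phase d)) => y.1 • S.lineForce ε y.2.1 y.2.2) b := by
    refine ckBigO_nhdsSet_of_isCompact (isCompact_Icc.prod hC₁c) fun y hy => ?_
    have e1 : CkBigO (𝓝[>] (0 : ℝ) ×ˢ 𝓝 y) (k + 1)
        (fun ε (y : ℝ × (ℝ × Phase d)) => S.lineForce ε y.2.1 y.2.2) b :=
      (H.ckBigO_lineForce (hD₁ _ hy.2)).comp_nhds (ckBigO_of_contDiffAt contDiffAt_snd) tendsto_fst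
        ((continuous_snd.tendsto y).comp tendsto_snd)
    exact ((ckBigO_of_contDiffAt contDiffAt_fst).smul e1).one_mul_left
  have tX : Tendsto (fun p : ℝ × (Phase d × Curve (Phase d)) => p.2.2) (𝓝[>] (0 : ℝ) ×ˢ
      𝓝 (z₀, (constCurve z₀ : Curve (Phase d)))) (𝓝 (constCurve z₀)) :=
    (continuous_snd.tendsto (z₀, (constCurve z₀ : Curve (Phase d)))).comp tendsto_snd
  have t0 : Tendsto (fun p : ℝ × (Phase d × Curve (Phase d)) => p.2.1) (𝓝[>] (0 : ℝ) ×ˢ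
      𝓝 (z₀, (constCurve z₀ : Curve (Phase d)))) (𝓝 z₀) :=
    (continuous_fst.tendsto (z₀, (constCurve z₀ : Curve (Phase d)))).comp tendsto_snd
  have t1' : Tendsto (fun p : ℝ × (Phase d × Curve (Phase d)) => evalCurve 1 p.2.2) (𝓝[>] (0 : ℝ) ×ˢ
      𝓝 (z₀, (constCurve z₀ : Curve (Phase d)))) (𝓝 z₀) :=
    Tendsto.comp (g := evalCurve 1) (y := 𝓝 (constCurve z₀))
      ((evalCurve (E := Phase d) 1).continuous.tendsto (constCurve z₀)) tX
  have t1 : Tendsto (fun p : ℝ × (Phase d × Curve (Phase d)) => p.2.2 1) (𝓝[>] (0 : ℝ) ×ˢ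
      𝓝 (z₀, (constCurve z₀ : Curve (Phase d)))) (𝓝 z₀) :=
    t1'.congr fun p => evalCurve_apply 1 p.2.2
  have e0 : CkBigO (𝓝[>] (0 : ℝ) ×ˢ
      𝓝 (z₀, (constCurve z₀ : Curve (Phase d)))) (k + 1) (fun ε (y : Phase d × Curve (Phase d)) => θ₀ ε y.1) (fun _ => 1) :=
    hθ₀.comp_nhds (ckBigO_of_contDiffAt contDiffAt_fst) tendsto_fst t0
  have e2 : CkBigO (𝓝[>] (0 : ℝ) ×ˢ
      𝓝 (z₀, (constCurve z₀ : Curve (Phase d)))) (k + 1) (fun _ (y : Phase d × Curve (Phase d)) => evalCurve 1 y.2)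
      (fun _ => 1) := ckBigO_evalCurve_snd 1
  have e1 : CkBigO (𝓝[>] (0 : ℝ) ×ˢ
      𝓝 (z₀, (constCurve z₀ : Curve (Phase d)))) (k + 1) (fun ε (y : Phase d × Curve (Phase d)) => θ₁ ε (y.2 1)) (fun _ => 1) :=
    (hθ₁.comp_nhds e2 tendsto_fst t1').congr (Eventually.of_forall fun p => by
      rw [evalCurve_apply])
  set Y : ℝ → Phase d × Curve (Phase d) → Curve (ℝ × (ℝ × Phase d)) := fun ε y =>
    curvePair (constCurve (θ₁ ε (y.2 1) - θ₀ ε y.1),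
      curvePair (affineCurve (θ₀ ε y.1, θ₁ ε (y.2 1)), y.2)) with hY
  have e3 : CkBigO (𝓝[>] (0 : ℝ) ×ˢ
      𝓝 (z₀, (constCurve z₀ : Curve (Phase d)))) (k + 1) (fun _ (y : Phase d × Curve (Phase d)) => y.2) (fun _ => 1) :=
    ckBigO_of_contDiffAt contDiffAt_snd
  have e4 : CkBigO (𝓝[>] (0 : ℝ) ×ˢ
      𝓝 (z₀, (constCurve z₀ : Curve (Phase d)))) (k + 1) (fun ε (y : Phase d × Curve (Phase d)) =>
      affineCurve (θ₀ ε y.1, θ₁ ε (y.2 1))) (fun _ => 1) := e0.affineCurve e1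
  have e5 : CkBigO (𝓝[>] (0 : ℝ) ×ˢ
      𝓝 (z₀, (constCurve z₀ : Curve (Phase d)))) (k + 1) (fun ε (y : Phase d × Curve (Phase d)) =>
      (constCurve (θ₁ ε (y.2 1) - θ₀ ε y.1) : Curve ℝ)) (fun _ => 1) := (e1.sub e0).constCurve
  have e6 : CkBigO (𝓝[>] (0 : ℝ) ×ˢ
      𝓝 (z₀, (constCurve z₀ : Curve (Phase d)))) (k + 1) (fun ε (y : Phase d × Curve (Phase d)) =>
      curvePair (affineCurve (θ₀ ε y.1, θ₁ ε (y.2 1)), y.2)) (fun _ => 1) :=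
    e4.curvePair e3
  have hY1 : CkBigO (𝓝[>] (0 : ℝ) ×ˢ
      𝓝 (z₀, (constCurve z₀ : Curve (Phase d)))) (k + 1) Y (fun _ => 1) := e5.curvePair e6
  have hmem : ∀ᶠ p in (𝓝[>] (0 : ℝ) ×ˢ
      𝓝 (z₀, (constCurve z₀ : Curve (Phase d)))), θ₀ p.1 p.2.1 < θ₁ p.1 (p.2.2 1) ∧
      θ₁ p.1 (p.2.2 1) - θ₀ p.1 p.2.1 ∈ Icc 0 (t₁ - t₀) ∧
      ∀ t : unitInterval, (affineCurve (θ₀ p.1 p.2.1, θ₁ p.1 (p.2.2 1)) t, p.2.2 t) ∈ C₁ := by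
    filter_upwards [(tendsto_fst.prodMk t0).eventually h₀, (tendsto_fst.prodMk t1).eventually h₁,
      tX.eventually (Metric.closedBall_mem_nhds _ hρ)] with p p0 p1 p2
    have hlt : θ₀ p.1 p.2.1 < θ₁ p.1 (p.2.2 1) := p0.2.trans_lt p1.1
    refine ⟨hlt, ⟨by linarith, by linarith [p0.1, p1.2]⟩, fun t => ⟨?_, ?_⟩⟩
    · refine affineCurve_mem (convex_Icc _ _) ⟨p0.1, ?_⟩ ⟨?_, p1.2⟩ t
      · exact p0.2.trans (p1.1.le.trans p1.2)
      · exact p0.1.trans (p0.2.trans p1.1.le)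
    · exact (ContinuousMap.dist_apply_le_dist (f := p.2.2) (g := constCurve z₀) t).trans p2
  have hYC : ∀ᶠ p in (𝓝[>] (0 : ℝ) ×ˢ
      𝓝 (z₀, (constCurve z₀ : Curve (Phase d)))), ∀ t, Y p.1 p.2 t ∈ C := hmem.mono fun p hp t => ⟨hp.2.1, hp.2.2 t⟩
  have hg : CkBigO (𝓝[>] (0 : ℝ) ×ˢ
      𝓝 (z₀, (constCurve z₀ : Curve (Phase d)))) (k + 1) (fun ε y => curvePrim 1 (nemytskii
      (fun y : ℝ × (ℝ × Phase d) => y.1 • S.lineForce ε y.2.1 y.2.2) (Y ε y))) b :=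
    (hforce.nemytskii_comp hY1 tendsto_fst hYC).clm (curvePrim 1)
  have hint : ∀ᶠ ε in 𝓝[>] (0 : ℝ), ∀ y ∈ C₁, (linePoint y.1 y.2).1 ∈ interior (Dε ε) := by
    have hc : Continuous fun y : ℝ × Phase d => (linePoint y.1 y.2).1 := by
      unfold linePoint; fun_prop
    filter_upwards [H.eventually_interior (hC₁c.image hc) (by rintro _ ⟨y, hy, rfl⟩; exact hD₁ y hy)]
      with ε hε y hy using hε ⟨y, hy, rfl⟩
  have hdom := H.adm.interior_subset_dom
  refine exists_flightStage H.small hg ?_ ?_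
  · filter_upwards [hmem, hint.prod_inl _, H.adm.eventually_param.prod_inl _] with p p1 p2 p3 hX
    exact orbitIn_interior H.adm p3 (fun y hy => hdom (hD₁ y hy)) p1.1 p1.2.2 hX p2
  · have hcz : Tendsto (fun p : ℝ × Phase d => (p.1, (p.2, (constCurve p.2 : Curve (Phase d)))))
        (𝓝[>] (0 : ℝ) ×ˢ 𝓝 z₀) (𝓝[>] (0 : ℝ) ×ˢ
      𝓝 (z₀, (constCurve z₀ : Curve (Phase d)))) :=
      tendsto_fst.prodMk (tendsto_snd.prodMk_nhds
        (((constCurve : Phase d →L[ℝ] Curve (Phase d)).continuous.tendsto z₀).comp tendsto_snd))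
    filter_upwards [hcz.eventually hmem, H.adm.eventually_param.prod_inl _] with p p1 p3
    have hm : ∀ s ∈ Icc (0 : ℝ) 1, (linePoint (θ₀ p.1 p.2 + s * (θ₁ p.1 p.2 - θ₀ p.1 p.2)) p.2).1 ∈
        S.Dt := by
      intro s hs
      have := hdom (hD₁ _ (p1.2.2 ⟨s, hs⟩))
      rwa [affineCurve_apply] at this
    obtain ⟨i1, i2⟩ := integral_lineForce_interior H.adm p3 p1.1 hm
    refine ⟨i1, i2.trans ?_⟩
    rw [curvePrim_apply]
    refine intervalIntegral.integral_congr fun s hs => ?_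
    rw [uIcc_of_le zero_le_one] at hs
    have e3 : curveVal (1 : Curve ℝ) s = 1 := rfl
    rw [e3, one_smul, curveVal_of_mem _ hs, nemytskii_apply fun t =>
      H.adm.continuousAt_smul_lineForce p3 (hdom (hD₁ _ (p1.2.2 t)))]
    simp only [hY, curvePair_apply, affineCurve_apply, constCurve_apply]

end SteepFamily

theorem eventually_prod_nhds_const {α E F : Type} [NormedAddCommGroup E] [NormedSpace ℝ E]
    [NormedAddCommGroup F] [NormedSpace ℝ F] {l : Filter α} {w : E} {z : F} {P : α × (E × F) → Prop} (h : ∀ᶠ p in l ×ˢ 𝓝 (w, z), P p) :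
    ∃ ρ > 0, ∀ u ∈ Metric.ball w ρ, ∀ᶠ p in l ×ˢ 𝓝 (u, z), P p := by
  obtain ⟨ρ, hρ, hb⟩ := eventually_prod_nhds_ball h
  refine ⟨ρ, hρ, fun u hu => ?_⟩
  have : Metric.ball (w, z) ρ ∈ 𝓝 (u, z) := Metric.isOpen_ball.mem_nhds (by
    rw [← ball_prod_same]; exact ⟨hu, Metric.mem_ball_self hρ⟩)
  filter_upwards [hb.prod_inl _, (eventually_of_mem this fun _ h => h).prod_inr l] with p p1 p2
  exact p1 _ p2

theorem tendsto_prodMk_const {α E F : Type} [TopologicalSpace E] [TopologicalSpace F]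
    (l : Filter α) (u : E) (z : F) :
    Tendsto (fun p : α × F => (p.1, (u, p.2))) (l ×ˢ 𝓝 z) (l ×ˢ 𝓝 (u, z)) :=
  tendsto_fst.prodMk (tendsto_const_nhds.prodMk_nhds tendsto_snd)

theorem tendsto_prodMk_param {α E F : Type} [TopologicalSpace E] [TopologicalSpace F]
    {l : Filter α} {u : α → E} {u₀ : E} (hu : Tendsto u l (𝓝 u₀)) (z : F) :
    Tendsto (fun p : α × F => (p.1, (u p.1, p.2))) (l ×ˢ 𝓝 z) (l ×ˢ 𝓝 (u₀, z)) :=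
  tendsto_fst.prodMk ((hu.comp tendsto_fst).prodMk_nhds tendsto_snd)

namespace SteepFamily

variable {d n : ℕ} {S : SteepFamily d n} {r k : ℕ} {i j : Fin n} {ε : ℝ} {x : Pos d}
  {ν : Fin n → ℝ → ℝ} {Dε Dint : ℝ → Set (Pos d)} {b : ℝ → ℝ≥0} {z₀ : Phase d} {T₀ T : ℝ}
  {τ : ℝ → ℝ × Phase d → ℝ}

theorem continuous_linePoint : Continuous fun y : ℝ × Phase d => linePoint y.1 y.2 := by
  unfold linePoint
  fun_prop

theorem tendsto_linePoint {α : Type} {𝓕 : Filter α} {t : α → ℝ} {Z : α → Phase d}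
    (ht : Tendsto t 𝓕 (𝓝 T₀)) (hZ : Tendsto Z 𝓕 (𝓝 z₀)) :
    Tendsto (fun a => linePoint (t a) (Z a)) 𝓕 (𝓝 (linePoint T₀ z₀)) :=
  Tendsto.comp (g := fun y : ℝ × Phase d => linePoint y.1 y.2) (f := fun a => (t a, Z a))
    (continuous_linePoint.tendsto (T₀, z₀)) (ht.prodMk_nhds hZ)

/-! ### A regular flight of the limit billiard -/

/-- The straight line of `z₀` is a regular flight of duration `T` from `Γ_j` to `Γ_i`. -/
structure IsRegularFlight (S : SteepFamily d n) (r : ℕ) (j i : Fin n) (z₀ : Phase d) (T : ℝ) :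
    Prop where
  pos : 0 < T
  start_mem : z₀.1 ∈ S.Γ j \ S.cornerSet r
  end_mem : (linePoint T z₀).1 ∈ S.Γ i \ S.cornerSet r
  start_angle : 0 < inner ℝ (S.limitGradient j z₀.1) z₀.2
  end_angle : inner ℝ (S.limitGradient i (linePoint T z₀).1) z₀.2 < 0
  inside : ∀ t ∈ Ioo 0 T, (linePoint t z₀).1 ∈ interior S.D

theorem linePoint_zero (z : Phase d) : linePoint 0 z = z := by simp [linePoint]

/-- Near a transversal intersection the depth is monotone along lines. -/
theorem IsAdmissible.exists_monotone_depth (hS : S.IsAdmissible r)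
    (hx : (linePoint T₀ z₀).1 ∈ S.Γ i \ S.cornerSet r) {c : ℝ}
    (hc : 0 < c * inner ℝ (S.limitGradient i (linePoint T₀ z₀).1) z₀.2) :
    ∃ ρ > 0, ∀ᶠ ε in 𝓝[>] (0 : ℝ), ∀ z ∈ Metric.ball z₀ ρ,
      StrictMonoOn (fun t => c * S.depth i ε (linePoint t z).1) (Ioo (T₀ - ρ) (T₀ + ρ)) := by
  have h1 : CkBigO (𝓝[>] (0 : ℝ) ×ˢ 𝓝 (linePoint T₀ z₀).1) (r + 1)
      (fun ε q => c * S.depth i ε q) (fun _ => 1) :=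
    (hS.ckLip_depth hx).1.clm (c • ContinuousLinearMap.id ℝ ℝ)
  have h2 : Tendsto (fun p : ℝ × Pos d => fderiv ℝ (fun q => c * S.depth i p.1 q) p.2)
      (𝓝[>] 0 ×ˢ 𝓝 (linePoint T₀ z₀).1)
      (𝓝 (c • innerSL ℝ (S.limitGradient i (linePoint T₀ z₀).1))) := by
    refine ((hS.tendsto_fderiv_depth hx).const_smul c).congr' ?_
    filter_upwards [(hS.ckLip_depth hx).1.differentiableAt] with p hp
    exact (hp.hasFDerivAt.const_mul c).fderiv.symm
  exact exists_strictMonoOn_line h1 h2 rfl (by simpa using hc)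

/-- A small positive level is met at a time that is separated from the limit time. -/
theorem IsLevelTime.exists_separated (hS : S.IsAdmissible r) (hτ : S.IsLevelTime i r z₀ T₀ τ)
    (hx : (linePoint T₀ z₀).1 ∈ S.Γ i \ S.cornerSet r) {c : ℝ} (hc' : c = 1 ∨ c = -1)
    (hc : 0 < c * inner ℝ (S.limitGradient i (linePoint T₀ z₀).1) z₀.2) :
    ∃ ρ > 0, ∀ u ∈ Ioo 0 ρ, ∃ t₀ > 0, ∀ᶠ p in 𝓝[>] (0 : ℝ) ×ˢ 𝓝 z₀,
      t₀ ≤ c * (τ p.1 (u, p.2) - T₀) := by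
  obtain ⟨R, hR, hmono⟩ := hS.exists_monotone_depth hx hc
  have e1 : ∀ᶠ p in 𝓝[>] (0 : ℝ) ×ˢ 𝓝 ((0 : ℝ), z₀), τ p.1 p.2 ∈ Ioo (T₀ - R) (T₀ + R) :=
    hτ.tendsto.eventually (Ioo_mem_nhds (by linarith) (by linarith))
  obtain ⟨ρ, hρ, hb⟩ := eventually_prod_nhds_const (e1.and hτ.level)
  refine ⟨ρ, hρ, fun u hu => ?_⟩
  have e2 := (tendsto_prodMk_const (𝓝[>] (0 : ℝ)) u z₀).eventually (hb u (by
    rw [Real.ball_eq_Ioo]; exact ⟨by linarith [hu.1], by linarith [hu.2]⟩))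
  have t1 : Tendsto (fun p : ℝ × (ℝ × Phase d) => (p.1, (linePoint p.2.1 p.2.2).1))
      (𝓝[>] (0 : ℝ) ×ˢ 𝓝 (T₀, z₀)) (𝓝[>] (0 : ℝ) ×ˢ 𝓝 (linePoint T₀ z₀).1) :=
    tendsto_fst.prodMk ((continuous_linePoint.fst.tendsto (T₀, z₀)).comp tendsto_snd)
  have e3 : ∀ᶠ p : ℝ × (ℝ × Phase d) in 𝓝[>] (0 : ℝ) ×ˢ 𝓝 (T₀, z₀),
      S.depth i p.1 (linePoint p.2.1 p.2.2).1 < u :=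
    t1.eventually ((hS.tendsto_depth hx).eventually_lt_const hu.1)
  obtain ⟨t₀, ht₀, h3⟩ := eventually_prod_nhds_ball e3
  refine ⟨t₀, ht₀, ?_⟩
  filter_upwards [e2, h3.prod_inl _, hmono.prod_inl _, eventually_mem_ball_prod (𝓝[>] (0 : ℝ)) z₀ ht₀,
    eventually_mem_ball_prod (𝓝[>] (0 : ℝ)) z₀ hR] with p p2 p3 p4 p5 p6
  by_contra! hlt
  have hdep : ∀ t ∈ Ioo (T₀ - t₀) (T₀ + t₀), S.depth i p.1 (linePoint t p.2).1 < u := by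
    intro t ht
    refine p3 (t, p.2) ?_
    rw [← ball_prod_same, Real.ball_eq_Ioo]
    exact ⟨ht, p5⟩
  have h0 := hdep T₀ ⟨by linarith, by linarith⟩
  have hT₀ : T₀ ∈ Ioo (T₀ - R) (T₀ + R) := ⟨by linarith, by linarith⟩
  have hl := p2.2
  by_cases hin : τ p.1 (u, p.2) ∈ Ioo (T₀ - t₀) (T₀ + t₀)
  · exact (hdep _ hin).ne hl
  · rcases hc' with rfl | rfl
    · have hle : τ p.1 (u, p.2) < T₀ := by
        by_contra! hle
        exact hin ⟨by linarith, by linarith⟩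
      have := p4 p.2 p6 p2.1 hT₀ hle
      simp only [one_mul] at this
      linarith
    · have hle : T₀ < τ p.1 (u, p.2) := by
        by_contra! hle
        exact hin ⟨by linarith, by linarith⟩
      have := p4 p.2 p6 hT₀ p2.1 hle
      simp only [neg_one_mul] at this
      linarith

theorem IsLevelTime.ckBigO_param (hτ : S.IsLevelTime i k z₀ T₀ τ) {u : ℝ → ℝ}
    (hu : Tendsto u (𝓝[>] 0) (𝓝 0)) :
    CkBigO (𝓝[>] (0 : ℝ) ×ˢ 𝓝 z₀) (k + 1) (fun ε z => τ ε (u ε, z)) (fun _ => 1) := by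
  have h1 : CkBigO (𝓝[>] (0 : ℝ) ×ˢ 𝓝 z₀) (k + 1) (fun ε _ => u ε) (fun _ => 1) := by
    refine CkBigO.const (K := 1) ?_
    filter_upwards [(hu.norm.eventually_lt_const (u := 1) (by simp)).prod_inl _] with p hp
    simpa using hp.le
  exact hτ.ckBigO.comp (h1.prodMk ckBigO_id) (tendsto_prodMk_param hu z₀)

theorem IsLevelTime.tendsto_param (hτ : S.IsLevelTime i k z₀ T₀ τ) {u : ℝ → ℝ}
    (hu : Tendsto u (𝓝[>] 0) (𝓝 0)) :
    Tendsto (fun p : ℝ × Phase d => τ p.1 (u p.1, p.2)) (𝓝[>] (0 : ℝ) ×ˢ 𝓝 z₀) (𝓝 T₀) :=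
  Tendsto.comp (g := fun p : ℝ × (ℝ × Phase d) => τ p.1 p.2) hτ.tendsto (tendsto_prodMk_param hu z₀)

theorem IsLevelTime.exists_ckBigO_const (hτ : S.IsLevelTime i k z₀ T₀ τ) :
    ∃ ρ > 0, ∀ u ∈ Metric.ball (0 : ℝ) ρ,
      CkBigO (𝓝[>] (0 : ℝ) ×ˢ 𝓝 z₀) (k + 1) (fun ε z => τ ε (u, z)) (fun _ => 1) := by
  obtain ⟨K, hK⟩ := hτ.ckBigO
  obtain ⟨ρ, hρ, h⟩ := eventually_prod_nhds_const hK
  refine ⟨ρ, hρ, fun u hu => ?_⟩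
  have h1 : CkBigO (𝓝[>] (0 : ℝ) ×ˢ 𝓝 (u, z₀)) (k + 1) τ (fun _ => 1) := ⟨K, h u hu⟩
  exact h1.comp ((CkBigO.const_one u).prodMk ckBigO_id) (tendsto_prodMk_const _ u z₀)

/-- Small positive levels are in the interior of the region. -/
theorem Approximates.exists_level_interior (H : S.Approximates r ν Dε Dint b)
    (hx : (linePoint T₀ z₀).1 ∈ S.Γ i \ S.cornerSet r) (hτ : S.IsLevelTime i k z₀ T₀ τ) :
    ∃ ρ > 0, ∀ u ∈ Ioo 0 ρ, ∀ᶠ p in 𝓝[>] (0 : ℝ) ×ˢ 𝓝 z₀,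
      (linePoint (τ p.1 (u, p.2)) p.2).1 ∈ interior (Dε p.1) := by
  obtain ⟨ρ, hρ, h⟩ := eventually_prod_nhds_const (hτ.level.and
    ((tendsto_fst.prodMk hτ.tendsto_levelPoint).eventually (H.adm.eventually_region hx H.region)))
  refine ⟨ρ, hρ, fun u hu => ?_⟩
  have e2 := (tendsto_prodMk_const (𝓝[>] (0 : ℝ)) u z₀).eventually (h u (by
    rw [Real.ball_eq_Ioo]; exact ⟨by linarith [hu.1], by linarith [hu.2]⟩))
  filter_upwards [e2, ((H.tendsto_level i).eventually_lt_const hu.1).prod_inl _] with p p1 p2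
  refine p1.2.1 ?_
  rw [show S.depth i p.1 (levelPoint τ p.1 (u, p.2)) = u from p1.1]
  exact p2

/-- The flight of the smooth flow from `Γ_j^ε` to `Γ_i^ε`. -/
theorem Approximates.exists_flight (H : S.Approximates (k + 1) ν Dε Dint b)
    (hz : S.IsRegularFlight (k + 1) j i z₀ T) {τj τi : ℝ → ℝ × Phase d → ℝ}
    (hj : S.IsLevelTime j (k + 1) z₀ 0 τj) (hi : S.IsLevelTime i (k + 1) z₀ T τi) :
    ∃ G, S.FlightStage k b (fun ε => interior (Dε ε)) z₀
      (fun ε Z => τj ε (S.levelDepth ν j ε, Z)) (fun ε Z => τi ε (S.levelDepth ν i ε, Z)) G := by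
  have hxj : (linePoint 0 z₀).1 ∈ S.Γ j \ S.cornerSet (k + 1) := by
    rw [linePoint_zero]; exact hz.start_mem
  have haj : 0 < inner ℝ (S.limitGradient j (linePoint 0 z₀).1) z₀.2 := by
    rw [linePoint_zero]; exact hz.start_angle
  obtain ⟨ρ₁, hρ₁, s₁⟩ := H.exists_layerStage hxj rfl haj.ne' hj
  obtain ⟨ρ₂, hρ₂, s₂⟩ := H.exists_layerStage hz.end_mem rfl hz.end_angle.ne hi
  obtain ⟨ρ₃, hρ₃, s₃⟩ := hj.exists_separated H.adm hxj (c := 1) (Or.inl rfl) (by simpa using haj)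
  obtain ⟨ρ₄, hρ₄, s₄⟩ := hi.exists_separated H.adm hz.end_mem (c := -1) (Or.inr rfl)
    (by simpa using hz.end_angle)
  obtain ⟨ρ₅, hρ₅, s₅⟩ := hj.exists_ckBigO_const
  obtain ⟨ρ₆, hρ₆, s₆⟩ := hi.exists_ckBigO_const
  obtain ⟨ρ₇, hρ₇, s₇⟩ := H.exists_level_interior hxj hj
  obtain ⟨ρ₈, hρ₈, s₈⟩ := H.exists_level_interior hz.end_mem hi
  have hT := hz.pos
  obtain ⟨ρ₉, hρ₉, s₉⟩ := eventually_prod_nhds_const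
    (hj.tendsto.eventually_lt_const (u := T / 2) (by linarith))
  obtain ⟨ρ₀, hρ₀, s₀⟩ := eventually_prod_nhds_const
    (hi.tendsto.eventually_const_lt (u := T / 2) (by linarith))
  obtain ⟨u, hu0, hu⟩ : ∃ u > 0, u < ρ₁ ∧ u < ρ₂ ∧ u < ρ₃ ∧ u < ρ₄ ∧ u < ρ₅ ∧ u < ρ₆ ∧ u < ρ₇ ∧
      u < ρ₈ ∧ u < ρ₉ ∧ u < ρ₀ := by
    have : ∀ᶠ u in 𝓝[>] (0 : ℝ), u < ρ₁ ∧ u < ρ₂ ∧ u < ρ₃ ∧ u < ρ₄ ∧ u < ρ₅ ∧ u < ρ₆ ∧ u < ρ₇ ∧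
        u < ρ₈ ∧ u < ρ₉ ∧ u < ρ₀ := by
      simp only [eventually_and]
      refine ⟨?_, ?_, ?_, ?_, ?_, ?_, ?_, ?_, ?_, ?_⟩ <;>
        exact mem_nhdsWithin_of_mem_nhds (Iio_mem_nhds (by assumption))
    obtain ⟨u, h1, h2⟩ := (this.and self_mem_nhdsWithin).exists
    exact ⟨u, h2, h1⟩
  obtain ⟨u1, u2, u3, u4, u5, u6, u7, u8, u9, u0⟩ := hu
  have hball : ∀ {ρ : ℝ}, u < ρ → u ∈ Metric.ball (0 : ℝ) ρ := fun h => by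
    rw [Real.ball_eq_Ioo]; exact ⟨by linarith, by linarith⟩
  obtain ⟨t₀, ht₀, q₃⟩ := s₃ u ⟨hu0, u3⟩
  obtain ⟨t₁, ht₁, q₄⟩ := s₄ u ⟨hu0, u4⟩
  have q₉ := (tendsto_prodMk_const (𝓝[>] (0 : ℝ)) u z₀).eventually (s₉ u (hball u9))
  have q₀ := (tendsto_prodMk_const (𝓝[>] (0 : ℝ)) u z₀).eventually (s₀ u (hball u0))
  have lvl : ∀ (i : Fin n) {ρ : ℝ}, 0 < ρ → ∀ᶠ ε in 𝓝[>] (0 : ℝ),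
      S.levelDepth ν i ε ∈ Ioo (-ρ) ρ ∧ S.levelDepth ν i ε < u := fun i ρ hρ =>
    ((H.tendsto_level i).eventually (Ioo_mem_nhds (neg_lt_zero.2 hρ) hρ)).and
      ((H.tendsto_level i).eventually_lt_const hu0)
  obtain ⟨G₁, h₁⟩ := s₁ (S.levelDepth ν j) (fun _ => u) (by
    filter_upwards [lvl j hρ₁] with ε hε
    exact ⟨⟨hε.1, ⟨by linarith, u1⟩⟩, ⟨le_rfl, hε.2.le⟩, mul_pos (sub_pos.2 hε.2) haj⟩)
  obtain ⟨G₃, h₃⟩ := s₂ (fun _ => u) (S.levelDepth ν i) (by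
    filter_upwards [lvl i hρ₂] with ε hε
    exact ⟨⟨⟨by linarith, u2⟩, hε.1⟩, ⟨hε.2.le, le_rfl⟩,
      mul_pos_of_neg_of_neg (sub_neg.2 hε.2) hz.end_angle⟩)
  obtain ⟨G₂, h₂⟩ := H.exists_interiorStage (t₀ := t₀) (t₁ := T - t₁) (c := T / 2)
    (fun t ht => hz.inside t ⟨by linarith [ht.1], by linarith [ht.2]⟩)
    ((s₅ u (hball u5)).of_le (Nat.le_succ _)) ((s₆ u (hball u6)).of_le (Nat.le_succ _)) (by
      filter_upwards [q₃, q₉] with p p1 p2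
      exact ⟨by linarith, p2.le⟩) (by
      filter_upwards [q₄, q₀] with p p1 p2
      exact ⟨p2, by linarith⟩)
  exact ⟨_, (h₁.comp H.small h₂ (s₇ u ⟨hu0, u7⟩)).comp H.small h₃ (s₈ u ⟨hu0, u8⟩)⟩

end SteepFamily

namespace SteepFamily

variable {d n : ℕ} {S : SteepFamily d n} {r k : ℕ} {i j : Fin n} {ε : ℝ} {x : Pos d}
  {ν : Fin n → ℝ → ℝ} {Dε Dint : ℝ → Set (Pos d)} {b : ℝ → ℝ≥0} {z₀ : Phase d} {T₀ T : ℝ}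
  {τ : ℝ → ℝ × Phase d → ℝ}

theorem Approximates.tendsto_levelDepth (H : S.Approximates r ν Dε Dint b) (i : Fin n) :
    Tendsto (S.levelDepth ν i) (𝓝[>] 0) (𝓝 0) := H.tendsto_level i

/-! ### Conservation of energy -/

theorem OrbitIn.energy_eq (hV : S.IsPotential r) (hε : ε ∈ Ioo 0 S.ε₀) {A : Set (Pos d)}
    {ρ ρ' : Phase d} (h : S.OrbitIn ε A ρ ρ') :
    ‖ρ'.2‖ ^ 2 / 2 + S.V ρ'.1 ε = ‖ρ.2‖ ^ 2 / 2 + S.V ρ.1 ε := by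
  obtain ⟨τ, hτ, γ, hγ, rfl, rfl, -⟩ := h
  have hd : ∀ t ∈ Icc 0 τ, HasDerivWithinAt (fun t => ‖(γ t).2‖ ^ 2 / 2 + S.V (γ t).1 ε) 0
      (Icc 0 τ) t := by
    intro t ht
    obtain ⟨h1, h2⟩ := hγ t ht
    have hq : HasDerivWithinAt (fun t => (γ t).1) _ (Icc 0 τ) t := h2.fst
    have hp : HasDerivWithinAt (fun t => (γ t).2) _ (Icc 0 τ) t := h2.snd
    have hc : ContDiffAt ℝ (r + 1) (fun q => S.V q ε) (γ t).1 :=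
      (hV.contDiffOn ε hε).contDiffAt (hV.isOpen_dom.mem_nhds h1)
    have hV' : HasFDerivAt (fun q => S.V q ε) (fderiv ℝ (fun q => S.V q ε) (γ t).1) (γ t).1 :=
      (hc.differentiableAt (by simp)).hasFDerivAt
    have h3 : HasDerivWithinAt (fun t => S.V (γ t).1 ε)
        (fderiv ℝ (fun q => S.V q ε) (γ t).1 (γ t).2) (Icc 0 τ) t :=
      hV'.comp_hasDerivWithinAt (f := fun t => (γ t).1) t hq
    refine ((hp.norm_sq.div_const 2).add h3).congr_deriv ?_
    rw [← inner_gradient, inner_neg_right, real_inner_comm]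
    ring
  refine constant_of_has_deriv_right_zero (fun t ht => (hd t ht).continuousWithinAt)
    (fun t ht => ?_) τ ⟨hτ.le, le_rfl⟩
  exact (hd t ⟨ht.1, ht.2.le⟩).mono_of_mem_nhdsWithin
    (mem_of_superset (Icc_mem_nhdsGE ht.2) (Icc_subset_Icc_left ht.1))

/-! ### The normals -/

theorem BoundaryLevels.sign_ne_zero (h : S.BoundaryLevels r) (i : Fin n) : S.σ i ≠ 0 := by
  rcases h.sign i with h | h <;> rw [h] <;> norm_num

theorem normal_eq_gradient_depth (h : S.BoundaryLevels r) {q : Pos d}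
    (hQ : DifferentiableAt ℝ (fun y => S.Q y ε) q) :
    S.normal i ε q = ‖gradient (S.depth i ε) q‖⁻¹ • gradient (S.depth i ε) q := by
  rw [gradient_depth _ _ _ hQ, norm_smul, Real.norm_eq_abs, h.abs_sign, one_mul, smul_smul, normal,
    div_eq_inv_mul]

theorem IsAdmissible.limitGradient_ne (hS : S.IsAdmissible r) (hx : x ∈ S.Γ i \ S.cornerSet r) :
    S.limitGradient i x ≠ 0 := smul_ne_zero (hS.levels.sign_ne_zero i) (hS.gradient_ne hx)

theorem IsAdmissible.eventually_normal (hS : S.IsAdmissible r) (hx : x ∈ S.Γ i \ S.cornerSet r) :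
    ∀ᶠ p in 𝓝[>] (0 : ℝ) ×ˢ 𝓝 x, gradient (S.depth i p.1) p.2 ≠ 0 ∧
      S.normal i p.1 p.2 = ‖gradient (S.depth i p.1) p.2‖⁻¹ • gradient (S.depth i p.1) p.2 := by
  filter_upwards [(hS.tendsto_gradient_depth hx).eventually_ne (hS.limitGradient_ne hx),
    hS.differentiableAt_pattern (hS.mem_dom hx)] with p p1 p2
  exact ⟨p1, normal_eq_gradient_depth hS.levels p2⟩

/-! ### The straight line of a regular flight -/

/-- The map that follows a line to the level surface of depth `α ε`. -/
def hitMap (τ : ℝ → ℝ × Phase d → ℝ) (α : ℝ → ℝ) (ε : ℝ) (Z : Phase d) : Phase d :=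
  linePoint (τ ε (α ε, Z)) Z

theorem Approximates.eventually_line_interior (H : S.Approximates r ν Dε Dint b)
    (hz : S.IsRegularFlight r j i z₀ T) (hi : S.IsLevelTime i k z₀ T τ) :
    ∀ᶠ p : ℝ × Phase d in 𝓝[>] (0 : ℝ) ×ˢ 𝓝 z₀, S.depth j p.1 p.2.1 = S.levelDepth ν j p.1 →
      ∀ t ∈ Ioo 0 (τ p.1 (S.levelDepth ν i p.1, p.2)), (linePoint t p.2).1 ∈ interior (Dε p.1) := by
  have hT := hz.pos
  have hxj : (linePoint 0 z₀).1 ∈ S.Γ j \ S.cornerSet r := by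
    rw [linePoint_zero]; exact hz.start_mem
  have haj : 0 < inner ℝ (S.limitGradient j (linePoint 0 z₀).1) z₀.2 := by
    rw [linePoint_zero]; exact hz.start_angle
  have tl : ∀ T₀, Tendsto (fun p : ℝ × (ℝ × Phase d) => (p.1, (linePoint p.2.1 p.2.2).1))
      (𝓝[>] (0 : ℝ) ×ˢ 𝓝 (T₀, z₀)) (𝓝[>] (0 : ℝ) ×ˢ 𝓝 (linePoint T₀ z₀).1) := fun T₀ =>
    tendsto_fst.prodMk ((continuous_linePoint.fst.tendsto (T₀, z₀)).comp tendsto_snd)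
  obtain ⟨ρ₁, hρ₁, m₁⟩ := H.adm.exists_monotone_depth hxj (c := 1) (by simpa using haj)
  obtain ⟨ρ₂, hρ₂, m₂⟩ := H.adm.exists_monotone_depth hz.end_mem (c := -1)
    (by simpa using hz.end_angle)
  obtain ⟨ρ₃, hρ₃, r₁⟩ := eventually_prod_nhds_ball ((tl 0).eventually
    (H.adm.eventually_region hxj H.region))
  obtain ⟨ρ₄, hρ₄, r₂⟩ := eventually_prod_nhds_ball ((tl T).eventually
    (H.adm.eventually_region hz.end_mem H.region))
  set s := min ρ₁ ρ₃ with hs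
  set s' := min ρ₂ ρ₄ with hs'
  have hs0 : 0 < s := lt_min hρ₁ hρ₃
  have hs0' : 0 < s' := lt_min hρ₂ hρ₄
  obtain ⟨ρ, hρ, htube⟩ := exists_interior_tube (t₀ := s / 2) (t₁ := T - s' / 2) (z₀ := z₀)
    isOpen_interior (U := interior S.D)
    (fun t ht => hz.inside t ⟨by linarith [ht.1], by linarith [ht.2]⟩)
  set K : Set (Pos d) := (fun y : ℝ × Phase d => (linePoint y.1 y.2).1) ''
    (Icc (s / 2) (T - s' / 2) ×ˢ Metric.closedBall z₀ ρ) with hK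
  have hKc : IsCompact K := (isCompact_Icc.prod (isCompact_closedBall z₀ ρ)).image
    continuous_linePoint.fst
  have hKD : K ⊆ interior S.D := by
    rintro _ ⟨y, hy, rfl⟩
    exact htube _ hy.1 _ hy.2
  have tτ := (hi.tendsto_param (H.tendsto_levelDepth i)).eventually
    (Ioo_mem_nhds (a := T - s') (b := T + s') (by linarith) (by linarith))
  filter_upwards [m₁.prod_inl _, m₂.prod_inl _, r₁.prod_inl _, r₂.prod_inl _, tτ,
    (H.eventually_interior hKc hKD).prod_inl _, eventually_mem_ball_prod (𝓝[>] (0 : ℝ)) z₀ hs0,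
    eventually_mem_ball_prod (𝓝[>] (0 : ℝ)) z₀ hs0', eventually_mem_ball_prod (𝓝[>] (0 : ℝ)) z₀ hρ,
    (tendsto_prodMk_param (H.tendsto_levelDepth i) z₀).eventually hi.level]
    with p p1 p2 p3 p4 p5 p6 p7 p8 p9 p0 hp t ht
  rcases lt_or_ge t s with h1 | h1
  · have hb : (t, p.2) ∈ Metric.ball ((0 : ℝ), z₀) ρ₃ := by
      rw [← ball_prod_same, Real.ball_eq_Ioo]
      exact ⟨⟨by linarith [ht.1], by linarith [h1.trans_le (min_le_right _ _)]⟩,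
        Metric.ball_subset_ball (min_le_right _ _) p7⟩
    refine (p3 _ hb).1 ?_
    have := p1 p.2 (Metric.ball_subset_ball (min_le_left _ _) p7)
      (a := 0) (b := t) ⟨by linarith, by linarith⟩
      ⟨by linarith [ht.1], by linarith [h1.trans_le (min_le_left _ _)]⟩ ht.1
    simp only [one_mul, linePoint_zero] at this
    rw [hp] at this
    exact this
  · rcases le_or_gt t (T - s' / 2) with h2 | h2
    · exact p6 ⟨(t, p.2), ⟨⟨by linarith, h2⟩, Metric.ball_subset_closedBall p9⟩, rfl⟩
    · have htT : t < T + s' := ht.2.trans p5.2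
      have hb : (t, p.2) ∈ Metric.ball (T, z₀) ρ₄ := by
        rw [← ball_prod_same, Real.ball_eq_Ioo]
        have h3 : s' ≤ ρ₄ := min_le_right _ _
        exact ⟨⟨by linarith, by linarith⟩, Metric.ball_subset_ball (min_le_right _ _) p8⟩
      refine (p4 _ hb).1 ?_
      have h3 : s' ≤ ρ₂ := min_le_left _ _
      have := p2 p.2 (Metric.ball_subset_ball (min_le_left _ _) p8) (a := t)
        (b := τ p.1 (S.levelDepth ν i p.1, p.2)) ⟨by linarith, by linarith⟩
        ⟨by linarith [p5.1], by linarith [p5.2]⟩ ht.2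
      simp only [neg_one_mul] at this
      rw [show S.depth i p.1 (linePoint (τ p.1 (S.levelDepth ν i p.1, p.2)) p.2).1 = _ from p0]
        at this
      change S.levelDepth ν i p.1 < S.depth i p.1 (linePoint t p.2).1
      linarith

/-! ### The first-order correction of the flight -/

theorem hasFDerivAt_hitMap {α : ℝ → ℝ} {Z : Phase d}
    (hlev : ∀ᶠ y in 𝓝 Z, S.depth i ε (hitMap τ α ε y).1 = α ε)
    (hτ : DifferentiableAt ℝ (fun y => τ ε (α ε, y)) Z)
    (hD : DifferentiableAt ℝ (S.depth i ε) (hitMap τ α ε Z).1)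
    (hne : inner ℝ (gradient (S.depth i ε) (hitMap τ α ε Z).1) Z.2 ≠ 0) (v : Phase d) :
    DifferentiableAt ℝ (hitMap τ α ε) Z ∧ fderiv ℝ (hitMap τ α ε) Z v =
      (v.1 + τ ε (α ε, Z) • v.2 - (inner ℝ (gradient (S.depth i ε) (hitMap τ α ε Z).1)
        (v.1 + τ ε (α ε, Z) • v.2) / inner ℝ (gradient (S.depth i ε) (hitMap τ α ε Z).1) Z.2) • Z.2,
      v.2) := by
  have hq : HasFDerivAt (fun y : Phase d => y.1 + τ ε (α ε, y) • y.2) _ Z :=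
    hasFDerivAt_fst.add (hτ.hasFDerivAt.fun_smul hasFDerivAt_snd)
  have h1 : HasFDerivAt (hitMap τ α ε) _ Z := hq.prodMk hasFDerivAt_snd
  have h2 := hD.hasFDerivAt.comp Z hq
  have h3 : fderiv ℝ (S.depth i ε ∘ fun y : Phase d => y.1 + τ ε (α ε, y) • y.2) Z = 0 := by
    have : S.depth i ε ∘ (fun y : Phase d => y.1 + τ ε (α ε, y) • y.2) =ᶠ[𝓝 Z] fun _ => α ε := hlev
    rw [this.fderiv_eq]
    simp
  rw [h2.fderiv] at h3
  have h4 := congrArg (fun L => L v) h3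
  simp only [ContinuousLinearMap.comp_apply, zero_apply, ← inner_gradient] at h4
  refine ⟨h1.differentiableAt, ?_⟩
  rw [h1.fderiv]
  simp only [ContinuousLinearMap.prod_apply, add_apply,
    ContinuousLinearMap.coe_fst', ContinuousLinearMap.coe_snd', Prod.mk.injEq, and_true,
    smul_apply, ContinuousLinearMap.smulRight_apply] at h4 ⊢
  rw [← add_assoc, inner_add_right _ _ (_ • Z.2), inner_smul_right] at h4
  have h5 : fderiv ℝ (fun y => τ ε (α ε, y)) Z v = -(inner ℝ (gradient (S.depth i ε)
      (hitMap τ α ε Z).1) (v.1 + τ ε (α ε, Z) • v.2) /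
      inner ℝ (gradient (S.depth i ε) (hitMap τ α ε Z).1) Z.2) := by
    rw [eq_neg_iff_add_eq_zero, ← sub_eq_zero]
    field_simp
    change inner ℝ (gradient (S.depth i ε) (hitMap τ α ε Z).1) (v.1 + τ ε (α ε, Z) • v.2) + _ *
      inner ℝ (gradient (S.depth i ε) (hitMap τ α ε Z).1) Z.2 = 0 at h4
    linarith
  rw [h5, neg_smul]
  abel

end SteepFamily

namespace SteepFamily

variable {d n : ℕ} {S : SteepFamily d n} {r k : ℕ} {i j : Fin n} {ε : ℝ} {x : Pos d}
  {ν : Fin n → ℝ → ℝ} {Dε Dint : ℝ → Set (Pos d)} {b : ℝ → ℝ≥0} {z₀ : Phase d} {T₀ T : ℝ}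
  {τ : ℝ → ℝ × Phase d → ℝ}

/-! ### The flight map and its approximation -/

/-- `F` is the flight map of the smooth flow, `F₀` the one of the billiard and `F₁` the first-order
correction, near a regular flight. -/
structure FlightApprox (S : SteepFamily d n) (k : ℕ) (ν : Fin n → ℝ → ℝ) (Dε : ℝ → Set (Pos d))
    (b : ℝ → ℝ≥0) (j i : Fin n) (z₀ : Phase d) (T : ℝ) (F F₀ F₁ : ℝ → Phase d → Phase d) :
    Prop where
  ckBigO : CkBigO (𝓝[>] (0 : ℝ) ×ˢ 𝓝 z₀) (k + 1) F (fun _ => 1)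
  ckBigO_free : CkBigO (𝓝[>] (0 : ℝ) ×ˢ 𝓝 z₀) (k + 1) F₀ (fun _ => 1)
  close : CkBigO (𝓝[>] (0 : ℝ) ×ˢ 𝓝 z₀) (k + 1) (fun ε z => F ε z - F₀ ε z) b
  first : CkBigO (𝓝[>] (0 : ℝ) ×ˢ 𝓝 z₀) k F₁ b
  second : CkBigO (𝓝[>] (0 : ℝ) ×ˢ 𝓝 z₀) k (fun ε z => F ε z - F₀ ε z - F₁ ε z)
    (fun ε => b ε ^ 2)
  tendsto : Tendsto (fun p : ℝ × Phase d => F p.1 p.2) (𝓝[>] (0 : ℝ) ×ˢ 𝓝 z₀)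
    (𝓝 (linePoint T z₀))
  tendsto_free : Tendsto (fun p : ℝ × Phase d => F₀ p.1 p.2) (𝓝[>] (0 : ℝ) ×ˢ 𝓝 z₀)
    (𝓝 (linePoint T z₀))
  level : ∀ᶠ p in 𝓝[>] (0 : ℝ) ×ˢ 𝓝 z₀, S.depth i p.1 (F p.1 p.2).1 = S.levelDepth ν i p.1
  free : ∀ᶠ p in 𝓝[>] (0 : ℝ) ×ˢ 𝓝 z₀, p.2 ∈ S.crossSection j p.1 (Dε p.1) →
    freeFlight (Dε p.1) p.2 = F₀ p.1 p.2 ∧ S.flightCorrection p.1 (Dε p.1) p.2 = F₁ p.1 p.2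
  hit : ∀ᶠ p in 𝓝[>] (0 : ℝ) ×ˢ 𝓝 z₀, p.2 ∈ S.crossSection j p.1 (Dε p.1) →
    IsLeast (hitTimes (Dε p.1) p.2) (freeTime (Dε p.1) p.2) ∧
    S.Q (freeFlight (Dε p.1) p.2).1 p.1 = S.Qc i + S.invBarrier i (ν i p.1) p.1 ∧
    inner ℝ p.2.2 (S.normal i p.1 (freeFlight (Dε p.1) p.2).1) < 0
  flight : ∀ᶠ p in 𝓝[>] (0 : ℝ) ×ˢ 𝓝 z₀, p.2 ∈ S.crossSection j p.1 (Dε p.1) →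
    S.SmoothFlight p.1 (Dε p.1) p.2 (F p.1 p.2) ∧
    ‖(F p.1 p.2).2‖ ^ 2 / 2 + S.V (F p.1 p.2).1 p.1 = 1 / 2

theorem timeCorrection_eq {A : Set (Pos d)} {ρ : Phase d} (h : S.BoundaryLevels r) (i : Fin n)
    (hQ : DifferentiableAt ℝ (fun y => S.Q y ε) (freeFlight A ρ).1) :
    S.timeCorrection ε A ρ = inner ℝ (gradient (S.depth i ε) (freeFlight A ρ).1)
      (∫ s in (0 : ℝ)..freeTime A ρ,
        (freeTime A ρ - s) • gradient (fun x => S.V x ε) (ρ.1 + s • ρ.2)) /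
    inner ℝ (gradient (S.depth i ε) (freeFlight A ρ).1) ρ.2 := by
  rw [gradient_depth _ _ _ hQ, real_inner_smul_left, real_inner_smul_left,
    mul_div_mul_left _ _ (h.sign_ne_zero i), timeCorrection]

/-- The explicit first-order correction of the flight is the derivative of the hitting map applied
to the first-order displacement of the line. -/
theorem flightCorrection_eq {A : Set (Pos d)} {α : ℝ → ℝ} {Z : Phase d} (h : S.BoundaryLevels r)
    (hlev : ∀ᶠ y in 𝓝 Z, S.depth i ε (hitMap τ α ε y).1 = α ε)
    (hτ : DifferentiableAt ℝ (fun y => τ ε (α ε, y)) Z)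
    (hQ : DifferentiableAt ℝ (fun y => S.Q y ε) (hitMap τ α ε Z).1)
    (hD : DifferentiableAt ℝ (S.depth i ε) (hitMap τ α ε Z).1)
    (hne : inner ℝ (gradient (S.depth i ε) (hitMap τ α ε Z).1) Z.2 ≠ 0)
    (hfree : freeTime A Z = τ ε (α ε, Z))
    (hint : IntervalIntegrable (fun t => S.lineForce ε t Z) MeasureTheory.volume 0 (τ ε (α ε, Z))) :
    S.flightCorrection ε A Z = fderiv ℝ (hitMap τ α ε) Z
      (∫ t in (0 : ℝ)..τ ε (α ε, Z), S.lineForce ε t Z) := by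
  have hff : freeFlight A Z = hitMap τ α ε Z := by rw [freeFlight, hfree]; rfl
  rw [(hasFDerivAt_hitMap hlev hτ hD hne _).2, flightCorrection,
    timeCorrection_eq h i (by rw [hff]; exact hQ), hff, hfree]
  set t₁ := τ ε (α ε, Z) with ht₁
  set g : ℝ → Pos d := fun s => gradient (fun x => S.V x ε) (Z.1 + s • Z.2) with hg
  have i1 : IntervalIntegrable (fun s => s • g s) MeasureTheory.volume 0 t₁ :=
    ⟨(ContinuousLinearMap.fst ℝ (Pos d) (Pos d)).integrable_comp hint.1,
      (ContinuousLinearMap.fst ℝ (Pos d) (Pos d)).integrable_comp hint.2⟩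
  have i2' : IntervalIntegrable (fun s => -g s) MeasureTheory.volume 0 t₁ :=
    ⟨(ContinuousLinearMap.snd ℝ (Pos d) (Pos d)).integrable_comp hint.1,
      (ContinuousLinearMap.snd ℝ (Pos d) (Pos d)).integrable_comp hint.2⟩
  have i2 : IntervalIntegrable g MeasureTheory.volume 0 t₁ := by
    have := i2'.neg
    rwa [show -(fun s => -g s) = g from funext fun s => neg_neg _] at this
  have e1 : (∫ t in (0 : ℝ)..t₁, S.lineForce ε t Z).1 = ∫ s in (0 : ℝ)..t₁, s • g s :=
    ((ContinuousLinearMap.fst ℝ (Pos d) (Pos d)).intervalIntegral_comp_comm hint).symm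
  have e2 : (∫ t in (0 : ℝ)..t₁, S.lineForce ε t Z).2 = -∫ s in (0 : ℝ)..t₁, g s := by
    rw [← intervalIntegral.integral_neg]
    exact ((ContinuousLinearMap.snd ℝ (Pos d) (Pos d)).intervalIntegral_comp_comm hint).symm
  have e3 : ∫ s in (0 : ℝ)..t₁, (s - t₁) • g s =
      (∫ s in (0 : ℝ)..t₁, s • g s) - t₁ • ∫ s in (0 : ℝ)..t₁, g s := by
    simp only [sub_smul]
    have i3 : IntervalIntegrable (fun s => t₁ • g s) MeasureTheory.volume 0 t₁ := i2.smul t₁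
    rw [intervalIntegral.integral_sub i1 i3, intervalIntegral.integral_smul]
  have e4 : ∫ s in (0 : ℝ)..t₁, (t₁ - s) • g s =
      -((∫ s in (0 : ℝ)..t₁, s • g s) - t₁ • ∫ s in (0 : ℝ)..t₁, g s) := by
    rw [← e3, ← intervalIntegral.integral_neg]
    simp only [← neg_smul, neg_sub]
  rw [e1, e2, e3, e4, smul_neg, ← sub_eq_add_neg, inner_neg_right, neg_div, neg_smul]
  simp only [Prod.mk.injEq, and_true]
  abel

theorem Approximates.exists_flightApprox (H : S.Approximates (k + 1) ν Dε Dint b)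
    (hz : S.IsRegularFlight (k + 1) j i z₀ T) :
    ∃ F F₀ F₁, S.FlightApprox k ν Dε b j i z₀ T F F₀ F₁ := by
  have hS := H.adm
  have hxj : (linePoint 0 z₀).1 ∈ S.Γ j \ S.cornerSet (k + 1) := by
    rw [linePoint_zero]; exact hz.start_mem
  have haj : 0 < inner ℝ (S.limitGradient j (linePoint 0 z₀).1) z₀.2 := by
    rw [linePoint_zero]; exact hz.start_angle
  obtain ⟨τj, hj⟩ := hS.exists_isLevelTime hxj rfl haj.ne'
  obtain ⟨τi, hi⟩ := hS.exists_isLevelTime hz.end_mem rfl hz.end_angle.ne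
  obtain ⟨G, hG⟩ := H.exists_flight hz hj hi
  set α := S.levelDepth ν i with hα
  have tα : Tendsto α (𝓝[>] 0) (𝓝 0) := H.tendsto_levelDepth i
  have hτ : CkBigO (𝓝[>] (0 : ℝ) ×ˢ 𝓝 z₀) (k + 1 + 1) (fun ε z => τi ε (α ε, z)) (fun _ => 1) :=
    hi.ckBigO_param tα
  have tτ := hi.tendsto_param tα
  have hid : CkBigO (𝓝[>] (0 : ℝ) ×ˢ 𝓝 z₀) (k + 1 + 1) (fun _ z => z) (fun _ => 1) := ckBigO_id
  have hhit : CkBigO (𝓝[>] (0 : ℝ) ×ˢ 𝓝 z₀) (k + 1 + 1) (hitMap τi α) (fun _ => 1) :=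
    (hid.fst.add (hτ.smul hid.snd).mul_one_right).prodMk hid.snd
  have thit : Tendsto (fun p : ℝ × Phase d => hitMap τi α p.1 p.2) (𝓝[>] (0 : ℝ) ×ˢ 𝓝 z₀)
      (𝓝 (linePoint T z₀)) := tendsto_linePoint tτ tendsto_snd
  have tG := tendsto_of_near_id H.small hG.close
  have G1 := ckBigO_one_of_near_id H.small hG.close
  have tG' : Tendsto (fun p : ℝ × Phase d => (p.1, G p.1 p.2)) (𝓝[>] (0 : ℝ) ×ˢ 𝓝 z₀)
      (𝓝[>] (0 : ℝ) ×ˢ 𝓝 z₀) := tendsto_fst.prodMk tG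
  have hlev : ∀ᶠ p in 𝓝[>] (0 : ℝ) ×ˢ 𝓝 z₀, S.depth i p.1 (hitMap τi α p.1 p.2).1 = α p.1 :=
    (tendsto_prodMk_param tα z₀).eventually hi.level
  have hF : CkBigO (𝓝[>] (0 : ℝ) ×ˢ 𝓝 z₀) (k + 1) (fun ε z => hitMap τi α ε (G ε z))
      (fun _ => 1) := (hhit.of_le (Nat.le_succ _)).comp_nhds G1 tendsto_fst tG
  have hclose : CkBigO (𝓝[>] (0 : ℝ) ×ˢ 𝓝 z₀) (k + 1)
      (fun ε z => hitMap τi α ε (G ε z) - hitMap τi α ε z) b :=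
    (hhit.ckLip.comp_sub G1 (hid.of_le (Nat.le_succ _)) hG.close tendsto_fst tG
      tendsto_snd).one_mul_left
  set Z₁ : ℝ → Phase d → Phase d := fun ε z => ∫ t in τj ε (S.levelDepth ν j ε, z)..τi ε (α ε, z),
    S.lineForce ε t z with hZ₁
  have hDhit : CkBigO (𝓝[>] (0 : ℝ) ×ˢ 𝓝 z₀) (k + 1) (fun ε => fderiv ℝ (hitMap τi α ε))
      (fun _ => 1) := hhit.fderiv
  have happ : ∀ {m : ℕ} {f : ℝ → Phase d → Phase d} {c : ℝ → ℝ≥0}, m ≤ k + 1 →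
      CkBigO (𝓝[>] (0 : ℝ) ×ˢ 𝓝 z₀) m f c →
      CkBigO (𝓝[>] (0 : ℝ) ×ˢ 𝓝 z₀) m (fun ε z => fderiv ℝ (hitMap τi α ε) z (f ε z)) c :=
    fun hm hf => ((hDhit.of_le hm).bilin (ContinuousLinearMap.id ℝ (Phase d →L[ℝ] Phase d))
      hf).one_mul_left
  have hfirst : CkBigO (𝓝[>] (0 : ℝ) ×ˢ 𝓝 z₀) k
      (fun ε z => fderiv ℝ (hitMap τi α ε) z (Z₁ ε z)) b :=
    happ (Nat.le_succ k) (hG.first.of_le (Nat.le_succ k))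
  have htaylor : CkBigO (𝓝[>] (0 : ℝ) ×ˢ 𝓝 z₀) k (fun ε z => hitMap τi α ε (G ε z) -
      hitMap τi α ε z - fderiv ℝ (hitMap τi α ε) z (G ε z - z)) (fun ε => b ε ^ 2) :=
    ((hDhit.ckLip).comp_taylor hhit.differentiableAt (G1.of_le (Nat.le_succ k))
      ((hid.of_le (Nat.le_succ _)).of_le (Nat.le_succ _)) (hG.close.of_le (Nat.le_succ k))
      tendsto_fst tG tendsto_snd).one_mul_left
  have hsecond : CkBigO (𝓝[>] (0 : ℝ) ×ˢ 𝓝 z₀) k (fun ε z => hitMap τi α ε (G ε z) -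
      hitMap τi α ε z - fderiv ℝ (hitMap τi α ε) z (Z₁ ε z)) (fun ε => b ε ^ 2) := by
    refine (htaylor.add (happ (Nat.le_succ k) hG.second)).congr (Eventually.of_forall fun p => ?_)
    simp only [hZ₁, map_sub]
    abel
  have tD := (tendsto_fst.prodMk thit.fst_nhds)
  have tstart : Tendsto (fun p : ℝ × Phase d => (p.1, p.2.1)) (𝓝[>] (0 : ℝ) ×ˢ 𝓝 z₀)
      (𝓝[>] (0 : ℝ) ×ˢ 𝓝 z₀.1) := tendsto_fst.prodMk tendsto_snd.fst_nhds
  have tj : Tendsto (fun p : ℝ × Phase d => (p.1, ((S.levelDepth ν j p.1, p.2), (0 : ℝ))))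
      (𝓝[>] (0 : ℝ) ×ˢ 𝓝 z₀) (𝓝[>] (0 : ℝ) ×ˢ 𝓝 (((0 : ℝ), z₀), (0 : ℝ))) :=
    tendsto_fst.prodMk ((((H.tendsto_levelDepth j).comp tendsto_fst).prodMk_nhds
      tendsto_snd).prodMk_nhds tendsto_const_nhds)
  have hstart : ∀ᶠ p in 𝓝[>] (0 : ℝ) ×ˢ 𝓝 z₀, p.2 ∈ S.crossSection j p.1 (Dε p.1) →
      S.depth j p.1 p.2.1 = S.levelDepth ν j p.1 ∧ τj p.1 (S.levelDepth ν j p.1, p.2) = 0 := by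
    filter_upwards [tstart.eventually (hS.eventually_region hz.start_mem H.region),
      tj.eventually hj.unique] with p p1 p2 hp
    have h1 : S.depth j p.1 p.2.1 = S.levelDepth ν j p.1 := p1.2.2.1 hp.1
    refine ⟨h1, (p2 ?_).symm⟩
    simp only [linePoint_zero]
    exact h1
  have hfront : ∀ᶠ p in 𝓝[>] (0 : ℝ) ×ˢ 𝓝 z₀, (hitMap τi α p.1 p.2).1 ∈ frontier (Dε p.1) := by
    filter_upwards [tD.eventually (hS.eventually_region hz.end_mem H.region), hlev] with p p1 p2
    exact p1.2.2.2 p2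
  have htime : ∀ᶠ p in 𝓝[>] (0 : ℝ) ×ˢ 𝓝 z₀, p.2 ∈ S.crossSection j p.1 (Dε p.1) →
      IsLeast (hitTimes (Dε p.1) p.2) (τi p.1 (α p.1, p.2)) := by
    filter_upwards [hstart, hfront, tτ.eventually_const_lt hz.pos,
      H.eventually_line_interior hz hi] with p p1 p2 p3 p4 hp
    refine ⟨⟨p3, p2⟩, fun t ht => ?_⟩
    by_contra! hlt
    exact ht.2.2 (p4 (p1 hp).1 t ⟨ht.1, hlt⟩)
  have hangle : ∀ᶠ p in 𝓝[>] (0 : ℝ) ×ˢ 𝓝 z₀,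
      inner ℝ (gradient (S.depth i p.1) (hitMap τi α p.1 p.2).1) p.2.2 < 0 :=
    (tendsto_prodMk_param tα z₀).eventually
      ((hS.ckBigO_levelForce hz.end_mem rfl hz.end_angle.ne hi).2.eventually_lt_const hz.end_angle)
  refine ⟨fun ε z => hitMap τi α ε (G ε z), hitMap τi α, fun ε z => fderiv ℝ (hitMap τi α ε) z
    (Z₁ ε z), hF, hhit.of_le (Nat.le_succ _), hclose, hfirst, hsecond, ?_, thit, tG'.eventually hlev,
    ?_, ?_, ?_⟩
  · exact Tendsto.comp (g := fun p : ℝ × Phase d => hitMap τi α p.1 p.2) thit tG'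
  · filter_upwards [hstart, htime, hangle, SpreadFilter.spread _ hlev, hτ.differentiableAt,
      tD.eventually (hS.differentiableAt_pattern (hS.mem_dom hz.end_mem)),
      tD.eventually (hS.ckLip_depth hz.end_mem).1.differentiableAt, hG.integrable]
      with p p1 p2 p3 p4 p5 p6 p7 p8 hp
    have hfree : freeTime (Dε p.1) p.2 = τi p.1 (α p.1, p.2) := (p2 hp).csInf_eq
    rw [(p1 hp).2] at p8
    refine ⟨by rw [freeFlight, hfree]; rfl, ?_⟩
    rw [flightCorrection_eq hS.levels p4 p5 p6 p7 p3.ne hfree p8]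
    simp only [hZ₁, (p1 hp).2]
  · filter_upwards [htime, hangle, hlev, tD.eventually (hS.eventually_normal hz.end_mem)]
      with p p2 p3 p4 p5 hp
    have hfree : freeTime (Dε p.1) p.2 = τi p.1 (α p.1, p.2) := (p2 hp).csInf_eq
    have hff : freeFlight (Dε p.1) p.2 = hitMap τi α p.1 p.2 := by rw [freeFlight, hfree]; rfl
    rw [hfree, hff, p5.2]
    refine ⟨p2 hp, ?_, ?_⟩
    · have := hS.levels.sub_eq i p.1 (hitMap τi α p.1 p.2).1
      rw [p4, hα, levelDepth, ← mul_assoc, hS.levels.sign_mul_self, one_mul] at this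
      linarith
    · rw [real_inner_smul_right, real_inner_comm]
      exact mul_neg_of_pos_of_neg (inv_pos.2 (norm_pos_iff.2 p5.1)) p3
  · filter_upwards [hstart, hG.orbit, tG'.eventually hfront, hS.eventually_param.prod_inl _]
      with p p1 p2 p3 p4 hp
    rw [(p1 hp).2, linePoint_zero] at p2
    refine ⟨smoothFlight_iff.2 ⟨p2, p3⟩, ?_⟩
    rw [← hp.2.1]
    exact p2.energy_eq hS.potential p4

end SteepFamily

/-! ### The mean of a curve -/

section Mean

variable {E F : Type} [NormedAddCommGroup E] [NormedSpace ℝ E] [CompleteSpace E]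
  [NormedAddCommGroup F] [NormedSpace ℝ F] [CompleteSpace F]

/-- The mean of a curve. -/
def meanCurve : Curve E →L[ℝ] E := (evalCurve 1).comp (curvePrim 1)

theorem curveVal_one_curve (s : ℝ) : curveVal (1 : Curve ℝ) s = 1 := rfl

theorem curvePrim_one_apply (Y : Curve E) (t : unitInterval) :
    curvePrim 1 Y t = ∫ s in (0 : ℝ)..t, curveVal Y s := by
  simp [curvePrim_apply, curveVal_one_curve]

theorem meanCurve_apply (Y : Curve E) : meanCurve Y = ∫ s in (0 : ℝ)..1, curveVal Y s :=
  curvePrim_one_apply Y 1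

theorem curvePrim_one_const (x : E) (t : unitInterval) :
    curvePrim 1 (constCurve x) t = (t : ℝ) • x := by
  simp [curvePrim_one_apply, curveVal]

theorem meanCurve_const (x : E) : meanCurve (constCurve x) = x := by
  simp [meanCurve_apply, curveVal]

theorem meanCurve_map (L : E →L[ℝ] F) {Y : Curve E} {Y' : Curve F} (h : ∀ t, Y' t = L (Y t)) :
    meanCurve Y' = L (meanCurve Y) := by
  rw [meanCurve_apply, meanCurve_apply, ← L.intervalIntegral_comp_comm
    ((continuous_curveVal Y).intervalIntegrable _ _)]
  exact intervalIntegral.integral_congr fun s _ => h _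

end Mean

/-! ### The reflection in a boundary layer -/

section Reflection

variable {d : ℕ} {l : Filter ℝ} {k : ℕ} {b : ℝ → ℝ≥0} {N : ℝ → Pos d → Pos d} {f : ℝ → ℝ → ℝ}
  {z₀ : Phase d} {g₀ : Pos d}

/-- The coefficient of `g` in the reflection of `p` in the direction `g`. -/
def reflectCoeff (y : Pos d × Pos d) : ℝ := -2 * inner ℝ y.1 y.2 / ‖y.2‖ ^ 2

/-- The reflection of `y.1` in the direction `y.2`. -/
def reflectVec (y : Pos d × Pos d) : Pos d := y.1 + reflectCoeff y • y.2

theorem contDiffAt_reflectCoeff {m : WithTop ℕ∞} {y : Pos d × Pos d} (hy : y.2 ≠ 0) :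
    ContDiffAt ℝ m reflectCoeff y := by
  unfold reflectCoeff
  refine (contDiffAt_const.mul (contDiffAt_fst.inner ℝ contDiffAt_snd)).div
    (contDiffAt_snd.norm_sq ℝ) ?_
  exact pow_ne_zero 2 (norm_ne_zero_iff.2 hy)

theorem contDiffAt_reflectVec {m : WithTop ℕ∞} {y : Pos d × Pos d} (hy : y.2 ≠ 0) :
    ContDiffAt ℝ m reflectVec y :=
  contDiffAt_fst.add ((contDiffAt_reflectCoeff hy).smul contDiffAt_snd)

theorem norm_reflectVec {y : Pos d × Pos d} (hy : y.2 ≠ 0) : ‖reflectVec y‖ = ‖y.1‖ := by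
  have h1 : ‖y.2‖ ^ 2 ≠ 0 := pow_ne_zero 2 (norm_ne_zero_iff.2 hy)
  rw [← sq_eq_sq₀ (norm_nonneg _) (norm_nonneg _), reflectVec, norm_add_sq_real,
    real_inner_smul_right, norm_smul, mul_pow, Real.norm_eq_abs, sq_abs, reflectCoeff]
  field_simp
  ring

/-- The momentum along a passage through the boundary layer, in a normalised time, that starts with
the momentum `z.2`, for the direction field `N` along the curve `Y`. -/
def layerMomentum (N : Pos d → Pos d) (z : Phase d) (Y : Curve (Pos d)) : Curve (Pos d) :=
  constCurve z.2 + reflectCoeff (z.2, meanCurve (nemytskii N Y)) • curvePrim 1 (nemytskii N Y)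

/-- The velocity in normalised time for the momentum `y.2`. -/
def layerVelocity (f : ℝ → ℝ) (y : ℝ × Pos d) : Pos d := (y.1 * f ((1 - ‖y.2‖ ^ 2) / 2)) • y.2

/-- The displacement along a passage through the boundary layer. -/
def layerDisplacement (N : Pos d → Pos d) (f : ℝ → ℝ) (z : Phase d) (Y : Curve (Pos d)) :
    Curve (Pos d) :=
  curvePrim 1 (nemytskii (layerVelocity f)
    (curvePair (constCurve (reflectCoeff (z.2, meanCurve (nemytskii N Y))), layerMomentum N z Y)))

theorem ckBigO_layerVelocity (hf : ∀ w, CkBigO (l ×ˢ 𝓝 w) k f b) (y : ℝ × Pos d) :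
    CkBigO (l ×ˢ 𝓝 y) k (fun ε => layerVelocity (f ε)) b := by
  have h1 : CkBigO (l ×ˢ 𝓝 y) k (fun _ (y : ℝ × Pos d) => (1 - ‖y.2‖ ^ 2) / 2) (fun _ => 1) :=
    ckBigO_of_contDiffAt ((contDiffAt_const.sub (contDiffAt_snd.norm_sq ℝ)).div_const 2)
  have t1 : Tendsto (fun p : ℝ × (ℝ × Pos d) => (1 - ‖p.2.2‖ ^ 2) / 2) (l ×ˢ 𝓝 y)
      (𝓝 ((1 - ‖y.2‖ ^ 2) / 2)) := by
    have : Continuous fun y : ℝ × Pos d => (1 - ‖y.2‖ ^ 2) / 2 := by fun_prop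
    exact (this.tendsto y).comp tendsto_snd
  have h2 : CkBigO (l ×ˢ 𝓝 y) k (fun ε (y : ℝ × Pos d) => f ε ((1 - ‖y.2‖ ^ 2) / 2)) b :=
    (hf _).comp_nhds h1 tendsto_fst t1
  have h3 : CkBigO (l ×ˢ 𝓝 y) k (fun _ (y : ℝ × Pos d) => y.1) (fun _ => 1) :=
    ckBigO_of_contDiffAt contDiffAt_fst
  have h4 : CkBigO (l ×ˢ 𝓝 y) k (fun _ (y : ℝ × Pos d) => y.2) (fun _ => 1) :=
    ckBigO_of_contDiffAt contDiffAt_snd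
  exact ((h3.smul h2).one_mul_left.smul h4).mul_one_right

/-- The ingredients of the passage through the boundary layer depend smoothly on the initial point
and on the curve of positions. -/
theorem ckBigO_layer (hN : CkBigO (l ×ˢ 𝓝 z₀.1) k N fun _ => 1)
    (tN : Tendsto (fun p : ℝ × Pos d => N p.1 p.2) (l ×ˢ 𝓝 z₀.1) (𝓝 g₀)) (hg : g₀ ≠ 0) :
    (CkBigO (l ×ˢ 𝓝 (z₀, constCurve z₀.1)) k
      (fun ε (y : Phase d × Curve (Pos d)) => reflectCoeff (y.1.2, meanCurve (nemytskii (N ε) y.2)))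
      (fun _ => 1) ∧
    CkBigO (l ×ˢ 𝓝 (z₀, constCurve z₀.1)) k
      (fun ε (y : Phase d × Curve (Pos d)) => layerMomentum (N ε) y.1 y.2) (fun _ => 1)) ∧
    (Tendsto (fun p : ℝ × (Phase d × Curve (Pos d)) =>
      reflectCoeff (p.2.1.2, meanCurve (nemytskii (N p.1) p.2.2)))
      (l ×ˢ 𝓝 (z₀, constCurve z₀.1)) (𝓝 (reflectCoeff (z₀.2, g₀))) ∧
    Tendsto (fun p : ℝ × (Phase d × Curve (Pos d)) => layerMomentum (N p.1) p.2.1 p.2.2)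
      (l ×ˢ 𝓝 (z₀, constCurve z₀.1))
      (𝓝 (constCurve z₀.2 + reflectCoeff (z₀.2, g₀) • curvePrim 1 (constCurve g₀)))) := by
  have tY : Tendsto (fun p : ℝ × (Phase d × Curve (Pos d)) => (p.1, p.2.2))
      (l ×ˢ 𝓝 (z₀, constCurve z₀.1)) (l ×ˢ 𝓝 (constCurve z₀.1 : Curve (Pos d))) :=
    tendsto_fst.prodMk ((continuous_snd.tendsto (z₀, constCurve z₀.1)).comp tendsto_snd)
  have tp : Tendsto (fun p : ℝ × (Phase d × Curve (Pos d)) => p.2.1.2)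
      (l ×ˢ 𝓝 (z₀, constCurve z₀.1)) (𝓝 z₀.2) :=
    (continuous_fst.snd.tendsto (z₀, constCurve z₀.1)).comp tendsto_snd
  have hY : CkBigO (l ×ˢ 𝓝 (z₀, (constCurve z₀.1 : Curve (Pos d)))) k
      (fun _ (y : Phase d × Curve (Pos d)) => y.2) (fun _ => 1) :=
    ckBigO_of_contDiffAt contDiffAt_snd
  have hp : CkBigO (l ×ˢ 𝓝 (z₀, (constCurve z₀.1 : Curve (Pos d)))) k
      (fun _ (y : Phase d × Curve (Pos d)) => y.1.2) (fun _ => 1) :=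
    ckBigO_of_contDiffAt contDiffAt_fst.snd
  have h1 : CkBigO (l ×ˢ 𝓝 (z₀, (constCurve z₀.1 : Curve (Pos d)))) k
      (fun ε (y : Phase d × Curve (Pos d)) => nemytskii (N ε) y.2) (fun _ => 1) :=
    hN.nemytskii_const.comp hY tY
  have t1 : Tendsto (fun p : ℝ × (Phase d × Curve (Pos d)) => nemytskii (N p.1) p.2.2)
      (l ×ˢ 𝓝 (z₀, constCurve z₀.1)) (𝓝 (constCurve g₀)) :=
    Tendsto.comp (g := fun p : ℝ × Curve (Pos d) => nemytskii (N p.1) p.2)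
      (tendsto_nemytskii_const (hN.of_le (Nat.zero_le k)) tN) tY
  have h2 : CkBigO (l ×ˢ 𝓝 (z₀, (constCurve z₀.1 : Curve (Pos d)))) k
      (fun ε (y : Phase d × Curve (Pos d)) => meanCurve (nemytskii (N ε) y.2)) (fun _ => 1) :=
    h1.clm meanCurve
  have t2 : Tendsto (fun p : ℝ × (Phase d × Curve (Pos d)) => meanCurve (nemytskii (N p.1) p.2.2))
      (l ×ˢ 𝓝 (z₀, constCurve z₀.1)) (𝓝 g₀) := by
    have := (meanCurve (E := Pos d)).continuous.tendsto (constCurve g₀)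
    rw [meanCurve_const] at this
    exact this.comp t1
  have h3 : CkBigO (l ×ˢ 𝓝 (z₀, (constCurve z₀.1 : Curve (Pos d)))) k
      (fun ε (y : Phase d × Curve (Pos d)) => curvePrim 1 (nemytskii (N ε) y.2)) (fun _ => 1) :=
    h1.clm (_root_.curvePrim 1)
  have t3 : Tendsto (fun p : ℝ × (Phase d × Curve (Pos d)) => curvePrim 1 (nemytskii (N p.1) p.2.2))
      (l ×ˢ 𝓝 (z₀, constCurve z₀.1)) (𝓝 (curvePrim 1 (constCurve g₀))) :=
    ((curvePrim (E := Pos d) 1).continuous.tendsto (constCurve g₀)).comp t1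
  have hg' : ((z₀.2, g₀) : Pos d × Pos d).2 ≠ 0 := hg
  have h4 : CkBigO (l ×ˢ 𝓝 (z₀, (constCurve z₀.1 : Curve (Pos d)))) k
      (fun ε (y : Phase d × Curve (Pos d)) => reflectCoeff (y.1.2, meanCurve (nemytskii (N ε) y.2)))
      (fun _ => 1) :=
    CkBigO.comp_fixed (contDiffAt_reflectCoeff hg') (hp.prodMk h2) (tp.prodMk_nhds t2)
  have t4 : Tendsto (fun p : ℝ × (Phase d × Curve (Pos d)) =>
      reflectCoeff (p.2.1.2, meanCurve (nemytskii (N p.1) p.2.2)))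
      (l ×ˢ 𝓝 (z₀, constCurve z₀.1)) (𝓝 (reflectCoeff (z₀.2, g₀))) :=
    Tendsto.comp (g := reflectCoeff)
      (contDiffAt_reflectCoeff (m := 0) hg').continuousAt (tp.prodMk_nhds t2)
  refine ⟨⟨h4, hp.constCurve.add (h4.smul h3).mul_one_right⟩, t4, ?_⟩
  exact (((constCurve (E := Pos d)).continuous.tendsto z₀.2).comp tp).add (t4.smul t3)

theorem ckBigO_layerDisplacement (hN : CkBigO (l ×ˢ 𝓝 z₀.1) k N fun _ => 1)
    (tN : Tendsto (fun p : ℝ × Pos d => N p.1 p.2) (l ×ˢ 𝓝 z₀.1) (𝓝 g₀)) (hg : g₀ ≠ 0)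
    (hf : ∀ w, CkBigO (l ×ˢ 𝓝 w) k f b) :
    CkBigO (l ×ˢ 𝓝 (z₀, constCurve z₀.1)) k
      (fun ε (y : Phase d × Curve (Pos d)) => layerDisplacement (N ε) (f ε) y.1 y.2) b := by
  obtain ⟨⟨h1, h2⟩, t1, t2⟩ := ckBigO_layer hN tN hg
  set R := max (‖reflectCoeff (z₀.2, g₀)‖ + 1)
    (‖constCurve z₀.2 + reflectCoeff (z₀.2, g₀) • curvePrim 1 (constCurve g₀)‖ + 1) with hR
  have hC : ∀ᶠ p : ℝ × (Phase d × Curve (Pos d)) in l ×ˢ 𝓝 (z₀, constCurve z₀.1), ∀ t,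
      curvePair (constCurve (reflectCoeff (p.2.1.2, meanCurve (nemytskii (N p.1) p.2.2))),
        layerMomentum (N p.1) p.2.1 p.2.2) t ∈ Metric.closedBall (0 : ℝ × Pos d) R := by
    filter_upwards [t1.norm.eventually_lt_const (lt_add_one _),
      t2.norm.eventually_lt_const (lt_add_one _)] with p p1 p2 t
    rw [mem_closedBall_zero_iff, curvePair_apply, constCurve_apply]
    exact max_le (p1.le.trans (le_max_left _ _))
      (((ContinuousMap.norm_coe_le_norm _ t).trans p2.le).trans (le_max_right _ _))
  have hv : CkBigO (l ×ˢ 𝓝ˢ (Metric.closedBall (0 : ℝ × Pos d) R)) k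
      (fun ε => layerVelocity (d := d) (f ε)) b :=
    ckBigO_nhdsSet_of_isCompact (isCompact_closedBall _ _) fun y _ => ckBigO_layerVelocity hf y
  have h3 : CkBigO (l ×ˢ 𝓝 (z₀, (constCurve z₀.1 : Curve (Pos d)))) k
      (fun ε (y : Phase d × Curve (Pos d)) => curvePair
        (constCurve (reflectCoeff (y.1.2, meanCurve (nemytskii (N ε) y.2))),
          layerMomentum (N ε) y.1 y.2)) (fun _ => 1) := h1.constCurve.curvePair h2
  exact (hv.nemytskii_comp h3 tendsto_fst hC).clm (_root_.curvePrim 1)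

end Reflection

section Reflection

variable {d : ℕ} {l : Filter ℝ} {k : ℕ} {b : ℝ → ℝ≥0} {N : ℝ → Pos d → Pos d} {f : ℝ → ℝ → ℝ}
  {z₀ : Phase d} {g₀ : Pos d}

/-- The phase point in which a passage through the boundary layer along `Y` ends. -/
def layerExit (N : Pos d → Pos d) (z : Phase d) (Y : Curve (Pos d)) : Phase d :=
  (Y 1, reflectVec (z.2, meanCurve (nemytskii N Y)))

/-- The reflection of a phase point in the direction field `N`. -/
def reflectIn (N : Pos d → Pos d) (z : Phase d) : Phase d := (z.1, reflectVec (z.2, N z.1))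

/-- The first-order term of the passage through the boundary layer. -/
def layerFirst (N : Pos d → Pos d) (f : ℝ → ℝ) (z : Phase d) : Phase d :=
  (layerDisplacement N f z (constCurve z.1) 1, fderiv ℝ reflectVec (z.2, N z.1)
    (0, fderiv ℝ N z.1 (meanCurve (layerDisplacement N f z (constCurve z.1)))))

theorem fderiv_nemytskii_const {N : Pos d → Pos d} {x : Pos d} (hN : ContDiffAt ℝ 1 N x)
    (Y : Curve (Pos d)) :
    meanCurve (fderiv ℝ (nemytskii N) (constCurve x) Y) = fderiv ℝ N x (meanCurve Y) := by
  have h1 : ∀ᶠ y in 𝓝 x, DifferentiableAt ℝ N y := by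
    filter_upwards [hN.eventually (by simp)] with y hy using hy.differentiableAt (by simp)
  have h2 : ContinuousAt (fderiv ℝ N) x :=
    (hN.fderiv_right (m := 0) (by simp)).continuousAt
  rw [(hasFDerivAt_nemytskii (Y := constCurve x) (fun _ => h1) fun _ => h2).fderiv]
  refine meanCurve_map _ fun t => ?_
  change nemytskii (fderiv ℝ N) (constCurve x) t (Y t) = _
  rw [nemytskii_apply fun _ => h2]
  rfl

theorem exists_reflection (hN : CkLip l (k + 1) z₀.1 N fun _ => 1)
    (tN : Tendsto (fun p : ℝ × Pos d => N p.1 p.2) (l ×ˢ 𝓝 z₀.1) (𝓝 g₀)) (hg : g₀ ≠ 0)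
    (hf : ∀ w, CkBigO (l ×ˢ 𝓝 w) (k + 1) f b) (hb : Tendsto b l (𝓝 0)) :
    ∃ X : ℝ → Phase d → Curve (Pos d), (∀ᶠ p in l ×ˢ 𝓝 z₀, X p.1 p.2 = constCurve p.2.1 +
        layerDisplacement (N p.1) (f p.1) p.2 (X p.1 p.2)) ∧
      Tendsto (fun p : ℝ × Phase d => X p.1 p.2) (l ×ˢ 𝓝 z₀) (𝓝 (constCurve z₀.1)) ∧
      CkBigO (l ×ˢ 𝓝 z₀) (k + 1)
        (fun ε z => layerExit (N ε) z (X ε z) - reflectIn (N ε) z) b ∧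
      CkBigO (l ×ˢ 𝓝 z₀) k (fun ε z => layerExit (N ε) z (X ε z) - reflectIn (N ε) z -
        layerFirst (N ε) (f ε) z) (fun ε => b ε ^ 2) := by
  obtain ⟨X, hX, tX, X1, Xb, Db, X2⟩ := exists_fixedPoint_perturbation (l := l)
    ((constCurve : Pos d →L[ℝ] Curve (Pos d)).comp (ContinuousLinearMap.fst ℝ (Pos d) (Pos d)))
    (z₀ := z₀) (k := k) (b := b) (ckBigO_layerDisplacement hN.1 tN hg hf) hb
  simp only [ContinuousLinearMap.comp_apply, ContinuousLinearMap.coe_fst'] at hX tX Xb Db X2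
  refine ⟨X, hX, tX, ?_⟩
  have hle := Nat.le_succ k
  have hz : CkBigO (l ×ˢ 𝓝 z₀) (k + 1) (fun _ (z : Phase d) => z) (fun _ => 1) := ckBigO_id
  have C1 : CkBigO (l ×ˢ 𝓝 z₀) (k + 1) (fun _ (z : Phase d) => (constCurve z.1 : Curve (Pos d)))
      (fun _ => 1) := hz.fst.constCurve
  have tC : Tendsto (fun p : ℝ × Phase d => (constCurve p.2.1 : Curve (Pos d))) (l ×ˢ 𝓝 z₀)
      (𝓝 (constCurve z₀.1)) :=
    ((constCurve (E := Pos d)).continuous.tendsto z₀.1).comp tendsto_snd.fst_nhds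
  -- the mean direction
  have m1 : CkBigO (l ×ˢ 𝓝 z₀) (k + 1)
      (fun ε z => nemytskii (N ε) (X ε z) - nemytskii (N ε) (constCurve z.1)) b :=
    (hN.nemytskii.comp_sub X1 C1 Xb tendsto_fst tX tC).one_mul_left
  have hcont : ∀ᶠ p : ℝ × Phase d in l ×ˢ 𝓝 z₀, ContDiffAt ℝ 1 (N p.1) p.2.1 := by
    filter_upwards [(tendsto_fst.prodMk (tendsto_snd (f := l) (g := 𝓝 z₀)).fst_nhds).eventually
      hN.1.contDiffAt] with p hp
    exact hp.of_le (by exact_mod_cast Nat.le_add_left 1 k)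
  have hmc : ∀ᶠ p : ℝ × Phase d in l ×ˢ 𝓝 z₀,
      meanCurve (nemytskii (N p.1) (constCurve p.2.1)) = N p.1 p.2.1 := by
    filter_upwards [hcont] with p hp
    have : nemytskii (N p.1) (constCurve p.2.1) = constCurve (N p.1 p.2.1) := by
      ext1 t
      rw [nemytskii_apply fun _ => hp.continuousAt]
      rfl
    rw [this, meanCurve_const]
  have M0 : CkBigO (l ×ˢ 𝓝 z₀) (k + 1) (fun ε (z : Phase d) => N ε z.1) (fun _ => 1) :=
    hN.1.comp_nhds hz.fst tendsto_fst tendsto_snd.fst_nhds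
  have tM0 : Tendsto (fun p : ℝ × Phase d => N p.1 p.2.1) (l ×ˢ 𝓝 z₀) (𝓝 g₀) :=
    Tendsto.comp (g := fun p : ℝ × Pos d => N p.1 p.2) tN
      (tendsto_fst.prodMk tendsto_snd.fst_nhds)
  have M1 : CkBigO (l ×ˢ 𝓝 z₀) (k + 1) (fun ε z => meanCurve (nemytskii (N ε) (X ε z)))
      (fun _ => 1) :=
    (hN.1.nemytskii_const.comp_nhds X1 tendsto_fst tX).clm meanCurve
  have tM1 : Tendsto (fun p : ℝ × Phase d => meanCurve (nemytskii (N p.1) (X p.1 p.2)))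
      (l ×ˢ 𝓝 z₀) (𝓝 g₀) := by
    have h1 := (meanCurve (E := Pos d)).continuous.tendsto (constCurve g₀)
    rw [meanCurve_const] at h1
    have h2 : Tendsto (fun p : ℝ × Phase d => nemytskii (N p.1) (X p.1 p.2)) (l ×ˢ 𝓝 z₀)
        (𝓝 (constCurve g₀)) :=
      Tendsto.comp (g := fun p : ℝ × Curve (Pos d) => nemytskii (N p.1) p.2)
        (tendsto_nemytskii_const (hN.1.of_le (Nat.zero_le _)) tN) (tendsto_fst.prodMk tX)
    exact h1.comp h2
  have mb : CkBigO (l ×ˢ 𝓝 z₀) (k + 1)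
      (fun ε z => meanCurve (nemytskii (N ε) (X ε z)) - N ε z.1) b := by
    refine (m1.clm meanCurve).congr ?_
    filter_upwards [hmc] with p hp
    rw [map_sub, hp]
  -- its first-order expansion
  have e1 : CkBigO (l ×ˢ 𝓝 z₀) k (fun ε z => nemytskii (N ε) (X ε z) -
      nemytskii (N ε) (constCurve z.1) - fderiv ℝ (nemytskii (N ε)) (constCurve z.1)
        (X ε z - constCurve z.1)) (fun ε => b ε ^ 2) :=
    (hN.nemytskii.fderiv.comp_taylor hN.nemytskii.1.differentiableAt (X1.of_le hle) (C1.of_le hle)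
      (Xb.of_le hle) tendsto_fst tX tC).one_mul_left
  have DN : CkBigO (l ×ˢ 𝓝 z₀) k
      (fun ε (z : Phase d) => fderiv ℝ (nemytskii (N ε)) (constCurve z.1)) (fun _ => 1) :=
    hN.nemytskii.fderiv.1.comp_nhds (C1.of_le hle) tendsto_fst tC
  have e2 : CkBigO (l ×ˢ 𝓝 z₀) k (fun ε (z : Phase d) =>
      fderiv ℝ (nemytskii (N ε)) (constCurve z.1) (X ε z - constCurve z.1 -
        layerDisplacement (N ε) (f ε) z (constCurve z.1))) (fun ε => b ε ^ 2) :=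
    (DN.bilin (ContinuousLinearMap.id ℝ (Curve (Pos d) →L[ℝ] Curve (Pos d))) X2).one_mul_left
  have m2 : CkBigO (l ×ˢ 𝓝 z₀) k (fun ε z => meanCurve (nemytskii (N ε) (X ε z)) - N ε z.1 -
      fderiv ℝ (N ε) z.1 (meanCurve (layerDisplacement (N ε) (f ε) z (constCurve z.1))))
      (fun ε => b ε ^ 2) := by
    refine ((e1.add e2).clm meanCurve).congr ?_
    filter_upwards [hmc, hcont] with p p1 p2
    rw [← fderiv_nemytskii_const p2, ← p1, ← map_sub, ← map_sub]
    congr 1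
    rw [map_sub (fderiv ℝ (nemytskii (N p.1)) (constCurve p.2.1))
      (X p.1 p.2 - constCurve p.2.1)]
    abel
  -- the reflection
  have hg' : ((z₀.2, g₀) : Pos d × Pos d).2 ≠ 0 := hg
  have φ2 : CkBigO (l ×ˢ 𝓝 (z₀.2, g₀)) (k + 1 + 1) (fun _ => reflectVec (d := d)) (fun _ => 1) :=
    ckBigO_of_contDiffAt (contDiffAt_reflectVec hg')
  have A1 : CkBigO (l ×ˢ 𝓝 z₀) (k + 1)
      (fun ε z => (z.2, meanCurve (nemytskii (N ε) (X ε z)))) (fun _ => 1) := hz.snd.prodMk M1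
  have A0 : CkBigO (l ×ˢ 𝓝 z₀) (k + 1)
      (fun ε (z : Phase d) => (z.2, N ε z.1)) (fun _ => 1) := hz.snd.prodMk M0
  have zero : ∀ {m : ℕ} {c : ℝ → ℝ≥0}, CkBigO (l ×ˢ 𝓝 z₀) m (fun _ (_ : Phase d) => (0 : Pos d)) c :=
    CkBigO.const (K := 0) (by simp)
  have Ab : CkBigO (l ×ˢ 𝓝 z₀) (k + 1) (fun ε z =>
      ((z.2, meanCurve (nemytskii (N ε) (X ε z))) : Pos d × Pos d) - (z.2, N ε z.1)) b := by
    refine (zero.prodMk mb).congr (Eventually.of_forall fun p => ?_)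
    simp
  have tA1 := (tendsto_snd (f := l) (g := 𝓝 z₀)).snd_nhds.prodMk_nhds tM1
  have tA0 := (tendsto_snd (f := l) (g := 𝓝 z₀)).snd_nhds.prodMk_nhds tM0
  have v1 : CkBigO (l ×ˢ 𝓝 z₀) (k + 1) (fun ε z =>
      reflectVec (z.2, meanCurve (nemytskii (N ε) (X ε z))) - reflectVec (z.2, N ε z.1)) b :=
    (φ2.ckLip.comp_sub A1 A0 Ab tendsto_fst tA1 tA0).one_mul_left
  have v2 : CkBigO (l ×ˢ 𝓝 z₀) k (fun ε z =>
      reflectVec (z.2, meanCurve (nemytskii (N ε) (X ε z))) - reflectVec (z.2, N ε z.1) -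
        fderiv ℝ reflectVec (z.2, N ε z.1)
          ((z.2, meanCurve (nemytskii (N ε) (X ε z))) - (z.2, N ε z.1))) (fun ε => b ε ^ 2) :=
    (φ2.fderiv.ckLip.comp_taylor φ2.differentiableAt (A1.of_le hle) (A0.of_le hle)
      (Ab.of_le hle) tendsto_fst tA1 tA0).one_mul_left
  have Dφ : CkBigO (l ×ˢ 𝓝 z₀) k (fun ε z => fderiv ℝ reflectVec (z.2, N ε z.1)) (fun _ => 1) :=
    (φ2.fderiv.of_le hle).comp_nhds (A0.of_le hle) tendsto_fst tA0
  have v3 : CkBigO (l ×ˢ 𝓝 z₀) k (fun ε z => fderiv ℝ reflectVec (z.2, N ε z.1)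
      (0, meanCurve (nemytskii (N ε) (X ε z)) - N ε z.1 -
      fderiv ℝ (N ε) z.1 (meanCurve (layerDisplacement (N ε) (f ε) z (constCurve z.1)))))
      (fun ε => b ε ^ 2) :=
    (Dφ.bilin (ContinuousLinearMap.id ℝ (Pos d × Pos d →L[ℝ] Pos d)) (zero.prodMk m2)).one_mul_left
  have q1 : CkBigO (l ×ˢ 𝓝 z₀) (k + 1) (fun ε z => X ε z 1 - z.1) b := Xb.clm (evalCurve 1)
  have q2 : CkBigO (l ×ˢ 𝓝 z₀) k (fun ε z => X ε z 1 - z.1 -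
      layerDisplacement (N ε) (f ε) z (constCurve z.1) 1) (fun ε => b ε ^ 2) := X2.clm (evalCurve 1)
  refine ⟨q1.prodMk v1, (q2.prodMk (v2.add v3)).congr (Eventually.of_forall fun p => ?_)⟩
  simp only [layerExit, reflectIn, layerFirst, Prod.mk_sub_mk, sub_self, Prod.mk.injEq, true_and]
  have : ∀ a c : Pos d, ((0, a - c) : Pos d × Pos d) = (0, a) - (0, c) := fun a c => by simp
  rw [this (meanCurve _ - N p.1 p.2.1), map_sub]
  abel

end Reflection

section Momentum

variable {d : ℕ}

theorem norm_curvePrim_sub_mean_le {Y : Curve (Pos d)} {c : ℝ}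
    (hc : ∀ t, ‖Y t - meanCurve Y‖ ≤ c) (t : unitInterval) :
    ‖curvePrim 1 Y t - (t : ℝ) • meanCurve Y‖ ≤ 2 * c * (t * (1 - t)) ∧
      ‖curvePrim 1 Y t - (t : ℝ) • meanCurve Y‖ ≤ c := by
  have hi : ∀ a b : ℝ, IntervalIntegrable (curveVal Y) MeasureTheory.volume a b := fun a b =>
    (continuous_curveVal Y).intervalIntegrable a b
  have hcv : ∀ a b : ℝ, ‖∫ s in a..b, (curveVal Y s - meanCurve Y)‖ ≤ c * |b - a| := fun a b =>
    intervalIntegral.norm_integral_le_of_norm_le_const fun s _ => hc _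
  have e1 : curvePrim 1 Y t - (t : ℝ) • meanCurve Y =
      ∫ s in (0 : ℝ)..t, (curveVal Y s - meanCurve Y) := by
    rw [intervalIntegral.integral_sub (hi _ _) intervalIntegrable_const, curvePrim_one_apply]
    simp
  have e2 : curvePrim 1 Y t - (t : ℝ) • meanCurve Y =
      -∫ s in (t : ℝ)..1, (curveVal Y s - meanCurve Y) := by
    rw [intervalIntegral.integral_sub (hi _ _) intervalIntegrable_const, curvePrim_one_apply,
      intervalIntegral.integral_const]
    have h1 := intervalIntegral.integral_add_adjacent_intervals (hi 0 t) (hi t 1)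
    rw [← meanCurve_apply] at h1
    rw [eq_sub_of_add_eq h1, sub_smul, one_smul]
    abel
  have h1 := hcv 0 t
  have h2 := hcv t 1
  rw [← e1, sub_zero, abs_of_nonneg t.2.1] at h1
  rw [← norm_neg, ← e2, abs_of_nonneg (sub_nonneg.2 t.2.2)] at h2
  have hc0 : 0 ≤ c := (norm_nonneg _).trans (hc 0)
  have t0 := t.2.1
  have t1 := t.2.2
  refine ⟨?_, h1.trans (mul_le_of_le_one_right hc0 t1)⟩
  rcases le_total (t : ℝ) (1 / 2) with h | h
  · nlinarith [mul_nonneg hc0 t0]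
  · nlinarith [mul_nonneg hc0 (sub_nonneg.2 t1)]

/-- Along the passage through the boundary layer the momentum is smaller than at both ends. -/
theorem norm_momentum_lt {Y : Curve (Pos d)} {p : Pos d} {c s : ℝ}
    (hc : ∀ t, ‖Y t - meanCurve Y‖ ≤ c) (hs : s = reflectCoeff (p, meanCurve Y)) (hs0 : 0 < s)
    (hlt : 2 * c * (2 * ‖p‖ + 2 * s * ‖meanCurve Y‖ + s * c) < s * ‖meanCurve Y‖ ^ 2)
    {t : unitInterval} (t0 : 0 < (t : ℝ)) (t1 : (t : ℝ) < 1) :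
    ‖p + s • curvePrim 1 Y t‖ < ‖p‖ := by
  obtain ⟨h1, h2⟩ := norm_curvePrim_sub_mean_le hc t
  set m := meanCurve Y with hm
  set e := curvePrim 1 Y t - (t : ℝ) • m with he
  have hY : curvePrim 1 Y t = (t : ℝ) • m + e := by rw [he]; abel
  have hm0 : ‖m‖ ^ 2 ≠ 0 := by
    intro h0
    rw [hs, reflectCoeff] at hs0
    simp only [h0, div_zero, lt_irrefl] at hs0
  have hpm : 2 * inner ℝ p m = -(s * ‖m‖ ^ 2) := by
    have h0 : s * ‖m‖ ^ 2 = -2 * inner ℝ p m := by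
      rw [hs, reflectCoeff]
      exact div_mul_cancel₀ _ hm0
    linarith
  have hc0 : 0 ≤ c := (norm_nonneg _).trans (hc 0)
  have i1 := real_inner_le_norm p e
  have i2 := real_inner_le_norm m e
  rw [← sq_lt_sq₀ (norm_nonneg _) (norm_nonneg _), hY, norm_add_sq_real, norm_smul,
    Real.norm_eq_abs, mul_pow, sq_abs, norm_add_sq_real, norm_smul, Real.norm_eq_abs, mul_pow,
    sq_abs, real_inner_smul_right, inner_add_right, real_inner_smul_right, real_inner_smul_left]
  have k1 : 0 < (t : ℝ) * (1 - t) := mul_pos t0 (by linarith)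
  have k2 : ‖e‖ * ‖e‖ ≤ ‖e‖ * c := mul_le_mul_of_nonneg_left h2 (norm_nonneg e)
  have k3 : ‖e‖ * (2 * ‖p‖ + 2 * s * ‖m‖ + s * c) ≤
      (t * (1 - t)) * (2 * c * (2 * ‖p‖ + 2 * s * ‖m‖ + s * c)) := by
    have : 0 ≤ 2 * ‖p‖ + 2 * s * ‖m‖ + s * c := by positivity
    nlinarith [mul_le_mul_of_nonneg_right h1 this]
  have k4 := mul_lt_mul_of_pos_left hlt k1
  have k5 : (t : ℝ) * inner ℝ m e ≤ ‖m‖ * ‖e‖ := by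
    have : (t : ℝ) * inner ℝ m e ≤ t * (‖m‖ * ‖e‖) := mul_le_mul_of_nonneg_left i2 t0.le
    nlinarith [mul_nonneg (norm_nonneg m) (norm_nonneg e)]
  have key : s * (-(t * (1 - t)) * (s * ‖m‖ ^ 2) + 2 * inner ℝ p e + 2 * s * (t * inner ℝ m e) +
      s * ‖e‖ ^ 2) < 0 := by
    refine mul_neg_of_pos_of_neg hs0 ?_
    nlinarith [mul_le_mul_of_nonneg_left k5 hs0.le, mul_le_mul_of_nonneg_left k2 hs0.le]
  have e4 : 2 * (s * (t * inner ℝ p m)) = -(s * t * (s * ‖m‖ ^ 2)) := by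
    rw [show 2 * (s * (t * inner ℝ p m)) = s * t * (2 * inner ℝ p m) by ring, hpm]
    ring
  nlinarith [key, e4]

theorem layerMomentum_apply (N : Pos d → Pos d) (z : Phase d) (Y : Curve (Pos d))
    (t : unitInterval) : layerMomentum N z Y t =
      z.2 + reflectCoeff (z.2, meanCurve (nemytskii N Y)) • curvePrim 1 (nemytskii N Y) t := rfl

theorem layerMomentum_zero (N : Pos d → Pos d) (z : Phase d) (Y : Curve (Pos d)) :
    layerMomentum N z Y 0 = z.2 := by
  simp [layerMomentum_apply]

theorem layerMomentum_one (N : Pos d → Pos d) (z : Phase d) (Y : Curve (Pos d)) :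
    layerMomentum N z Y 1 = reflectVec (z.2, meanCurve (nemytskii N Y)) := rfl

theorem hasDerivWithinAt_layerMomentum {N : Pos d → Pos d} {z : Phase d} {Y : Curve (Pos d)}
    (hN : ∀ t, ContinuousAt N (Y t)) {s : ℝ} (hs : s ∈ Icc (0 : ℝ) 1) :
    HasDerivWithinAt (curveVal (layerMomentum N z Y))
      (reflectCoeff (z.2, meanCurve (nemytskii N Y)) • N (curveVal Y s)) (Icc 0 1) s := by
  have h1 := ((hasDerivWithinAt_curvePrim 1 (nemytskii N Y) hs).const_smul
    (reflectCoeff (z.2, meanCurve (nemytskii N Y)))).const_add z.2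
  rw [curveVal_one_curve, one_smul, curveVal_of_mem _ hs, nemytskii_apply hN,
    ← curveVal_of_mem Y hs] at h1
  exact h1

theorem hasDerivWithinAt_layerDisplacement {N : Pos d → Pos d} {f : ℝ → ℝ} {z : Phase d}
    {Y : Curve (Pos d)} (hf : ∀ t, ContinuousAt f ((1 - ‖layerMomentum N z Y t‖ ^ 2) / 2))
    (hY : Y = constCurve z.1 + layerDisplacement N f z Y) {s : ℝ} (hs : s ∈ Icc (0 : ℝ) 1) :
    HasDerivWithinAt (curveVal Y) (layerVelocity f
      (reflectCoeff (z.2, meanCurve (nemytskii N Y)), curveVal (layerMomentum N z Y) s))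
      (Icc 0 1) s := by
  have e1 : ∀ s, curveVal Y s = z.1 + curveVal (layerDisplacement N f z Y) s := by
    intro s
    conv_lhs => rw [hY]
    rfl
  have h3 := (hasDerivWithinAt_curvePrim 1 (nemytskii (layerVelocity f)
    (curvePair (constCurve (reflectCoeff (z.2, meanCurve (nemytskii N Y))),
      layerMomentum N z Y))) hs).const_add z.1
  have hc : ∀ t, ContinuousAt (layerVelocity (d := d) f)
      (curvePair (constCurve (reflectCoeff (z.2, meanCurve (nemytskii N Y))),
        layerMomentum N z Y) t) := by
    intro t
    rw [curvePair_apply, constCurve_apply]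
    have h1 : ContinuousAt (fun y : ℝ × Pos d => (1 - ‖y.2‖ ^ 2) / 2)
        (reflectCoeff (z.2, meanCurve (nemytskii N Y)), layerMomentum N z Y t) := by fun_prop
    have h2 : ContinuousAt (fun y : ℝ × Pos d => f ((1 - ‖y.2‖ ^ 2) / 2))
        (reflectCoeff (z.2, meanCurve (nemytskii N Y)), layerMomentum N z Y t) :=
      ContinuousAt.comp (g := f) (f := fun y : ℝ × Pos d => (1 - ‖y.2‖ ^ 2) / 2) (hf t) h1
    exact (continuousAt_fst.mul h2).smul continuousAt_snd
  rw [curveVal_one_curve, one_smul, curveVal_of_mem _ hs, nemytskii_apply hc, curvePair_apply,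
    constCurve_apply, ← curveVal_of_mem _ hs] at h3
  exact h3.congr (fun s _ => e1 s) (e1 s)

end Momentum

namespace SteepFamily

variable {d n : ℕ} {S : SteepFamily d n} {r k : ℕ} {i : Fin n} {ε : ℝ} {x : Pos d}
  {ν : Fin n → ℝ → ℝ} {f : ℝ → ℝ} {z : Phase d} {Y : Curve (Pos d)}

/-- The smooth flow through the boundary layer. -/
theorem orbitIn_reflection (hS : S.IsAdmissible r) (hε : ε ∈ Ioo 0 S.ε₀)
    (himg : Icc (ν i ε) (1 / 2) ⊆ (fun s => S.W i s ε) '' Ioo (-S.a) S.a)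
    (hneg : ∀ u ∈ Ioo (-S.a) S.a, S.σ i * deriv (fun s => S.W i s ε) (S.σ i * u) < 0)
    (hfc : ∀ w ∈ Icc (ν i ε) (1 / 2), ContinuousAt f w)
    (hf : ∀ w ∈ Icc (ν i ε) (1 / 2), f w = -(S.σ i * deriv (fun w => S.invBarrier i w ε) w))
    (hY : Y = constCurve z.1 + layerDisplacement (gradient (S.depth i ε)) f z Y)
    (hmem : ∀ t, Y t ∈ S.N i)
    (hs0 : 0 < reflectCoeff (z.2, meanCurve (nemytskii (gradient (S.depth i ε)) Y)))
    (hlt : ∀ t : unitInterval, 0 < (t : ℝ) → (t : ℝ) < 1 →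
      ‖layerMomentum (gradient (S.depth i ε)) z Y t‖ < ‖z.2‖)
    (hν : ‖z.2‖ ^ 2 = 1 - 2 * ν i ε) (hlev : S.depth i ε z.1 = S.levelDepth ν i ε) :
    (∀ t, S.depth i ε (Y t) = S.σ i * S.invBarrier i
      ((1 - ‖layerMomentum (gradient (S.depth i ε)) z Y t‖ ^ 2) / 2) ε) ∧
    ∀ B : Set (Pos d), (∀ t : unitInterval, 0 < (t : ℝ) → (t : ℝ) < 1 → Y t ∈ B) →
      S.OrbitIn ε B z (layerExit (gradient (S.depth i ε)) z Y) := by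
  set N := gradient (S.depth i ε) with hN
  set s₀ := reflectCoeff (z.2, meanCurve (nemytskii N Y)) with hs₀
  set P := layerMomentum N z Y with hP
  have hm0 : meanCurve (nemytskii N Y) ≠ 0 := by
    intro h0
    rw [hs₀, reflectCoeff] at hs0
    simp [h0] at hs0
  have hNd : ∀ t, ContDiffAt ℝ (r + 1) (S.depth i ε) (Y t) := fun t =>
    hS.contDiffAt_depth hε ((hS.barrier.subset i).2 (hmem t))
  have hNc : ∀ t, ContinuousAt N (Y t) := fun t => (contDiffAt_gradient (hNd t)).continuousAt
  have hle : ∀ t, ‖P t‖ ≤ ‖z.2‖ := by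
    intro t
    rcases t.2.1.eq_or_lt with h0 | h0
    · obtain rfl : t = 0 := Subtype.ext h0.symm
      rw [hP, layerMomentum_zero]
    · rcases t.2.2.eq_or_lt with h1 | h1
      · obtain rfl : t = 1 := Subtype.ext h1
        rw [hP, layerMomentum_one, norm_reflectVec (y := (z.2, meanCurve (nemytskii N Y))) hm0]
      · exact (hlt t h0 h1).le
  have hw : ∀ t, (1 - ‖P t‖ ^ 2) / 2 ∈ Icc (ν i ε) (1 / 2) := by
    intro t
    have := pow_le_pow_left₀ (norm_nonneg _) (hle t) 2
    constructor <;> nlinarith [sq_nonneg ‖P t‖]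
  have hdP : ∀ s ∈ Icc (0 : ℝ) 1, HasDerivWithinAt (curveVal P) (s₀ • N (curveVal Y s)) (Icc 0 1) s :=
    fun s hs => hasDerivWithinAt_layerMomentum hNc hs
  have hdY : ∀ s ∈ Icc (0 : ℝ) 1, HasDerivWithinAt (curveVal Y)
      (layerVelocity f (s₀, curveVal P s)) (Icc 0 1) s :=
    fun s hs => hasDerivWithinAt_layerDisplacement (fun t => hfc _ (hw t)) hY hs
  have hinj := hS.injOn_barrierFun hε hneg
  have hsq := hS.levels.sign_mul_self i
  have hY0 : curveVal Y 0 = z.1 := by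
    rw [curveVal_zero]
    have := congrArg (fun Y : Curve (Pos d) => Y 0) hY
    simpa [layerDisplacement, curvePrim_one_apply] using this
  have hP0 : curveVal P 0 = z.2 := by rw [curveVal_zero, hP, layerMomentum_zero]
  -- the depth along the orbit
  have hdiff : ∀ s ∈ Icc (0 : ℝ) 1, HasDerivWithinAt (fun s => S.depth i ε (curveVal Y s) -
      S.σ i * S.invBarrier i ((1 - ‖curveVal P s‖ ^ 2) / 2) ε) 0 (Icc 0 1) s := by
    intro s hs
    have hws := hw ⟨s, hs⟩
    rw [← curveVal_of_mem P hs] at hws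
    have h1 : HasDerivWithinAt (fun s => S.depth i ε (curveVal Y s))
        (fderiv ℝ (S.depth i ε) (curveVal Y s) (layerVelocity f (s₀, curveVal P s))) (Icc 0 1) s := by
      have h0 := ((hNd ⟨s, hs⟩).differentiableAt (by simp)).hasFDerivAt
      rw [← curveVal_of_mem Y hs] at h0
      exact h0.comp_hasDerivWithinAt (f := curveVal Y) s (hdY s hs)
    have h2 : HasDerivWithinAt (fun s => (1 - ‖curveVal P s‖ ^ 2) / 2) _ (Icc 0 1) s :=
      ((hdP s hs).norm_sq.const_sub 1).div_const 2
    have h3 := (hS.contDiffAt_invBarrier hε hinj (himg hws)).2.differentiableAt.hasDerivAt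
    have h4 : HasDerivWithinAt (fun s => S.invBarrier i ((1 - ‖curveVal P s‖ ^ 2) / 2) ε) _
        (Icc 0 1) s := h3.comp_hasDerivWithinAt (h := fun s => (1 - ‖curveVal P s‖ ^ 2) / 2) s h2
    refine (h1.sub (h4.const_mul (S.σ i))).congr_deriv ?_
    rw [← inner_gradient, layerVelocity, hf _ hws, real_inner_smul_right, real_inner_smul_right,
      real_inner_comm]
    ring
  have hdepth : ∀ t, S.depth i ε (Y t) = S.σ i * S.invBarrier i ((1 - ‖P t‖ ^ 2) / 2) ε := by
    intro t
    have := constant_of_has_deriv_right_zero (fun s hs => (hdiff s hs).continuousWithinAt)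
      (fun s hs => (hdiff s ⟨hs.1, hs.2.le⟩).mono_of_mem_nhdsWithin
        (mem_of_superset (Icc_mem_nhdsGE hs.2) (Icc_subset_Icc_left hs.1))) t t.2
    simp only [hY0, hP0, hlev] at this
    rw [curveVal_of_mem Y t.2, curveVal_of_mem P t.2, hν, levelDepth,
      show (1 - (1 - 2 * ν i ε)) / 2 = ν i ε by ring, sub_self] at this
    exact sub_eq_zero.1 this
  refine ⟨hdepth, fun B hB => ?_⟩
  -- the orbit
  have hfb : ∀ t, 0 < f ((1 - ‖P t‖ ^ 2) / 2) ∧ f ((1 - ‖P t‖ ^ 2) / 2) *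
      S.barrierDeriv i ε (S.depth i ε (Y t)) = -1 ∧ S.depth i ε (Y t) ∈ Ioo (-S.a) S.a := by
    intro t
    have hQ := invBarrier_mem (himg (hw t))
    have hu : S.depth i ε (Y t) ∈ Ioo (-S.a) S.a := by
      rw [hdepth]; exact hS.levels.sign_mul_mem i hQ
    have e1 : S.σ i * S.depth i ε (Y t) = S.invBarrier i ((1 - ‖P t‖ ^ 2) / 2) ε := by
      rw [hdepth, ← mul_assoc, hsq, one_mul]
    have h1 := hneg _ hu
    rw [e1] at h1
    have h2 := (hS.contDiffAt_invBarrier hε hinj (himg (hw t))).2.deriv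
    rw [hf _ (hw t), h2, barrierDeriv, e1]
    set W' := deriv (fun s => S.W i s ε) (S.invBarrier i ((1 - ‖P t‖ ^ 2) / 2) ε) with hW'
    have hW0 : W' ≠ 0 := fun h => by simp [h] at h1
    refine ⟨?_, ?_, hu⟩
    · have : S.σ i * W'⁻¹ = (S.σ i * W')⁻¹ := by
        rw [mul_inv, ← eq_inv_of_mul_eq_one_left hsq]
      rw [this, neg_pos]
      exact inv_lt_zero.2 h1
    · field_simp
      nlinarith [hsq]
  set c : Curve ℝ := ⟨fun t => s₀ * f ((1 - ‖P t‖ ^ 2) / 2), by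
    have h1 : Continuous fun t => (1 - ‖P t‖ ^ 2) / 2 := by fun_prop
    exact continuous_const.mul (continuous_iff_continuousAt.2 fun t =>
      ContinuousAt.comp (g := f) (f := fun t => (1 - ‖P t‖ ^ 2) / 2) (hfc _ (hw t))
        h1.continuousAt)⟩ with hc
  have key := orbitIn_of_reparam (S := S) (ε := ε) (A := B)
    (Y := fun s => (curveVal Y s, curveVal P s)) c
    (fun t => mul_pos hs0 (hfb t).1) (fun s hs => by
      change curveVal Y s ∈ S.Dt
      rw [curveVal_of_mem Y hs]; exact (hS.barrier.subset i).2 (hmem _)) (fun s hs => ?_) (fun s hs => by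
      change curveVal Y s ∈ B
      rw [curveVal_of_mem Y (Ioo_subset_Icc_self hs)]; exact hB _ hs.1 hs.2)
  · simp only [hY0, hP0, curveVal_one] at key
    exact key
  · refine ((hdY s hs).prodMk (hdP s hs)).congr_deriv ?_
    rw [curveVal_of_mem c hs, curveVal_of_mem Y hs, curveVal_of_mem P hs, hamField, layerVelocity]
    obtain ⟨f1, f2, f3⟩ := hfb ⟨s, hs⟩
    have hg := hS.gradient_potential hε (hmem ⟨s, hs⟩) f3
    simp only [Prod.smul_mk, Prod.mk.injEq]
    refine ⟨rfl, ?_⟩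
    rw [hg, smul_neg, smul_smul]
    change s₀ • N _ = -((s₀ * f ((1 - ‖P ⟨s, hs⟩‖ ^ 2) / 2) * _) • N _)
    rw [mul_assoc, f2, mul_neg_one, neg_smul, neg_neg]

end SteepFamily

theorem reflectCoeff_pos {d : ℕ} {p g : Pos d} (h : inner ℝ g p < 0) : 0 < reflectCoeff (p, g) := by
  have hg : g ≠ 0 := fun h0 => by simp [h0] at h
  rw [real_inner_comm] at h
  exact div_pos (by linarith) (pow_pos (norm_pos_iff.2 hg) 2)

theorem inner_reflectVec {d : ℕ} {p g : Pos d} (hg : g ≠ 0) :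
    inner ℝ (reflectVec (p, g)) g = -inner ℝ p g := by
  have h1 : ‖g‖ ^ 2 ≠ 0 := pow_ne_zero 2 (norm_ne_zero_iff.2 hg)
  rw [reflectVec, inner_add_left, real_inner_smul_left, real_inner_self_eq_norm_sq, reflectCoeff,
    div_mul_cancel₀ _ h1]
  ring

namespace SteepFamily

variable {d n : ℕ} {S : SteepFamily d n} {r k : ℕ} {i j : Fin n} {ε : ℝ} {x : Pos d}
  {ν : Fin n → ℝ → ℝ} {Dε Dint : ℝ → Set (Pos d)} {b : ℝ → ℝ≥0} {z₀ : Phase d}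

/-! ### The reflection map and its approximation -/

theorem reflect_eq_reflectIn {z : Phase d} (hg : gradient (S.depth i ε) z.1 ≠ 0)
    (hn : S.normal i ε z.1 = ‖gradient (S.depth i ε) z.1‖⁻¹ • gradient (S.depth i ε) z.1) :
    S.reflect i ε z = reflectIn (gradient (S.depth i ε)) z := by
  have h1 : ‖gradient (S.depth i ε) z.1‖ ≠ 0 := norm_ne_zero_iff.2 hg
  rw [reflect, reflectIn, hn, reflectVec, reflectCoeff, real_inner_smul_right, smul_smul,
    sub_eq_add_neg, ← neg_smul]
  congr 3
  field_simp

theorem ckLip_gradient_depth (hS : S.IsAdmissible r) (hx : x ∈ S.Γ i \ S.cornerSet r) :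
    CkLip (𝓝[>] (0 : ℝ)) r x (fun ε => gradient (S.depth i ε)) (fun _ => 1) :=
  ckLip_gradient (hS.ckLip_depth hx)

theorem tendsto_limitGradient (hS : S.IsAdmissible r) (hx : x ∈ S.Γ i \ S.cornerSet r) :
    Tendsto (fun p : ℝ × Pos d => gradient (S.depth i p.1) p.2) (𝓝[>] 0 ×ˢ 𝓝 x)
      (𝓝 (S.limitGradient i x)) := hS.tendsto_gradient_depth hx

/-- The reflection map `R` of the smooth flow near a regular collision; `f` describes the
barrier. -/
structure ReflectionApprox (S : SteepFamily d n) (k : ℕ) (ν : Fin n → ℝ → ℝ)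
    (Dε : ℝ → Set (Pos d)) (b : ℝ → ℝ≥0) (i : Fin n) (z₀ : Phase d) (f : ℝ → ℝ → ℝ)
    (R : ℝ → Phase d → Phase d) : Prop where
  force : ∀ w, CkBigO (𝓝[>] (0 : ℝ) ×ˢ 𝓝 w) (k + 1) f b
  force_eq : ∀ᶠ ε in 𝓝[>] (0 : ℝ), ∀ w ∈ Icc (ν i ε) (1 / 2),
    f ε w = -(S.σ i * deriv (fun w => S.invBarrier i w ε) w)
  close : CkBigO (𝓝[>] (0 : ℝ) ×ˢ 𝓝 z₀) (k + 1) (fun ε z => R ε z - S.reflect i ε z) b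
  second : CkBigO (𝓝[>] (0 : ℝ) ×ˢ 𝓝 z₀) k (fun ε z => R ε z - S.reflect i ε z -
    layerFirst (gradient (S.depth i ε)) (f ε) z) (fun ε => b ε ^ 2)
  reflection : ∀ᶠ p : ℝ × Phase d in 𝓝[>] (0 : ℝ) ×ˢ 𝓝 z₀,
    S.depth i p.1 p.2.1 = S.levelDepth ν i p.1 → ‖p.2.2‖ ^ 2 = 1 - 2 * ν i p.1 →
      S.SmoothReflection p.1 (Dε p.1) p.2 (R p.1 p.2) ∧ R p.1 p.2 ∈ S.crossSection i p.1 (Dε p.1)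

theorem Approximates.eventually_continuousAt_force (H : S.Approximates r ν Dε Dint b) (i : Fin n)
    {f : ℝ → ℝ → ℝ} (hf : ∀ w, CkBigO (𝓝[>] (0 : ℝ) ×ˢ 𝓝 w) k f b) :
    ∀ᶠ ε in 𝓝[>] (0 : ℝ), ∀ w ∈ Icc (ν i ε) (1 / 2), ContinuousAt (f ε) w := by
  obtain ⟨u, hu, v, hv, huv⟩ := eventually_prod_iff.1
    (ckBigO_nhdsSet_of_isCompact (C := Icc (0 : ℝ) (1 / 2)) isCompact_Icc
      fun w _ => hf w).contDiffAt
  filter_upwards [hu, H.ν_pos i] with ε hε hν w hw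
  exact (huv hε (hv.self_of_nhdsSet w ⟨hν.le.trans hw.1, hw.2⟩)).continuousAt

theorem Approximates.exists_reflectionApprox (H : S.Approximates (k + 1) ν Dε Dint b)
    (hx : z₀.1 ∈ S.Γ i \ S.cornerSet (k + 1))
    (ha : inner ℝ (S.limitGradient i z₀.1) z₀.2 < 0) :
    ∃ f R, S.ReflectionApprox k ν Dε b i z₀ f R := by
  have hS := H.adm
  obtain ⟨f₀, hf₀, hfeq⟩ := H.exists_extension i
  set f : ℝ → ℝ → ℝ := fun ε w => -(S.σ i * f₀ ε w) with hf
  have hf1 : ∀ w, CkBigO (𝓝[>] (0 : ℝ) ×ˢ 𝓝 w) (k + 1) f b := fun w =>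
    ((hf₀ w).clm (S.σ i • ContinuousLinearMap.id ℝ ℝ)).neg
  have hf2 : ∀ᶠ ε in 𝓝[>] (0 : ℝ), ∀ w ∈ Icc (ν i ε) (1 / 2),
      f ε w = -(S.σ i * deriv (fun w => S.invBarrier i w ε) w) := by
    filter_upwards [hfeq] with ε hε w hw
    rw [hf, ← hε hw]
  have hN := ckLip_gradient_depth hS hx
  have tN := tendsto_limitGradient hS hx
  have hg := hS.limitGradient_ne hx
  obtain ⟨X, hX, tX, h1, h2⟩ := exists_reflection hN tN hg hf1 H.small
  set g := S.limitGradient i z₀.1 with hgdef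
  set s := reflectCoeff (z₀.2, g) with hs
  have hs0 : 0 < s := reflectCoeff_pos ha
  have t1 : Tendsto (fun p : ℝ × Phase d => (p.1, p.2.1)) (𝓝[>] (0 : ℝ) ×ˢ 𝓝 z₀)
      (𝓝[>] (0 : ℝ) ×ˢ 𝓝 z₀.1) := tendsto_fst.prodMk tendsto_snd.fst_nhds
  have tXp : Tendsto (fun p : ℝ × Phase d => (p.1, X p.1 p.2)) (𝓝[>] (0 : ℝ) ×ˢ 𝓝 z₀)
      (𝓝[>] (0 : ℝ) ×ˢ 𝓝 (constCurve z₀.1 : Curve (Pos d))) := tendsto_fst.prodMk tX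
  have hrefl : ∀ᶠ p in 𝓝[>] (0 : ℝ) ×ˢ 𝓝 z₀,
      reflectIn (gradient (S.depth i p.1)) p.2 = S.reflect i p.1 p.2 := by
    filter_upwards [t1.eventually (hS.eventually_normal hx)] with p hp
    exact (reflect_eq_reflectIn hp.1 hp.2).symm
  refine ⟨f, fun ε z => layerExit (gradient (S.depth i ε)) z (X ε z), hf1, hf2, ?_, ?_, ?_⟩
  · refine h1.congr ?_
    filter_upwards [hrefl] with p hp
    rw [hp]
  · refine h2.congr ?_
    filter_upwards [hrefl] with p hp
    rw [hp]
  -- the limits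
  have tnem : Tendsto (fun p : ℝ × Phase d => nemytskii (gradient (S.depth i p.1)) (X p.1 p.2))
      (𝓝[>] (0 : ℝ) ×ˢ 𝓝 z₀) (𝓝 (constCurve g : Curve (Pos d))) := by
    have h0 : CkBigO (𝓝[>] (0 : ℝ) ×ˢ 𝓝 z₀.1) 0 (fun ε => gradient (S.depth i ε)) (fun _ => 1) :=
      hN.1.of_le (Nat.zero_le _)
    have h3 : Tendsto (fun p : ℝ × Curve (Pos d) => nemytskii (gradient (S.depth i p.1)) p.2)
        (𝓝[>] (0 : ℝ) ×ˢ 𝓝 (constCurve z₀.1 : Curve (Pos d)))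
        (𝓝 (constCurve g : Curve (Pos d))) := tendsto_nemytskii_const h0 tN
    exact Tendsto.comp (f := fun p : ℝ × Phase d => (p.1, X p.1 p.2)) h3 tXp
  have tmean : Tendsto (fun p : ℝ × Phase d =>
      meanCurve (nemytskii (gradient (S.depth i p.1)) (X p.1 p.2)))
      (𝓝[>] (0 : ℝ) ×ˢ 𝓝 z₀) (𝓝 g) := by
    have := (meanCurve (E := Pos d)).continuous.tendsto (constCurve g)
    rw [meanCurve_const] at this
    exact this.comp tnem
  have tp : Tendsto (fun p : ℝ × Phase d => p.2.2) (𝓝[>] (0 : ℝ) ×ˢ 𝓝 z₀) (𝓝 z₀.2) :=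
    tendsto_snd.snd_nhds
  have c1 : ContinuousAt reflectCoeff (z₀.2, g) :=
    (contDiffAt_reflectCoeff (m := 0) (y := (z₀.2, g)) hg).continuousAt
  have c2 : ContinuousAt reflectVec (z₀.2, g) :=
    (contDiffAt_reflectVec (m := 0) (y := (z₀.2, g)) hg).continuousAt
  have tcoeff : Tendsto (fun p : ℝ × Phase d => reflectCoeff (p.2.2,
      meanCurve (nemytskii (gradient (S.depth i p.1)) (X p.1 p.2))))
      (𝓝[>] (0 : ℝ) ×ˢ 𝓝 z₀) (𝓝 s) :=
    c1.tendsto.comp (tp.prodMk_nhds tmean)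
  have tvec : Tendsto (fun p : ℝ × Phase d => reflectVec (p.2.2,
      meanCurve (nemytskii (gradient (S.depth i p.1)) (X p.1 p.2))))
      (𝓝[>] (0 : ℝ) ×ˢ 𝓝 z₀) (𝓝 (reflectVec (z₀.2, g))) :=
    c2.tendsto.comp (tp.prodMk_nhds tmean)
  have tX1 : Tendsto (fun p : ℝ × Phase d => X p.1 p.2 1) (𝓝[>] (0 : ℝ) ×ˢ 𝓝 z₀) (𝓝 z₀.1) :=
    ((evalCurve (E := Pos d) 1).continuous.tendsto (constCurve z₀.1)).comp tX
  have tgX : Tendsto (fun p : ℝ × Phase d => gradient (S.depth i p.1) (X p.1 p.2 1))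
      (𝓝[>] (0 : ℝ) ×ˢ 𝓝 z₀) (𝓝 g) :=
    Tendsto.comp (g := fun p : ℝ × Pos d => gradient (S.depth i p.1) p.2)
      (f := fun p : ℝ × Phase d => (p.1, X p.1 p.2 1)) tN (tendsto_fst.prodMk tX1)
  have tout := tvec.inner (𝕜 := ℝ) tgX
  rw [inner_reflectVec hg] at tout
  have hout := tout.eventually_const_lt (u := 0) (by rw [real_inner_comm]; linarith)
  -- the oscillation of the direction field
  obtain ⟨c, hc0, hc⟩ : ∃ c > 0, 2 * c * (2 * ‖z₀.2‖ + 2 * s * ‖g‖ + s * c) < s * ‖g‖ ^ 2 := by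
    have hcont : Continuous fun c : ℝ => 2 * c * (2 * ‖z₀.2‖ + 2 * s * ‖g‖ + s * c) := by fun_prop
    have h0 := (hcont.tendsto 0).eventually_lt_const (u := s * ‖g‖ ^ 2) (by
      simpa using mul_pos hs0 (pow_pos (norm_pos_iff.2 hg) 2))
    obtain ⟨c, h1, h2⟩ := ((h0.filter_mono nhdsWithin_le_nhds).and
      (self_mem_nhdsWithin (s := Ioi (0 : ℝ)))).exists
    exact ⟨c, h2, h1⟩
  have hosc : ∀ᶠ p : ℝ × Phase d in 𝓝[>] (0 : ℝ) ×ˢ 𝓝 z₀, ∀ t,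
      ‖nemytskii (gradient (S.depth i p.1)) (X p.1 p.2) t -
        meanCurve (nemytskii (gradient (S.depth i p.1)) (X p.1 p.2))‖ ≤ c := by
    filter_upwards [tnem.eventually (Metric.ball_mem_nhds _ (half_pos hc0)),
      tmean.eventually (Metric.ball_mem_nhds _ (half_pos hc0))] with p p1 p2 t
    have e1 := (ContinuousMap.dist_apply_le_dist (f := nemytskii (gradient (S.depth i p.1))
      (X p.1 p.2)) (g := constCurve g) t).trans_lt p1
    rw [← dist_eq_norm]
    refine (dist_triangle_right _ _ g).trans ?_
    rw [constCurve_apply] at e1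
    linarith
  have hineq := ((tendsto_const_nhds (x := 2 * c)).mul (((tp.norm.const_mul 2).add
    ((tcoeff.const_mul 2).mul tmean.norm)).add (tcoeff.mul_const c))).eventually_lt
    (tcoeff.mul (tmean.norm.pow 2)) hc
  have hfc := H.eventually_continuousAt_force i hf1
  have hreg := tXp.eventually (eventually_forall_curve_const
    ((hS.eventually_region hx H.region).and ((hS.eventually_normal hx).and
      ((eventually_of_mem (hS.mem_nbhd hx) fun _ h => h).prod_inr (𝓝[>] (0 : ℝ))))))
  filter_upwards [hX, hineq, hosc, tcoeff.eventually_const_lt hs0, hreg, hfc.prod_inl _,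
    hf2.prod_inl _, hS.eventually_param.prod_inl _, (H.eventually_mem_image i).prod_inl _,
    (hS.eventually_deriv_barrier_neg i).prod_inl _, (H.eventually_level i).prod_inl _,
    (H.tendsto_ν i).eventually_lt_const (u := 1 / 2) (by norm_num) |>.prod_inl _, hout]
    with p p1 p2 p3 p4 p5 p6 p7 p8 p9 p10 p11 p12 p13 hlev hen
  have hm0 : meanCurve (nemytskii (gradient (S.depth i p.1)) (X p.1 p.2)) ≠ 0 := by
    intro h0
    simp [reflectCoeff, h0] at p4
  have hmom : ∀ t : unitInterval, 0 < (t : ℝ) → (t : ℝ) < 1 →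
      ‖layerMomentum (gradient (S.depth i p.1)) p.2 (X p.1 p.2) t‖ < ‖p.2.2‖ := fun t h0 h1 =>
    norm_momentum_lt p3 rfl p4 p2 h0 h1
  obtain ⟨q1, q2⟩ := orbitIn_reflection hS p8 p9 p10 p6 p7 p1 (fun t => (p5 t).2.2) p4 hmom hen hlev
  have hend : ‖layerMomentum (gradient (S.depth i p.1)) p.2 (X p.1 p.2) 1‖ = ‖p.2.2‖ := by
    rw [layerMomentum_one, norm_reflectVec hm0]
  have hd1 : S.depth i p.1 (X p.1 p.2 1) = S.levelDepth ν i p.1 := by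
    rw [q1, hend, hen, levelDepth, show (1 - (1 - 2 * ν i p.1)) / 2 = ν i p.1 by ring]
  have hfr : X p.1 p.2 1 ∈ frontier (Dε p.1) := (p5 1).1.2.2.2 hd1
  refine ⟨smoothReflection_iff.2 ⟨q2 _ fun t h0 h1 => ?_, hfr⟩, hfr, ?_, ?_⟩
  · refine (p5 t).1.2.1 ?_
    change S.depth i p.1 (X p.1 p.2 t) < S.levelDepth ν i p.1
    set w := (1 - ‖layerMomentum (gradient (S.depth i p.1)) p.2 (X p.1 p.2) t‖ ^ 2) / 2 with hw
    have hwν : ν i p.1 < w := by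
      have := pow_lt_pow_left₀ (hmom t h0 h1) (norm_nonneg _) two_ne_zero
      rw [hen] at this
      rw [hw]
      linarith
    have hwI : w ∈ Icc (ν i p.1) (1 / 2) := ⟨hwν.le, by
      rw [hw]
      have := sq_nonneg (‖layerMomentum (gradient (S.depth i p.1)) p.2 (X p.1 p.2) t‖)
      linarith⟩
    have hb : S.barrier i p.1 (S.depth i p.1 (X p.1 p.2 t)) = w := by
      rw [q1, SteepFamily.barrier, ← mul_assoc, hS.levels.sign_mul_self, one_mul,
        apply_invBarrier (p9 hwI)]
    have hmem : S.depth i p.1 (X p.1 p.2 t) ∈ Ioo (-S.a) S.a := by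
      rw [q1]; exact hS.levels.sign_mul_mem i (invBarrier_mem (p9 hwI))
    rw [← (hS.strictAntiOn_barrier p8 p10).lt_iff_gt p11.1 hmem, hb, p11.2]
    exact hwν
  · change ‖reflectVec (p.2.2, meanCurve (nemytskii (gradient (S.depth i p.1)) (X p.1 p.2)))‖ ^ 2 / 2 +
      S.V (X p.1 p.2 1) p.1 = 1 / 2
    rw [norm_reflectVec hm0, hS.potential_eq p8 (p5 1).2.2, hd1, p11.2, hen]
    ring
  · change 0 < inner ℝ (reflectVec (p.2.2,
      meanCurve (nemytskii (gradient (S.depth i p.1)) (X p.1 p.2)))) (S.normal i p.1 (X p.1 p.2 1))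
    rw [(p5 1).2.1.2, real_inner_smul_right]
    exact mul_pos (inv_pos.2 (norm_pos_iff.2 (p5 1).2.1.1)) p13

end SteepFamily

/-! ### The first-order correction of the reflection -/

section Integrals

theorem integral_one_sub_two_mul_of_even {φ : ℝ → ℝ} (h : ∀ u, φ (-u) = φ u)
    (hφ : ContinuousOn φ (Icc (-1) 1)) :
    ∫ s in (0 : ℝ)..1, φ (1 - 2 * s) = ∫ u in (0 : ℝ)..1, φ u := by
  have h1 : IntervalIntegrable φ MeasureTheory.volume (-1) 0 :=
    ContinuousOn.intervalIntegrable_of_Icc (by norm_num)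
      (hφ.mono (Icc_subset_Icc le_rfl (by norm_num)))
  have h2 : IntervalIntegrable φ MeasureTheory.volume 0 1 :=
    ContinuousOn.intervalIntegrable_of_Icc (by norm_num)
      (hφ.mono (Icc_subset_Icc (by norm_num) le_rfl))
  have h3 : ∫ u in (-1 : ℝ)..0, φ u = ∫ u in (0 : ℝ)..1, φ u := by
    have := intervalIntegral.integral_comp_neg (a := (0 : ℝ)) (b := 1) φ
    simp only [h, neg_zero] at this
    exact this.symm
  rw [intervalIntegral.integral_comp_sub_mul φ two_ne_zero 1]
  norm_num
  rw [← intervalIntegral.integral_add_adjacent_intervals h1 h2, h3]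
  ring

theorem integral_one_sub_two_mul_of_odd {φ : ℝ → ℝ} (h : ∀ u, φ (-u) = -φ u) :
    ∫ s in (0 : ℝ)..1, φ (1 - 2 * s) = 0 := by
  have h3 := intervalIntegral.integral_comp_neg (a := (-1 : ℝ)) (b := 1) φ
  simp only [h, neg_neg, intervalIntegral.integral_neg] at h3
  rw [intervalIntegral.integral_comp_sub_mul φ two_ne_zero 1]
  norm_num
  linarith

variable {E : Type} [NormedAddCommGroup E] [NormedSpace ℝ E] [CompleteSpace E]

theorem intervalIntegrable_smul_const {φ : ℝ → ℝ} {a b : ℝ}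
    (h : IntervalIntegrable φ MeasureTheory.volume a b) (v : E) :
    IntervalIntegrable (fun s => φ s • v) MeasureTheory.volume a b :=
  ⟨MeasureTheory.Integrable.smul_const h.1 v, MeasureTheory.Integrable.smul_const h.2 v⟩

theorem meanCurve_curvePrim (Y : Curve E) :
    meanCurve (curvePrim 1 Y) = ∫ s in (0 : ℝ)..1, (1 - s) • curveVal Y s := by
  have h1 : ∀ s ∈ Ioo (0 : ℝ) 1, HasDerivAt (fun s => (s - 1) • curveVal (curvePrim 1 Y) s)
      (curveVal (curvePrim 1 Y) s - (1 - s) • curveVal Y s) s := fun s hs => by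
    have h2 := (hasDerivWithinAt_curvePrim 1 Y ⟨hs.1.le, hs.2.le⟩).hasDerivAt
      (Icc_mem_nhds hs.1 hs.2)
    refine (((hasDerivAt_id s).sub_const 1).fun_smul h2).congr_deriv ?_
    rw [curveVal_one_curve, one_smul, one_smul, ← neg_sub s 1, neg_smul]
    simp [add_comm]
  have h0 : ∀ Z : Curve E, Continuous fun s => (s - 1) • curveVal Z s := fun Z =>
    (continuous_id.sub continuous_const).smul (continuous_curveVal Z)
  have h2 : Continuous fun s => (1 - s) • curveVal Y s :=
    (continuous_const.sub continuous_id).smul (continuous_curveVal Y)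
  have h3 := intervalIntegral.integral_eq_sub_of_hasDerivAt_of_le zero_le_one
    (h0 (curvePrim 1 Y)).continuousOn h1
    (((continuous_curveVal _).sub h2).intervalIntegrable _ _)
  rw [intervalIntegral.integral_sub ((continuous_curveVal _).intervalIntegrable _ _)
    (h2.intervalIntegrable _ _)] at h3
  rw [meanCurve_apply]
  simpa [sub_eq_zero] using h3

end Integrals

section Displacement

variable {d : ℕ}

/-- The first-order displacement along a passage through the boundary layer, and its mean, in terms
of the normal and the tangential component of the momentum. -/
theorem layerDisplacement_const {N : Pos d → Pos d} {f : ℝ → ℝ} {z : Phase d} {m x : Pos d}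
    {c : ℝ} (hN : ContinuousAt N z.1) (hx : inner ℝ x m = 0) (hm : ‖m‖ = 1)
    (hz : z.2 = x + c • m) (hs : reflectCoeff (z.2, N z.1) • N z.1 = (-2 * c) • m)
    (hf : ∀ u ∈ Icc (-1 : ℝ) 1, ContinuousAt f ((1 - ‖x‖ ^ 2 - (c * u) ^ 2) / 2)) :
    layerDisplacement N f z (constCurve z.1) 1 = (reflectCoeff (z.2, N z.1) *
      ∫ u in (0 : ℝ)..1, f ((1 - ‖x‖ ^ 2 - (c * u) ^ 2) / 2)) • x ∧
    (2 : ℝ) • meanCurve (layerDisplacement N f z (constCurve z.1)) = reflectCoeff (z.2, N z.1) •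
      ((∫ u in (0 : ℝ)..1, f ((1 - ‖x‖ ^ 2 - (c * u) ^ 2) / 2)) • x +
        (c * ∫ u in (0 : ℝ)..1, f ((1 - ‖x‖ ^ 2 - (c * u) ^ 2) / 2) * u ^ 2) • m) := by
  set s₀ := reflectCoeff (z.2, N z.1) with hs₀
  set a : ℕ → ℝ → ℝ := fun k u => f ((1 - ‖x‖ ^ 2 - (c * u) ^ 2) / 2) * u ^ k with ha
  have hac : ∀ k, ContinuousOn (a k) (Icc (-1) 1) := fun k u hu =>
    (((hf u hu).comp (f := fun u : ℝ => (1 - ‖x‖ ^ 2 - (c * u) ^ 2) / 2)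
      (by fun_prop)).mul (by fun_prop)).continuousWithinAt
  have hi : ∀ k, IntervalIntegrable (fun s => a k (1 - 2 * s)) MeasureTheory.volume 0 1 := fun k =>
    ContinuousOn.intervalIntegrable_of_Icc zero_le_one ((hac k).comp (by fun_prop) fun s hs =>
      ⟨by linarith [hs.2], by linarith [hs.1]⟩)
  have e0 : ∫ s in (0 : ℝ)..1, a 0 (1 - 2 * s) =
      ∫ u in (0 : ℝ)..1, f ((1 - ‖x‖ ^ 2 - (c * u) ^ 2) / 2) := by
    rw [integral_one_sub_two_mul_of_even (fun u => by simp [ha]) (hac 0)]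
    simp [ha]
  have e1 : ∫ s in (0 : ℝ)..1, a 1 (1 - 2 * s) = 0 :=
    integral_one_sub_two_mul_of_odd fun u => by simp [ha]
  have e2 : ∫ s in (0 : ℝ)..1, a 2 (1 - 2 * s) =
      ∫ u in (0 : ℝ)..1, f ((1 - ‖x‖ ^ 2 - (c * u) ^ 2) / 2) * u ^ 2 :=
    integral_one_sub_two_mul_of_even (fun u => by simp [ha]) (hac 2)
  have hnem : nemytskii N (constCurve z.1) = constCurve (N z.1) := by
    ext1 t
    rw [nemytskii_apply fun _ => hN]
    rfl
  have hmom : ∀ t : unitInterval, layerMomentum N z (constCurve z.1) t =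
      x + (c * (1 - 2 * t)) • m := fun t => by
    rw [layerMomentum_apply, hnem, meanCurve_const, curvePrim_one_const, smul_comm, hs, hz,
      smul_smul, add_assoc, ← add_smul]
    ring_nf
  have hnorm : ∀ v : ℝ, ‖x + v • m‖ ^ 2 = ‖x‖ ^ 2 + v ^ 2 := fun v => by
    rw [norm_add_sq_real, real_inner_smul_right, hx, norm_smul, hm, mul_one, Real.norm_eq_abs,
      sq_abs]
    ring
  set G := nemytskii (layerVelocity f) (curvePair (constCurve (reflectCoeff (z.2,
    meanCurve (nemytskii N (constCurve z.1)))), layerMomentum N z (constCurve z.1))) with hG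
  have hGt : ∀ s ∈ Icc (0 : ℝ) 1, curveVal G s =
      (s₀ * a 0 (1 - 2 * s)) • x + (s₀ * (c * a 1 (1 - 2 * s))) • m := fun s hs' => by
    have hval : ∀ t : unitInterval, curvePair (constCurve (reflectCoeff (z.2,
        meanCurve (nemytskii N (constCurve z.1)))), layerMomentum N z (constCurve z.1)) t =
        (s₀, x + (c * (1 - 2 * t)) • m) := fun t => by
      rw [curvePair_apply, hmom, hnem, meanCurve_const]
      rfl
    rw [curveVal_of_mem _ hs', hG, nemytskii_apply, hval]
    · simp only [layerVelocity, hnorm, ha, smul_add, smul_smul, pow_zero, pow_one, mul_one,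
        ← sub_sub]
      congr 2
      ring
    · intro t
      rw [hval]
      have h1 : ContinuousAt (fun y : ℝ × Pos d => f ((1 - ‖y.2‖ ^ 2) / 2))
          (s₀, x + (c * (1 - 2 * t)) • m) := by
        refine ContinuousAt.comp (g := f) (f := fun y : ℝ × Pos d => (1 - ‖y.2‖ ^ 2) / 2) ?_
          (by fun_prop)
        change ContinuousAt f ((1 - ‖x + (c * (1 - 2 * (t : ℝ))) • m‖ ^ 2) / 2)
        rw [hnorm, ← sub_sub]
        exact hf _ ⟨by linarith [t.2.2], by linarith [t.2.1]⟩
      exact (continuousAt_fst.mul h1).smul continuousAt_snd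
  have hX : layerDisplacement N f z (constCurve z.1) = curvePrim 1 G := rfl
  constructor
  · rw [hX, curvePrim_one_apply]
    simp only [Set.Icc.coe_one]
    rw [intervalIntegral.integral_congr (g := fun s => (s₀ * a 0 (1 - 2 * s)) • x +
      (s₀ * (c * a 1 (1 - 2 * s))) • m) (fun s hs => hGt s (by simpa using hs)),
      intervalIntegral.integral_add (intervalIntegrable_smul_const ((hi 0).const_mul _) x)
        (intervalIntegrable_smul_const (((hi 1).const_mul _).const_mul _) m),
      intervalIntegral.integral_smul_const, intervalIntegral.integral_smul_const,
      intervalIntegral.integral_const_mul, intervalIntegral.integral_const_mul,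
      intervalIntegral.integral_const_mul, e0, e1]
    simp
  · rw [hX, meanCurve_curvePrim, ← intervalIntegral.integral_smul,
      intervalIntegral.integral_congr (g := fun s =>
        (s₀ * (a 0 (1 - 2 * s) + a 1 (1 - 2 * s))) • x +
        (s₀ * (c * (a 1 (1 - 2 * s) + a 2 (1 - 2 * s)))) • m),
      intervalIntegral.integral_add (intervalIntegrable_smul_const (((hi 0).add (hi 1)).const_mul _) x)
        (intervalIntegrable_smul_const ((((hi 1).add (hi 2)).const_mul _).const_mul _) m),
      intervalIntegral.integral_smul_const, intervalIntegral.integral_smul_const,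
      intervalIntegral.integral_const_mul, intervalIntegral.integral_const_mul,
      intervalIntegral.integral_const_mul, intervalIntegral.integral_add (hi 0) (hi 1),
      intervalIntegral.integral_add (hi 1) (hi 2), e0, e1, e2]
    · simp [smul_smul]
    · intro s hs'
      simp only
      rw [hGt s (by simpa using hs'), smul_add, smul_add]
      simp only [smul_smul, ha, pow_zero, pow_one]
      congr 2 <;> ring

end Displacement

namespace SteepFamily

variable {d n : ℕ} {S : SteepFamily d n} {r : ℕ} {i : Fin n} {ε : ℝ}

theorem layerIntegral_eq {f : ℝ → ℝ} {z : Phase d} {ν P : ℝ} (k : ℕ) (hP : 0 ≤ P)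
    (hz : P ^ 2 = 1 - 2 * ν - ‖S.tangentPart i ε z‖ ^ 2)
    (hf : ∀ w ∈ Icc ν (1 / 2), f w = deriv (fun w => S.invBarrier i w ε) w) :
    S.layerIntegral k i ν ε z = 2 * (P ^ (k + 1) *
      ∫ u in (0 : ℝ)..1, f ((1 - ‖S.tangentPart i ε z‖ ^ 2 - (P * u) ^ 2) / 2) * u ^ k) := by
  rw [layerIntegral, ← hz, Real.sqrt_sq hP]
  congr 1
  rcases hP.eq_or_lt with h0 | h0
  · simp [← h0]
  · have h1 := intervalIntegral.integral_comp_mul_left (a := 0) (b := 1) (fun s =>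
      deriv (fun w => S.invBarrier i w ε) ((1 - ‖S.tangentPart i ε z‖ ^ 2 - s ^ 2) / 2) * s ^ k)
      h0.ne'
    rw [mul_zero, mul_one, eq_inv_smul_iff₀ h0.ne'] at h1
    rw [← h1, smul_eq_mul, pow_succ' P k, mul_assoc P]
    refine congrArg (P * ·) ?_
    rw [← intervalIntegral.integral_const_mul]
    refine intervalIntegral.integral_congr fun u hu => ?_
    rw [uIcc_of_le zero_le_one] at hu
    have h2 : u ^ 2 ≤ 1 := pow_le_one₀ hu.1 hu.2
    change _ = P ^ k * (f _ * u ^ k)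
    rw [hf _ ⟨?_, ?_⟩]
    · ring
    · have : (P * u) ^ 2 ≤ P ^ 2 := by
        rw [mul_pow]; exact mul_le_of_le_one_right (sq_nonneg P) h2
      linarith
    · have := sq_nonneg (P * u)
      have := sq_nonneg (‖S.tangentPart i ε z‖)
      linarith

theorem layerFirst_eq_reflectCorrection (hS : S.BoundaryLevels r) {f : ℝ → ℝ} {z : Phase d} {ν : ℝ}
    (hN : ContDiffAt ℝ 1 (gradient (S.depth i ε)) z.1)
    (hn : ∀ᶠ y in 𝓝 z.1, gradient (S.depth i ε) y ≠ 0 ∧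
      S.normal i ε y = ‖gradient (S.depth i ε) y‖⁻¹ • gradient (S.depth i ε) y)
    (hQ : DifferentiableAt ℝ (fun y => S.Q y ε) z.1)
    (ha : inner ℝ (gradient (S.depth i ε) z.1) z.2 < 0) (hz : ‖z.2‖ ^ 2 = 1 - 2 * ν)
    (hf : ∀ w ∈ Icc ν (1 / 2), ContinuousAt f w)
    (hfe : ∀ w ∈ Icc ν (1 / 2), f w = -(S.σ i * deriv (fun w => S.invBarrier i w ε) w)) :
    layerFirst (gradient (S.depth i ε)) f z = S.reflectCorrection i ν ε z := by
  set N := gradient (S.depth i ε) with hNdef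
  set m := S.normal i ε z.1 with hm
  set c := S.normalPart i ε z with hc
  set x := S.tangentPart i ε z with hx
  have hσ := hS.sign_mul_self i
  obtain ⟨hN0, hmN⟩ := hn.self_of_nhds
  rw [← hm] at hmN
  have hg : 0 < ‖N z.1‖ := norm_pos_iff.2 hN0
  have hm1 : ‖m‖ = 1 := by rw [hmN, norm_smul, norm_inv, norm_norm, inv_mul_cancel₀ hg.ne']
  have hcN : inner ℝ (N z.1) z.2 = ‖N z.1‖ * c := by
    rw [hc, normalPart, ← hm, hmN, real_inner_smul_left, mul_inv_cancel_left₀ hg.ne']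
  have hc0 : c < 0 := by
    rw [hcN] at ha
    exact neg_of_mul_neg_right ha hg.le
  have hzx : z.2 = x + c • m := by rw [hx, tangentPart, sub_add_cancel]
  have hxm : inner ℝ x m = 0 := by
    rw [hx, tangentPart, inner_sub_left, real_inner_smul_left, real_inner_self_eq_norm_sq,
      show ‖S.normal i ε z.1‖ = 1 from hm1, normalPart, real_inner_comm]
    ring
  have hs : reflectCoeff (z.2, N z.1) = -2 * c / ‖N z.1‖ := by
    rw [reflectCoeff, real_inner_comm, hcN]
    field_simp
  have hsm : reflectCoeff (z.2, N z.1) • N z.1 = (-2 * c) • m := by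
    rw [hs, hmN, smul_smul, div_eq_mul_inv]
  have hnorm : ‖z.2‖ ^ 2 = ‖x‖ ^ 2 + c ^ 2 := by
    rw [hzx, norm_add_sq_real, real_inner_smul_right, hxm, norm_smul, hm1, mul_one,
      Real.norm_eq_abs, sq_abs]
    ring
  have hP : (-c) ^ 2 = 1 - 2 * ν - ‖x‖ ^ 2 := by linarith [hnorm, neg_sq c]
  have hQy : (S.Qy i ε z.1)⁻¹ = S.σ i / ‖N z.1‖ := by
    have h1 : gradient (fun x => S.Q x ε) z.1 = S.σ i • N z.1 := by
      rw [hNdef, gradient_depth _ _ _ hQ, smul_smul, hσ, one_smul]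
    have h2 : S.Qy i ε z.1 = S.σ i * ‖N z.1‖ := by
      rw [Qy, h1, show S.normal i ε z.1 = m from rfl, hmN, real_inner_smul_left,
        real_inner_smul_right, real_inner_self_eq_norm_sq]
      field_simp
    rw [h2, mul_inv, inv_eq_of_mul_eq_one_left hσ, div_eq_mul_inv]
  obtain ⟨hd, hmean⟩ := layerDisplacement_const (f := f) hN.continuousAt hxm hm1 hzx hsm
    fun u hu => hf _ (by
      have h1 : u ^ 2 ≤ 1 := by rw [sq_le_one_iff_abs_le_one, abs_le]; exact hu
      have h2 : (c * u) ^ 2 ≤ c ^ 2 := by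
        rw [mul_pow]; exact mul_le_of_le_one_right (sq_nonneg c) h1
      have := sq_nonneg (c * u)
      have := sq_nonneg (‖x‖)
      constructor <;> linarith)
  have hfe' : ∀ w ∈ Icc ν (1 / 2), -(S.σ i * f w) = deriv (fun w => S.invBarrier i w ε) w :=
    fun w hw => by rw [hfe w hw, mul_neg, neg_neg, ← mul_assoc, hσ, one_mul]
  set A := fun k : ℕ => ∫ u in (0 : ℝ)..1, f ((1 - ‖x‖ ^ 2 - (c * u) ^ 2) / 2) * u ^ k with hA
  have hI : ∀ k, S.layerIntegral k i ν ε z = -(2 * (-c) ^ (k + 1) * (S.σ i * A k)) := fun k => by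
    rw [layerIntegral_eq k (neg_nonneg.2 hc0.le) hP hfe', hA]
    simp only [neg_mul, neg_sq, intervalIntegral.integral_neg, mul_assoc,
      intervalIntegral.integral_const_mul]
    ring
  have hA0 : ∫ u in (0 : ℝ)..1, f ((1 - ‖x‖ ^ 2 - (c * u) ^ 2) / 2) = A 0 := by simp [hA]
  rw [hA0] at hd hmean
  change (2 : ℝ) • _ = _ • (A 0 • x + (c * A 2) • m) at hmean
  set Y := meanCurve (layerDisplacement N f z (constCurve z.1)) with hY
  -- the derivative of the normal
  have hnd : DifferentiableAt ℝ (S.normal i ε) z.1 := by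
    have h1 : DifferentiableAt ℝ (fun y => ‖N y‖⁻¹ • N y) z.1 :=
      (((hN.differentiableAt (by simp)).norm ℝ hN0).inv hg.ne').smul (hN.differentiableAt (by simp))
    exact h1.congr_of_eventuallyEq (hn.mono fun y hy => hy.2)
  have hort : ∀ v, inner ℝ m (fderiv ℝ (S.normal i ε) z.1 v) = 0 := fun v => by
    have h1 : (fun y => inner ℝ (S.normal i ε y) (S.normal i ε y)) =ᶠ[𝓝 z.1] fun _ => (1 : ℝ) := by
      filter_upwards [hn] with y hy
      rw [real_inner_self_eq_norm_sq, hy.2, norm_smul, norm_inv, norm_norm,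
        inv_mul_cancel₀ (norm_ne_zero_iff.2 hy.1), one_pow]
    have h2 := (hnd.hasFDerivAt.inner ℝ hnd.hasFDerivAt).unique
      ((hasFDerivAt_const (1 : ℝ) z.1).congr_of_eventuallyEq h1)
    have h3 := DFunLike.congr_fun h2 v
    simp only [ContinuousLinearMap.comp_apply, ContinuousLinearMap.prod_apply,
      fderivInnerCLM_apply, zero_apply] at h3
    rw [real_inner_comm m] at h3
    change inner ℝ m _ + inner ℝ m _ = 0 at h3
    linarith
  have hJ : S.vecJ i ν ε z = (2 : ℝ) • fderiv ℝ (S.normal i ε) z.1 Y := by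
    rw [← map_smul, hmean, vecJ, hQy, hI, hI, hs, map_smul, map_add, map_smul, map_smul, ← hc, ← hx,
      ← hm]
    have e1 : S.σ i / ‖N z.1‖ * -(-(2 * (-c) ^ (2 + 1) * (S.σ i * A 2)) / c) =
        -2 * c / ‖N z.1‖ * (c * A 2) := by
      have := hc0.ne
      field_simp
      linear_combination (-(c ^ 3) * A 2) * hσ
    have e2 : S.σ i / ‖N z.1‖ * -(2 * (-c) ^ (0 + 1) * (S.σ i * A 0)) = -(-2 * c / ‖N z.1‖ * A 0) := by
      field_simp
      linear_combination (c * A 0) * hσ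
    rw [smul_sub, smul_add, smul_smul, smul_smul, smul_smul, smul_smul, e1, e2]
    module
  have hder : fderiv ℝ reflectVec (z.2, N z.1) (0, fderiv ℝ N z.1 Y) =
      -(2 * inner ℝ z.2 (fderiv ℝ (S.normal i ε) z.1 Y)) • m -
        (2 * c) • fderiv ℝ (S.normal i ε) z.1 Y := by
    have h1 : HasFDerivAt (fun y => reflectVec (z.2, N y)) ((fderiv ℝ reflectVec (z.2, N z.1)).comp
        ((0 : Pos d →L[ℝ] Pos d).prod (fderiv ℝ N z.1))) z.1 :=
      HasFDerivAt.comp (g := reflectVec) (f := fun y => (z.2, N y)) z.1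
        ((contDiffAt_reflectVec (m := 1) (y := (z.2, N z.1)) hN0).differentiableAt
          (by simp)).hasFDerivAt
        ((hasFDerivAt_const z.2 z.1).prodMk (hN.differentiableAt (by simp)).hasFDerivAt)
    have h2 : (fun y => reflectVec (z.2, N y)) =ᶠ[𝓝 z.1] fun y =>
        z.2 - (2 * inner ℝ z.2 (S.normal i ε y)) • S.normal i ε y := by
      filter_upwards [hn] with y hy
      exact (congrArg Prod.snd (reflect_eq_reflectIn (z := (y, z.2)) hy.1 hy.2)).symm
    have h3 := ((((hasFDerivAt_const z.2 z.1).inner ℝ hnd.hasFDerivAt).const_mul 2).fun_smul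
      hnd.hasFDerivAt).const_sub z.2
    have h4 := DFunLike.congr_fun (h1.unique (h3.congr_of_eventuallyEq h2)) Y
    refine Eq.trans h4 ?_
    simp [fderivInnerCLM_apply]
    rw [hc, normalPart, real_inner_comm z.2 (S.normal i ε z.1), sub_eq_add_neg]
  rw [layerFirst, reflectCorrection]
  refine Prod.ext ?_ ?_
  · change layerDisplacement N f z (constCurve z.1) 1 = _
    rw [hd, div_eq_mul_inv, hQy, hI, hs]
    congr 1
    field_simp
    linear_combination (c * A 0) * hσ
  · change fderiv ℝ reflectVec (z.2, N z.1) (0, fderiv ℝ N z.1 Y) = _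
    rw [hder, hJ, real_inner_smul_right]
    have : inner ℝ x (fderiv ℝ (S.normal i ε) z.1 Y) =
        inner ℝ z.2 (fderiv ℝ (S.normal i ε) z.1 Y) := by
      rw [hzx, inner_add_left, real_inner_smul_left, hort, mul_zero, add_zero]
    rw [this]
    module

end SteepFamily

/-! ### Smoothness of the first-order correction of the reflection -/

section CkLip

variable {α E F G : Type} [NormedAddCommGroup E] [NormedSpace ℝ E]
  [NormedAddCommGroup F] [NormedSpace ℝ F] [NormedAddCommGroup G] [NormedSpace ℝ G]
  {l : Filter α} {k : ℕ} {z : E} {f : α → E → F} {b : α → ℝ≥0}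

theorem CkLip.one_mul_left (h : CkLip l k z f (fun a => 1 * b a)) : CkLip l k z f b := by
  simpa using h

theorem CkLip.comp_fst {y : E × G} (h : CkLip l k y.1 f b) :
    CkLip l k y (fun a (x : E × G) => f a x.1) b := by
  have t1 : Tendsto (fun p : α × (E × G) => (p.1, p.2.1)) (l ×ˢ 𝓝 y) (l ×ˢ 𝓝 y.1) :=
    tendsto_fst.prodMk tendsto_snd.fst_nhds
  have h0 : ∀ k, CkBigO (l ×ˢ 𝓝 y) k (fun _ (x : E × G) => x.1) (fun _ => 1) := fun k =>
    ckBigO_of_contDiffAt contDiffAt_fst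
  induction k generalizing F with
  | zero =>
    refine ⟨h.1.comp_nhds (h0 0) tendsto_fst tendsto_snd.fst_nhds, ?_⟩
    obtain ⟨K, hK⟩ := h.2
    refine ⟨K, ?_⟩
    have t2 : Tendsto (fun p : α × ((E × G) × (E × G)) => (p.1, (p.2.1.1, p.2.2.1)))
        (l ×ˢ 𝓝 (y, y)) (l ×ˢ 𝓝 (y.1, y.1)) := by
      refine tendsto_fst.prodMk (Tendsto.prodMk_nhds ?_ ?_)
      · exact (continuous_fst.fst.tendsto (y, y)).comp tendsto_snd
      · exact (continuous_snd.fst.tendsto (y, y)).comp tendsto_snd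
    filter_upwards [t2.eventually hK] with p hp
    rw [norm_iteratedFDeriv_zero_sub] at hp ⊢
    exact hp.trans (by gcongr; exact norm_fst_le (p.2.1 - p.2.2))
  | succ k ih =>
    refine CkLip.succ (h.1.comp_nhds (h0 _) tendsto_fst tendsto_snd.fst_nhds) ?_
    refine ((ih h.fderiv).clm ((ContinuousLinearMap.compL ℝ (E × G) E F).flip
      (ContinuousLinearMap.fst ℝ E G))).congr ?_
    filter_upwards [t1.eventually h.1.differentiableAt] with p hp
    exact (hp.hasFDerivAt.comp p.2 hasFDerivAt_fst).fderiv.symm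

theorem CkLip.comp_fixed {x₀ : F} {φ : F → G} (h : CkLip l (k + 1) z f (fun _ => 1))
    (hφ : ContDiffAt ℝ (k + 2 : ℕ) φ x₀)
    (ht : Tendsto (fun p : α × E => f p.1 p.2) (l ×ˢ 𝓝 z) (𝓝 x₀)) :
    CkLip l (k + 1) z (fun a x => φ (f a x)) (fun _ => 1) := by
  have h1 : ContDiffAt ℝ (k + 1 : ℕ) (_root_.fderiv ℝ φ) x₀ :=
    hφ.fderiv_right (m := (k + 1 : ℕ)) (by norm_cast)
  refine CkLip.succ (CkBigO.comp_fixed (hφ.of_le (by norm_cast; omega)) h.1 ht) ?_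
  have h2 : CkLip l k z (fun a x => _root_.fderiv ℝ φ (f a x)) (fun _ => 1) :=
    (CkBigO.comp_fixed h1 h.1 ht).ckLip
  refine (h2.bilin (ContinuousLinearMap.compL ℝ E F G) h.fderiv).one_mul_left.congr ?_
  have h3 : ∀ᶠ y in 𝓝 x₀, DifferentiableAt ℝ φ y :=
    ((hφ.of_le (m := (1 : ℕ)) (by norm_cast; omega)).eventually (by simp)).mono fun y hy => hy.differentiableAt (by norm_cast)
  filter_upwards [ht.eventually h3, h.1.differentiableAt] with p p1 p2
  exact (p1.hasFDerivAt.comp p.2 p2.hasFDerivAt).fderiv.symm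

end CkLip

theorem contDiffAt_normalize {d : ℕ} {m : WithTop ℕ∞} {g : Pos d} (hg : g ≠ 0) :
    ContDiffAt ℝ m (fun g : Pos d => ‖g‖⁻¹ • g) g :=
  ((contDiffAt_norm ℝ hg).inv (norm_ne_zero_iff.2 hg)).smul contDiffAt_id

namespace SteepFamily

variable {d n : ℕ} {S : SteepFamily d n} {r k : ℕ} {i j : Fin n} {ε : ℝ} {x : Pos d}
  {ν : Fin n → ℝ → ℝ} {Dε Dint : ℝ → Set (Pos d)} {b : ℝ → ℝ≥0} {z₀ : Phase d}

theorem inv_Qy (hS : S.BoundaryLevels r) {q : Pos d}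
    (hn : S.normal i ε q = ‖gradient (S.depth i ε) q‖⁻¹ • gradient (S.depth i ε) q)
    (hg : gradient (S.depth i ε) q ≠ 0) (hQ : DifferentiableAt ℝ (fun y => S.Q y ε) q) :
    (S.Qy i ε q)⁻¹ = S.σ i * ‖gradient (S.depth i ε) q‖⁻¹ := by
  have hσ := hS.sign_mul_self i
  have h0 : ‖gradient (S.depth i ε) q‖ ≠ 0 := norm_ne_zero_iff.2 hg
  have h1 : gradient (fun x => S.Q x ε) q = S.σ i • gradient (S.depth i ε) q := by
    rw [gradient_depth _ _ _ hQ, smul_smul, hσ, one_smul]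
  have h2 : S.Qy i ε q = S.σ i * ‖gradient (S.depth i ε) q‖ := by
    rw [Qy, h1, hn, real_inner_smul_left, real_inner_smul_right, real_inner_self_eq_norm_sq]
    field_simp
  rw [h2, mul_inv, inv_eq_of_mul_eq_one_left hσ]

theorem IsAdmissible.ckLip_normal (hS : S.IsAdmissible (k + 1))
    (hx : x ∈ S.Γ i \ S.cornerSet (k + 1)) :
    CkLip (𝓝[>] (0 : ℝ)) (k + 1) x (S.normal i) (fun _ => 1) := by
  refine ((ckLip_gradient_depth hS hx).comp_fixed
    (contDiffAt_normalize (hS.limitGradient_ne hx)) (tendsto_limitGradient hS hx)).congr ?_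
  filter_upwards [hS.eventually_normal hx] with p hp
  exact hp.2.symm

theorem IsAdmissible.tendsto_normal (hS : S.IsAdmissible r)
    (hx : x ∈ S.Γ i \ S.cornerSet r) :
    Tendsto (fun p : ℝ × Pos d => S.normal i p.1 p.2) (𝓝[>] 0 ×ˢ 𝓝 x)
      (𝓝 (‖S.limitGradient i x‖⁻¹ • S.limitGradient i x)) := by
  have h1 : ContinuousAt (fun g : Pos d => ‖g‖⁻¹ • g) (S.limitGradient i x) :=
    (contDiffAt_normalize (m := 0) (hS.limitGradient_ne hx)).continuousAt
  refine (h1.tendsto.comp (tendsto_limitGradient hS hx)).congr' ?_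
  filter_upwards [hS.eventually_normal hx] with p hp
  exact hp.2.symm

theorem IsAdmissible.ckLip_reflect (hS : S.IsAdmissible (k + 1))
    (hx : z₀.1 ∈ S.Γ i \ S.cornerSet (k + 1)) :
    CkLip (𝓝[>] (0 : ℝ)) (k + 1) z₀ (S.reflect i) (fun _ => 1) := by
  have hz : CkBigO (𝓝[>] (0 : ℝ) ×ˢ 𝓝 z₀) (k + 1 + 1) (fun _ (z : Phase d) => z) (fun _ => 1) :=
    ckBigO_id
  have hn : CkLip (𝓝[>] (0 : ℝ)) (k + 1) z₀ (fun ε (z : Phase d) => S.normal i ε z.1)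
      (fun _ => 1) := (hS.ckLip_normal hx).comp_fst
  have h1 : CkLip (𝓝[>] (0 : ℝ)) (k + 1) z₀
      (fun ε (z : Phase d) => inner ℝ z.2 (S.normal i ε z.1)) (fun _ => 1) :=
    (hz.snd.ckLip.bilin (innerSL ℝ) hn).one_mul_left
  have h2 : CkLip (𝓝[>] (0 : ℝ)) (k + 1) z₀
      (fun ε (z : Phase d) => (2 * inner ℝ z.2 (S.normal i ε z.1)) • S.normal i ε z.1)
      (fun _ => 1) :=
    ((h1.clm ((2 : ℝ) • ContinuousLinearMap.id ℝ ℝ)).smul hn).one_mul_left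
  exact hz.fst.ckLip.prodMk (hz.snd.ckLip.sub h2)

section Correction

variable (H : S.Approximates (k + 1) ν Dε Dint b) (hx : z₀.1 ∈ S.Γ i \ S.cornerSet (k + 1))
  (ha : inner ℝ (S.limitGradient i z₀.1) z₀.2 < 0)

include H hx

theorem Approximates.ckLip_normalPart :
    CkLip (𝓝[>] (0 : ℝ)) (k + 1) z₀ (S.normalPart i) (fun _ => 1) :=
  (((H.adm.ckLip_normal hx).comp_fst (y := z₀)).bilin (innerSL ℝ)
    (ckBigO_id.snd (k := k + 1 + 1)).ckLip).one_mul_left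

theorem Approximates.ckLip_tangentPart :
    CkLip (𝓝[>] (0 : ℝ)) (k + 1) z₀ (S.tangentPart i) (fun _ => 1) :=
  (ckBigO_id.snd (k := k + 1 + 1)).ckLip.sub
    ((H.ckLip_normalPart hx).smul ((H.adm.ckLip_normal hx).comp_fst (y := z₀))).one_mul_left

theorem Approximates.tendsto_normalPart : Tendsto (fun p : ℝ × Phase d => S.normalPart i p.1 p.2)
    (𝓝[>] 0 ×ˢ 𝓝 z₀) (𝓝 (‖S.limitGradient i z₀.1‖⁻¹ * inner ℝ (S.limitGradient i z₀.1) z₀.2)) := by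
  have t1 : Tendsto (fun p : ℝ × Phase d => S.normal i p.1 p.2.1) (𝓝[>] 0 ×ˢ 𝓝 z₀)
      (𝓝 (‖S.limitGradient i z₀.1‖⁻¹ • S.limitGradient i z₀.1)) :=
    Tendsto.comp (g := fun p : ℝ × Pos d => S.normal i p.1 p.2)
      (f := fun p : ℝ × Phase d => (p.1, p.2.1)) (H.adm.tendsto_normal hx)
      (tendsto_fst.prodMk tendsto_snd.fst_nhds)
  have t2 := t1.inner (𝕜 := ℝ) (tendsto_snd (f := 𝓝[>] (0 : ℝ)) (g := 𝓝 z₀)).snd_nhds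
  rwa [real_inner_smul_left] at t2

theorem Approximates.tendsto_radicand (hz : ‖z₀.2‖ = 1) :
    Tendsto (fun p : ℝ × Phase d => 1 - 2 * ν i p.1 - ‖S.tangentPart i p.1 p.2‖ ^ 2)
      (𝓝[>] 0 ×ˢ 𝓝 z₀)
      (𝓝 ((‖S.limitGradient i z₀.1‖⁻¹ * inner ℝ (S.limitGradient i z₀.1) z₀.2) ^ 2)) := by
  have hS := H.adm
  have t1 := H.tendsto_normalPart hx
  have tp : Tendsto (fun p : ℝ × Phase d => p.2.2) (𝓝[>] (0 : ℝ) ×ˢ 𝓝 z₀) (𝓝 z₀.2) :=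
    tendsto_snd.snd_nhds
  have tν : Tendsto (fun p : ℝ × Phase d => ν i p.1) (𝓝[>] (0 : ℝ) ×ˢ 𝓝 z₀) (𝓝 0) :=
    (H.tendsto_ν i).comp tendsto_fst
  have t2 := (((tendsto_const_nhds (x := (1 : ℝ))).sub (tν.const_mul 2)).sub (tp.norm.pow 2)).add
    (t1.pow 2)
  rw [hz, mul_zero, sub_zero, one_pow, sub_self, zero_add] at t2
  refine t2.congr' ?_
  filter_upwards [(tendsto_fst.prodMk tendsto_snd.fst_nhds).eventually (hS.eventually_normal hx)]
    with p hp
  have h1 : ‖S.normal i p.1 p.2.1‖ = 1 := by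
    rw [hp.2, norm_smul, norm_inv, norm_norm, inv_mul_cancel₀ (norm_ne_zero_iff.2 hp.1)]
  have h2 : ‖S.tangentPart i p.1 p.2‖ ^ 2 = ‖p.2.2‖ ^ 2 - S.normalPart i p.1 p.2 ^ 2 := by
    rw [tangentPart, norm_sub_sq_real, real_inner_smul_right, norm_smul, h1, mul_one,
      Real.norm_eq_abs, sq_abs, normalPart, real_inner_comm]
    ring
  rw [h2]
  ring

include ha

theorem Approximates.ckBigO_layerIntegral (hz : ‖z₀.2‖ = 1) (m : ℕ) :
    CkBigO (𝓝[>] (0 : ℝ) ×ˢ 𝓝 z₀) (k + 1) (fun ε z => S.layerIntegral m i (ν i ε) ε z) b := by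
  obtain ⟨f, hf, hfe⟩ := H.exists_extension i
  have hg := norm_pos_iff.2 (H.adm.limitGradient_ne hx)
  have t1 := H.tendsto_radicand hx hz
  set c := ‖S.limitGradient i z₀.1‖⁻¹ * inner ℝ (S.limitGradient i z₀.1) z₀.2 with hc
  have hc0 : 0 < c ^ 2 := by
    have : c < 0 := mul_neg_of_pos_of_neg (inv_pos.2 hg) ha
    rw [← neg_sq]
    exact pow_pos (neg_pos.2 this) 2
  have X2 : CkBigO (𝓝[>] (0 : ℝ) ×ˢ 𝓝 z₀) (k + 1)
      (fun ε z => ‖S.tangentPart i ε z‖ ^ 2) (fun _ => 1) := by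
    have hX := (H.ckLip_tangentPart hx).1
    exact ((hX.bilin (innerSL ℝ) hX).one_mul_left).congr (Eventually.of_forall fun p =>
      real_inner_self_eq_norm_sq (S.tangentPart i p.1 p.2))
  have cν : CkBigO (𝓝[>] (0 : ℝ) ×ˢ 𝓝 z₀) (k + 1) (fun ε _ => 1 - 2 * ν i ε) (fun _ => 1) := by
    refine CkBigO.const (K := 2) ?_
    have t2 : Tendsto (fun p : ℝ × Phase d => ‖1 - 2 * ν i p.1‖) (𝓝[>] (0 : ℝ) ×ˢ 𝓝 z₀)
        (𝓝 ‖(1 : ℝ) - 2 * 0‖) :=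
      (tendsto_const_nhds.sub (((H.tendsto_ν i).comp tendsto_fst).const_mul 2)).norm
    filter_upwards [t2.eventually_lt_const (u := 2) (by norm_num)] with p hp
    simpa using hp.le
  have P1 : CkBigO (𝓝[>] (0 : ℝ) ×ˢ 𝓝 z₀) (k + 1)
      (fun ε z => Real.sqrt (1 - 2 * ν i ε - ‖S.tangentPart i ε z‖ ^ 2)) (fun _ => 1) :=
    CkBigO.comp_fixed (φ := Real.sqrt) (Real.contDiffAt_sqrt hc0.ne') (cν.sub X2) t1
  have Pm : CkBigO (𝓝[>] (0 : ℝ) ×ˢ 𝓝 z₀) (k + 1)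
      (fun ε z => Real.sqrt (1 - 2 * ν i ε - ‖S.tangentPart i ε z‖ ^ 2) ^ (m + 1)) (fun _ => 1) :=
    CkBigO.comp_fixed (φ := fun y => Real.sqrt y ^ (m + 1))
      ((Real.contDiffAt_sqrt hc0.ne').pow _) (cν.sub X2) t1
  have hP := t1.eventually_const_lt hc0
  set w : Curve ℝ := ⟨fun t => (t : ℝ) ^ 2, by fun_prop⟩ with hw
  set wm : Curve ℝ := ⟨fun t => (t : ℝ) ^ m, by fun_prop⟩ with hwm
  set Y : ℝ → Phase d → Curve ℝ := fun ε z =>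
    constCurve ((1 / 2 : ℝ) * (1 - ‖S.tangentPart i ε z‖ ^ 2)) -
      ((1 / 2 : ℝ) * (1 - 2 * ν i ε - ‖S.tangentPart i ε z‖ ^ 2)) • w with hYdef
  have Y1 : CkBigO (𝓝[>] (0 : ℝ) ×ˢ 𝓝 z₀) (k + 1) Y (fun _ => 1) :=
    ((((CkBigO.const_one (1 : ℝ)).sub X2).clm
      ((1 / 2 : ℝ) • ContinuousLinearMap.id ℝ ℝ)).constCurve).sub
      (((cν.sub X2).clm ((1 / 2 : ℝ) • ContinuousLinearMap.id ℝ ℝ)).smul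
        (CkBigO.const_one w)).one_mul_left
  have hY : ∀ᶠ p : ℝ × Phase d in 𝓝[>] (0 : ℝ) ×ˢ 𝓝 z₀, ∀ t, Y p.1 p.2 t ∈ Icc 0 (1 / 2) := by
    filter_upwards [hP, (H.ν_pos i).prod_inl _] with p hp hν t
    change (1 / 2 : ℝ) * (1 - ‖S.tangentPart i p.1 p.2‖ ^ 2) - ((1 / 2 : ℝ) * (1 - 2 * ν i p.1 -
      ‖S.tangentPart i p.1 p.2‖ ^ 2)) * (t : ℝ) ^ 2 ∈ _
    have h1 : (t : ℝ) ^ 2 ≤ 1 := pow_le_one₀ t.2.1 t.2.2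
    have h2 := sq_nonneg (t : ℝ)
    have h3 := sq_nonneg (‖S.tangentPart i p.1 p.2‖)
    constructor <;> nlinarith
  have hfC : CkBigO (𝓝[>] (0 : ℝ) ×ˢ 𝓝ˢ (Icc (0 : ℝ) (1 / 2))) (k + 1) f b :=
    ckBigO_nhdsSet_of_isCompact isCompact_Icc fun w _ => hf w
  have Z1 := hfC.nemytskii_comp Y1 tendsto_fst hY
  have Z2 := (Pm.smul (Z1.clm ((evalCurve (E := ℝ) 1).comp (curvePrim wm)))).one_mul_left.clm
    ((2 : ℝ) • ContinuousLinearMap.id ℝ ℝ)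
  refine Z2.congr ?_
  filter_upwards [hP, hfe.prod_inl _, (tendsto_nhdsSet_curve tendsto_fst hY).eventually
    (eventually_forall_curve hfC.contDiffAt)] with p p1 p3 p4
  rw [layerIntegral_eq m (Real.sqrt_nonneg _) (Real.sq_sqrt p1.le) fun w hw => p3 hw]
  change (2 : ℝ) * (_ * curvePrim wm (nemytskii (f p.1) (Y p.1 p.2)) 1) = _
  rw [curvePrim_apply]
  refine congrArg (fun y => 2 * (_ * y)) (intervalIntegral.integral_congr fun u hu => ?_)
  rw [Set.Icc.coe_one, uIcc_of_le zero_le_one] at hu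
  change curveVal wm u • curveVal _ u = f p.1 _ * u ^ m
  rw [curveVal_of_mem _ hu, curveVal_of_mem _ hu, nemytskii_apply fun t => (p4 t).continuousAt,
    smul_eq_mul, mul_comm, mul_pow, Real.sq_sqrt p1.le]
  change f p.1 ((1 / 2 : ℝ) * (1 - ‖S.tangentPart i p.1 p.2‖ ^ 2) - ((1 / 2 : ℝ) *
    (1 - 2 * ν i p.1 - ‖S.tangentPart i p.1 p.2‖ ^ 2)) * u ^ 2) * u ^ m = _
  congr 2
  ring

theorem Approximates.ckLip_reflectCorrection (hz : ‖z₀.2‖ = 1) :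
    CkLip (𝓝[>] (0 : ℝ)) k z₀ (fun ε z => S.reflectCorrection i (ν i ε) ε z) b := by
  have hS := H.adm
  have hI := fun m => (H.ckBigO_layerIntegral hx ha hz m).ckLip
  have tc := H.tendsto_normalPart hx
  have hg := norm_pos_iff.2 (hS.limitGradient_ne hx)
  have hc0 : ‖S.limitGradient i z₀.1‖⁻¹ * inner ℝ (S.limitGradient i z₀.1) z₀.2 ≠ 0 :=
    (mul_neg_of_pos_of_neg (inv_pos.2 hg) ha).ne
  have hc : CkLip (𝓝[>] (0 : ℝ)) k z₀ (S.normalPart i) (fun _ => 1) := (H.ckLip_normalPart hx).pred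
  have hci : CkLip (𝓝[>] (0 : ℝ)) k z₀ (fun ε z => (S.normalPart i ε z)⁻¹) (fun _ => 1) :=
    (CkBigO.comp_fixed (contDiffAt_inv ℝ hc0) (H.ckLip_normalPart hx).1 tc).ckLip
  have hX : CkLip (𝓝[>] (0 : ℝ)) k z₀ (S.tangentPart i) (fun _ => 1) :=
    (H.ckLip_tangentPart hx).pred
  have hn : CkLip (𝓝[>] (0 : ℝ)) k z₀ (fun ε (z : Phase d) => S.normal i ε z.1) (fun _ => 1) :=
    (hS.ckLip_normal hx).comp_fst.pred
  have hD : CkLip (𝓝[>] (0 : ℝ)) k z₀ (fun ε (z : Phase d) => fderiv ℝ (S.normal i ε) z.1)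
      (fun _ => 1) := (hS.ckLip_normal hx).fderiv.comp_fst
  have hQ : CkLip (𝓝[>] (0 : ℝ)) k z₀ (fun ε (z : Phase d) => (S.Qy i ε z.1)⁻¹) (fun _ => 1) := by
    have h1 : CkBigO (𝓝[>] (0 : ℝ) ×ˢ 𝓝 z₀.1) (k + 1)
        (fun ε q => ‖gradient (S.depth i ε) q‖⁻¹) (fun _ => 1) :=
      CkBigO.comp_fixed (φ := fun g : Pos d => ‖g‖⁻¹)
        ((contDiffAt_norm ℝ (hS.limitGradient_ne hx)).inv hg.ne')
        (ckLip_gradient_depth hS hx).1 (tendsto_limitGradient hS hx)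
    refine ((h1.ckLip.comp_fst (y := z₀)).clm (S.σ i • ContinuousLinearMap.id ℝ ℝ)).congr ?_
    filter_upwards [(tendsto_fst.prodMk tendsto_snd.fst_nhds).eventually
      ((hS.eventually_normal hx).and (hS.differentiableAt_pattern (hS.mem_dom hx)))] with p hp
    exact (inv_Qy hS.levels hp.1.2 hp.1.1 hp.2).symm
  have hDn : CkLip (𝓝[>] (0 : ℝ)) k z₀
      (fun ε (z : Phase d) => fderiv ℝ (S.normal i ε) z.1 (S.normal i ε z.1)) (fun _ => 1) :=
    (hD.bilin (ContinuousLinearMap.id ℝ (Pos d →L[ℝ] Pos d)) hn).one_mul_left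
  have hDX : CkLip (𝓝[>] (0 : ℝ)) k z₀
      (fun ε (z : Phase d) => fderiv ℝ (S.normal i ε) z.1 (S.tangentPart i ε z)) (fun _ => 1) :=
    (hD.bilin (ContinuousLinearMap.id ℝ (Pos d →L[ℝ] Pos d)) hX).one_mul_left
  have right : ∀ {F : Type} [NormedAddCommGroup F] [NormedSpace ℝ F] {h : ℝ → Phase d → F},
      CkLip (𝓝[>] (0 : ℝ)) k z₀ h (fun ε => b ε * 1) → CkLip (𝓝[>] (0 : ℝ)) k z₀ h b :=
    fun h => by simpa using h
  have hJ : CkLip (𝓝[>] (0 : ℝ)) k z₀ (fun ε z => S.vecJ i (ν i ε) ε z) b :=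
    (hQ.smul ((right ((right ((hI 2).smul hci)).neg.smul hDn)).sub
      (right ((hI 0).smul hDX)))).one_mul_left
  have hX1 : CkLip (𝓝[>] (0 : ℝ)) k z₀ (fun ε z =>
      -(S.layerIntegral 0 i (ν i ε) ε z / S.Qy i ε z.1) • S.tangentPart i ε z) b :=
    right ((right ((hI 0).smul hQ)).neg.smul hX)
  have hP1 : CkLip (𝓝[>] (0 : ℝ)) k z₀ (fun ε z => -S.normalPart i ε z • S.vecJ i (ν i ε) ε z -
      (inner ℝ (S.tangentPart i ε z) (S.vecJ i (ν i ε) ε z) : ℝ) • S.normal i ε z.1) b :=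
    (hc.neg.smul hJ).one_mul_left.sub (right ((hX.bilin (innerSL ℝ) hJ).one_mul_left.smul hn))
  exact hX1.prodMk hP1

end Correction

end SteepFamily

namespace SteepFamily

variable {d n : ℕ} {S : SteepFamily d n} {r k : ℕ} {i j : Fin n} {ε : ℝ} {x : Pos d}
  {ν : Fin n → ℝ → ℝ} {Dε Dint : ℝ → Set (Pos d)} {b : ℝ → ℝ≥0} {z₀ : Phase d} {T : ℝ}

/-! ### The Poincaré map near a regular orbit -/

/-- The assertions about the Poincaré map at a phase point `ρ` of the cross-section: `Φ` is its
value, and `g₁, g₂, g₃` are the values of the error terms. -/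
structure IsPoincareAt (S : SteepFamily d n) (ν : Fin n → ℝ → ℝ) (A : Set (Pos d)) (i : Fin n)
    (ε : ℝ) (ρ Φ g₁ g₂ g₃ : Phase d) : Prop where
  segment : ∀ s ∈ Icc 0 (freeTime A ρ), ρ.1 + s • ρ.2 ∈ S.Dt
  endpoint : (freeFlight A ρ + S.flightCorrection ε A ρ).1 ∈ S.Dt
  isLeast : IsLeast (hitTimes A ρ) (freeTime A ρ)
  hit : S.Q (freeFlight A ρ).1 ε = S.Qc i + S.invBarrier i (ν i ε) ε
  angle : inner ℝ ρ.2 (S.normal i ε (freeFlight A ρ).1) < 0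
  poincare : ∀ ρ', S.SmoothPoincare ε A ρ ρ' ↔ ρ' = Φ
  mem : Φ ∈ S.crossSection i ε A
  close : g₁ = Φ - S.billiardMap i ε A ρ
  second : g₂ = Φ - (S.billiardMap i ε A ρ + S.mapCorrection i (ν i ε) ε A ρ)
  correction : g₃ = S.mapCorrection i (ν i ε) ε A ρ

theorem ReflectionApprox.eventually_first (H : S.Approximates (k + 1) ν Dε Dint b)
    (hx : z₀.1 ∈ S.Γ i \ S.cornerSet (k + 1))
    (ha : inner ℝ (S.limitGradient i z₀.1) z₀.2 < 0) {f : ℝ → ℝ → ℝ} {R : ℝ → Phase d → Phase d}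
    (hR : S.ReflectionApprox k ν Dε b i z₀ f R) :
    ∀ᶠ p : ℝ × Phase d in 𝓝[>] (0 : ℝ) ×ˢ 𝓝 z₀, ‖p.2.2‖ ^ 2 = 1 - 2 * ν i p.1 →
      layerFirst (gradient (S.depth i p.1)) (f p.1) p.2 =
        S.reflectCorrection i (ν i p.1) p.1 p.2 := by
  have hS := H.adm
  have t1 : Tendsto (fun p : ℝ × Phase d => (p.1, p.2.1)) (𝓝[>] (0 : ℝ) ×ˢ 𝓝 z₀)
      (𝓝[>] (0 : ℝ) ×ˢ 𝓝 z₀.1) := tendsto_fst.prodMk tendsto_snd.fst_nhds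
  have t2 : Tendsto (fun p : ℝ × Phase d => inner ℝ (gradient (S.depth i p.1) p.2.1) p.2.2)
      (𝓝[>] (0 : ℝ) ×ˢ 𝓝 z₀) (𝓝 (inner ℝ (S.limitGradient i z₀.1) z₀.2)) :=
    ((tendsto_limitGradient hS hx).comp t1).inner tendsto_snd.snd_nhds
  filter_upwards [t1.eventually ((ckLip_gradient_depth hS hx).1.contDiffAt.and
    ((SpreadFilter.spread _ (hS.eventually_normal hx)).and
      (hS.differentiableAt_pattern (hS.mem_dom hx)))), t2.eventually_lt_const ha,
    (H.eventually_continuousAt_force i hR.force).prod_inl _, hR.force_eq.prod_inl _]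
    with p p1 p2 p3 p4 hp
  exact layerFirst_eq_reflectCorrection hS.levels
    (p1.1.of_le (by exact_mod_cast Nat.le_add_left 1 k)) p1.2.1 p1.2.2 p2 hp p3 p4

theorem IsRegularFlight.eventually_segment (hS : S.IsAdmissible r)
    (hz : S.IsRegularFlight r j i z₀ T) :
    ∀ᶠ y in 𝓝 (z₀.1, (linePoint T z₀).1), ∀ a ∈ Icc (0 : ℝ) 1, y.1 + a • (y.2 - y.1) ∈ S.Dt := by
  refine isCompact_Icc.eventually_forall_of_forall_eventually fun a ha => ?_
  have h1 : Continuous fun y : (Pos d × Pos d) × ℝ => y.1.1 + y.2 • (y.1.2 - y.1.1) := by fun_prop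
  refine h1.continuousAt.eventually (hS.potential.isOpen_dom.mem_nhds ?_)
  have h2 : z₀.1 + a • ((linePoint T z₀).1 - z₀.1) = (linePoint (a * T) z₀).1 := by
    simp [linePoint, smul_smul]
  change z₀.1 + a • ((linePoint T z₀).1 - z₀.1) ∈ S.Dt
  rw [h2]
  rcases ha.1.eq_or_lt with rfl | h0
  · rw [zero_mul, linePoint_zero]
    exact mem_of_mem_nhds (hS.mem_dom hz.start_mem)
  rcases ha.2.eq_or_lt with rfl | h3
  · rw [one_mul]
    exact mem_of_mem_nhds (hS.mem_dom hz.end_mem)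
  · exact hS.interior_subset_dom (hz.inside _ ⟨mul_pos h0 hz.pos, mul_lt_of_lt_one_left hz.pos h3⟩)

theorem Approximates.exists_poincare (H : S.Approximates (k + 1) ν Dε Dint b)
    (hz : S.IsRegularFlight (k + 1) j i z₀ T) (h1 : ‖z₀.2‖ = 1) :
    ∃ Φ G₁ G₂ G₃ : ℝ → Phase d → Phase d,
      CkBigO (𝓝[>] (0 : ℝ) ×ˢ 𝓝 z₀) (k + 1) G₁ b ∧
      CkBigO (𝓝[>] (0 : ℝ) ×ˢ 𝓝 z₀) k G₂ (fun ε => b ε ^ 2) ∧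
      CkBigO (𝓝[>] (0 : ℝ) ×ˢ 𝓝 z₀) k G₃ b ∧
      ∀ᶠ p : ℝ × Phase d in 𝓝[>] (0 : ℝ) ×ˢ 𝓝 z₀, p.2 ∈ S.crossSection j p.1 (Dε p.1) →
        S.IsPoincareAt ν (Dε p.1) i p.1 p.2 (Φ p.1 p.2) (G₁ p.1 p.2) (G₂ p.1 p.2)
          (G₃ p.1 p.2) := by
  have hS := H.adm
  obtain ⟨F, F₀, F₁, hF⟩ := H.exists_flightApprox hz
  have hx := hz.end_mem
  have ha : inner ℝ (S.limitGradient i (linePoint T z₀).1) (linePoint T z₀).2 < 0 := hz.end_angle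
  have hc1 : ‖(linePoint T z₀).2‖ = 1 := h1
  obtain ⟨f, R, hR⟩ := H.exists_reflectionApprox hx ha
  have hk := Nat.le_succ k
  have hb1 : ∀ᶠ p : ℝ × Phase d in 𝓝[>] (0 : ℝ) ×ˢ 𝓝 z₀, b p.1 ≤ 1 :=
    (H.small.eventually_le_const zero_lt_one).prod_inl _
  have tF : Tendsto (fun p : ℝ × Phase d => (p.1, F p.1 p.2)) (𝓝[>] (0 : ℝ) ×ˢ 𝓝 z₀)
      (𝓝[>] (0 : ℝ) ×ˢ 𝓝 (linePoint T z₀)) := tendsto_fst.prodMk hF.tendsto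
  have hrefl := hS.ckLip_reflect (z₀ := linePoint T z₀) hx
  have hcorr := H.ckLip_reflectCorrection hx ha hc1
  have A1 : CkBigO (𝓝[>] (0 : ℝ) ×ˢ 𝓝 z₀) k (fun ε z => F₀ ε z + F₁ ε z) (fun _ => 1) :=
    (hF.ckBigO_free.of_le hk).add (hF.first.scale 1 (by simpa using hb1))
  have tA : Tendsto (fun p : ℝ × Phase d => F₀ p.1 p.2 + F₁ p.1 p.2) (𝓝[>] (0 : ℝ) ×ˢ 𝓝 z₀)
      (𝓝 (linePoint T z₀)) := by
    simpa using hF.tendsto_free.add (hF.first.tendsto_zero tendsto_fst H.small)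
  have Ab : CkBigO (𝓝[>] (0 : ℝ) ×ˢ 𝓝 z₀) k (fun ε z => F₀ ε z + F₁ ε z - F₀ ε z) b :=
    hF.first.congr (Eventually.of_forall fun p => (add_sub_cancel_left _ _).symm)
  have FA : CkBigO (𝓝[>] (0 : ℝ) ×ˢ 𝓝 z₀) k (fun ε z => F ε z - (F₀ ε z + F₁ ε z))
      (fun ε => b ε ^ 2) :=
    hF.second.congr (Eventually.of_forall fun p => sub_sub _ _ _)
  have F1 := hF.ckBigO.of_le hk
  refine ⟨fun ε z => R ε (F ε z),
    fun ε z => (R ε (F ε z) - S.reflect i ε (F ε z)) +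
      (S.reflect i ε (F ε z) - S.reflect i ε (F₀ ε z)),
    fun ε z => (R ε (F ε z) - S.reflect i ε (F ε z) -
        layerFirst (gradient (S.depth i ε)) (f ε) (F ε z)) +
      (S.reflectCorrection i (ν i ε) ε (F ε z) -
        S.reflectCorrection i (ν i ε) ε (F₀ ε z + F₁ ε z)) +
      (S.reflect i ε (F ε z) - S.reflect i ε (F₀ ε z + F₁ ε z)),
    fun ε z => (S.reflect i ε (F₀ ε z + F₁ ε z) - S.reflect i ε (F₀ ε z)) +
      S.reflectCorrection i (ν i ε) ε (F₀ ε z + F₁ ε z), ?_, ?_, ?_, ?_⟩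
  · have c1 : CkBigO (𝓝[>] (0 : ℝ) ×ˢ 𝓝 z₀) (k + 1)
        (fun ε z => R ε (F ε z) - S.reflect i ε (F ε z)) b :=
      hR.close.comp_nhds hF.ckBigO tendsto_fst hF.tendsto
    have c2 : CkBigO (𝓝[>] (0 : ℝ) ×ˢ 𝓝 z₀) (k + 1)
        (fun ε z => S.reflect i ε (F ε z) - S.reflect i ε (F₀ ε z)) b :=
      (hrefl.comp_sub hF.ckBigO hF.ckBigO_free hF.close tendsto_fst hF.tendsto
        hF.tendsto_free).one_mul_left
    exact c1.add c2
  · have c1 : CkBigO (𝓝[>] (0 : ℝ) ×ˢ 𝓝 z₀) k (fun ε z => R ε (F ε z) -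
        S.reflect i ε (F ε z) - layerFirst (gradient (S.depth i ε)) (f ε) (F ε z))
        (fun ε => b ε ^ 2) := hR.second.comp_nhds F1 tendsto_fst hF.tendsto
    have c2 : CkBigO (𝓝[>] (0 : ℝ) ×ˢ 𝓝 z₀) k (fun ε z =>
        S.reflectCorrection i (ν i ε) ε (F ε z) -
        S.reflectCorrection i (ν i ε) ε (F₀ ε z + F₁ ε z)) (fun ε => b ε ^ 2) := by
      refine (hcorr.comp_sub F1 A1 FA tendsto_fst hF.tendsto tA).scale 1 ?_
      filter_upwards [hb1] with p hp
      gcongr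
    have c3 : CkBigO (𝓝[>] (0 : ℝ) ×ˢ 𝓝 z₀) k (fun ε z => S.reflect i ε (F ε z) -
        S.reflect i ε (F₀ ε z + F₁ ε z)) (fun ε => b ε ^ 2) :=
      (hrefl.pred.comp_sub F1 A1 FA tendsto_fst hF.tendsto tA).one_mul_left
    exact (c1.add c2).add c3
  · have c1 : CkBigO (𝓝[>] (0 : ℝ) ×ˢ 𝓝 z₀) k (fun ε z => S.reflect i ε (F₀ ε z + F₁ ε z) -
        S.reflect i ε (F₀ ε z)) b :=
      (hrefl.pred.comp_sub A1 (hF.ckBigO_free.of_le hk) Ab tendsto_fst tA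
        hF.tendsto_free).one_mul_left
    have c2 : CkBigO (𝓝[>] (0 : ℝ) ×ˢ 𝓝 z₀) k (fun ε z =>
        S.reflectCorrection i (ν i ε) ε (F₀ ε z + F₁ ε z)) b :=
      hcorr.1.comp_nhds A1 tendsto_fst tA
    exact c1.add c2
  · have tN : ∀ᶠ p : ℝ × Phase d in 𝓝[>] (0 : ℝ) ×ˢ 𝓝 z₀, (F p.1 p.2).1 ∈ S.N i :=
      hF.tendsto.fst_nhds.eventually (hS.mem_nbhd hx)
    have tseg := (tendsto_snd.fst_nhds.prodMk_nhds hF.tendsto_free.fst_nhds).eventually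
      (hz.eventually_segment hS)
    filter_upwards [hF.level, hF.free, hF.hit, hF.flight, tF.eventually hR.reflection,
      tF.eventually (hR.eventually_first H hx ha), tN, (H.eventually_level i).prod_inl _,
      hS.eventually_param.prod_inl _, tseg, tA.fst_nhds.eventually (hS.mem_dom hx)]
      with p p1 p2 p3 p4 p5 p6 p7 p8 p9 p10 p11 hp
    obtain ⟨f1, f2⟩ := p2 hp
    obtain ⟨s1, s2⟩ := p4 hp
    obtain ⟨h1, h2, h3⟩ := p3 hp
    have hen : ‖(F p.1 p.2).2‖ ^ 2 = 1 - 2 * ν i p.1 := by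
      rw [hS.potential_eq p9 p7, p1, p8.2] at s2
      linarith
    obtain ⟨r1, r2⟩ := p5 p1 hen
    have e1 := p6 hen
    refine ⟨fun s hs => ?_, by rwa [f1, f2], h1, h2, h3, smoothPoincare_iff_eq (Nat.le_add_left 1 k) hS.potential p9 s1 r1, r2,
      ?_, ?_, ?_⟩
    · have h4 : freeTime (Dε p.1) p.2 ≠ 0 := h1.1.1.ne'
      have h5 := p10 (s / freeTime (Dε p.1) p.2)
        ⟨div_nonneg hs.1 h1.1.1.le, div_le_one_of_le₀ hs.2 h1.1.1.le⟩
      rwa [← f1, freeFlight, add_sub_cancel_left, smul_smul, div_mul_cancel₀ _ h4] at h5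
    · rw [billiardMap, f1]
      abel
    · rw [mapCorrection, billiardMap, f1, f2, e1]
      abel
    · rw [mapCorrection, billiardMap, f1, f2]
      abel

end SteepFamily

/-! ### Invariance under translations -/

section Translation

variable {d : ℕ} {A : Set (Pos d)} {v : Pos d}

theorem frontier_add_iff (hA : ∀ q, q + v ∈ A ↔ q ∈ A) (q : Pos d) :
    q + v ∈ frontier A ↔ q ∈ frontier A := by
  have h1 : (Homeomorph.addRight v) ⁻¹' A = A := Set.ext hA
  have h2 := (Homeomorph.addRight v).preimage_frontier A
  rw [h1] at h2
  exact Set.ext_iff.1 h2 q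

theorem interior_add_iff (hA : ∀ q, q + v ∈ A ↔ q ∈ A) (q : Pos d) :
    q + v ∈ interior A ↔ q ∈ interior A := by
  have h1 : (Homeomorph.addRight v) ⁻¹' A = A := Set.ext hA
  have h2 := (Homeomorph.addRight v).preimage_interior A
  rw [h1] at h2
  exact Set.ext_iff.1 h2 q

theorem closure_add_iff (hA : ∀ q, q + v ∈ A ↔ q ∈ A) (q : Pos d) :
    q + v ∈ closure A ↔ q ∈ closure A := by
  have h1 : (Homeomorph.addRight v) ⁻¹' A = A := Set.ext hA
  have h2 := (Homeomorph.addRight v).preimage_closure A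
  rw [h1] at h2
  exact Set.ext_iff.1 h2 q

theorem hitTimes_add (hA : ∀ q, q + v ∈ A ↔ q ∈ A) (ρ : Phase d) :
    hitTimes A (ρ + (v, 0)) = hitTimes A ρ := by
  ext t
  simp only [hitTimes, Prod.fst_add, Prod.snd_add, add_zero, Set.mem_ofPred_eq]
  rw [add_right_comm, frontier_add_iff hA]

theorem freeTime_add (hA : ∀ q, q + v ∈ A ↔ q ∈ A) (ρ : Phase d) :
    freeTime A (ρ + (v, 0)) = freeTime A ρ := by
  rw [freeTime, hitTimes_add hA, freeTime]

theorem freeFlight_add (hA : ∀ q, q + v ∈ A ↔ q ∈ A) (ρ : Phase d) :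
    freeFlight A (ρ + (v, 0)) = freeFlight A ρ + (v, 0) := by
  rw [freeFlight, freeTime_add hA, freeFlight]
  ext1 <;> simp [add_right_comm]

theorem gradient_add_of_periodic {f : Pos d → ℝ} {U : Set (Pos d)} (hU : IsOpen U)
    (hf : ∀ q ∈ U, f (q + v) = f q) {q : Pos d} (hq : q ∈ U) :
    gradient f (q + v) = gradient f q := by
  have h1 : (fun y => f (y + v)) =ᶠ[𝓝 q] f := by
    filter_upwards [hU.mem_nhds hq] with y hy using hf y hy
  rw [gradient, gradient, ← h1.fderiv_eq, fderiv_comp_add_right]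

end Translation

namespace SteepFamily

variable {d n : ℕ} {S : SteepFamily d n} {r k : ℕ} {i j : Fin n} {ε : ℝ} {q v : Pos d}
  {A : Set (Pos d)} {ρ ρ' : Phase d}

theorem IsAdmissible.gradient_V_add (hS : S.IsAdmissible r) (hv : v ∈ S.Λ) (hq : q ∈ S.Dt) :
    gradient (fun x => S.V x ε) (q + v) = gradient (fun x => S.V x ε) q :=
  gradient_add_of_periodic hS.potential.isOpen_dom
    (fun y hy => hS.potential.periodic v hv y hy ε) hq

theorem IsAdmissible.gradient_Q_add (hS : S.IsAdmissible r) (hv : v ∈ S.Λ) (hq : q ∈ S.Dt) :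
    gradient (fun x => S.Q x ε) (q + v) = gradient (fun x => S.Q x ε) q :=
  gradient_add_of_periodic hS.potential.isOpen_dom
    (fun y hy => hS.pattern.periodic v hv y hy ε) hq

theorem IsAdmissible.normal_add (hS : S.IsAdmissible r) (hv : v ∈ S.Λ) (hq : q ∈ S.Dt) :
    S.normal i ε (q + v) = S.normal i ε q := by
  rw [normal, hS.gradient_Q_add hv hq, normal]

theorem IsAdmissible.fderiv_normal_add (hS : S.IsAdmissible r) (hv : v ∈ S.Λ) (hq : q ∈ S.Dt) :
    fderiv ℝ (S.normal i ε) (q + v) = fderiv ℝ (S.normal i ε) q := by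
  have h1 : (fun y => S.normal i ε (y + v)) =ᶠ[𝓝 q] S.normal i ε := by
    filter_upwards [hS.potential.isOpen_dom.mem_nhds hq] with y hy using hS.normal_add hv hy
  rw [← h1.fderiv_eq, fderiv_comp_add_right]

theorem IsAdmissible.mem_crossSection_add (hS : S.IsAdmissible r) (hv : v ∈ S.Λ)
    (hA : ∀ q, q + v ∈ A ↔ q ∈ A) (hρ : ρ.1 ∈ S.Dt) :
    ρ + (v, 0) ∈ S.crossSection i ε A ↔ ρ ∈ S.crossSection i ε A := by
  simp only [crossSection, Set.mem_ofPred_eq, Prod.fst_add, Prod.snd_add, add_zero,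
    frontier_add_iff hA, hS.normal_add hv hρ, hS.potential.periodic v hv _ hρ ε]

theorem IsAdmissible.reflect_add (hS : S.IsAdmissible r) (hv : v ∈ S.Λ) (hρ : ρ.1 ∈ S.Dt) :
    S.reflect i ε (ρ + (v, 0)) = S.reflect i ε ρ + (v, 0) := by
  simp [reflect, hS.normal_add hv hρ]

theorem IsAdmissible.reflectCorrection_add (hS : S.IsAdmissible r) (hv : v ∈ S.Λ)
    (hρ : ρ.1 ∈ S.Dt) (ν : ℝ) :
    S.reflectCorrection i ν ε (ρ + (v, 0)) = S.reflectCorrection i ν ε ρ := by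
  simp only [reflectCorrection, vecJ, layerIntegral, tangentPart, normalPart, Qy, Prod.fst_add,
    Prod.snd_add, add_zero, hS.normal_add hv hρ, hS.fderiv_normal_add hv hρ,
    hS.gradient_Q_add hv hρ]

theorem IsAdmissible.flightCorrection_add (hS : S.IsAdmissible r) (hv : v ∈ S.Λ)
    (hA : ∀ q, q + v ∈ A ↔ q ∈ A) (h0 : 0 ≤ freeTime A ρ)
    (hρ : ∀ s ∈ Icc 0 (freeTime A ρ), ρ.1 + s • ρ.2 ∈ S.Dt) :
    S.flightCorrection ε A (ρ + (v, 0)) = S.flightCorrection ε A ρ := by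
  have h1 : ∀ s ∈ uIcc 0 (freeTime A ρ), gradient (fun x => S.V x ε)
      ((ρ + (v, 0)).1 + s • (ρ + (v, 0)).2) = gradient (fun x => S.V x ε) (ρ.1 + s • ρ.2) := by
    intro s hs
    rw [uIcc_of_le h0] at hs
    rw [Prod.fst_add, Prod.snd_add, add_zero, add_right_comm, hS.gradient_V_add hv (hρ s hs)]
  have h2 : (freeFlight A ρ).1 ∈ S.Dt := hρ _ ⟨h0, le_rfl⟩
  have h3 : ∀ φ : ℝ → ℝ, ∫ s in (0 : ℝ)..freeTime A ρ, φ s • gradient (fun x => S.V x ε)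
      ((ρ + (v, 0)).1 + s • (ρ + (v, 0)).2) =
      ∫ s in (0 : ℝ)..freeTime A ρ, φ s • gradient (fun x => S.V x ε) (ρ.1 + s • ρ.2) := fun φ =>
    intervalIntegral.integral_congr fun s hs => by simp only [h1 s hs]
  rw [flightCorrection, timeCorrection, freeTime_add hA, freeFlight_add hA, h3, h3,
    intervalIntegral.integral_congr h1, Prod.fst_add, hS.gradient_Q_add hv h2, Prod.snd_add,
    add_zero, flightCorrection, timeCorrection]

theorem IsAdmissible.billiardMap_add (hS : S.IsAdmissible r) (hv : v ∈ S.Λ)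
    (hA : ∀ q, q + v ∈ A ↔ q ∈ A) (hρ : (freeFlight A ρ).1 ∈ S.Dt) :
    S.billiardMap i ε A (ρ + (v, 0)) = S.billiardMap i ε A ρ + (v, 0) := by
  rw [billiardMap, freeFlight_add hA, hS.reflect_add hv hρ, billiardMap]

theorem IsAdmissible.mapCorrection_add (hS : S.IsAdmissible r) (hv : v ∈ S.Λ)
    (hA : ∀ q, q + v ∈ A ↔ q ∈ A) (h0 : 0 ≤ freeTime A ρ)
    (hρ : ∀ s ∈ Icc 0 (freeTime A ρ), ρ.1 + s • ρ.2 ∈ S.Dt)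
    (h1 : (freeFlight A ρ + S.flightCorrection ε A ρ).1 ∈ S.Dt) (ν : ℝ) :
    S.mapCorrection i ν ε A (ρ + (v, 0)) = S.mapCorrection i ν ε A ρ := by
  have h2 : (freeFlight A ρ).1 ∈ S.Dt := hρ _ ⟨h0, le_rfl⟩
  rw [mapCorrection, hS.flightCorrection_add hv hA h0 hρ, freeFlight_add hA, add_right_comm,
    hS.reflect_add hv h1, hS.reflectCorrection_add hv h1, hS.billiardMap_add hv hA h2,
    mapCorrection]
  abel

theorem IsAdmissible.isOrbit_add (hS : S.IsAdmissible r) (hv : v ∈ S.Λ) {T : ℝ} {γ : ℝ → Phase d}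
    (h : S.IsOrbit ε T γ) : S.IsOrbit ε T fun t => γ t + (v, 0) := by
  intro t ht
  obtain ⟨h1, h2⟩ := h t ht
  refine ⟨(hS.potential.periodic_dom v hv _).2 h1, ?_⟩
  rw [Prod.fst_add, Prod.snd_add, add_zero, hS.gradient_V_add hv h1]
  exact h2.add_const _

theorem IsAdmissible.smoothPoincare_add (hS : S.IsAdmissible r) (hv : v ∈ S.Λ)
    (hA : ∀ q, q + v ∈ A ↔ q ∈ A) (h : S.SmoothPoincare ε A ρ ρ') :
    S.SmoothPoincare ε A (ρ + (v, 0)) (ρ' + (v, 0)) := by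
  obtain ⟨ρ₁, ⟨τ, hτ, γ, g1, g2, g3, g4, g5⟩, ⟨τ', hτ', γ', g1', g2', g3', g4', g5'⟩⟩ := h
  exact ⟨ρ₁ + (v, 0),
    ⟨τ, hτ, _, hS.isOrbit_add hv g1, by simp only [g2], by simp only [g3],
      fun t ht => (interior_add_iff hA _).2 (g4 t ht), (frontier_add_iff hA _).2 g5⟩,
    ⟨τ', hτ', _, hS.isOrbit_add hv g1', by simp only [g2'], by simp only [g3'],
      fun t ht => (closure_add_iff hA _).not.2 (g4' t ht), (frontier_add_iff hA _).2 g5'⟩⟩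

theorem SmoothPoincare.mem_dom (h : S.SmoothPoincare ε A ρ ρ') : ρ.1 ∈ S.Dt ∧ ρ'.1 ∈ S.Dt := by
  obtain ⟨ρ₁, ⟨τ, hτ, γ, g1, g2, g3, g4, g5⟩, ⟨τ', hτ', γ', g1', g2', g3', g4', g5'⟩⟩ := h
  exact ⟨g2 ▸ (g1 0 ⟨le_rfl, hτ.le⟩).1, g3' ▸ (g1' τ' ⟨hτ'.le, le_rfl⟩).1⟩

theorem IsPoincareAt.translate (hS : S.IsAdmissible r) (hv : v ∈ S.Λ)
    (hA : ∀ v ∈ S.Λ, ∀ q, q + v ∈ A ↔ q ∈ A) {ν : Fin n → ℝ → ℝ} {Φ g₁ g₂ g₃ : Phase d}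
    (h : S.IsPoincareAt ν A i ε ρ Φ g₁ g₂ g₃) :
    S.IsPoincareAt ν A i ε (ρ + (v, 0)) (Φ + (v, 0)) g₁ g₂ g₃ := by
  have hA' := hA v hv
  have h0 : 0 ≤ freeTime A ρ := h.isLeast.1.1.le
  have h1 : (freeFlight A ρ).1 ∈ S.Dt := h.segment _ ⟨h0, le_rfl⟩
  have h2 := (h.poincare Φ).2 rfl
  have hD := fun q => hS.potential.periodic_dom v hv q
  refine ⟨fun s hs => ?_, ?_, ?_, ?_, ?_, fun ρ' => ⟨fun h3 => ?_, ?_⟩, ?_, ?_, ?_, ?_⟩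
  · rw [freeTime_add hA'] at hs
    rw [Prod.fst_add, Prod.snd_add, add_zero, add_right_comm, hD]
    exact h.segment s hs
  · rw [hS.flightCorrection_add hv hA' h0 h.segment, freeFlight_add hA', add_right_comm,
      Prod.fst_add, hD]
    exact h.endpoint
  · rw [hitTimes_add hA', freeTime_add hA']
    exact h.isLeast
  · rw [freeFlight_add hA', Prod.fst_add, hS.pattern.periodic v hv _ h1]
    exact h.hit
  · rw [freeFlight_add hA', Prod.fst_add, hS.normal_add hv h1, Prod.snd_add, add_zero]
    exact h.angle
  · have h4 := hS.smoothPoincare_add (neg_mem hv) (hA _ (neg_mem hv)) h3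
    have h5 : ρ + (v, 0) + (-v, 0) = ρ := by rw [add_assoc]; simp
    rw [h5, h.poincare] at h4
    rw [← h4, add_assoc]
    simp
  · rintro rfl
    exact hS.smoothPoincare_add hv hA' h2
  · exact (hS.mem_crossSection_add hv hA' h2.mem_dom.2).2 h.mem
  · rw [hS.billiardMap_add hv hA' h1, add_sub_add_right_eq_sub]
    exact h.close
  · rw [hS.billiardMap_add hv hA' h1, hS.mapCorrection_add hv hA' h0 h.segment h.endpoint,
      add_right_comm, add_sub_add_right_eq_sub]
    exact h.second
  · rw [hS.mapCorrection_add hv hA' h0 h.segment h.endpoint]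
    exact h.correction

end SteepFamily

/-! ### Regular orbits -/

theorem IsHypersurfaceAt.add {d k : ℕ} {A : Set (Pos d)} {x v : Pos d}
    (hA : ∀ q, q + v ∈ A ↔ q ∈ A) (h : IsHypersurfaceAt k A x) : IsHypersurfaceAt k A (x + v) := by
  obtain ⟨g, h1, h2, h3⟩ := h
  have h4 : x + v + -v = x := add_neg_cancel_right x v
  have t : Tendsto (fun y => y + -v) (𝓝 (x + v)) (𝓝 x) := by
    have := (continuous_add_const (-v)).tendsto (x + v)
    rwa [h4] at this
  refine ⟨fun y => g (y + -v), ?_, ?_, ?_⟩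
  · rw [← h4] at h1
    exact h1.comp (x + v) (contDiffAt_id.add contDiffAt_const)
  · rw [fderiv_comp_add_right, h4]
    exact h2
  · filter_upwards [t.eventually h3] with y hy
    rw [← hy, ← hA (y + -v), neg_add_cancel_right]

namespace SteepFamily

variable {d n : ℕ} {S : SteepFamily d n} {r k : ℕ} {i j : Fin n} {ε : ℝ} {p q v x : Pos d}
  {C T : ℝ}

theorem IsTable.comp_subset (h : S.IsTable) (i : Fin n) : S.Γ i ⊆ S.D := fun x hx => by
  have h1 : x ∈ frontier S.D := by rw [h.frontier_eq]; exact mem_iUnion.2 ⟨i, hx⟩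
  exact h.isClosed.closure_eq ▸ frontier_subset_closure h1

theorem IsTable.cornerSet_add (h : S.IsTable) (hv : v ∈ S.Λ) (hx : x + v ∈ S.cornerSet r) :
    x ∈ S.cornerSet r := by
  obtain ⟨i, h1, h2⟩ := mem_iUnion.1 hx
  exact mem_iUnion.2 ⟨i, (h.periodic_comp i v hv x).1 h1,
    fun h3 => h2 (h3.add (h.periodic_comp i v hv))⟩

theorem notMem_of_forall_le_dist {s : Set (Pos d)} (hC : 0 < C) (h : ∀ c ∈ s, C ≤ dist q c) :
    q ∉ s := fun hq => by
  have := h q hq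
  rw [dist_self] at this
  linarith

theorem IsAdmissible.continuousAt_normal_zero (hS : S.IsAdmissible r)
    (hx : x ∈ S.Γ i \ S.cornerSet r) : ContinuousAt (S.normal i 0) x := by
  have h1 : ContDiffAt ℝ (r + 1) (fun q => S.Q q 0) x :=
    (hS.pattern.contDiffOn 0 ⟨le_rfl, hS.potential.pos⟩).contDiffAt (hS.mem_dom hx)
  have h2 : ContinuousAt (gradient fun q => S.Q q 0) x :=
    ((InnerProductSpace.toDual ℝ (Pos d)).symm.continuous.continuousAt).comp
      ((h1.fderiv_right (m := 0) (by
        rw [zero_add]; exact_mod_cast Nat.le_add_left 1 r)).continuousAt)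
  exact (continuousAt_const.div h2.norm (norm_ne_zero_iff.2 (hS.gradient_ne hx))).smul h2

/-- At a common point of two boundary components that is not a corner the normals agree. -/
theorem IsAdmissible.normal_eq (hS : S.IsAdmissible r) (hi : x ∈ S.Γ i \ S.cornerSet r)
    (hj : x ∈ S.Γ j \ S.cornerSet r) : S.normal i 0 x = S.normal j 0 x := by
  suffices h : S.σ i = S.σ j by rw [normal, normal, h]
  have hc : S.Qc i = S.Qc j := (hS.levels.level i x hi).symm.trans (hS.levels.level j x hj)
  have hQ : S.Q x 0 = S.Qc i := hS.levels.level i x hi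
  have h1 : ContDiffAt ℝ (r + 1) (fun q => S.Q q 0) x :=
    (hS.pattern.contDiffOn 0 ⟨le_rfl, hS.potential.pos⟩).contDiffAt (hS.mem_dom hi)
  have h2 : DifferentiableAt ℝ (fun q => S.Q q 0) x := h1.differentiableAt (by norm_cast)
  by_contra hne
  have hopp : S.σ j = -S.σ i := by
    rcases hS.levels.sign i with h | h <;> rcases hS.levels.sign j with h' | h' <;>
      simp_all
  have h4 : ∀ᶠ y in 𝓝 x, y ∈ S.D → S.Q y 0 = S.Qc i := by
    filter_upwards [hS.levels.side i x hi, hS.levels.side j x hj] with y h5 h6 h7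
    have e1 := h5.1 h7
    have e2 := h6.1 h7
    rw [hopp, ← hc] at e2
    have e3 : S.σ i * (S.Q y 0 - S.Qc i) = 0 := by linarith
    exact sub_eq_zero.1 ((mul_eq_zero.1 e3).resolve_left (hS.levels.sign_ne_zero i))
  have h5 : ∀ᶠ y in 𝓝 x, S.σ i * (S.Q y 0 - S.Qc i) ≤ 0 := by
    filter_upwards [hS.levels.side i x hi, h4] with y h6 h7
    by_contra h8
    push Not at h8
    rw [h7 (h6.2 h8.le), sub_self, mul_zero] at h8
    exact lt_irrefl _ h8
  have h6 : IsLocalMax (fun y => S.σ i * (S.Q y 0 - S.Qc i)) x := by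
    filter_upwards [h5] with y hy
    rw [hQ, sub_self, mul_zero]
    exact hy
  have h7 := h6.fderiv_eq_zero
  rw [fderiv_const_mul (h2.sub_const _), fderiv_sub_const] at h7
  have h8 : fderiv ℝ (fun q => S.Q q 0) x = 0 :=
    (smul_eq_zero.1 h7).resolve_left (hS.levels.sign_ne_zero i)
  exact hS.gradient_ne hi (by rw [gradient, h8, map_zero])

theorem IsRegularOrbit.translate (hS : S.IsAdmissible r) (hC : 0 < C) (hv : v ∈ S.Λ)
    (h : S.IsRegularOrbit r C j i q p T) : S.IsRegularOrbit r C j i (q + v) p T := by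
  have hT := hS.table
  have hq := hS.mem_dom ⟨h.start_mem, notMem_of_forall_le_dist hC h.start_corner⟩
  have hq' := hS.mem_dom ⟨h.end_mem, notMem_of_forall_le_dist hC h.end_corner⟩
  have hd : ∀ a c : Pos d, dist (a + v) c = dist a (c + -v) := fun a c => by
    rw [← dist_add_right a (c + -v) v, neg_add_cancel_right]
  have hcor : ∀ c ∈ S.cornerSet r, c + -v ∈ S.cornerSet r := fun c hc =>
    hT.cornerSet_add hv (by rwa [neg_add_cancel_right])
  refine ⟨h.speed, (hT.periodic_comp j v hv q).2 h.start_mem, ?_, h.time_pos, h.time_le,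
    fun c hc => ?_, fun c hc => ?_, ?_, ?_, fun t ht => ?_, fun t ht y hy => ?_⟩
  · rw [add_right_comm, hT.periodic_comp i v hv]
    exact h.end_mem
  · rw [hd]
    exact h.start_corner _ (hcor c hc)
  · rw [add_right_comm, hd]
    exact h.end_corner _ (hcor c hc)
  · rw [hS.normal_add hv (mem_of_mem_nhds hq)]
    exact h.start_angle
  · rw [add_right_comm, hS.normal_add hv (mem_of_mem_nhds hq')]
    exact h.end_angle
  · rw [add_right_comm, hT.periodic v hv]
    exact h.inside t ht
  · rw [add_right_comm, hd]
    exact h.clearance t ht _ ((frontier_add_iff (hT.periodic v hv) _).1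
      (by rwa [neg_add_cancel_right]))

theorem inner_limitGradient_normal (hx : S.limitGradient i x ≠ 0) :
    inner ℝ (S.limitGradient i x) p = ‖gradient (fun y => S.Q y 0) x‖ * inner ℝ p (S.normal i 0 x) := by
  have h1 : ‖gradient (fun y => S.Q y 0) x‖ ≠ 0 := by
    intro h0
    rw [norm_eq_zero] at h0
    exact hx (by rw [limitGradient, h0, smul_zero])
  rw [normal_zero_eq, real_inner_smul_right, mul_inv_cancel_left₀ h1, real_inner_comm,
    limitGradient]

/-- Limits of regular orbits with a uniform constant are regular. -/
theorem IsAdmissible.isRegularFlight_of_tendsto (hS : S.IsAdmissible r) (hC : 0 < C)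
    {u : ℕ → Phase d × ℝ} {y : Phase d × ℝ}
    (hu : ∀ m, S.IsRegularOrbit r C j i (u m).1.1 (u m).1.2 (u m).2)
    (h : Tendsto u atTop (𝓝 y)) : S.IsRegularFlight r j i y.1 y.2 ∧ ‖y.1.2‖ = 1 := by
  obtain ⟨⟨q, p⟩, T⟩ := y
  have tq : Tendsto (fun m => (u m).1.1) atTop (𝓝 q) := h.fst_nhds.fst_nhds
  have tp : Tendsto (fun m => (u m).1.2) atTop (𝓝 p) := h.fst_nhds.snd_nhds
  have tT : Tendsto (fun m => (u m).2) atTop (𝓝 T) := h.snd_nhds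
  have te : Tendsto (fun m => (u m).1.1 + (u m).2 • (u m).1.2) atTop (𝓝 (q + T • p)) :=
    tq.add (tT.smul tp)
  have hspeed : ‖p‖ = 1 := tendsto_nhds_unique tp.norm (by simp [(hu _).speed])
  have hΓ := hS.table.isClosed_comp
  have m1 : q ∈ S.Γ j \ S.cornerSet r :=
    ⟨(hΓ j).mem_of_tendsto tq (Eventually.of_forall fun m => (hu m).start_mem),
      notMem_of_forall_le_dist hC fun c hc => ge_of_tendsto' (tq.dist tendsto_const_nhds)
        fun m => (hu m).start_corner c hc⟩
  have m2 : q + T • p ∈ S.Γ i \ S.cornerSet r :=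
    ⟨(hΓ i).mem_of_tendsto te (Eventually.of_forall fun m => (hu m).end_mem),
      notMem_of_forall_le_dist hC fun c hc => ge_of_tendsto' (te.dist tendsto_const_nhds)
        fun m => (hu m).end_corner c hc⟩
  have a1 : C ≤ inner ℝ p (S.normal j 0 q) := ge_of_tendsto'
    (tp.inner ((hS.continuousAt_normal_zero m1).tendsto.comp tq)) fun m => (hu m).start_angle
  have a2 : inner ℝ p (S.normal i 0 (q + T • p)) ≤ -C := le_of_tendsto'
    (tp.inner ((hS.continuousAt_normal_zero m2).tendsto.comp te)) fun m => (hu m).end_angle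
  have hT0 : 0 ≤ T := ge_of_tendsto' tT fun m => (hu m).time_pos.le
  have hT : 0 < T := by
    refine hT0.lt_of_ne fun h0 => ?_
    rw [← h0, zero_smul, add_zero] at a2 m2
    rw [hS.normal_eq m2 m1] at a2
    linarith
  refine ⟨⟨hT, m1, m2, ?_, ?_, fun t ht => ?_⟩, hspeed⟩
  · rw [inner_limitGradient_normal (hS.limitGradient_ne m1)]
    exact mul_pos (norm_pos_iff.2 (hS.gradient_ne m1)) (hC.trans_le a1)
  · change inner ℝ (S.limitGradient i (q + T • p)) p < 0
    rw [inner_limitGradient_normal (hS.limitGradient_ne m2)]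
    exact mul_neg_of_pos_of_neg (norm_pos_iff.2 (hS.gradient_ne m2)) (by linarith)
  · change q + t • p ∈ interior S.D
    have tt : Tendsto (fun m => (u m).1.1 + t • (u m).1.2) atTop (𝓝 (q + t • p)) :=
      tq.add (tp.const_smul t)
    have ev : ∀ᶠ m in atTop, t ∈ Ioo 0 (u m).2 :=
      (tT.eventually_const_lt ht.2).mono fun m hm => ⟨ht.1, hm⟩
    have hD : q + t • p ∈ S.D :=
      hS.table.isClosed.mem_of_tendsto tt (ev.mono fun m hm => (hu m).inside t hm)
    by_contra hint
    have hf : q + t • p ∈ frontier S.D := ⟨subset_closure hD, hint⟩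
    have hle : C * min t (T - t) ≤ dist (q + t • p) (q + t • p) :=
      le_of_tendsto_of_tendsto ((tendsto_const_nhds.min (tT.sub_const t)).const_mul C)
        (tt.dist tendsto_const_nhds) (ev.mono fun m hm => (hu m).clearance t hm _ hf)
    rw [dist_self] at hle
    have : 0 < min t (T - t) := lt_min ht.1 (sub_pos.2 ht.2)
    nlinarith

end SteepFamily

/-! ### Uniformity -/

/-- Constants that exist locally can be chosen uniformly on a compact set. -/
theorem IsCompact.exists_uniform {X : Type} [TopologicalSpace X] {s : Set X} (hs : IsCompact s)
    (P : X → ℝ → ℝ≥0 → ℝ → Prop)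
    (hmono : ∀ x κ κ' K K' ε ε', κ' ≤ κ → K ≤ K' → ε' ≤ ε → P x κ K ε → P x κ' K' ε')
    (h : ∀ x ∈ s, ∃ κ > 0, ∃ K, ∃ ε > 0, ∀ᶠ y in 𝓝[s] x, P y κ K ε) :
    ∃ κ > 0, ∃ K, ∃ ε > 0, ∀ x ∈ s, P x κ K ε := by
  refine hs.induction_on (p := fun t => ∃ κ > 0, ∃ K, ∃ ε > 0, ∀ x ∈ t, P x κ K ε)
    ⟨1, one_pos, 0, 1, one_pos, by simp⟩ ?_ ?_ ?_
  · rintro t t' htt' ⟨κ, hκ, K, ε, hε, h1⟩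
    exact ⟨κ, hκ, K, ε, hε, fun x hx => h1 x (htt' hx)⟩
  · rintro t t' ⟨κ, hκ, K, ε, hε, h1⟩ ⟨κ', hκ', K', ε', hε', h2⟩
    refine ⟨min κ κ', lt_min hκ hκ', max K K', min ε ε', lt_min hε hε', fun x hx => ?_⟩
    rcases hx with hx | hx
    · exact hmono x _ _ _ _ _ _ (min_le_left _ _) (le_max_left _ _) (min_le_left _ _) (h1 x hx)
    · exact hmono x _ _ _ _ _ _ (min_le_right _ _) (le_max_right _ _) (min_le_right _ _) (h2 x hx)
  · intro x hx
    obtain ⟨κ, hκ, K, ε, hε, h1⟩ := h x hx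
    exact ⟨_, h1, κ, hκ, K, ε, hε, fun y hy => hy⟩

/-- On `U` the function `g` is of class `C^k` with derivatives bounded by `c`. -/
def BoundedOn {d : ℕ} (k : ℕ) (U : Set (Phase d)) (g : Phase d → Phase d) (c : ℝ≥0) : Prop :=
  ∀ ρ ∈ U, ContDiffAt ℝ k g ρ ∧ ∀ l ≤ k, ‖iteratedFDeriv ℝ l g ρ‖ ≤ c

theorem BoundedOn.mono {d k : ℕ} {U U' : Set (Phase d)} {g : Phase d → Phase d} {c c' : ℝ≥0}
    (h : BoundedOn k U g c) (hU : U' ⊆ U) (hc : c ≤ c') : BoundedOn k U' g c' := fun ρ hρ =>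
  ⟨(h ρ (hU hρ)).1, fun l hl => ((h ρ (hU hρ)).2 l hl).trans (by exact_mod_cast hc)⟩

theorem BoundedOn.comp_add {d k : ℕ} {z w : Phase d} {κ : ℝ} {g : Phase d → Phase d} {c : ℝ≥0}
    (h : BoundedOn k (Metric.ball (z + w) κ) g c) :
    BoundedOn k (Metric.ball z κ) (fun ρ => g (ρ + w)) c := fun ρ hρ => by
  obtain ⟨h1, h2⟩ := h (ρ + w) (by rwa [Metric.mem_ball, dist_add_right])
  refine ⟨h1.comp ρ (contDiffAt_id.add contDiffAt_const), fun l hl => ?_⟩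
  rw [iteratedFDeriv_comp_add_right]
  exact h2 l hl

theorem BoundedOn.isCkBounded {d k : ℕ} {U M : Set (Phase d)} {g f : Phase d → Phase d} {c : ℝ≥0}
    {e : ℝ≥0∞} (h : BoundedOn k U g c) (hf : ∀ ρ ∈ U ∩ M, g ρ = f ρ) (hc : c ≤ e) :
    IsCkBounded k U M f e := by
  refine ⟨g, fun ρ hρ => (h ρ hρ).1.contDiffWithinAt, hf, fun l hl ρ hρ => le_trans ?_ hc⟩
  rw [enorm_le_coe]
  exact (h ρ hρ).2 l hl

theorem eventually_boundedOn {d k : ℕ} {l : Filter ℝ} {z : Phase d} {f : ℝ → Phase d → Phase d}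
    {b : ℝ → ℝ≥0} (h : CkBigO (l ×ˢ 𝓝 z) k f b) :
    ∃ K : ℝ≥0, ∃ κ > 0, ∀ᶠ ε in l, BoundedOn k (Metric.ball z κ) (f ε) (K * b ε) := by
  obtain ⟨K, hK⟩ := h.exists_bound
  obtain ⟨κ, hκ, h1⟩ := eventually_prod_nhds_ball hK
  refine ⟨K, κ, hκ, h1.mono fun ε hε ρ hρ => ?_⟩
  simpa using hε ρ hρ

namespace SteepFamily

variable {d n : ℕ} {S : SteepFamily d n} {r k : ℕ} {i j : Fin n} {ε κ : ℝ} {K : ℝ≥0}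
  {ν : Fin n → ℝ → ℝ} {A : Set (Pos d)} {Dε Dint : ℝ → Set (Pos d)} {b : ℝ → ℝ≥0} {z : Phase d}
  {β : ℝ≥0} {v : Pos d} {C T : ℝ}

/-- The Poincaré map near `z` is defined and approximated with the constant `K`. -/
def PoincareBound (S : SteepFamily d n) (k : ℕ) (ν : Fin n → ℝ → ℝ) (A : Set (Pos d)) (β : ℝ≥0)
    (j i : Fin n) (ε : ℝ) (z : Phase d) (κ : ℝ) (K : ℝ≥0) : Prop :=
  (∀ ρ ∈ Metric.ball z κ, ρ.1 ∈ S.Dt) ∧ ∃ Φ g₁ g₂ g₃ : Phase d → Phase d,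
    BoundedOn (k + 1) (Metric.ball z κ) g₁ (K * β) ∧
    BoundedOn k (Metric.ball z κ) g₂ (K * β ^ 2) ∧ BoundedOn k (Metric.ball z κ) g₃ (K * β) ∧
    ∀ ρ ∈ Metric.ball z κ ∩ S.crossSection j ε A,
      S.IsPoincareAt ν A i ε ρ (Φ ρ) (g₁ ρ) (g₂ ρ) (g₃ ρ)

theorem PoincareBound.mono {z' : Phase d} {κ' : ℝ} {K' : ℝ≥0}
    (h : S.PoincareBound k ν A β j i ε z κ K)
    (hb : Metric.ball z' κ' ⊆ Metric.ball z κ) (hK : K ≤ K') :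
    S.PoincareBound k ν A β j i ε z' κ' K' := by
  obtain ⟨h0, Φ, g₁, g₂, g₃, h1, h2, h3, h4⟩ := h
  exact ⟨fun ρ hρ => h0 ρ (hb hρ), Φ, g₁, g₂, g₃, h1.mono hb (by gcongr), h2.mono hb (by gcongr),
    h3.mono hb (by gcongr), fun ρ hρ => h4 ρ ⟨hb hρ.1, hρ.2⟩⟩

theorem PoincareBound.translate (hS : S.IsAdmissible r) (hv : v ∈ S.Λ)
    (hA : ∀ v ∈ S.Λ, ∀ q, q + v ∈ A ↔ q ∈ A)
    (h : S.PoincareBound k ν A β j i ε (z + (v, 0)) κ K) :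
    S.PoincareBound k ν A β j i ε z κ K := by
  obtain ⟨h0, Φ, g₁, g₂, g₃, h1, h2, h3, h4⟩ := h
  have hb : ∀ ρ ∈ Metric.ball z κ, ρ + (v, 0) ∈ Metric.ball (z + (v, 0)) κ := fun ρ hρ => by
    rwa [Metric.mem_ball, dist_add_right]
  have hD : ∀ ρ ∈ Metric.ball z κ, ρ.1 ∈ S.Dt := fun ρ hρ =>
    (hS.potential.periodic_dom v hv _).1 (h0 _ (hb ρ hρ))
  refine ⟨hD, fun ρ => Φ (ρ + (v, 0)) + (-v, 0), _, _, _, h1.comp_add, h2.comp_add, h3.comp_add,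
    fun ρ hρ => ?_⟩
  have h5 := (h4 _ ⟨hb ρ hρ.1, (hS.mem_crossSection_add hv (hA v hv) (hD ρ hρ.1)).2 hρ.2⟩).translate
    hS (neg_mem hv) hA
  have h6 : ρ + (v, 0) + (-v, 0) = ρ := by rw [add_assoc]; simp
  rwa [h6] at h5

theorem Approximates.exists_poincareBound (H : S.Approximates (k + 1) ν Dε Dint b)
    (hz : S.IsRegularFlight (k + 1) j i z T) (h1 : ‖z.2‖ = 1) :
    ∃ κ > 0, ∃ K, ∃ ε₁ > 0, ∀ᶠ y in 𝓝 z, ∀ ε ∈ Ioo 0 ε₁,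
      S.PoincareBound k ν (Dε ε) (b ε) j i ε y κ K := by
  obtain ⟨Φ, G₁, G₂, G₃, c1, c2, c3, h2⟩ := H.exists_poincare hz h1
  obtain ⟨K₁, κ₁, hκ₁, e1⟩ := eventually_boundedOn c1
  obtain ⟨K₂, κ₂, hκ₂, e2⟩ := eventually_boundedOn c2
  obtain ⟨K₃, κ₃, hκ₃, e3⟩ := eventually_boundedOn c3
  obtain ⟨κ₄, hκ₄, e4⟩ := eventually_prod_nhds_ball h2
  obtain ⟨κ₅, hκ₅, e5⟩ := Metric.eventually_nhds_iff_ball.1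
    (continuousAt_fst.eventually (H.adm.mem_dom hz.start_mem))
  set κ := min κ₁ (min κ₂ (min κ₃ (min κ₄ κ₅))) with hκ
  have hκ0 : 0 < κ := by positivity
  have hle : κ ≤ κ₁ ∧ κ ≤ κ₂ ∧ κ ≤ κ₃ ∧ κ ≤ κ₄ ∧ κ ≤ κ₅ := by simp [hκ]
  obtain ⟨ε₁, hε₁, h3⟩ := mem_nhdsGT_iff_exists_Ioo_subset.1 (e1.and (e2.and (e3.and e4)))
  refine ⟨κ / 2, half_pos hκ0, max K₁ (max K₂ K₃), ε₁, hε₁, ?_⟩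
  filter_upwards [Metric.ball_mem_nhds z (half_pos hκ0)] with y hy ε hε
  obtain ⟨f1, f2, f3, f4⟩ := h3 hε
  have hsub : Metric.ball y (κ / 2) ⊆ Metric.ball z κ :=
    Metric.ball_subset_ball' (by rw [Metric.mem_ball] at hy; linarith)
  refine PoincareBound.mono (z := z) (κ := κ) (K := max K₁ (max K₂ K₃)) ?_ hsub le_rfl
  exact ⟨fun ρ hρ => e5 ρ (Metric.ball_subset_ball hle.2.2.2.2 hρ), Φ ε, G₁ ε, G₂ ε, G₃ ε,
    f1.mono (Metric.ball_subset_ball hle.1) (by gcongr; exact le_max_left _ _),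
    f2.mono (Metric.ball_subset_ball hle.2.1)
      (by gcongr; exact (le_max_left _ _).trans (le_max_right _ _)),
    f3.mono (Metric.ball_subset_ball hle.2.2.1)
      (by gcongr; exact (le_max_right _ _).trans (le_max_right _ _)),
    fun ρ hρ => f4 ρ (Metric.ball_subset_ball hle.2.2.2.1 hρ.1) hρ.2⟩

theorem Approximates.exists_poincareBound_uniform (H : S.Approximates (k + 1) ν Dε Dint b)
    (hC : 0 < C) (j i : Fin n) :
    ∃ κ > 0, ∃ K, ∃ ε₁ > 0, ∀ q p T, S.IsRegularOrbit (k + 1) C j i q p T → ∀ ε ∈ Ioo 0 ε₁,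
      S.PoincareBound k ν (Dε ε) (b ε) j i ε (q, p) κ K := by
  have hS := H.adm
  obtain ⟨B, hB, hB'⟩ := hS.table.compact_mod
  set R : Set (Phase d × ℝ) :=
    {y | y.1.1 ∈ B ∧ S.IsRegularOrbit (k + 1) C j i y.1.1 y.1.2 y.2} with hR
  have hsub : R ⊆ (B ×ˢ Metric.closedBall 0 1) ×ˢ Icc 0 (1 / C) := fun y hy =>
    ⟨⟨hy.1, by rw [mem_closedBall_zero_iff, hy.2.speed]⟩, hy.2.time_pos.le, hy.2.time_le⟩
  have hcomp : IsCompact (closure R) :=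
    ((hB.prod (isCompact_closedBall _ _)).prod isCompact_Icc).closure_of_subset hsub
  obtain ⟨κ, hκ, K, ε₁, hε₁, h1⟩ := hcomp.exists_uniform
    (fun y κ K ε₁ => ∀ ε ∈ Ioo 0 ε₁, S.PoincareBound k ν (Dε ε) (b ε) j i ε y.1 κ K)
    (fun y κ κ' K K' ε₁ ε₁' h1 h2 h3 h4 ε hε =>
      (h4 ε ⟨hε.1, hε.2.trans_le h3⟩).mono (Metric.ball_subset_ball h1) h2)
    fun y hy => by
      obtain ⟨u, hu, hlim⟩ := mem_closure_iff_seq_limit.1 hy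
      obtain ⟨h1, h2⟩ := hS.isRegularFlight_of_tendsto hC (fun m => (hu m).2) hlim
      obtain ⟨κ, hκ, K, ε₁, hε₁, h3⟩ := H.exists_poincareBound h1 h2
      exact ⟨κ, hκ, K, ε₁, hε₁, (continuousAt_fst.eventually h3).filter_mono nhdsWithin_le_nhds⟩
  refine ⟨κ, hκ, K, ε₁, hε₁, fun q p T hq ε hε => ?_⟩
  obtain ⟨v, hv, hvB⟩ := hB' q (hS.table.comp_subset j hq.start_mem)
  refine PoincareBound.translate hS hv (H.region.periodic ε) ?_
  have h2 := h1 ((q + v, p), T) (subset_closure ⟨hvB, hq.translate hS hC hv⟩) ε hε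
  simpa using h2

theorem tendsto_iSup_zero {f : Fin n → ℝ → ℝ≥0∞} (h : ∀ i, Tendsto (f i) (𝓝[>] 0) (𝓝 0)) :
    Tendsto (fun ε => ⨆ i, f i ε) (𝓝[>] 0) (𝓝 0) := by
  have h1 : Tendsto (fun ε => ∑ i, f i ε) (𝓝[>] 0) (𝓝 0) := by
    simpa using tendsto_finsetSum Finset.univ fun i _ => h i
  exact tendsto_of_tendsto_of_tendsto_of_le_of_le tendsto_const_nhds h1 (fun _ => zero_le)
    fun ε => iSup_le fun i => Finset.single_le_sum (f := fun i => f i ε) (fun _ _ => zero_le)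
      (Finset.mem_univ i)

end SteepFamily

theorem theorem3 {d n r : ℕ} (hr : 1 ≤ r) (S : SteepFamily d n) (hS : S.IsAdmissible r)
    (ν δ : Fin n → ℝ → ℝ) (Dε Dint : ℝ → Set (Pos d))
    -- the heights `ν_i` tend to zero, and `η_i = 𝒬_i(ν_i; ε)` is defined
    (hν_pos : ∀ i, ∀ᶠ ε in 𝓝[>] (0 : ℝ), 0 < ν i ε)
    (hν_mem : ∀ i, ∀ᶠ ε in 𝓝[>] (0 : ℝ),
      ν i ε ∈ (fun s => S.W i s ε) '' Ioo (-S.a) S.a)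
    (hν : ∀ i, Tendsto (ν i) (𝓝[>] 0) (𝓝 0))
    (hδ : ∀ i, Tendsto (δ i) (𝓝[>] 0) (𝓝 0))
    -- the auxiliary table, bounded by the surfaces `Q = Q_i + η_i`
    (hDε : S.IsLevelRegion r (fun i ε => S.invBarrier i (ν i ε) ε) Dε)
    -- the inner region, bounded by the surfaces `Q = Q_i + δ_i`
    (hDint : S.IsLevelRegion r δ Dint)
    (hsub : ∀ᶠ ε in 𝓝[>] (0 : ℝ), Dint ε ⊆ Dε ε)
    (hm : Tendsto (fun ε => S.mSup r (Dint ε) ε) (𝓝[>] 0) (𝓝 0))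
    (hM : ∀ i, Tendsto (fun ε => S.MSup r i (ν i ε) ε) (𝓝[>] 0) (𝓝 0)) :
    ∀ C > 0, ∃ κ > 0, ∃ K : ℝ≥0, ∃ ε₁ > 0,
      ∀ (j i : Fin n) (q₀ p₀ : Pos d) (T : ℝ), S.IsRegularOrbit r C j i q₀ p₀ T →
      ∀ ε ∈ Ioo 0 ε₁, ∃ Φ : Phase d → Phase d,
        -- the billiard map of the auxiliary table is defined, with a transversal hit near `Γ_i`
        (∀ ρ ∈ Metric.ball (q₀, p₀) κ ∩ S.crossSection j ε (Dε ε),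
          IsLeast (hitTimes (Dε ε) ρ) (freeTime (Dε ε) ρ) ∧
          S.Q (freeFlight (Dε ε) ρ).1 ε = S.Qc i + S.invBarrier i (ν i ε) ε ∧
          inner ℝ ρ.2 (S.normal i ε (freeFlight (Dε ε) ρ).1) < 0) ∧
        -- the Poincaré map of the smooth flow is defined and is given by `Φ`
        (∀ ρ ∈ Metric.ball (q₀, p₀) κ ∩ S.crossSection j ε (Dε ε),
          (∀ ρ', S.SmoothPoincare ε (Dε ε) ρ ρ' ↔ ρ' = Φ ρ) ∧
          Φ ρ ∈ S.crossSection i ε (Dε ε)) ∧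
        -- `Φ^ε = B^ε + O(m + ν + M)` in `C^r`
        IsCkBounded r (Metric.ball (q₀, p₀) κ) (S.crossSection j ε (Dε ε))
          (fun ρ => Φ ρ - S.billiardMap i ε (Dε ε) ρ) (K * S.err r ν Dint ε) ∧
        -- `Φ^ε = B^ε + Φ_1^ε + O((m + ν + M)²)` in `C^{r-1}`
        IsCkBounded (r - 1) (Metric.ball (q₀, p₀) κ) (S.crossSection j ε (Dε ε))
          (fun ρ => Φ ρ - (S.billiardMap i ε (Dε ε) ρ + S.mapCorrection i (ν i ε) ε (Dε ε) ρ))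
          (K * S.err r ν Dint ε ^ 2) ∧
        -- `Φ_1^ε = O(m + ν + M)` in `C^{r-1}`
        IsCkBounded (r - 1) (Metric.ball (q₀, p₀) κ) (S.crossSection j ε (Dε ε))
          (fun ρ => S.mapCorrection i (ν i ε) ε (Dε ε) ρ) (K * S.err r ν Dint ε) := by
  obtain ⟨k, rfl⟩ : ∃ k, r = k + 1 := ⟨r - 1, by omega⟩
  have herr : Tendsto (S.err (k + 1) ν Dint) (𝓝[>] 0) (𝓝 0) := by
    have h1 : ∀ i, Tendsto (fun ε => ENNReal.ofReal (ν i ε)) (𝓝[>] 0) (𝓝 0) := fun i => by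
      simpa using ENNReal.tendsto_ofReal (hν i)
    have h2 := (hm.add (SteepFamily.tendsto_iSup_zero h1)).add (SteepFamily.tendsto_iSup_zero hM)
    rw [add_zero, add_zero] at h2
    exact h2
  have hfin : ∀ᶠ ε in 𝓝[>] (0 : ℝ), ((S.err (k + 1) ν Dint ε).toNNReal : ℝ≥0∞) =
      S.err (k + 1) ν Dint ε := by
    filter_upwards [herr.eventually_lt_const ENNReal.zero_lt_top] with ε hε
    exact ENNReal.coe_toNNReal hε.ne
  have H : S.Approximates (k + 1) ν Dε Dint fun ε => (S.err (k + 1) ν Dint ε).toNNReal := by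
    refine ⟨hS, hν_pos, hν_mem, fun i => ?_, hDε, hDint.inner, ?_, ?_, fun i => ?_⟩
    · filter_upwards [hfin] with ε hε
      have h1 : ENNReal.ofReal (ν i ε) ≤ S.err (k + 1) ν Dint ε :=
        (le_iSup (fun i => ENNReal.ofReal (ν i ε)) i).trans
          (le_add_self.trans le_self_add)
      rw [← hε] at h1
      exact (ENNReal.ofReal_le_iff_le_toReal ENNReal.coe_ne_top).1 h1
    · exact (ENNReal.tendsto_toNNReal ENNReal.zero_ne_top).comp herr
    · filter_upwards [hfin] with ε hε
      rw [hε]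
      exact le_self_add.trans le_self_add
    · filter_upwards [hfin] with ε hε
      rw [hε]
      exact (le_iSup (fun i => S.MSup (k + 1) i (ν i ε) ε) i).trans le_add_self
  intro C hC
  obtain ⟨κ, hκ, K, ε₂, hε₂, h1⟩ := (isCompact_univ (X := Fin n × Fin n)).exists_uniform
    (fun y κ K ε₁ => ∀ q p T, S.IsRegularOrbit (k + 1) C y.1 y.2 q p T → ∀ ε ∈ Ioo 0 ε₁,
      S.PoincareBound k ν (Dε ε) (S.err (k + 1) ν Dint ε).toNNReal y.1 y.2 ε (q, p) κ K)
    (fun y κ κ' K K' ε₁ ε₁' h1 h2 h3 h4 q p T hq ε hε =>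
      (h4 q p T hq ε ⟨hε.1, hε.2.trans_le h3⟩).mono (Metric.ball_subset_ball h1) h2)
    fun y _ => by
      obtain ⟨κ, hκ, K, ε₁, hε₁, h1⟩ := H.exists_poincareBound_uniform hC y.1 y.2
      refine ⟨κ, hκ, K, ε₁, hε₁, ?_⟩
      rw [nhdsWithin_univ, nhds_discrete]
      exact eventually_pure.2 h1
  obtain ⟨ε₃, hε₃, h2⟩ := mem_nhdsGT_iff_exists_Ioo_subset.1 hfin
  refine ⟨κ, hκ, K, min ε₂ ε₃, lt_min hε₂ hε₃, fun j i q₀ p₀ T hreg ε hε => ?_⟩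
  obtain ⟨-, Φ, g₁, g₂, g₃, b1, b2, b3, h3⟩ :=
    h1 (j, i) (mem_univ _) q₀ p₀ T hreg ε ⟨hε.1, hε.2.trans_le (min_le_left _ _)⟩
  have h4 : ((S.err (k + 1) ν Dint ε).toNNReal : ℝ≥0∞) = S.err (k + 1) ν Dint ε :=
    h2 ⟨hε.1, hε.2.trans_le (min_le_right _ _)⟩
  refine ⟨Φ, fun ρ hρ => ⟨(h3 ρ hρ).isLeast, (h3 ρ hρ).hit, (h3 ρ hρ).angle⟩,
    fun ρ hρ => ⟨(h3 ρ hρ).poincare, (h3 ρ hρ).mem⟩,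
    b1.isCkBounded (fun ρ hρ => (h3 ρ hρ).close) ?_,
    b2.isCkBounded (fun ρ hρ => (h3 ρ hρ).second) ?_,
    b3.isCkBounded (fun ρ hρ => (h3 ρ hρ).correction) ?_⟩
  all_goals rw [← h4]; push_cast; exact le_rfl

end
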